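/- Let $\alpha,h,c_0>0$, let $\gamma_T(s)=(s+\alpha,0,h)$ and $\gamma_R(s)=(s-\alpha,0,h)$ for $s\in(s_0,s_1)$, identify $x=(x_1,x_2)\in\mathbb R^2$ with $(x_1,x_2,0)\in\mathbb R^3$, and put $R(s,x)=|\gamma_T(s)-x|+|x-\gamma_R(s)|$. Let $Y=(s_0,s_1)\times(t_0,t_1)$ and let $A(s,t,x,\omega)$ be a smooth complex function on $Y\times\mathbb R^2\times\mathbb R$ such that * (symbol of order $2$) for every compact $\mathcal K\subset Y\times\mathbb R^2$ and all $k$ and multi-indices $\beta$ there is $C$ with $|\partial_\omega^k\partial_{s,t,x}^{\beta}A(s,t,x,\omega)|\le C(1+|\omega|)^{2-k}$ for $(s,t,x)\in\mathcal K$, $\omega\in\mathbb R$; * there is a compact $Q\subset Y$ such that $A(s,t,x,\omega)=0$ whenever $(s,t)\notin Q$; * $A(s,t,x,\omega)=0$ whenever $(s,t)$ lies in some neighbourhood of $\{(s,2\sqrt{\alpha^2+h^2}/c_0): s_0<s<s_1\}$. Define, as oscillatory integrals in $\omega$ (limits of $\int\chi(\varepsilon\omega)\cdots d\omega$ as $\varepsilon\to0^+$,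 for every $\chi\in C_c^\infty(\mathbb R)$ with $\chi(0)=1$), $$FV(s,t)=\iint e^{-i\omega(t-R(s,x)/c_0)}A(s,t,x,\omega)V(x)\,dx\,d\omega,$$ $$F^*W(x)=\iiint e^{i\omega(t-R(s,x)/c_0)}\overline{A(s,t,x,\omega)}\,W(s,t)\,ds\,dt\,d\omega .$$ Then: 1. For every $V\in C_c^\infty(\mathbb R^2)$ the oscillatory integrals that define $FV$ and $F^*FV$ converge at every point, and $FV$ and $F^*FV$ are continuous. 2. $F^*F$ has a Schwartz kernel $K\in\mathcal D'(\mathbb R^2\times\mathbb R^2)$, that is, $\langle K,u\otimes v\rangle=\int (F^*Fv)(x)u(x)\,dx$ for all test functions $u,v$, and it can be written as an oscillatory integral $$K(x,y)=\int e^{i\phi(x,y,s,\omega)}\widetilde A(x,y,s,\omega)\,ds\,d\omega,\qquad \phi=\frac{\omega}{c_0}\bigl(R(s,y)-R(s,x)\bigr),$$ where $\widetilde A$ is a symbol of order $4$ (in $\omega$) on $\mathbb R^2\times\mathbb R^2\times(s_0,s_1)$ that vanishes for $s$ outside a compact subset of $(s_0,s_1)$. 3. The kernel $K$ of $F^*F$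 satisfies $$WF(K)'\subset\Delta\cup\Lambda .$$ Here $WF(K)'=\{((x,\xi),(y,\eta)) : ((x,y),(\xi,-\eta))\in WF(K)\}$, $$\Delta=\{(x_1,x_2,\xi_1,\xi_2;\,x_1,x_2,\xi_1,\xi_2)\},\qquad \Lambda=\{(x_1,x_2,\xi_1,\xi_2;\,x_1,-x_2,\xi_1,-\xi_2)\},$$ and in both sets $x$ runs through $\mathbb R^2$ and $(\xi_1,\xi_2)$ through the non-zero multiples of $(-\partial_{x_1}R(s,x),-\partial_{x_2}R(s,x))$, $s\in(s_0,s_1)$. -/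

import Mathlib

open Set Filter Topology MeasureTheory TopologicalSpace
open scoped Distributions ComplexConjugate

noncomputable section

namespace BistaticSAR

/-! ### Wavefront sets -/

section Wavefront

variable {E : Type*} [NormedAddCommGroup E] [NormedSpace ℝ E] {Ω : Opens E}

/-- The product `χ g` of a real test function `χ` and a smooth real function `g`. -/
def mulSmooth (χ : 𝓓(Ω, ℝ)) (g : E → ℝ) (hg : ContDiff ℝ (⊤ : ℕ∞) g) : 𝓓(Ω, ℝ) where
  toFun x := χ x * g x
  contDiff' := χ.contDiff.mul hg
  hasCompactSupport' := χ.hasCompactSupport.mul_right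
  tsupport_subset' := (tsupport_mul_subset_left (f := fun x => χ x) (g := g)).trans
    χ.tsupport_subset

lemma contDiff_cos_dual (ζ : StrongDual ℝ E) : ContDiff ℝ (⊤ : ℕ∞) fun x => Real.cos (ζ x) :=
  Real.contDiff_cos.comp ζ.contDiff

lemma contDiff_sin_dual (ζ : StrongDual ℝ E) : ContDiff ℝ (⊤ : ℕ∞) fun x => Real.sin (ζ x) :=
  Real.contDiff_sin.comp ζ.contDiff

/-- The Fourier transform of `χ u` at the covector `ζ`, that is `⟨u, χ e^{-iζ}⟩`. Distributions
are tested on real functions, hence the split into `cos` and `sin`. -/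
def localizedFourier (u : 𝓓'(Ω, ℂ)) (χ : 𝓓(Ω, ℝ)) (ζ : StrongDual ℝ E) : ℂ :=
  u (mulSmooth χ _ (contDiff_cos_dual ζ)) - Complex.I * u (mulSmooth χ _ (contDiff_sin_dual ζ))

/-- `u` is microlocally smooth at `(x, ξ)`: for some cutoff `χ` with `χ x ≠ 0`, the Fourier
transform of `χ u` decreases rapidly in an open cone that contains `ξ`. -/
def MicrolocallySmoothAt (u : 𝓓'(Ω, ℂ)) (x : E) (ξ : StrongDual ℝ E) : Prop :=
  ∃ χ : 𝓓(Ω, ℝ), χ x ≠ 0 ∧ ∃ Γ : Set (StrongDual ℝ E), IsOpen Γ ∧ ξ ∈ Γ ∧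
    (∀ ζ ∈ Γ, ∀ r : ℝ, 0 < r → r • ζ ∈ Γ) ∧
    ∀ N : ℕ, ∃ C : ℝ, ∀ ζ ∈ Γ, ‖localizedFourier u χ ζ‖ ≤ C / (1 + ‖ζ‖) ^ N

/-- The wavefront set of a distribution on `Ω`, a subset of the cotangent bundle of `Ω` with the
zero section removed. -/
def wavefrontSet (u : 𝓓'(Ω, ℂ)) : Set (E × StrongDual ℝ E) :=
  {p | p.1 ∈ Ω ∧ p.2 ≠ 0 ∧ ¬ MicrolocallySmoothAt u p.1 p.2}

end Wavefront

/-! ### Oscillatory integrals and symbols -/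

/-- `I` is the value of the oscillatory integral `∫ f(ω) dω`: the limit, as `ε → 0`, of
`∫ χ(ε ω) f(ω) dω`, for every smooth compactly supported cutoff `χ` with `χ 0 = 1`. -/
def HasOscIntegral (f : ℝ → ℂ) (I : ℂ) : Prop :=
  ∀ χ : ℝ → ℝ, ContDiff ℝ (⊤ : ℕ∞) χ → HasCompactSupport χ → χ 0 = 1 →
    Tendsto (fun ε : ℝ => ∫ ω, (χ (ε * ω) : ℂ) * f ω) (𝓝[>] 0) (𝓝 I)

/-- The oscillatory integral of `f` exists. -/
def OscConvergent (f : ℝ → ℂ) : Prop := ∃ I, HasOscIntegral f I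

open Classical in
/-- The value of the oscillatory integral of `f` (and `0` where it does not exist). -/
def oscIntegral (f : ℝ → ℂ) : ℂ :=
  if hf : OscConvergent f then hf.choose else 0

/-- `a(p, ω)` is smooth on `U × ℝ` and a symbol of order `m` there: for every compact `K ⊆ U` and
all `j`, `k`, the derivatives of order `j` in `p` and order `k` in `ω` are
`O((1 + |ω|) ^ (m - k))`, uniformly for `p ∈ K`. -/
def IsSymbol {P : Type*} [NormedAddCommGroup P] [NormedSpace ℝ P] (U : Set P) (m : ℝ)
    (a : P → ℝ → ℂ) : Prop :=
  ContDiffOn ℝ (⊤ : ℕ∞) (fun q : P × ℝ => a q.1 q.2) (U ×ˢ univ) ∧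
  ∀ K ⊆ U, IsCompact K → ∀ j k : ℕ, ∃ C : ℝ, ∀ p ∈ K, ∀ ω : ℝ,
    ‖iteratedFDeriv ℝ j (fun q => iteratedDeriv k (a q) ω) p‖ ≤ C * (1 + |ω|) ^ (m - (k : ℝ))

/-! ### The bistatic geometry -/

/-- The ground, with coordinates `(x₁, x₂)`. -/
abbrev Plane : Type := EuclideanSpace ℝ (Fin 2)

/-- The point `(x₁, x₂, 0)`. -/
def ground (x : Plane) : EuclideanSpace ℝ (Fin 3) := !₂[x 0, x 1, 0]

/-- The transmitter `γ_T(s) = (s + α, 0, h)`. -/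
def transmitter (α h s : ℝ) : EuclideanSpace ℝ (Fin 3) := !₂[s + α, 0, h]

/-- The receiver `γ_R(s) = (s - α, 0, h)`. -/
def receiver (α h s : ℝ) : EuclideanSpace ℝ (Fin 3) := !₂[s - α, 0, h]

/-- The bistatic distance `R(s, x) = |γ_T(s) - x| + |x - γ_R(s)|`. -/
def bistaticDist (α h s : ℝ) (x : Plane) : ℝ :=
  dist (transmitter α h s) (ground x) + dist (ground x) (receiver α h s)

/-- The phase `φ(x, y, s, ω) = (ω / c₀) (R(s, y) - R(s, x))`. -/
def kernelPhase (α h c₀ : ℝ) (x y : Plane) (s ω : ℝ) : ℝ :=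
  ω / c₀ * (bistaticDist α h s y - bistaticDist α h s x)

/-- The amplitudes `A(s, t, x, ω)` of the forward operator: symbols of order `2` that are supported
over a compact subset of the data space `Y = (s₀, s₁) × (t₀, t₁)`, and vanish for `(s, t)` near the
curve `t = 2 √(α² + h²) / c₀` (the data from the points directly underneath). -/
structure IsAmplitude (α h c₀ s₀ s₁ t₀ t₁ : ℝ) (A : ℝ × ℝ × Plane → ℝ → ℂ) : Prop where
  symbol : IsSymbol (Ioo s₀ s₁ ×ˢ Ioo t₀ t₁ ×ˢ univ) 2 A
  compact_support : ∃ Q : Set (ℝ × ℝ), IsCompact Q ∧ Q ⊆ Ioo s₀ s₁ ×ˢ Ioo t₀ t₁ ∧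
    ∀ s t x ω, (s, t) ∉ Q → A (s, t, x) ω = 0
  vanish_below : ∃ U : Set (ℝ × ℝ), IsOpen U ∧
    (∀ s ∈ Ioo s₀ s₁, (s, 2 * √(α ^ 2 + h ^ 2) / c₀) ∈ U) ∧
    ∀ s t x ω, (s, t) ∈ U → A (s, t, x) ω = 0

/-! ### The forward operator, its adjoint, and the kernel -/

/-- `∫ e^{-iω(t - R(s,x)/c₀)} A(s,t,x,ω) V(x) dx`, to be integrated in `ω`. -/
def forwardIntegrand (α h c₀ : ℝ) (A : ℝ × ℝ × Plane → ℝ → ℂ) (V : Plane → ℂ)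
    (s t ω : ℝ) : ℂ :=
  ∫ x : Plane, Complex.exp (-Complex.I * ((ω * (t - bistaticDist α h s x / c₀) : ℝ) : ℂ)) *
    A (s, t, x) ω * V x

/-- The linearized forward scattering operator
`F V(s,t) = ∫∫ e^{-iω(t - R(s,x)/c₀)} A(s,t,x,ω) V(x) dx dω`. -/
def forward (α h c₀ : ℝ) (A : ℝ × ℝ × Plane → ℝ → ℂ) (V : Plane → ℂ) (s t : ℝ) : ℂ :=
  oscIntegral (forwardIntegrand α h c₀ A V s t)

/-- `∫∫ e^{iω(t - R(s,x)/c₀)} conj(A(s,t,x,ω)) W(s,t) ds dt`, to be integrated in `ω`. The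
amplitude vanishes for `(s, t)` outside the data space. -/
def adjointIntegrand (α h c₀ : ℝ) (A : ℝ × ℝ × Plane → ℝ → ℂ) (W : ℝ → ℝ → ℂ)
    (x : Plane) (ω : ℝ) : ℂ :=
  ∫ s : ℝ, ∫ t : ℝ, Complex.exp (Complex.I * ((ω * (t - bistaticDist α h s x / c₀) : ℝ) : ℂ)) *
    conj (A (s, t, x) ω) * W s t

/-- The `L²` adjoint
`F* W(x) = ∫∫∫ e^{iω(t - R(s,x)/c₀)} conj(A(s,t,x,ω)) W(s,t) ds dt dω`. -/
def backproject (α h c₀ : ℝ) (A : ℝ × ℝ × Plane → ℝ → ℂ) (W : ℝ → ℝ → ℂ) (x : Plane) : ℂ :=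
  oscIntegral (adjointIntegrand α h c₀ A W x)

/-- The reconstruction operator `F* F`. -/
def normalOp (α h c₀ : ℝ) (A : ℝ × ℝ × Plane → ℝ → ℂ) (V : Plane → ℂ) : Plane → ℂ :=
  backproject α h c₀ A (forward α h c₀ A V)

/-- The test function `(u ⊗ v)(x, y) = u(x) v(y)`. -/
def tensor (u v : 𝓓((⊤ : Opens Plane), ℝ)) : 𝓓((⊤ : Opens (Plane × Plane)), ℝ) where
  toFun z := u z.1 * v z.2
  contDiff' := (u.contDiff.comp contDiff_fst).mul (v.contDiff.comp contDiff_snd)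
  hasCompactSupport' := by
    refine HasCompactSupport.intro
      (u.hasCompactSupport.isCompact.prod v.hasCompactSupport.isCompact) fun z hz => ?_
    rw [mem_prod, not_and_or] at hz
    rcases hz with hz | hz
    · rw [image_eq_zero_of_notMem_tsupport hz, zero_mul]
    · rw [image_eq_zero_of_notMem_tsupport hz, mul_zero]
  tsupport_subset' := fun _ _ => trivial

/-- `K` is the Schwartz kernel of `T`: `⟨K, u ⊗ v⟩ = ∫ (T v)(x) u(x) dx` for all test functions
`u`, `v`. -/
def IsSchwartzKernel (T : (Plane → ℂ) → Plane → ℂ)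
    (K : 𝓓'((⊤ : Opens (Plane × Plane)), ℂ)) : Prop :=
  ∀ u v : 𝓓((⊤ : Opens Plane), ℝ), K (tensor u v) = ∫ x, T (fun y => (v y : ℂ)) x * (u x : ℂ)

/-- `K(x,y) = ∫∫ e^{iφ(x,y,s,ω)} a(x,y,s,ω) ds dω` as an oscillatory integral. -/
def IsKernelOscIntegral (α h c₀ : ℝ) (a : Plane × Plane × ℝ → ℝ → ℂ)
    (K : 𝓓'((⊤ : Opens (Plane × Plane)), ℂ)) : Prop :=
  ∀ Φ : 𝓓((⊤ : Opens (Plane × Plane)), ℝ),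
    HasOscIntegral (fun ω => ∫ s : ℝ, ∫ x : Plane, ∫ y : Plane,
      Complex.exp (Complex.I * (kernelPhase α h c₀ x y s ω : ℂ)) * a (x, y, s) ω *
        (Φ (x, y) : ℂ)) (K Φ)

/-- The covector on the product that pairs to `⟨ξ, x⟩ + ⟨η, y⟩`. -/
def pairCovector (ξ η : Plane) : StrongDual ℝ (Plane × Plane) :=
  (innerSL ℝ ξ).coprod (innerSL ℝ η)

/-- The twisted wavefront set
`WF(K)' = {((x, ξ), (y, η)) : ((x, y), (ξ, -η)) ∈ WF(K)}`. -/
def twistedWavefrontSet (K : 𝓓'((⊤ : Opens (Plane × Plane)), ℂ)) :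
    Set ((Plane × Plane) × (Plane × Plane)) :=
  {p | ((p.1.1, p.2.1), pairCovector p.1.2 (-p.2.2)) ∈ wavefrontSet K}

/-- The covectors at `x` that are non-zero multiples of `-∂ₓR(s, x)` for some `s ∈ (s₀, s₁)`. -/
def covectors (α h s₀ s₁ : ℝ) (x : Plane) : Set Plane :=
  {ξ | ∃ s ∈ Ioo s₀ s₁, ∃ τ : ℝ, τ ≠ 0 ∧ ξ = τ • (-gradient (bistaticDist α h s) x)}

/-- The reflection `(x₁, x₂) ↦ (x₁, -x₂)`. -/
def reflect (x : Plane) : Plane := !₂[x 0, -x 1]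

/-- `Δ = {(x, ξ; x, ξ)}`. -/
def diagonalRelation (α h s₀ s₁ : ℝ) : Set ((Plane × Plane) × (Plane × Plane)) :=
  {p | p.1.2 ∈ covectors α h s₀ s₁ p.1.1 ∧ p.2 = p.1}

/-- `Λ = {(x₁, x₂, ξ₁, ξ₂; x₁, -x₂, ξ₁, -ξ₂)}`. -/
def reflectionRelation (α h s₀ s₁ : ℝ) : Set ((Plane × Plane) × (Plane × Plane)) :=
  {p | p.1.2 ∈ covectors α h s₀ s₁ p.1.1 ∧ p.2 = (reflect p.1.1, reflect p.1.2)}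

end BistaticSAR

end

/-! Removing `t` from the amplitude. In terms of the delay `r = t - R(s,x)/c₀`, the Fourier
transform in time of `F V(s, ·)` at `ω` is `∫ e^{iωR(s,x)/c₀} B(s,x,ω) V(x) dx` (`fourierData`),
where the reduced amplitude is `B(s,x,ω) = ∫∫ e^{-iσr} a(s,x,r,ω+σ) dr dσ` (`redAmp`). `B` is again
a symbol of order 2 (`SymFam.redAmp`). Under the reduction a factor `r` becomes a derivative in `ω`,
so `B` decreases rapidly wherever `a` vanishes for small `r` (`norm_redAmp_le_of_vanish`).

Convergence. The gradient of `R(s, ·)` vanishes only at the ground point midway below the antennas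
(`eq_of_distGrad_eq_zero`), and the data from that point lie where `A` is zero. Near that point `B`
decreases rapidly; elsewhere the phase `ωR/c₀` is not stationary and
`norm_integral_le_of_nonstationary` applies. Hence `fourierData` of a test function decreases
rapidly in `ω` (`norm_fourierData_le`), `F V` is its inverse Fourier transform, and `F* F V(x)` is
an absolutely convergent integral of `e^{-iωR(s,x)/c₀} conj(B(s,x,ω))` against it, up to the factor
`1/2π`. The kernel therefore has the amplitude `B(s,y,ω) conj(B(s,x,ω)) / 2π`, of order `2 + 2`.

Wavefront set. The Fourier transform of the kernel, localized by `u ⊗ v` near `(x₀, y₀)`, is a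
pairing of the data of `e^{-i⟨ξ,x⟩}u` and `e^{-i⟨η,y⟩}v`. When `|ω|` is small against `(ξ, η)`, the
phase in `x` or in `y` is not stationary because `∇R` is bounded; otherwise decay in `ω` is decay in
`(ξ, η)`. Smooth cutoffs in the data space commute with `F` and may be moved from `F` to `F*`, so a
finite covering of the support reduces the claim to data near one point `(s, t)`
(`exists_decays_near`). Its contribution decreases rapidly unless `t = R(s,x₀)/c₀ = R(s,y₀)/c₀`
(otherwise a reduced amplitude is negligible), the Doppler shifts of `x₀` and `y₀` agree (otherwise
the phase is not stationary in `s`), and `(ξ, η)` is proportional to `(-∇R(s,x₀), ∇R(s,y₀))`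
(otherwise it is not stationary in `(x, y)`). On an isochrone the Doppler shift is strictly monotone
in `x₁`, so equal range and Doppler shift force `y₀ = x₀` or `y₀` to be the reflection of `x₀`
(`eq_or_eq_reflect`). These two cases are `Δ` and `Λ`. -/

namespace BistaticSAR

/-! ### Differentiation under the integral sign to all orders -/

section ParametricIntegral

variable {E α F : Type*} [NormedAddCommGroup E] [NormedSpace ℝ E] [NormedAddCommGroup F]
  [NormedSpace ℝ F]

/-- The integrals of the Taylor coefficients form a Taylor series of the integral: each coefficient
differentiates into the next by dominated convergence, the bound of order `j + 1` being the
dominating one. Uniqueness of the Taylor series then gives the formula for the derivatives. -/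
theorem contDiff_integral_of_dominated [MeasurableSpace α] {μ : Measure α} {f : E → α → F}
    (hf : ∀ y, ContDiff ℝ (⊤ : ℕ∞) fun x => f x y)
    (hm : ∀ (j : ℕ) x, AEStronglyMeasurable (fun y => iteratedFDeriv ℝ j (fun x' => f x' y) x) μ)
    (hb : ∀ (j : ℕ) x₀, ∃ b : α → ℝ, Integrable b μ ∧
      ∀ᶠ x in 𝓝 x₀, ∀ y, ‖iteratedFDeriv ℝ j (fun x' => f x' y) x‖ ≤ b y) :
    ContDiff ℝ (⊤ : ℕ∞) (fun x => ∫ y, f x y ∂μ) ∧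
    ∀ (j : ℕ) x, iteratedFDeriv ℝ j (fun x' => ∫ y, f x' y ∂μ) x =
      ∫ y, iteratedFDeriv ℝ j (fun x' => f x' y) x ∂μ := by
  have hder : ∀ (j : ℕ) (x : E), HasFDerivAt
      (fun x' => ∫ y, iteratedFDeriv ℝ j (fun x'' => f x'' y) x' ∂μ)
      (∫ y, iteratedFDeriv ℝ (j + 1) (fun x'' => f x'' y) x ∂μ).curryLeft x := by
    intro j x
    obtain ⟨b0, hb0, hb0'⟩ := hb j x
    obtain ⟨b, hbi, hb'⟩ := hb (j + 1) x
    have key := hasFDerivAt_integral_of_dominated_of_fderiv_le (μ := μ) (𝕜 := ℝ) (x₀ := x)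
      (F := fun x' y => iteratedFDeriv ℝ j (fun x'' => f x'' y) x')
      (F' := fun x' y => (iteratedFDeriv ℝ (j + 1) (fun x'' => f x'' y) x').curryLeft)
      (bound := b) hb' (Eventually.of_forall fun x' => hm j x')
      (hb0.mono' (hm j x) (Eventually.of_forall hb0'.self_of_nhds))
      ((continuousMultilinearCurryLeftEquiv ℝ (fun _ : Fin (j + 1) => E)
        F).continuous.comp_aestronglyMeasurable (hm (j + 1) x))
      (Eventually.of_forall fun y x' hx' => by
        have : ‖(iteratedFDeriv ℝ (j + 1) (fun x'' => f x'' y) x').curryLeft‖ =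
          ‖iteratedFDeriv ℝ (j + 1) (fun x'' => f x'' y) x'‖ :=
          (continuousMultilinearCurryLeftEquiv ℝ (fun _ : Fin (j + 1) => E) F).norm_map _
        rw [this]; exact hx' y) hbi
      (Eventually.of_forall fun y x' _ => by
        have := (contDiff_iff_ftaylorSeries.1 (hf y)).fderiv j
          (by exact_mod_cast WithTop.coe_lt_top (j : ℕ)) x'
        exact this)
    have h2 := ContinuousLinearEquiv.integral_comp_comm (𝕜 := ℝ) (μ := μ)
      (E := ContinuousMultilinearMap ℝ (fun _ : Fin (j + 1) => E) F)
      (F := E →L[ℝ] ContinuousMultilinearMap ℝ (fun _ : Fin j => E) F)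
      (continuousMultilinearCurryLeftEquiv ℝ (fun _ : Fin (j + 1) => E) F).toContinuousLinearEquiv
      (fun y => iteratedFDeriv ℝ (j + 1) (fun x'' => f x'' y) x)
    exact key.congr_fderiv h2
  have hT : HasFTaylorSeriesUpTo (⊤ : ℕ∞) (fun x => ∫ y, f x y ∂μ)
      (fun x j => ∫ y, iteratedFDeriv ℝ j (fun x' => f x' y) x ∂μ) := by
    refine ⟨fun x => ?_, fun j _ x => hder j x, fun j _ => ?_⟩
    · have h2 := (continuousMultilinearCurryFin0 ℝ E F).toContinuousLinearEquiv.integral_comp_comm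
        (φ := fun y => iteratedFDeriv ℝ 0 (fun x'' => f x'' y) x) (μ := μ)
      refine h2.symm.trans ?_
      simp
    · exact continuous_iff_continuousAt.2 fun x => (hder j x).continuousAt
  refine ⟨hT.contDiff, fun j x => ?_⟩
  exact (hT.eq_iteratedFDeriv (by exact_mod_cast le_top) x).symm

variable [NormedAddCommGroup α] [NormedSpace ℝ α]

lemma iteratedFDeriv_slice {f : E × α → F} (hf : ContDiff ℝ (⊤ : ℕ∞) f) (j : ℕ) (x : E) (y : α) :
    iteratedFDeriv ℝ j (fun x' => f (x', y)) x =
      (iteratedFDeriv ℝ j f (x, y)).compContinuousLinearMap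
        fun _ => ContinuousLinearMap.inl ℝ E α := by
  have h1 : (fun x' => f (x', y)) = (fun z => f (z + (0, y))) ∘ ContinuousLinearMap.inl ℝ E α := by
    ext x'; simp
  have h3 : ContDiff ℝ (⊤ : ℕ∞) fun z => f (z + (0, y)) := hf.comp (contDiff_id.add contDiff_const)
  rw [h1, ContinuousLinearMap.iteratedFDeriv_comp_right _ h3 x (i := j)
    (by exact_mod_cast le_top), iteratedFDeriv_comp_add_right]
  simp

lemma norm_iteratedFDeriv_slice_le {f : E × α → F} (hf : ContDiff ℝ (⊤ : ℕ∞) f) (j : ℕ)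
    (x : E) (y : α) :
    ‖iteratedFDeriv ℝ j (fun x' => f (x', y)) x‖ ≤ ‖iteratedFDeriv ℝ j f (x, y)‖ := by
  rw [iteratedFDeriv_slice hf]
  refine (ContinuousMultilinearMap.norm_compContinuousLinearMap_le _ _).trans ?_
  refine mul_le_of_le_one_right (norm_nonneg _) ?_
  exact Finset.prod_le_one (fun _ _ => norm_nonneg _)
    fun _ _ => ContinuousLinearMap.norm_inl_le_one ℝ E α

lemma continuous_iteratedFDeriv_slice {f : E × α → F} (hf : ContDiff ℝ (⊤ : ℕ∞) f) (j : ℕ) :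
    Continuous fun z : E × α => iteratedFDeriv ℝ j (fun x' => f (x', z.2)) z.1 := by
  simp_rw [iteratedFDeriv_slice hf]
  exact (ContinuousMultilinearMap.compContinuousLinearMapL (𝕜 := ℝ) (E := fun _ : Fin j => E)
    (E₁ := fun _ : Fin j => E × α) (F := F)
    fun _ => ContinuousLinearMap.inl ℝ E α).continuous.comp
    (hf.continuous_iteratedFDeriv (m := j) (by exact_mod_cast le_top))

/-- Differentiation under the integral sign for jointly smooth integrands. -/
theorem contDiff_integral_of_contDiff [MeasurableSpace α] [BorelSpace α]
    [SecondCountableTopology α] {μ : Measure α} {f : E × α → F}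
    (hf : ContDiff ℝ (⊤ : ℕ∞) f)
    (hb : ∀ (j : ℕ) x₀, ∃ b : α → ℝ, Integrable b μ ∧
      ∀ᶠ x in 𝓝 x₀, ∀ y, ‖iteratedFDeriv ℝ j (fun x' => f (x', y)) x‖ ≤ b y) :
    ContDiff ℝ (⊤ : ℕ∞) (fun x => ∫ y, f (x, y) ∂μ) ∧
    ∀ (j : ℕ) x, iteratedFDeriv ℝ j (fun x' => ∫ y, f (x', y) ∂μ) x =
      ∫ y, iteratedFDeriv ℝ j (fun x' => f (x', y)) x ∂μ :=
  contDiff_integral_of_dominated (f := fun x y => f (x, y))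
    (fun _ => hf.comp (contDiff_id.prodMk contDiff_const))
    (fun j x => ((continuous_iteratedFDeriv_slice hf j).comp
      (Continuous.prodMk_right x)).aestronglyMeasurable) hb

end ParametricIntegral

/-! ### Uniform families of symbols -/

section Symbols

variable {ι P P' : Type*} [NormedAddCommGroup P] [NormedSpace ℝ P] [NormedAddCommGroup P']
  [NormedSpace ℝ P']

/-- The derivative in the frequency variable. -/
noncomputable def freqDeriv {F : Type*} [NormedAddCommGroup F] [NormedSpace ℝ F]
    (a : P × ℝ → F) : P × ℝ → F := fun z => fderiv ℝ a z (0, 1)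

/-- All derivatives of the family are `O((1 + |ω|) ^ m)`, locally uniformly in `p`. -/
def SymBound (a : ι → P × ℝ → ℂ) (m : ℝ) : Prop :=
  ∀ K : Set P, IsCompact K → ∀ j : ℕ, ∃ C : ℝ, ∀ i, ∀ p ∈ K, ∀ ω : ℝ,
    ‖iteratedFDeriv ℝ j (a i) (p, ω)‖ ≤ C * (1 + |ω|) ^ m

/-- A family of smooth symbols of order `m` with common bounds. -/
structure SymFam (a : ι → P × ℝ → ℂ) (m : ℝ) : Prop where
  smooth : ∀ i, ContDiff ℝ (⊤ : ℕ∞) (a i)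
  bound : ∀ k : ℕ, SymBound (fun i => freqDeriv^[k] (a i)) (m - k)

lemma one_add_abs_pos (ω : ℝ) : 0 < 1 + |ω| := by positivity

lemma contDiff_freqDeriv {F : Type*} [NormedAddCommGroup F] [NormedSpace ℝ F] {a : P × ℝ → F} (ha : ContDiff ℝ (⊤ : ℕ∞) a) :
    ContDiff ℝ (⊤ : ℕ∞) (freqDeriv a) :=
  (ha.fderiv_right (m := (⊤ : ℕ∞)) (by norm_num)).clm_apply contDiff_const

lemma contDiff_iterate_freqDeriv {F : Type*} [NormedAddCommGroup F] [NormedSpace ℝ F]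
    {a : P × ℝ → F} (ha : ContDiff ℝ (⊤ : ℕ∞) a) (k : ℕ) :
    ContDiff ℝ (⊤ : ℕ∞) (BistaticSAR.freqDeriv^[k] a) := by
  induction k generalizing a with
  | zero => exact ha
  | succ k ih => exact ih (contDiff_freqDeriv ha)

lemma SymBound.nonneg {a : ι → P × ℝ → ℂ} {m : ℝ} (h : SymBound a m) {K : Set P}
    (hK : IsCompact K) (j : ℕ) : ∃ C : ℝ, 0 ≤ C ∧ ∀ i, ∀ p ∈ K, ∀ ω : ℝ,
    ‖iteratedFDeriv ℝ j (a i) (p, ω)‖ ≤ C * (1 + |ω|) ^ m := by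
  obtain ⟨C, hC⟩ := h K hK j
  refine ⟨max C 0, le_max_right _ _, fun i p hp ω => (hC i p hp ω).trans ?_⟩
  gcongr
  exact le_max_left _ _

lemma SymBound.uniform {a : ι → P × ℝ → ℂ} {m : ℝ} (h : SymBound a m) {K : Set P}
    (hK : IsCompact K) (n : ℕ) : ∃ C : ℝ, 0 ≤ C ∧ ∀ j ≤ n, ∀ i, ∀ p ∈ K, ∀ ω : ℝ,
    ‖iteratedFDeriv ℝ j (a i) (p, ω)‖ ≤ C * (1 + |ω|) ^ m := by
  choose C hC0 hC using h.nonneg hK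
  refine ⟨∑ j ∈ Finset.range (n + 1), C j, Finset.sum_nonneg fun j _ => hC0 j,
    fun j hj i p hp ω => (hC j i p hp ω).trans ?_⟩
  gcongr
  exact Finset.single_le_sum (f := C) (fun j _ => hC0 j) (Finset.mem_range.2 (by omega))

lemma SymBound.add {a b : ι → P × ℝ → ℂ} {m : ℝ} (ha : SymBound a m) (hb : SymBound b m)
    (sa : ∀ i, ContDiff ℝ (⊤ : ℕ∞) (a i)) (sb : ∀ i, ContDiff ℝ (⊤ : ℕ∞) (b i)) :
    SymBound (fun i => a i + b i) m := by
  intro K hK j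
  obtain ⟨C, hC⟩ := ha K hK j
  obtain ⟨D, hD⟩ := hb K hK j
  refine ⟨C + D, fun i p hp ω => ?_⟩
  rw [iteratedFDeriv_add_apply ((sa i).of_le (by exact_mod_cast le_top)).contDiffAt
    ((sb i).of_le (by exact_mod_cast le_top)).contDiffAt, add_mul]
  exact (norm_add_le _ _).trans (add_le_add (hC i p hp ω) (hD i p hp ω))

lemma SymBound.mul {a b : ι → P × ℝ → ℂ} {m m' : ℝ} (ha : SymBound a m) (hb : SymBound b m')
    (sa : ∀ i, ContDiff ℝ (⊤ : ℕ∞) (a i)) (sb : ∀ i, ContDiff ℝ (⊤ : ℕ∞) (b i)) :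
    SymBound (fun i => a i * b i) (m + m') := by
  intro K hK j
  obtain ⟨C, hC0, hC⟩ := ha.uniform hK j
  obtain ⟨D, hD0, hD⟩ := hb.uniform hK j
  refine ⟨∑ l ∈ Finset.range (j + 1), (j.choose l : ℝ) * C * D, fun i p hp ω => ?_⟩
  refine (norm_iteratedFDeriv_mul_le (sa i) (sb i) (p, ω) (n := j)
    (by exact_mod_cast le_top)).trans ?_
  rw [Finset.sum_mul]
  refine Finset.sum_le_sum fun l hl => ?_
  have h1 := hC l (by have := Finset.mem_range.1 hl; omega) i p hp ω
  have h2 := hD (j - l) (by omega) i p hp ω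
  rw [Real.rpow_add (one_add_abs_pos ω)]
  calc _ ≤ (j.choose l : ℝ) * (C * (1 + |ω|) ^ m) * (D * (1 + |ω|) ^ m') := by gcongr
    _ = _ := by ring

lemma freqDeriv_add {a b : P × ℝ → ℂ} (ha : ContDiff ℝ (⊤ : ℕ∞) a)
    (hb : ContDiff ℝ (⊤ : ℕ∞) b) : freqDeriv (a + b) = freqDeriv a + freqDeriv b := by
  ext z
  simp [freqDeriv, fderiv_add (ha.differentiable (by simp) z) (hb.differentiable (by simp) z)]

lemma iterate_freqDeriv_add {a b : P × ℝ → ℂ} (ha : ContDiff ℝ (⊤ : ℕ∞) a)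
    (hb : ContDiff ℝ (⊤ : ℕ∞) b) (k : ℕ) :
    freqDeriv^[k] (a + b) = freqDeriv^[k] a + freqDeriv^[k] b := by
  induction k generalizing a b with
  | zero => rfl
  | succ k ih =>
    simp only [Function.iterate_succ_apply]
    rw [freqDeriv_add ha hb, ih (contDiff_freqDeriv ha) (contDiff_freqDeriv hb)]

lemma freqDeriv_mul {a b : P × ℝ → ℂ} (ha : ContDiff ℝ (⊤ : ℕ∞) a)
    (hb : ContDiff ℝ (⊤ : ℕ∞) b) :
    freqDeriv (a * b) = freqDeriv a * b + a * freqDeriv b := by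
  ext z
  simp [freqDeriv, fderiv_mul (ha.differentiable (by simp) z) (hb.differentiable (by simp) z)]
  ring

lemma SymFam.freqDeriv {a : ι → P × ℝ → ℂ} {m : ℝ} (h : SymFam a m) :
    SymFam (fun i => freqDeriv (a i)) (m - 1) :=
  ⟨fun i => contDiff_freqDeriv (h.smooth i), fun k => by
    have := h.bound (k + 1)
    simp only [Function.iterate_succ_apply] at this
    convert this using 1
    push_cast; ring⟩

lemma SymFam.symBound {a : ι → P × ℝ → ℂ} {m : ℝ} (h : SymFam a m) : SymBound a m := by
  simpa using h.bound 0

lemma SymFam.add {a b : ι → P × ℝ → ℂ} {m : ℝ} (ha : SymFam a m) (hb : SymFam b m) :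
    SymFam (fun i => a i + b i) m :=
  ⟨fun i => (ha.smooth i).add (hb.smooth i), fun k => by
    simp_rw [fun i => iterate_freqDeriv_add (ha.smooth i) (hb.smooth i) k]
    exact (ha.bound k).add (hb.bound k) (fun i => contDiff_iterate_freqDeriv (ha.smooth i) k)
      (fun i => contDiff_iterate_freqDeriv (hb.smooth i) k)⟩

/-- The product rule in `ω` puts the loss of one order on either factor, so induction on the number
of frequency derivatives works with the orders `m`, `m'` generalized. -/
lemma SymFam.mul {a b : ι → P × ℝ → ℂ} {m m' : ℝ} (ha : SymFam a m) (hb : SymFam b m') :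
    SymFam (fun i => a i * b i) (m + m') := by
  refine ⟨fun i => (ha.smooth i).mul (hb.smooth i), fun k => ?_⟩
  induction k generalizing a b m m' with
  | zero => simpa using ha.symBound.mul hb.symBound ha.smooth hb.smooth
  | succ k ih =>
    simp only [Function.iterate_succ_apply]
    simp_rw [fun i => freqDeriv_mul (ha.smooth i) (hb.smooth i)]
    simp_rw [fun i => iterate_freqDeriv_add (a := BistaticSAR.freqDeriv (a i) * b i)
      (b := a i * BistaticSAR.freqDeriv (b i)) ((contDiff_freqDeriv (ha.smooth i)).mul (hb.smooth i))
      ((ha.smooth i).mul (contDiff_freqDeriv (hb.smooth i))) k]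
    have h1 := ih ha.freqDeriv hb
    have h2 := ih ha hb.freqDeriv
    refine SymBound.add ?_ ?_
      (fun i => contDiff_iterate_freqDeriv ((contDiff_freqDeriv (ha.smooth i)).mul (hb.smooth i)) k)
      (fun i => contDiff_iterate_freqDeriv ((ha.smooth i).mul (contDiff_freqDeriv (hb.smooth i))) k)
    · convert h1 using 1
      push_cast; ring
    · convert h2 using 1
      push_cast; ring

lemma SymFam.reindex {κ : Type*} {a : ι → P × ℝ → ℂ} {m : ℝ} (h : SymFam a m) (f : κ → ι) :
    SymFam (fun i => a (f i)) m :=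
  ⟨fun _ => h.smooth _, fun k K hK j => (h.bound k K hK j).imp fun _ hC i => hC (f i)⟩

/-- A family of smooth functions of `p` alone, with common bounds, is of order `0`. -/
lemma SymFam.of_param {φ : P → ℂ} (hφ : ContDiff ℝ (⊤ : ℕ∞) φ) :
    SymFam (fun (_ : ι) (z : P × ℝ) => φ z.1) 0 := by
  have hs : ContDiff ℝ (⊤ : ℕ∞) fun z : P × ℝ => φ z.1 := hφ.comp contDiff_fst
  have hz : BistaticSAR.freqDeriv (fun z : P × ℝ => φ z.1) = 0 := by
    ext z
    have : HasFDerivAt (fun z : P × ℝ => φ z.1)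
        ((fderiv ℝ φ z.1).comp (ContinuousLinearMap.fst ℝ P ℝ)) z :=
      ((hφ.differentiable (by simp) z.1).hasFDerivAt).comp z hasFDerivAt_fst
    simp [BistaticSAR.freqDeriv, this.fderiv]
  have hz' : ∀ k : ℕ, BistaticSAR.freqDeriv^[k] (0 : P × ℝ → ℂ) = 0 := by
    intro k
    induction k with
    | zero => rfl
    | succ k ih =>
      rw [Function.iterate_succ_apply]
      have : BistaticSAR.freqDeriv (0 : P × ℝ → ℂ) = 0 := by
        ext z
        have : fderiv ℝ (0 : P × ℝ → ℂ) z = 0 := by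
          rw [show (0 : P × ℝ → ℂ) = fun _ => 0 from rfl]; simp
        simp [BistaticSAR.freqDeriv, this]
      rw [this, ih]
  refine ⟨fun _ => hs, fun k K hK j => ?_⟩
  cases k with
  | succ k =>
    refine ⟨0, fun _ p hp ω => ?_⟩
    simp only [Function.iterate_succ_apply, hz, hz' k]
    rw [show (0 : P × ℝ → ℂ) = fun _ => 0 from rfl]
    simp
  | zero =>
    obtain ⟨C, hC⟩ := (hK.image (f := fun p => iteratedFDeriv ℝ j φ p)
      (hφ.continuous_iteratedFDeriv (m := j) (by exact_mod_cast le_top))).isBounded.exists_norm_le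
    refine ⟨C, fun i p hp ω => ?_⟩
    simp only [Function.iterate_zero, id, CharP.cast_eq_zero, sub_zero, Real.rpow_zero, mul_one]
    have h1 : (fun z : P × ℝ => φ z.1) = φ ∘ ContinuousLinearMap.fst ℝ P ℝ := rfl
    rw [h1, ContinuousLinearMap.iteratedFDeriv_comp_right _ hφ _ (i := j)
      (by exact_mod_cast le_top)]
    refine (ContinuousMultilinearMap.norm_compContinuousLinearMap_le _ _).trans ?_
    refine (mul_le_of_le_one_right (norm_nonneg _) ?_).trans (hC _ ⟨p, hp, rfl⟩)
    exact Finset.prod_le_one (fun _ _ => norm_nonneg _)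
      fun _ _ => ContinuousLinearMap.norm_fst_le ℝ P ℝ

lemma SymFam.param_mul {a : ι → P × ℝ → ℂ} {m : ℝ} (h : SymFam a m) {φ : P → ℂ}
    (hφ : ContDiff ℝ (⊤ : ℕ∞) φ) : SymFam (fun i z => φ z.1 * a i z) m := by
  have := (SymFam.of_param (ι := ι) hφ).mul h
  rw [zero_add] at this
  exact this

lemma freqDeriv_comp {a : P × ℝ → ℂ} (ha : ContDiff ℝ (⊤ : ℕ∞) a) {Φ : P' → P}
    (hΦ : ContDiff ℝ (⊤ : ℕ∞) Φ) :
    freqDeriv (fun z : P' × ℝ => a (Φ z.1, z.2)) = fun z => freqDeriv a (Φ z.1, z.2) := by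
  ext z
  have h1 : HasFDerivAt (fun z : P' × ℝ => (Φ z.1, z.2))
      (((fderiv ℝ Φ z.1).comp (ContinuousLinearMap.fst ℝ P' ℝ)).prod
        (ContinuousLinearMap.snd ℝ P' ℝ)) z :=
    (((hΦ.differentiable (by simp) z.1).hasFDerivAt).comp z hasFDerivAt_fst).prodMk hasFDerivAt_snd
  have h2 := ((ha.differentiable (by simp) (Φ z.1, z.2)).hasFDerivAt).comp z h1
  have h3 : fderiv ℝ (fun z : P' × ℝ => a (Φ z.1, z.2)) z = _ := h2.fderiv
  simp [freqDeriv, h3]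

lemma iterate_freqDeriv_comp {a : P × ℝ → ℂ} (ha : ContDiff ℝ (⊤ : ℕ∞) a) {Φ : P' → P}
    (hΦ : ContDiff ℝ (⊤ : ℕ∞) Φ) (k : ℕ) :
    freqDeriv^[k] (fun z : P' × ℝ => a (Φ z.1, z.2)) = fun z => freqDeriv^[k] a (Φ z.1, z.2) := by
  induction k generalizing a with
  | zero => rfl
  | succ k ih =>
    simp only [Function.iterate_succ_apply]
    rw [freqDeriv_comp ha hΦ, ih (contDiff_freqDeriv ha)]

end Symbols

end BistaticSAR

namespace BistaticSAR

/-! ### Symbol families under change of parameters, conjugation, differentiation and frequency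
cutoffs -/

section Symbols

variable {ι P P' F : Type*} [NormedAddCommGroup P] [NormedSpace ℝ P] [NormedAddCommGroup P']
  [NormedSpace ℝ P'] [NormedAddCommGroup F] [NormedSpace ℝ F]

/-- The substitution leaves `ω` alone, so it commutes with the frequency derivative, and the chain
rule of order `j` needs only bounds for the derivatives of `(p, ω) ↦ (Φ p, ω)`. Those of positive
order do not depend on `ω`, hence are bounded on `K × ℝ`. -/
lemma SymFam.comp {a : ι → P × ℝ → ℂ} {m : ℝ} (h : SymFam a m) {Φ : P' → P}
    (hΦ : ContDiff ℝ (⊤ : ℕ∞) Φ) : SymFam (fun i (z : P' × ℝ) => a i (Φ z.1, z.2)) m := by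
  have hΨ : ContDiff ℝ (⊤ : ℕ∞) fun z : P' × ℝ => (Φ z.1, z.2) :=
    (hΦ.comp contDiff_fst).prodMk contDiff_snd
  refine ⟨fun i => (h.smooth i).comp hΨ, fun k => ?_⟩
  simp_rw [fun i => iterate_freqDeriv_comp (h.smooth i) hΦ k]
  intro K hK j
  obtain ⟨C, hC0, hC⟩ := (h.bound k).uniform (hK.image hΦ.continuous) j
  -- The bound is wanted in the form `D ^ l`; taking `D ≥ 1` makes a plain bound by `D` sufficient.
  have hD : ∃ D : ℝ, 1 ≤ D ∧ ∀ l, 1 ≤ l → l ≤ j → ∀ p ∈ K, ∀ ω : ℝ,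
      ‖iteratedFDeriv ℝ l (fun z : P' × ℝ => (Φ z.1, z.2)) (p, ω)‖ ≤ D ^ l := by
    have hb : ∀ l : ℕ, ∃ D : ℝ, 0 ≤ D ∧ ∀ p ∈ K,
        ‖iteratedFDeriv ℝ l (fun z : P' × ℝ => (Φ z.1, z.2)) (p, 0)‖ ≤ D := fun l => by
      obtain ⟨D, hD⟩ := (hK.image (f := fun p : P' =>
        iteratedFDeriv ℝ l (fun z : P' × ℝ => (Φ z.1, z.2)) (p, 0))
        ((hΨ.continuous_iteratedFDeriv (m := l) (by exact_mod_cast le_top)).comp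
          (Continuous.prodMk_left 0))).isBounded.exists_norm_le
      exact ⟨max D 0, le_max_right _ _, fun p hp => (hD _ ⟨p, hp, rfl⟩).trans (le_max_left _ _)⟩
    choose D hD0 hD using hb
    refine ⟨1 + ∑ l ∈ Finset.range (j + 1), D l,
      le_add_of_nonneg_right (Finset.sum_nonneg fun l _ => hD0 l), fun l hl hlj p hp ω => ?_⟩
    have hge : D l ≤ 1 + ∑ l ∈ Finset.range (j + 1), D l :=
      (Finset.single_le_sum (f := D) (fun l _ => hD0 l)
        (Finset.mem_range.2 (by omega : l < j + 1))).trans (by linarith)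
    have h1 : (1 : ℝ) ≤ 1 + ∑ l ∈ Finset.range (j + 1), D l :=
      le_add_of_nonneg_right (Finset.sum_nonneg fun l _ => hD0 l)
    refine le_trans ?_ (le_self_pow₀ h1 (by omega))
    refine le_trans ?_ hge
    refine le_trans (le_of_eq ?_) (hD l p hp)
    -- Translating in `ω` changes the map only by a constant, so its derivatives at `(p, ω)` are
    -- those at `(p, 0)`.
    have e : (fun z : P' × ℝ => (Φ z.1, z.2)) =
        (fun z : P' × ℝ => (Φ (z + (0, -ω)).1, (z + (0, -ω)).2)) + fun _ => ((0 : P), ω) := by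
      ext z <;> simp
    have hs : ContDiff ℝ (⊤ : ℕ∞)
        fun z : P' × ℝ => (Φ (z + (0, -ω)).1, (z + (0, -ω)).2) :=
      hΨ.comp (contDiff_id.add contDiff_const)
    conv_lhs => rw [e]
    rw [iteratedFDeriv_add_apply (hs.of_le (by exact_mod_cast le_top)).contDiffAt
      contDiff_const.contDiffAt, iteratedFDeriv_const_of_ne (by omega)]
    rw [iteratedFDeriv_comp_add_right (f := fun z : P' × ℝ => (Φ z.1, z.2)) l (0, -ω)]
    simp
  obtain ⟨D, hD1, hD⟩ := hD
  refine ⟨j.factorial * C * D ^ j, fun i p hp ω => ?_⟩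
  refine (norm_iteratedFDeriv_comp_le (contDiff_iterate_freqDeriv (h.smooth i) k) hΨ
    (n := j) (by exact_mod_cast le_top) (p, ω)
    (fun l hl => hC l hl i (Φ p) ⟨p, hp, rfl⟩ ω) (fun l h1 h2 => hD l h1 h2 p hp ω)).trans ?_
  exact le_of_eq (by ring)

lemma freqDeriv_conj {a : P × ℝ → ℂ} (ha : ContDiff ℝ (⊤ : ℕ∞) a) :
    freqDeriv (fun z => conj (a z)) = fun z => conj (freqDeriv a z) := by
  ext z
  have h1 : HasFDerivAt (fun z => conj (a z)) _ z :=
    (Complex.conjCLE.toContinuousLinearMap.hasFDerivAt (x := a z)).comp z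
      (ha.differentiable (by simp) z).hasFDerivAt
  rw [freqDeriv, h1.fderiv]
  rfl

lemma SymFam.conj {a : ι → P × ℝ → ℂ} {m : ℝ} (h : SymFam a m) :
    SymFam (fun i z => conj (a i z)) m := by
  have hc : ∀ (k : ℕ) {a : P × ℝ → ℂ}, ContDiff ℝ (⊤ : ℕ∞) a →
      BistaticSAR.freqDeriv^[k] (fun z => (starRingEnd ℂ) (a z)) =
        fun z => (starRingEnd ℂ) (BistaticSAR.freqDeriv^[k] a z) := by
    intro k
    induction k with
    | zero => intros; rfl
    | succ k ih =>
      intro a ha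
      simp only [Function.iterate_succ_apply]
      rw [freqDeriv_conj ha, ih (contDiff_freqDeriv ha)]
  refine ⟨fun i => Complex.conjCLE.contDiff.comp (h.smooth i), fun k => ?_⟩
  simp_rw [fun i => hc k (h.smooth i)]
  intro K hK j
  obtain ⟨C, hC⟩ := h.bound k K hK j
  refine ⟨C, fun i p hp ω => le_trans (le_of_eq ?_) (hC i p hp ω)⟩
  exact Complex.conjLIE.norm_iteratedFDeriv_comp_left (BistaticSAR.freqDeriv^[k] (a i)) (p, ω) j

lemma fderiv_fderiv_apply_comm {a : P → F} (ha : ContDiff ℝ (⊤ : ℕ∞) a) (z v w : P) :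
    fderiv ℝ (fun z => fderiv ℝ a z v) z w = fderiv ℝ (fun z => fderiv ℝ a z w) z v := by
  have hd : DifferentiableAt ℝ (fderiv ℝ a) z :=
    (ha.fderiv_right (m := (⊤ : ℕ∞)) (by norm_num)).differentiable (by simp) z
  have h1 : ∀ u, fderiv ℝ (fun z => fderiv ℝ a z u) z = (fderiv ℝ (fderiv ℝ a) z).flip u := by
    intro u
    rw [fderiv_clm_apply hd (differentiableAt_const u)]
    simp
  rw [h1, h1]
  have hs : IsSymmSndFDerivAt ℝ a z :=
    (ha.contDiffAt (x := z)).isSymmSndFDerivAt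
      (by simpa using WithTop.coe_le_coe.2 (le_top : (2 : ℕ∞) ≤ ⊤))
  exact hs.eq w v

/-- Second derivatives are symmetric, so a derivative in a fixed direction commutes with the
frequency derivatives; it costs one total derivative and no order. -/
lemma SymFam.dirDeriv {a : ι → P × ℝ → ℂ} {m : ℝ} (h : SymFam a m) (v : P × ℝ) :
    SymFam (fun i z => fderiv ℝ (a i) z v) m := by
  have hsm : ∀ {b : P × ℝ → ℂ}, ContDiff ℝ (⊤ : ℕ∞) b →
      ContDiff ℝ (⊤ : ℕ∞) fun z => fderiv ℝ b z v := fun hb =>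
    (hb.fderiv_right (m := (⊤ : ℕ∞)) (by norm_num)).clm_apply contDiff_const
  have hc : ∀ (k : ℕ) {b : P × ℝ → ℂ}, ContDiff ℝ (⊤ : ℕ∞) b →
      BistaticSAR.freqDeriv^[k] (fun z => fderiv ℝ b z v) =
        fun z => fderiv ℝ (BistaticSAR.freqDeriv^[k] b) z v := by
    intro k
    induction k with
    | zero => intros; rfl
    | succ k ih =>
      intro b hb
      simp only [Function.iterate_succ_apply]
      rw [← ih (contDiff_freqDeriv hb)]
      congr 1
      ext z
      exact fderiv_fderiv_apply_comm hb z v (0, 1)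
  refine ⟨fun i => hsm (h.smooth i), fun k => ?_⟩
  simp_rw [fun i => hc k (h.smooth i)]
  intro K hK j
  obtain ⟨C, hC⟩ := h.bound k K hK (j + 1)
  let L : (P × ℝ →L[ℝ] ℂ) →L[ℝ] ℂ := ContinuousLinearMap.apply ℝ ℂ v
  refine ⟨‖L‖ * C, fun i p hp ω => ?_⟩
  have hfd : ContDiff ℝ (⊤ : ℕ∞) (fderiv ℝ (BistaticSAR.freqDeriv^[k] (a i))) :=
    (contDiff_iterate_freqDeriv (h.smooth i) k).fderiv_right (by norm_num)
  have h1 := L.norm_iteratedFDeriv_comp_left (f := fderiv ℝ (BistaticSAR.freqDeriv^[k] (a i)))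
    (x := (p, ω)) (n := j) hfd.contDiffAt (by exact_mod_cast le_top)
  refine h1.trans ?_
  rw [norm_iteratedFDeriv_fderiv, mul_assoc]
  exact mul_le_mul_of_nonneg_left (hC i p hp ω) (norm_nonneg _)

lemma freqDeriv_slice {b : P × ℝ → F} (hb : ContDiff ℝ (⊤ : ℕ∞) b) (q : P) (ω : ℝ) :
    HasDerivAt (fun ω => b (q, ω)) (freqDeriv b (q, ω)) ω := by
  have h1 : HasDerivAt (fun ω : ℝ => (q, ω)) ((0 : P), (1 : ℝ)) ω :=
    (hasDerivAt_const ω q).prodMk (hasDerivAt_id ω)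
  exact ((hb.differentiable (by simp) (q, ω)).hasFDerivAt).comp_hasDerivAt ω h1

lemma iteratedDeriv_slice {b : P × ℝ → F} (hb : ContDiff ℝ (⊤ : ℕ∞) b) (k : ℕ) (q : P) (ω : ℝ) :
    iteratedDeriv k (fun ω => b (q, ω)) ω = freqDeriv^[k] b (q, ω) := by
  induction k generalizing b with
  | zero => simp
  | succ k ih =>
    rw [iteratedDeriv_succ', Function.iterate_succ_apply, ← ih (contDiff_freqDeriv hb)]
    congr 1
    ext ω
    exact (freqDeriv_slice hb q ω).deriv

/-- A smooth cutoff `χ(ε ω)` is a symbol of order `0`, uniformly in `ε ∈ [0, 1]`. -/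
lemma SymFam.cutoff {χ : ℝ → ℝ} (hχ : ContDiff ℝ (⊤ : ℕ∞) χ) (hc : HasCompactSupport χ) :
    SymFam (fun (ε : Icc (0 : ℝ) 1) (z : P × ℝ) => (χ (ε * z.2) : ℂ)) 0 := by
  have hsm : ∀ {g : ℝ → ℂ}, ContDiff ℝ (⊤ : ℕ∞) g → ∀ ε : ℝ,
      ContDiff ℝ (⊤ : ℕ∞) fun z : P × ℝ => g (ε * z.2) := fun hg ε =>
    hg.comp (contDiff_const.mul contDiff_snd)
  have hit : ∀ (k : ℕ) {g : ℝ → ℂ}, ContDiff ℝ (⊤ : ℕ∞) g → ∀ ε : ℝ,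
      BistaticSAR.freqDeriv^[k] (fun z : P × ℝ => g (ε * z.2)) =
        fun z : P × ℝ => (ε : ℂ) ^ k * iteratedDeriv k g (ε * z.2) := by
    intro k g hg ε
    ext ⟨q, ω⟩
    rw [← iteratedDeriv_slice (hsm hg ε)]
    have hgk : ContDiff ℝ k g := hg.of_le (by exact_mod_cast le_top)
    change iteratedDeriv k (fun ω => g (ε * ω)) ω = _
    rw [iteratedDeriv_comp_const_smul hgk ε]
    simp
  set g : ℝ → ℂ := fun x => (χ x : ℂ) with hgdef
  have hg : ContDiff ℝ (⊤ : ℕ∞) g := Complex.ofRealCLM.contDiff.comp hχ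
  have hgc : HasCompactSupport g := hc.comp_left (g := fun x : ℝ => (x : ℂ)) (by simp)
  refine ⟨fun ε => hsm hg ε, fun k => ?_⟩
  have hit' : (fun ε : Icc (0 : ℝ) 1 =>
      BistaticSAR.freqDeriv^[k] fun z : P × ℝ => (χ (ε * z.2) : ℂ)) = fun ε : Icc (0 : ℝ) 1 =>
        fun z : P × ℝ => ((ε : ℝ) : ℂ) ^ k * iteratedDeriv k g (ε * z.2) :=
    funext fun ε => hit k hg ε
  rw [hit']
  intro K hK j
  have hgk : ContDiff ℝ (⊤ : ℕ∞) (iteratedDeriv k g) := by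
    rw [iteratedDeriv_eq_iterate]; exact hg.iterate_deriv k
  have hgkc : HasCompactSupport (iteratedDeriv k g) := by
    rw [iteratedDeriv_eq_equiv_comp]; exact (hgc.iteratedFDeriv k).comp_left (map_zero _)
  have hgkj : HasCompactSupport (iteratedFDeriv ℝ j (iteratedDeriv k g)) := hgkc.iteratedFDeriv j
  obtain ⟨C, hC⟩ := hgkj.exists_bound_of_continuous
    (hgk.continuous_iteratedFDeriv (m := j) (by exact_mod_cast le_top))
  obtain ⟨r, hr⟩ := hgkj.isCompact.isBounded.exists_norm_le
  have hC0 : 0 ≤ C := (norm_nonneg _).trans (hC 0)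
  refine ⟨C * (1 + |r|) ^ k, fun ε p hp ω => ?_⟩
  have hε0 : (0 : ℝ) ≤ ε := ε.2.1
  have hε1 : (ε : ℝ) ≤ 1 := ε.2.2
  have e1 : (fun z : P × ℝ => ((ε : ℝ) : ℂ) ^ k * iteratedDeriv k g (ε * z.2)) =
      fun z => ((ε : ℝ) ^ k) • (iteratedDeriv k g ∘ ((ε : ℝ) • ContinuousLinearMap.snd ℝ P ℝ)) z := by
    ext z; simp
  beta_reduce
  rw [e1, iteratedFDeriv_const_smul_apply' ((hgk.comp (ContinuousLinearMap.contDiff _)).of_le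
    (by exact_mod_cast le_top)).contDiffAt, norm_smul, Real.norm_of_nonneg (by positivity),
    ContinuousLinearMap.iteratedFDeriv_comp_right _ hgk _ (i := j) (by exact_mod_cast le_top)]
  have h2 : ‖((iteratedFDeriv ℝ j (iteratedDeriv k g)) ((ε : ℝ) * ω)).compContinuousLinearMap
      fun _ : Fin j => ((ε : ℝ) • ContinuousLinearMap.snd ℝ P ℝ)‖ ≤
      ‖iteratedFDeriv ℝ j (iteratedDeriv k g) ((ε : ℝ) * ω)‖ := by
    refine (ContinuousMultilinearMap.norm_compContinuousLinearMap_le _ _).trans ?_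
    refine mul_le_of_le_one_right (norm_nonneg _) (Finset.prod_le_one (fun _ _ => norm_nonneg _)
      fun _ _ => ?_)
    rw [norm_smul, Real.norm_of_nonneg hε0]
    exact mul_le_one₀ hε1 (norm_nonneg _) (ContinuousLinearMap.norm_snd_le ℝ P ℝ)
  refine (mul_le_mul_of_nonneg_left h2 (by positivity)).trans ?_
  rw [zero_sub, Real.rpow_neg (one_add_abs_pos ω).le, Real.rpow_natCast, ← div_eq_mul_inv,
    le_div_iff₀ (by positivity)]
  -- Each frequency derivative produces a factor `ε`. On the support of the derivatives of `χ` one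
  -- has `ε|ω| ≤ r`, so `ε(1 + |ω|)` is bounded and `ε ^ k` supplies the decay `(1 + |ω|) ^ (-k)`
  -- uniformly in `ε`.
  by_cases hz : iteratedFDeriv ℝ j (iteratedDeriv k g) ((ε : ℝ) * ω) = 0
  · rw [hz]; simp; positivity
  · have h3 := hr _ (subset_tsupport _ hz)
    rw [Real.norm_eq_abs, abs_mul, abs_of_nonneg hε0] at h3
    have h4 : (ε : ℝ) * (1 + |ω|) ≤ 1 + |r| := by
      have := le_abs_self r
      nlinarith
    calc _ = ‖iteratedFDeriv ℝ j (iteratedDeriv k g) ((ε : ℝ) * ω)‖ *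
          ((ε : ℝ) * (1 + |ω|)) ^ k := by rw [mul_pow]; ring
      _ ≤ C * (1 + |r|) ^ k := by
        gcongr
        exact hC _

end Symbols

/-! ### Mixed partial derivatives versus total derivatives in the symbol estimates -/

section Conversion

/-- The total derivative splits into the derivative in `p` and the one in `ω`, both of which commute
with further frequency derivatives, and induction on `n` applies to each part. The target `F` varies
in the induction because the derivative in `p` takes values in `P →L[ℝ] F`. -/
lemma norm_iteratedFDeriv_le_of_mixed {P : Type} [NormedAddCommGroup P] [NormedSpace ℝ P]
    {K : Set P} {m : ℝ} (n : ℕ) :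
    ∀ {F : Type} [NormedAddCommGroup F] [NormedSpace ℝ F] {b : P × ℝ → F},
    ContDiff ℝ (⊤ : ℕ∞) b →
    (∀ j k : ℕ, ∃ C : ℝ, ∀ p ∈ K, ∀ ω : ℝ,
      ‖iteratedFDeriv ℝ j (fun q => freqDeriv^[k] b (q, ω)) p‖ ≤ C * (1 + |ω|) ^ m) →
    ∃ C : ℝ, ∀ p ∈ K, ∀ ω : ℝ, ‖iteratedFDeriv ℝ n b (p, ω)‖ ≤ C * (1 + |ω|) ^ m := by
  induction n with
  | zero =>
    intro F _ _ b hb h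
    obtain ⟨C, hC⟩ := h 0 0
    refine ⟨C, fun p hp ω => ?_⟩
    simpa using hC p hp ω
  | succ n ih =>
    intro F _ _ b hb h
    let D : ∀ (c : P × ℝ → F), P × ℝ → P →L[ℝ] F :=
      fun c z => (fderiv ℝ c z).comp (ContinuousLinearMap.inl ℝ P ℝ)
    have hDs : ∀ {c : P × ℝ → F}, ContDiff ℝ (⊤ : ℕ∞) c → ContDiff ℝ (⊤ : ℕ∞) (D c) := fun hc =>
      (hc.fderiv_right (m := (⊤ : ℕ∞)) (by norm_num)).clm_comp contDiff_const
    have hcomm : ∀ (k : ℕ) {c : P × ℝ → F}, ContDiff ℝ (⊤ : ℕ∞) c →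
        freqDeriv^[k] (D c) = D (freqDeriv^[k] c) := by
      intro k
      induction k with
      | zero => intros; rfl
      | succ k ihk =>
        intro c hc
        simp only [Function.iterate_succ_apply]
        rw [← ihk (contDiff_freqDeriv hc)]
        congr 1
        ext z v
        have h1 : fderiv ℝ (D c) z (0, 1) v = fderiv ℝ (fun z => D c z v) z (0, 1) := by
          rw [fderiv_clm_apply ((hDs hc).differentiable (by simp) z) (differentiableAt_const v)]
          simp
        exact h1.trans (fderiv_fderiv_apply_comm hc z (v, 0) (0, 1))
    have hslice : ∀ {c : P × ℝ → F}, ContDiff ℝ (⊤ : ℕ∞) c → ∀ ω,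
        (fun q => D c (q, ω)) = fderiv ℝ fun q => c (q, ω) := by
      intro c hc ω
      ext1 q
      have h1 : HasFDerivAt (fun q : P => (q, ω)) (ContinuousLinearMap.inl ℝ P ℝ) q := 
        hasFDerivAt_prodMk_left q ω
      exact (((hc.differentiable (by simp) (q, ω)).hasFDerivAt).comp q h1).fderiv.symm
    obtain ⟨C₁, hC₁⟩ := ih (hDs hb) (fun j k => by
      obtain ⟨C, hC⟩ := h (j + 1) k
      refine ⟨C, fun p hp ω => ?_⟩
      rw [hcomm k hb, hslice (contDiff_iterate_freqDeriv hb k), norm_iteratedFDeriv_fderiv]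
      exact hC p hp ω)
    obtain ⟨C₂, hC₂⟩ := ih (contDiff_freqDeriv hb) (fun j k => h j (k + 1))
    let L₁ : (P →L[ℝ] F) →L[ℝ] (P × ℝ →L[ℝ] F) :=
      (ContinuousLinearMap.compL ℝ (P × ℝ) P F).flip (ContinuousLinearMap.fst ℝ P ℝ)
    let L₂ : F →L[ℝ] (P × ℝ →L[ℝ] F) :=
      ContinuousLinearMap.smulRightL ℝ (P × ℝ) F (ContinuousLinearMap.snd ℝ P ℝ)
    have hsplit : fderiv ℝ b = (L₁ ∘ D b) + (L₂ ∘ freqDeriv b) := by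
      refine funext fun z => ContinuousLinearMap.ext fun v => ?_
      have : v = (v.1, 0) + v.2 • ((0 : P), (1 : ℝ)) := by ext <;> simp
      conv_lhs => rw [this, map_add, map_smul]
      simp [L₁, L₂, D, freqDeriv]
    refine ⟨‖L₁‖ * C₁ + ‖L₂‖ * C₂, fun p hp ω => ?_⟩
    have hn : ((n : ℕ) : WithTop ℕ∞) ≤ ((⊤ : ℕ∞) : WithTop ℕ∞) := by exact_mod_cast le_top
    rw [← norm_iteratedFDeriv_fderiv, hsplit, iteratedFDeriv_add_apply
      ((L₁.contDiff.comp (hDs hb)).of_le hn).contDiffAt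
      ((L₂.contDiff.comp (contDiff_freqDeriv hb)).of_le hn).contDiffAt, add_mul, mul_assoc,
      mul_assoc]
    refine (norm_add_le _ _).trans (add_le_add ?_ ?_)
    · exact (L₁.norm_iteratedFDeriv_comp_left (hDs hb).contDiffAt hn).trans
        (mul_le_mul_of_nonneg_left (hC₁ p hp ω) (norm_nonneg _))
    · exact (L₂.norm_iteratedFDeriv_comp_left (contDiff_freqDeriv hb).contDiffAt hn).trans
        (mul_le_mul_of_nonneg_left (hC₂ p hp ω) (norm_nonneg _))

lemma SymFam.of_mixed {ι P : Type} [NormedAddCommGroup P] [NormedSpace ℝ P] {b : P × ℝ → ℂ}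
    {m : ℝ} (hb : ContDiff ℝ (⊤ : ℕ∞) b)
    (h : ∀ K : Set P, IsCompact K → ∀ j k : ℕ, ∃ C : ℝ, ∀ p ∈ K, ∀ ω : ℝ,
      ‖iteratedFDeriv ℝ j (fun q => iteratedDeriv k (fun ω => b (q, ω)) ω) p‖ ≤
        C * (1 + |ω|) ^ (m - k)) : SymFam (fun _ : ι => b) m := by
  refine ⟨fun _ => hb, fun k K hK n => ?_⟩
  -- The total derivatives of the `k`-th frequency derivative contain `l` further ones in `ω`. These
  -- gain `l` more orders, and the gain is discarded.
  obtain ⟨C, hC⟩ := norm_iteratedFDeriv_le_of_mixed (K := K) (m := m - k) n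
    (contDiff_iterate_freqDeriv hb k) (fun j l => by
      obtain ⟨C, hC⟩ := h K hK j (l + k)
      refine ⟨max C 0, fun p hp ω => ?_⟩
      simp_rw [iteratedDeriv_slice hb, Function.iterate_add_apply] at hC
      refine (hC p hp ω).trans ?_
      gcongr
      · exact le_max_left _ _
      · linarith [abs_nonneg ω]
      · linarith [(Nat.cast_nonneg l : (0 : ℝ) ≤ l)])
  exact ⟨C, fun _ => hC⟩

lemma SymFam.isSymbol {ι P : Type*} [NormedAddCommGroup P] [NormedSpace ℝ P]
    {a : ι → P × ℝ → ℂ} {m : ℝ} (h : SymFam a m) (i : ι) (U : Set P) :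
    IsSymbol U m fun p ω => a i (p, ω) := by
  refine ⟨(h.smooth i).contDiffOn, fun K _ hK j k => ?_⟩
  obtain ⟨C, hC⟩ := h.bound k K hK j
  refine ⟨C, fun p hp ω => ?_⟩
  simp_rw [iteratedDeriv_slice (h.smooth i)]
  exact (norm_iteratedFDeriv_slice_le (contDiff_iterate_freqDeriv (h.smooth i) k) j p ω).trans
    (hC i p hp ω)

end Conversion

end BistaticSAR

namespace BistaticSAR

/-! ### Compactly supported parametric integrals -/

section CompactParametric

variable {E α F : Type*} [NormedAddCommGroup E] [NormedSpace ℝ E] [NormedAddCommGroup F]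
  [NormedSpace ℝ F] [NormedAddCommGroup α] [NormedSpace ℝ α] [MeasurableSpace α] [BorelSpace α]
  [SecondCountableTopology α] {μ : Measure α} [IsFiniteMeasureOnCompacts μ]

theorem contDiff_integral_of_locally_compact_support [LocallyCompactSpace E] {f : E × α → F}
    (hf : ContDiff ℝ (⊤ : ℕ∞) f)
    (hs : ∀ x₀, ∃ k : Set α, IsCompact k ∧ ∀ᶠ x in 𝓝 x₀, ∀ y ∉ k, f (x, y) = 0) :
    ContDiff ℝ (⊤ : ℕ∞) (fun x => ∫ y, f (x, y) ∂μ) := by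
  refine (contDiff_integral_of_contDiff hf fun j x₀ => ?_).1
  obtain ⟨k, hk, hz⟩ := hs x₀
  obtain ⟨K, hK, hKx⟩ := exists_compact_mem_nhds x₀
  obtain ⟨C, hC⟩ := ((hK.prod hk).image (continuous_iteratedFDeriv_slice hf j)).isBounded.exists_norm_le
  refine ⟨k.indicator fun _ => max C 0,
    (integrable_indicator_iff hk.measurableSet).2 (integrableOn_const hk.measure_lt_top.ne), ?_⟩
  -- For `y ∉ k` the integrand vanishes for all parameters near `x`, so its derivatives at `x`
  -- vanish too; a constant on `k` then dominates.
  filter_upwards [eventually_eventually_nhds.2 hz, hKx] with x hx hxK y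
  by_cases hy : y ∈ k
  · rw [indicator_of_mem hy]
    exact (hC _ ⟨(x, y), ⟨hxK, hy⟩, rfl⟩).trans (le_max_left _ _)
  · rw [indicator_of_notMem hy]
    have : (fun x' => f (x', y)) =ᶠ[𝓝 x] fun _ => 0 := hx.mono fun x' hx' => hx' y hy
    rw [this.iteratedFDeriv ℝ j |>.eq_of_nhds]
    simp

theorem hasDerivAt_integral_of_compact_support {f : ℝ × ℝ → ℂ} (hf : ContDiff ℝ (⊤ : ℕ∞) f)
    {ρ : ℝ} (hs : ∀ x r, ρ < |r| → f (x, r) = 0) (x : ℝ) :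
    Integrable (fun r => fderiv ℝ f (x, r) (1, 0)) ∧
    HasDerivAt (fun x => ∫ r, f (x, r)) (∫ r, fderiv ℝ f (x, r) (1, 0)) x := by
  have hcf : Continuous fun z : ℝ × ℝ => fderiv ℝ f z (1, 0) :=
    ((hf.fderiv_right (m := (⊤ : ℕ∞)) (by norm_num)).clm_apply contDiff_const).continuous
  have hd : ∀ r x, HasDerivAt (fun x => f (x, r)) (fderiv ℝ f (x, r) (1, 0)) x := fun r x =>
    ((hf.differentiable (by simp) (x, r)).hasFDerivAt).comp_hasDerivAt x
      ((hasDerivAt_id x).prodMk (hasDerivAt_const x r))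
  have hz : ∀ r x, ρ < |r| → fderiv ℝ f (x, r) (1, 0) = 0 := fun r x hr => by
    rw [← (hd r x).deriv]
    simp [hs _ r hr]
  obtain ⟨C, hC⟩ := (((isCompact_closedBall x 1).prod (isCompact_Icc (a := -ρ) (b := ρ))).image
    hcf).isBounded.exists_norm_le
  have hint : ∀ {g : ℝ → ℂ}, Continuous g → (∀ r, ρ < |r| → g r = 0) → Integrable g :=
    fun hg h => hg.integrable_of_hasCompactSupport
      (HasCompactSupport.intro (isCompact_Icc (a := -ρ) (b := ρ)) fun r hr => h r (by
        by_contra h'; exact hr (abs_le.1 (not_lt.1 h'))))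
  refine hasDerivAt_integral_of_dominated_loc_of_deriv_le (F := fun x r => f (x, r))
    (F' := fun x r => fderiv ℝ f (x, r) (1, 0)) (s := Metric.closedBall x 1)
    (bound := (Icc (-ρ) ρ).indicator fun _ => C)
    (Metric.closedBall_mem_nhds x one_pos)
    (Eventually.of_forall fun x => (hf.continuous.comp (Continuous.prodMk_right x)).aestronglyMeasurable)
    (hint (hf.continuous.comp (Continuous.prodMk_right x)) (hs x))
    (hcf.comp (Continuous.prodMk_right x)).aestronglyMeasurable
    (Eventually.of_forall fun r x' hx' => ?_)
    ((integrable_indicator_iff measurableSet_Icc).2 (integrableOn_const isCompact_Icc.measure_lt_top.ne))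
    (Eventually.of_forall fun r x' _ => hd r x')
  by_cases hr : r ∈ Icc (-ρ) ρ
  · rw [indicator_of_mem hr]
    exact hC _ ⟨(x', r), ⟨hx', hr⟩, rfl⟩
  · rw [indicator_of_notMem hr, hz r x' (by by_contra h'; exact hr (abs_le.1 (not_lt.1 h')))]
    simp

end CompactParametric

/-! ### Elimination of the time variable from a phase function -/

section Reduction

/-- The character `e^{-iσr}`. -/
noncomputable def negChar (σ r : ℝ) : ℂ := Complex.exp (-(Complex.I * σ * r))

lemma norm_negChar (σ r : ℝ) : ‖negChar σ r‖ = 1 := by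
  rw [negChar, show -(Complex.I * σ * r) = ((-(σ * r) : ℝ) : ℂ) * Complex.I by push_cast; ring,
    Complex.norm_exp_ofReal_mul_I]

lemma contDiff_negChar : ContDiff ℝ (⊤ : ℕ∞) fun z : ℝ × ℝ => negChar z.1 z.2 := by
  unfold negChar
  exact (((contDiff_const.mul (Complex.ofRealCLM.contDiff.comp contDiff_fst)).mul
    (Complex.ofRealCLM.contDiff.comp contDiff_snd)).neg).cexp

lemma hasDerivAt_negChar (σ r : ℝ) :
    HasDerivAt (fun r => negChar σ r) (-(Complex.I * σ) * negChar σ r) r := by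
  have h : HasDerivAt (fun r : ℝ => -(Complex.I * σ * (r : ℂ))) (-(Complex.I * σ * 1)) r :=
    ((Complex.ofRealCLM.hasDerivAt (x := r)).const_mul _).neg
  refine h.cexp.congr_deriv ?_
  simp only [negChar]; ring

lemma negChar_comm (σ r : ℝ) : negChar σ r = negChar r σ := by
  unfold negChar; congr 1; ring

variable {ι P : Type*} [NormedAddCommGroup P] [NormedSpace ℝ P]

/-- The Fourier transform of an amplitude in its last parameter. -/
noncomputable def tHat (a : (P × ℝ) × ℝ → ℂ) (p : P) (σ ω : ℝ) : ℂ :=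
  ∫ r : ℝ, negChar σ r * a ((p, r), ω)

/-- The reduced amplitude `∫∫ e^{-iσr} a(p, r, ω + σ) dr dσ`. -/
noncomputable def redAmp (a : (P × ℝ) × ℝ → ℂ) (z : P × ℝ) : ℂ :=
  ∫ σ : ℝ, tHat a z.1 σ (z.2 + σ)

/-- The support in `r` is compact, locally uniformly in `p`. -/
def RSupp (a : ι → (P × ℝ) × ℝ → ℂ) : Prop :=
  ∀ K : Set P, IsCompact K → ∃ ρ : ℝ, ∀ i, ∀ p ∈ K, ∀ r ω : ℝ, ρ < |r| → a i ((p, r), ω) = 0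

/-- The operator `1 - ∂ᵣ²`. -/
noncomputable def rOp (a : (P × ℝ) × ℝ → ℂ) : (P × ℝ) × ℝ → ℂ := fun z =>
  a z + (-1 : ℂ) * fderiv ℝ (fun z => fderiv ℝ a z ((0, 1), 0)) z ((0, 1), 0)

lemma hasDerivAt_rslice {a : (P × ℝ) × ℝ → ℂ} (ha : ContDiff ℝ (⊤ : ℕ∞) a) (p : P) (r ω : ℝ) :
    HasDerivAt (fun r => a ((p, r), ω)) (fderiv ℝ a ((p, r), ω) ((0, 1), 0)) r :=
  ((ha.differentiable (by simp) ((p, r), ω)).hasFDerivAt).comp_hasDerivAt r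
    (((hasDerivAt_const r p).prodMk (hasDerivAt_id r)).prodMk (hasDerivAt_const r ω))

lemma fderiv_rslice_eq_zero {a : (P × ℝ) × ℝ → ℂ} (ha : ContDiff ℝ (⊤ : ℕ∞) a) {p : P} {ω ρ : ℝ}
    (h : ∀ r, ρ < |r| → a ((p, r), ω) = 0) (r : ℝ) (hr : ρ < |r|) :
    fderiv ℝ a ((p, r), ω) ((0, 1), 0) = 0 := by
  rw [← (hasDerivAt_rslice ha p r ω).deriv]
  have : (fun r => a ((p, r), ω)) =ᶠ[𝓝 r] fun _ => 0 := by
    filter_upwards [(isOpen_lt continuous_const continuous_abs).mem_nhds hr] with r' hr'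
    exact h r' hr'
  rw [this.deriv_eq]
  simp

lemma contDiff_dirDeriv {E : Type*} [NormedAddCommGroup E] [NormedSpace ℝ E] {a : E → ℂ}
    (ha : ContDiff ℝ (⊤ : ℕ∞) a) (v : E) : ContDiff ℝ (⊤ : ℕ∞) fun z => fderiv ℝ a z v :=
  (ha.fderiv_right (m := (⊤ : ℕ∞)) (by norm_num)).clm_apply contDiff_const

lemma integrable_of_eq_zero {g : ℝ → ℂ} (hg : Continuous g) {ρ : ℝ} (h : ∀ r, ρ < |r| → g r = 0) :
    Integrable g :=
  hg.integrable_of_hasCompactSupport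
    (HasCompactSupport.intro (isCompact_Icc (a := -ρ) (b := ρ)) fun r hr => h r (by
      by_contra h'; exact hr (abs_le.1 (not_lt.1 h'))))

lemma continuous_negChar_mul {a : (P × ℝ) × ℝ → ℂ} (ha : Continuous a) (p : P) (σ ω : ℝ) :
    Continuous fun r => negChar σ r * a ((p, r), ω) :=
  (contDiff_negChar.continuous.comp (Continuous.prodMk_right σ)).mul
    (ha.comp (by fun_prop))

lemma integrable_negChar_mul {a : (P × ℝ) × ℝ → ℂ} (ha : Continuous a) {p : P} {ω ρ : ℝ}
    (h : ∀ r, ρ < |r| → a ((p, r), ω) = 0) (σ : ℝ) :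
    Integrable fun r => negChar σ r * a ((p, r), ω) :=
  integrable_of_eq_zero (continuous_negChar_mul ha p σ ω) fun r hr => by rw [h r hr, mul_zero]

lemma tHat_fderiv {a : (P × ℝ) × ℝ → ℂ} (ha : ContDiff ℝ (⊤ : ℕ∞) a) {p : P} {ω ρ : ℝ}
    (h : ∀ r, ρ < |r| → a ((p, r), ω) = 0) (σ : ℝ) :
    tHat (fun z => fderiv ℝ a z ((0, 1), 0)) p σ ω = Complex.I * σ * tHat a p σ ω := by
  have h1 := integral_mul_deriv_eq_deriv_mul_of_integrable (u := fun r => negChar σ r)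
    (v := fun r => a ((p, r), ω)) (u' := fun r => -(Complex.I * σ) * negChar σ r)
    (v' := fun r => fderiv ℝ a ((p, r), ω) ((0, 1), 0))
    (fun r _ => hasDerivAt_negChar σ r) (fun r _ => hasDerivAt_rslice ha p r ω)
    (integrable_negChar_mul (contDiff_dirDeriv ha ((0, 1), 0)).continuous
      (fderiv_rslice_eq_zero ha h) σ)
    (by
      have := (integrable_negChar_mul ha.continuous h σ).const_mul (-(Complex.I * σ))
      refine this.congr (Eventually.of_forall fun r => ?_)
      simp [mul_assoc])
    (integrable_negChar_mul ha.continuous h σ)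
  unfold tHat
  rw [h1]
  simp_rw [mul_assoc (-(Complex.I * (σ : ℂ)))]
  rw [integral_const_mul]
  ring

lemma SymFam.rOp {a : ι → (P × ℝ) × ℝ → ℂ} {m : ℝ} (h : SymFam a m) :
    SymFam (fun i => rOp (a i)) m := by
  have h2 := ((h.dirDeriv ((0, 1), 0)).dirDeriv ((0, 1), 0)).param_mul
    (φ := fun _ => (-1 : ℂ)) contDiff_const
  exact h.add h2

lemma rOp_eq_zero {a : (P × ℝ) × ℝ → ℂ} (ha : ContDiff ℝ (⊤ : ℕ∞) a) {p : P} {ω ρ : ℝ}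
    (h : ∀ r, ρ < |r| → a ((p, r), ω) = 0) (r : ℝ) (hr : ρ < |r|) : rOp a ((p, r), ω) = 0 := by
  rw [rOp, h r hr, fderiv_rslice_eq_zero (contDiff_dirDeriv ha _) (fderiv_rslice_eq_zero ha h) r hr]
  simp

lemma contDiff_rOp {a : (P × ℝ) × ℝ → ℂ} (ha : ContDiff ℝ (⊤ : ℕ∞) a) :
    ContDiff ℝ (⊤ : ℕ∞) (rOp a) :=
  ha.add (contDiff_const.mul (contDiff_dirDeriv (contDiff_dirDeriv ha _) _))

/-- Two integrations by parts turn `-∂ᵣ²` into `σ²`. The factor `1 + σ²` has no zeros and can be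
divided out, which is the source of all decay in `σ`. -/
lemma tHat_rOp {a : (P × ℝ) × ℝ → ℂ} (ha : ContDiff ℝ (⊤ : ℕ∞) a) {p : P} {ω ρ : ℝ}
    (h : ∀ r, ρ < |r| → a ((p, r), ω) = 0) (σ : ℝ) :
    tHat (rOp a) p σ ω = (1 + σ ^ 2 : ℝ) * tHat a p σ ω := by
  have h1 := tHat_fderiv (contDiff_dirDeriv ha ((0, 1), 0)) (fderiv_rslice_eq_zero ha h) σ
  rw [tHat_fderiv ha h] at h1
  have h2 := integrable_negChar_mul (contDiff_dirDeriv (contDiff_dirDeriv ha ((0, 1), 0))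
    ((0, 1), 0)).continuous (fderiv_rslice_eq_zero (contDiff_dirDeriv ha ((0, 1), 0))
    (fderiv_rslice_eq_zero ha h)) σ
  have : tHat (rOp a) p σ ω = tHat a p σ ω -
      tHat (fun z => fderiv ℝ (fun z => fderiv ℝ a z ((0, 1), 0)) z ((0, 1), 0)) p σ ω := by
    unfold tHat
    rw [← integral_sub (integrable_negChar_mul ha.continuous h σ) h2]
    congr 1; ext r
    rw [rOp]; ring
  rw [this, h1]
  push_cast
  linear_combination (-(σ : ℂ) ^ 2 * tHat a p σ ω) * Complex.I_sq

lemma tHat_iterate_rOp {a : (P × ℝ) × ℝ → ℂ} (ha : ContDiff ℝ (⊤ : ℕ∞) a) {p : P} {ω ρ : ℝ}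
    (h : ∀ r, ρ < |r| → a ((p, r), ω) = 0) (σ : ℝ) (N : ℕ) :
    tHat (rOp^[N] a) p σ ω = ((1 + σ ^ 2) ^ N : ℝ) * tHat a p σ ω := by
  induction N generalizing a with
  | zero => simp
  | succ N ih =>
    rw [Function.iterate_succ_apply, ih (contDiff_rOp ha) (rOp_eq_zero ha h), tHat_rOp ha h]
    push_cast; ring

lemma SymFam.iterate_rOp {a : ι → (P × ℝ) × ℝ → ℂ} {m : ℝ} (h : SymFam a m) (N : ℕ) :
    SymFam (fun i => BistaticSAR.rOp^[N] (a i)) m := by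
  induction N generalizing a with
  | zero => exact h
  | succ N ih => exact ih h.rOp

lemma iterate_rOp_eq_zero {a : (P × ℝ) × ℝ → ℂ} (ha : ContDiff ℝ (⊤ : ℕ∞) a) {p : P} {ω ρ : ℝ}
    (h : ∀ r, ρ < |r| → a ((p, r), ω) = 0) (N : ℕ) (r : ℝ) (hr : ρ < |r|) :
    rOp^[N] a ((p, r), ω) = 0 := by
  induction N generalizing a with
  | zero => exact h r hr
  | succ N ih => exact ih (contDiff_rOp ha) (rOp_eq_zero ha h)

/-- Peetre's inequality. For negative `m` it follows from the positive case applied to `ω = (ω + σ)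
+ (-σ)`. -/
lemma one_add_abs_add_rpow_le (m ω σ : ℝ) :
    (1 + |ω + σ|) ^ m ≤ (1 + |ω|) ^ m * (1 + |σ|) ^ |m| := by
  have h1 : ∀ a b : ℝ, 1 + |a + b| ≤ (1 + |a|) * (1 + |b|) := fun a b => by
    nlinarith [abs_add_le a b, abs_nonneg a, abs_nonneg b, mul_nonneg (abs_nonneg a) (abs_nonneg b)]
  rcases le_total 0 m with hm | hm
  · rw [abs_of_nonneg hm, ← Real.mul_rpow (by positivity) (by positivity)]
    exact Real.rpow_le_rpow (by positivity) (h1 ω σ) hm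
  · rw [abs_of_nonpos hm, Real.rpow_neg (by positivity), ← div_eq_mul_inv,
      le_div_iff₀ (by positivity), ← Real.mul_rpow (by positivity) (by positivity)]
    refine Real.rpow_le_rpow_of_nonpos (by positivity) ?_ hm
    have := h1 (ω + σ) (-σ)
    rwa [add_neg_cancel_right, abs_neg] at this

lemma integrable_one_add_abs_rpow {M : ℝ} (hM : 1 < M) :
    Integrable fun σ : ℝ => (1 + |σ|) ^ (-M) := by
  have := integrable_one_add_norm (E := ℝ) (μ := volume) (r := M) (by simpa using hM)
  simpa using this

lemma inv_one_add_sq_pow_le (N : ℕ) (σ : ℝ) :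
    ((1 + σ ^ 2) ^ N)⁻¹ ≤ 2 ^ N * (1 + |σ|) ^ (-(2 * N : ℝ)) := by
  have h1 : (1 + |σ|) ^ 2 ≤ 2 * (1 + σ ^ 2) := by
    nlinarith [sq_abs σ, sq_nonneg (1 - |σ|)]
  rw [Real.rpow_neg (by positivity), ← div_eq_mul_inv, inv_eq_one_div,
    div_le_div_iff₀ (by positivity) (by positivity), one_mul, ← mul_pow]
  calc (1 + |σ|) ^ (2 * N : ℝ) = ((1 + |σ|) ^ 2) ^ N := by
        rw [← pow_mul]; exact_mod_cast Real.rpow_natCast (1 + |σ|) (2 * N)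
    _ ≤ _ := by gcongr

lemma SymFam.norm_le {a : ι → P × ℝ → ℂ} {m : ℝ} (h : SymFam a m) {K : Set P} (hK : IsCompact K) :
    ∃ C : ℝ, 0 ≤ C ∧ ∀ i, ∀ p ∈ K, ∀ ω : ℝ, ‖a i (p, ω)‖ ≤ C * (1 + |ω|) ^ m := by
  simpa using h.symBound.nonneg hK 0

/-- Divide the transform of `(1 - ∂ᵣ²)^N a` by `(1 + σ²)^N` with `2N ≥ M`. The operator does not
change the order of the symbol, and the integral over `r` runs over a bounded interval. -/
lemma norm_tHat_le {a : ι → (P × ℝ) × ℝ → ℂ} {m : ℝ} (h : SymFam a m) (hr : RSupp a) {K : Set P}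
    (hK : IsCompact K) (M : ℝ) : ∃ C : ℝ, 0 ≤ C ∧ ∀ i, ∀ p ∈ K, ∀ σ ω : ℝ,
    ‖tHat (a i) p σ ω‖ ≤ C * (1 + |σ|) ^ (-M) * (1 + |ω|) ^ m := by
  obtain ⟨N, hN⟩ := exists_nat_ge (M / 2)
  obtain ⟨ρ, hρ⟩ := hr K hK
  obtain ⟨C, hC0, hC⟩ := (h.iterate_rOp N).norm_le (hK.prod (isCompact_Icc (a := -ρ) (b := ρ)))
  refine ⟨2 ^ N * (C * (2 * |ρ|)), by positivity, fun i p hp σ ω => ?_⟩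
  have h1 := tHat_iterate_rOp (h.smooth i) (fun r => hρ i p hp r ω) σ N
  have h2 : ‖tHat (rOp^[N] (a i)) p σ ω‖ ≤ C * (1 + |ω|) ^ m * (2 * |ρ|) := by
    unfold tHat
    have hsub : ∫ r, negChar σ r * rOp^[N] (a i) ((p, r), ω) =
        ∫ r in Icc (-ρ) ρ, negChar σ r * rOp^[N] (a i) ((p, r), ω) := by
      rw [setIntegral_eq_integral_of_forall_compl_eq_zero]
      intro r hr
      rw [iterate_rOp_eq_zero (h.smooth i) (fun r => hρ i p hp r ω) N r
        (by by_contra h'; exact hr (abs_le.1 (not_lt.1 h'))), mul_zero]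
    rw [hsub]
    refine (norm_setIntegral_le_of_norm_le_const (C := C * (1 + |ω|) ^ m)
      isCompact_Icc.measure_lt_top fun r hr => ?_).trans ?_
    · rw [norm_mul, norm_negChar, one_mul]
      exact hC i (p, r) ⟨hp, hr⟩ ω
    · gcongr
      simp only [Real.volume_real_Icc]
      rw [max_le_iff]
      exact ⟨by linarith [le_abs_self ρ], by positivity⟩
  have h3 : ‖tHat (a i) p σ ω‖ = ((1 + σ ^ 2) ^ N)⁻¹ * ‖tHat (rOp^[N] (a i)) p σ ω‖ := by
    rw [h1, norm_mul, Complex.norm_real, Real.norm_of_nonneg (by positivity), ← mul_assoc,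
      inv_mul_cancel₀ (by positivity), one_mul]
  rw [h3]
  have h4 : (1 + |σ|) ^ (-(2 * N : ℝ)) ≤ (1 + |σ|) ^ (-M) :=
    Real.rpow_le_rpow_of_exponent_le (by linarith [abs_nonneg σ]) (by linarith)
  calc _ ≤ (2 ^ N * (1 + |σ|) ^ (-M)) * (C * (1 + |ω|) ^ m * (2 * |ρ|)) := by
        gcongr
        exact (inv_one_add_sq_pow_le N σ).trans (by gcongr)
    _ = _ := by ring

end Reduction

end BistaticSAR

namespace BistaticSAR

/-! ### The reduced amplitude is a symbol, negligible where the amplitude vanishes for small delay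
-/

section Reduction

variable {ι P : Type*} [NormedAddCommGroup P] [NormedSpace ℝ P]

/-- The absolutely convergent form of the integrand of `redAmp`. -/
noncomputable def redIntegrand (N : ℕ) (a : (P × ℝ) × ℝ → ℂ) (w : (P × ℝ) × (ℝ × ℝ)) : ℂ :=
  ((((1 + w.2.1 ^ 2) ^ N)⁻¹ : ℝ) : ℂ) * negChar w.2.1 w.2.2 *
    rOp^[N] a ((w.1.1, w.2.2), w.1.2 + w.2.1)

lemma contDiff_iterate_rOp {a : (P × ℝ) × ℝ → ℂ} (ha : ContDiff ℝ (⊤ : ℕ∞) a) (N : ℕ) :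
    ContDiff ℝ (⊤ : ℕ∞) (rOp^[N] a) := by
  induction N generalizing a with
  | zero => exact ha
  | succ N ih => exact ih (contDiff_rOp ha)

lemma contDiff_redIntegrand {a : (P × ℝ) × ℝ → ℂ} (ha : ContDiff ℝ (⊤ : ℕ∞) a) (N : ℕ) :
    ContDiff ℝ (⊤ : ℕ∞) (redIntegrand N a) := by
  unfold redIntegrand
  refine ContDiff.mul (ContDiff.mul ?_ ?_) ?_
  · refine Complex.ofRealCLM.contDiff.comp (ContDiff.inv ?_ fun w => by positivity)
    fun_prop
  · exact contDiff_negChar.comp contDiff_snd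
  · refine (contDiff_iterate_rOp ha N).comp ?_
    fun_prop

/-- Only the amplitude depends on `(p, ω)`; the other factors are constants for these derivatives.
Peetre's inequality moves the growth in `ω + σ` to `ω` at the price of `(1 + |σ|) ^ |m|`, which the
weight `(1 + σ²) ^ (-N)` absorbs once `N` is large. -/
lemma norm_iteratedFDeriv_redIntegrand_le {a : ι → (P × ℝ) × ℝ → ℂ} {m : ℝ} (h : SymFam a m)
    (hr : RSupp a) [LocallyCompactSpace P] {K : Set P} (hK : IsCompact K) (N j : ℕ) :
    ∃ C ρ : ℝ, 0 ≤ C ∧ ∀ i, ∀ p ∈ K, ∀ ω : ℝ, ∀ y : ℝ × ℝ,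
      ‖iteratedFDeriv ℝ j (fun z => redIntegrand N (a i) (z, y)) (p, ω)‖ ≤
        C * (1 + |ω|) ^ m * ((1 + |y.1|) ^ (|m| - 2 * N) * (Icc (-ρ) ρ).indicator 1 y.2) := by
  -- The bound `ρ` for the support in `r` is taken over a neighbourhood of `K`, so that for `|r| >
  -- ρ` the integrand vanishes near every `p ∈ K` and its derivatives vanish as well.
  obtain ⟨K', hK', hKK'⟩ := exists_compact_superset hK
  obtain ⟨ρ, hρ⟩ := hr K' hK'
  obtain ⟨C, hC0, hC⟩ := (h.iterate_rOp N).symBound.nonneg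
    (hK.prod (isCompact_Icc (a := -ρ) (b := ρ))) j
  refine ⟨2 ^ N * C, ρ, by positivity, fun i p hp ω y => ?_⟩
  obtain ⟨σ, r⟩ := y
  by_cases hy : r ∈ Icc (-ρ) ρ
  · let L : P × ℝ →L[ℝ] (P × ℝ) × ℝ :=
      (((ContinuousLinearMap.fst ℝ P ℝ).prod 0).prod (ContinuousLinearMap.snd ℝ P ℝ))
    have hL : ‖L‖ ≤ 1 := by
      refine ContinuousLinearMap.opNorm_le_bound _ zero_le_one fun z => ?_
      simp [L, Prod.norm_def]
    let b := rOp^[N] (a i)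
    have hb : ContDiff ℝ (⊤ : ℕ∞) b := contDiff_iterate_rOp (h.smooth i) N
    have hb' : ContDiff ℝ (⊤ : ℕ∞) fun z => b (z + ((0, r), σ)) :=
      hb.comp (contDiff_id.add contDiff_const)
    let c : ℂ := ((((1 + σ ^ 2) ^ N)⁻¹ : ℝ) : ℂ) * negChar σ r
    have e1 : (fun z => redIntegrand N (a i) (z, (σ, r))) =
        fun z => c • ((fun z => b (z + ((0, r), σ))) ∘ L) z := by
      ext z
      simp [redIntegrand, L, c, b]
    have hn : ((j : ℕ) : WithTop ℕ∞) ≤ ((⊤ : ℕ∞) : WithTop ℕ∞) := by exact_mod_cast le_top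
    have hc : ‖c‖ = ((1 + σ ^ 2) ^ N)⁻¹ := by
      simp only [c]
      rw [norm_mul, norm_negChar, Complex.norm_real, Real.norm_of_nonneg (by positivity), mul_one]
    have h2 : ‖iteratedFDeriv ℝ j ((fun z => b (z + ((0, r), σ))) ∘ L) (p, ω)‖ ≤
        C * (1 + |ω + σ|) ^ m := by
      rw [ContinuousLinearMap.iteratedFDeriv_comp_right _ hb' _ hn]
      refine (ContinuousMultilinearMap.norm_compContinuousLinearMap_le _ _).trans ?_
      refine (mul_le_of_le_one_right (norm_nonneg _) (Finset.prod_le_one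
        (fun _ _ => norm_nonneg _) fun _ _ => hL)).trans ?_
      rw [iteratedFDeriv_comp_add_right]
      have : L (p, ω) + ((0, r), σ) = ((p, r), ω + σ) := by simp [L]
      rw [this]
      exact hC i (p, r) ⟨hp, hy⟩ (ω + σ)
    have hm1 : (fun z => c • ((fun z => b (z + ((0, r), σ))) ∘ L) z) =
        c • ((fun z => b (z + ((0, r), σ))) ∘ L) := rfl
    rw [e1, hm1, iteratedFDeriv_const_smul_apply ((hb'.comp L.contDiff).of_le hn).contDiffAt,
      norm_smul, hc, indicator_of_mem hy]
    have hp1 : (1 + |σ|) ^ (|m| - 2 * N) = (1 + |σ|) ^ |m| * (1 + |σ|) ^ (-(2 * N : ℝ)) := by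
      rw [← Real.rpow_add (by positivity)]; ring_nf
    calc _ ≤ (2 ^ N * (1 + |σ|) ^ (-(2 * N : ℝ))) * (C * ((1 + |ω|) ^ m * (1 + |σ|) ^ |m|)) := by
          gcongr
          · exact inv_one_add_sq_pow_le N σ
          · exact h2.trans (by gcongr; exact one_add_abs_add_rpow_le m ω σ)
      _ = _ := by simp only [Pi.one_apply]; rw [hp1]; ring
  · rw [indicator_of_notMem hy]
    have hnear : (fun z => redIntegrand N (a i) (z, (σ, r))) =ᶠ[𝓝 (p, ω)] fun _ => 0 := by
      have hint : (interior K' ×ˢ univ : Set (P × ℝ)) ∈ 𝓝 (p, ω) :=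
        (isOpen_interior.prod isOpen_univ).mem_nhds ⟨hKK' hp, trivial⟩
      filter_upwards [hint] with z hz
      have := iterate_rOp_eq_zero (h.smooth i) (p := z.1) (ω := z.2 + σ) (ρ := ρ)
        (fun r => hρ i z.1 (interior_subset hz.1) r _) N r
        (by by_contra h'; exact hy (abs_le.1 (not_lt.1 h')))
      simp [redIntegrand, this]
    rw [(hnear.iteratedFDeriv ℝ j).eq_of_nhds]
    simp

lemma integrable_redWeight {m : ℝ} {N : ℕ} (hN : |m| + 2 ≤ 2 * N) (ρ : ℝ) :
    Integrable fun y : ℝ × ℝ =>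
      (1 + |y.1|) ^ (|m| - 2 * N) * (Icc (-ρ) ρ).indicator (1 : ℝ → ℝ) y.2 := by
  have h1 : Integrable fun σ : ℝ => (1 + |σ|) ^ (|m| - 2 * N) := by
    have := integrable_one_add_abs_rpow (M := 2 * N - |m|) (by linarith)
    simpa using this
  exact h1.mul_prod ((integrable_indicator_iff measurableSet_Icc).2
    (integrableOn_const isCompact_Icc.measure_lt_top.ne))

/-- The iterated integral in the definition need not converge absolutely in `(σ, r)`. After `N`
integrations by parts in `r` it does, and Fubini identifies it with an integral over the plane that
may be differentiated freely. -/
lemma redAmp_eq_integral {a : ι → (P × ℝ) × ℝ → ℂ} {m : ℝ} (h : SymFam a m)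
    (hr : RSupp a) [LocallyCompactSpace P] {N : ℕ} (hN : |m| + 2 ≤ 2 * N) (i : ι) :
    redAmp (a i) = fun z => ∫ y, redIntegrand N (a i) (z, y) := by
  ext ⟨p, ω⟩
  obtain ⟨C, ρ, hC0, hC⟩ := norm_iteratedFDeriv_redIntegrand_le h hr (isCompact_singleton (x := p)) N 0
  have hint : Integrable fun y => redIntegrand N (a i) ((p, ω), y) := by
    refine Integrable.mono' ((integrable_redWeight hN ρ).const_mul (C * (1 + |ω|) ^ m))
      ((contDiff_redIntegrand (h.smooth i) N).continuous.comp
        (Continuous.prodMk_right (p, ω))).aestronglyMeasurable (Eventually.of_forall fun y => ?_)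
    simpa using hC i p rfl ω y
  obtain ⟨ρ', hρ'⟩ := hr {p} isCompact_singleton
  rw [Measure.volume_eq_prod, integral_prod _ hint, redAmp]
  congr 1; ext σ
  have h1 := tHat_iterate_rOp (h.smooth i) (p := p) (ω := ω + σ)
    (fun r => hρ' i p rfl r (ω + σ)) σ N
  simp only [redIntegrand]
  simp_rw [mul_assoc]
  rw [integral_const_mul]
  change _ = _ * tHat (rOp^[N] (a i)) p σ (ω + σ)
  rw [h1, ← mul_assoc, ← Complex.ofReal_mul, inv_mul_cancel₀ (by positivity)]
  simp

lemma contDiff_redAmp {a : ι → (P × ℝ) × ℝ → ℂ} {m : ℝ} (h : SymFam a m)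
    (hr : RSupp a) [LocallyCompactSpace P] :
    (∀ i, ContDiff ℝ (⊤ : ℕ∞) (redAmp (a i))) ∧ SymBound (fun i => redAmp (a i)) m := by
  -- With this `N` the weight in `σ` has exponent at most `-2` and is integrable.
  obtain ⟨N, hN⟩ := exists_nat_ge ((|m| + 2) / 2)
  have hN : |m| + 2 ≤ 2 * N := by linarith
  have key : ∀ i, ContDiff ℝ (⊤ : ℕ∞) (redAmp (a i)) ∧ ∀ (j : ℕ) z,
      iteratedFDeriv ℝ j (redAmp (a i)) z =
        ∫ y, iteratedFDeriv ℝ j (fun z => redIntegrand N (a i) (z, y)) z := by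
    intro i
    rw [redAmp_eq_integral h hr hN i]
    refine contDiff_integral_of_contDiff (contDiff_redIntegrand (h.smooth i) N) fun j z₀ => ?_
    obtain ⟨K, hK, hKz⟩ := exists_compact_mem_nhds z₀.1
    obtain ⟨C, ρ, hC0, hC⟩ := norm_iteratedFDeriv_redIntegrand_le h hr hK N j
    refine ⟨_, (integrable_redWeight hN ρ).const_mul (C * ((1 + |z₀.2|) ^ m * 2 ^ |m|)), ?_⟩
    have h1 : ∀ᶠ z : P × ℝ in 𝓝 z₀, z.1 ∈ K := continuous_fst.continuousAt.eventually hKz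
    have h2 : ∀ᶠ z : P × ℝ in 𝓝 z₀, |z.2 - z₀.2| < 1 := by
      have : Continuous fun z : P × ℝ => |z.2 - z₀.2| := by fun_prop
      exact this.continuousAt.eventually_lt continuousAt_const (by simp)
    filter_upwards [h1, h2] with z hz1 hz2 y
    refine (hC i z.1 hz1 z.2 y).trans ?_
    gcongr
    · refine mul_nonneg (by positivity) (indicator_nonneg (fun _ _ => zero_le_one) _)
    · have := one_add_abs_add_rpow_le m z₀.2 (z.2 - z₀.2)
      rw [add_sub_cancel] at this
      refine this.trans ?_
      gcongr
      linarith
  refine ⟨fun i => (key i).1, fun K hK j => ?_⟩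
  obtain ⟨C, ρ, hC0, hC⟩ := norm_iteratedFDeriv_redIntegrand_le h hr hK N j
  refine ⟨C * ∫ y : ℝ × ℝ, (1 + |y.1|) ^ (|m| - 2 * N) * (Icc (-ρ) ρ).indicator (1 : ℝ → ℝ) y.2,
    fun i p hp ω => ?_⟩
  rw [(key i).2]
  refine (norm_integral_le_of_norm_le ((integrable_redWeight hN ρ).const_mul (C * (1 + |ω|) ^ m))
    (Eventually.of_forall (hC i p hp ω))).trans ?_
  rw [integral_const_mul]
  exact le_of_eq (by ring)

lemma RSupp.freqDeriv {a : ι → (P × ℝ) × ℝ → ℂ} (hr : RSupp a) {m : ℝ} (h : SymFam a m) :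
    RSupp (fun i => freqDeriv (a i)) := by
  intro K hK
  obtain ⟨ρ, hρ⟩ := hr K hK
  refine ⟨ρ, fun i p hp r ω hr => ?_⟩
  beta_reduce
  rw [← (freqDeriv_slice (h.smooth i) (p, r) ω).deriv]
  simp [hρ i p hp r _ hr]

/-- `tHat` is integrable along the lines that occur in `redAmp`. -/
lemma integrable_tHat {a : ι → (P × ℝ) × ℝ → ℂ} {m : ℝ} (h : SymFam a m) (hr : RSupp a) (i : ι)
    (p : P) (ω : ℝ) : Integrable fun σ => tHat (a i) p σ (ω + σ) := by
  obtain ⟨C, hC0, hC⟩ := norm_tHat_le h hr (isCompact_singleton (x := p)) (|m| + 2)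
  obtain ⟨ρ, hρ⟩ := hr {p} isCompact_singleton
  have hcont : Continuous fun σ => tHat (a i) p σ (ω + σ) := by
    have hsm : ContDiff ℝ (⊤ : ℕ∞) fun z : ℝ × ℝ => negChar z.1 z.2 * a i ((p, z.2), ω + z.1) :=
      contDiff_negChar.mul ((h.smooth i).comp (by fun_prop))
    exact (contDiff_integral_of_locally_compact_support (μ := volume) hsm fun x₀ =>
      ⟨Icc (-ρ) ρ, isCompact_Icc, Eventually.of_forall fun x r hr => by
        simp only
        rw [hρ i p rfl r _ (by by_contra h'; exact hr (abs_le.1 (not_lt.1 h'))),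
          mul_zero]⟩).continuous
  refine Integrable.mono' ((integrable_one_add_abs_rpow (M := 2) (by norm_num)).const_mul
    (C * (1 + |ω|) ^ m)) hcont.aestronglyMeasurable (Eventually.of_forall fun σ => ?_)
  refine (hC i p rfl σ (ω + σ)).trans ?_
  have h1 := one_add_abs_add_rpow_le m ω σ
  have h2 : (1 + |σ|) ^ (-(2 : ℝ)) = (1 + |σ|) ^ (-(|m| + 2)) * (1 + |σ|) ^ |m| := by
    rw [← Real.rpow_add (by positivity)]; ring_nf
  rw [h2]
  calc _ ≤ C * (1 + |σ|) ^ (-(|m| + 2)) * ((1 + |ω|) ^ m * (1 + |σ|) ^ |m|) := by gcongr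
    _ = _ := by ring

lemma hasDerivAt_tHat_freq {a : (P × ℝ) × ℝ → ℂ} (ha : ContDiff ℝ (⊤ : ℕ∞) a) {p : P} {ρ : ℝ}
    (hρ : ∀ r ω, ρ < |r| → a ((p, r), ω) = 0) (σ ω : ℝ) :
    HasDerivAt (fun ω => tHat a p σ ω) (tHat (freqDeriv a) p σ ω) ω := by
  have hsm : ContDiff ℝ (⊤ : ℕ∞) fun z : ℝ × ℝ => negChar σ z.2 * a ((p, z.2), z.1) :=
    (contDiff_negChar.comp (contDiff_const.prodMk contDiff_snd)).mul (ha.comp (by fun_prop))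
  have := (hasDerivAt_integral_of_compact_support hsm (ρ := ρ)
    (fun x r hr => by simp [hρ r x hr]) ω).2
  refine this.congr_deriv ?_
  unfold tHat
  congr 1; ext r
  have h1 : HasDerivAt (fun ω => negChar σ r * a ((p, r), ω))
      (negChar σ r * freqDeriv a ((p, r), ω)) ω := (freqDeriv_slice ha (p, r) ω).const_mul _
  rw [← h1.deriv]
  exact ((((hsm.differentiable (by simp) (ω, r)).hasFDerivAt).comp_hasDerivAt ω
    ((hasDerivAt_id ω).prodMk (hasDerivAt_const ω r))).deriv).symm

lemma hasDerivAt_redAmp {a : ι → (P × ℝ) × ℝ → ℂ} {m : ℝ} (h : SymFam a m) (hr : RSupp a)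
    (i : ι) (p : P) (ω : ℝ) :
    HasDerivAt (fun ω => redAmp (a i) (p, ω)) (redAmp (freqDeriv (a i)) (p, ω)) ω := by
  have h' := h.freqDeriv
  have hr' := hr.freqDeriv h
  obtain ⟨C, hC0, hC⟩ := norm_tHat_le h' hr' (isCompact_singleton (x := p)) (|m - 1| + 2)
  obtain ⟨ρ, hρ⟩ := hr {p} isCompact_singleton
  refine (hasDerivAt_integral_of_dominated_loc_of_deriv_le (F := fun ω σ => tHat (a i) p σ (ω + σ))
    (F' := fun ω σ => tHat (freqDeriv (a i)) p σ (ω + σ)) (s := Metric.ball ω 1)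
    (bound := fun σ => C * ((1 + |ω|) ^ (m - 1) * 2 ^ |m - 1|) * (1 + |σ|) ^ (-(2 : ℝ)))
    (Metric.ball_mem_nhds ω one_pos)
    (Eventually.of_forall fun ω => (integrable_tHat h hr i p ω).aestronglyMeasurable)
    (integrable_tHat h hr i p ω) (integrable_tHat h' hr' i p ω).aestronglyMeasurable
    (Eventually.of_forall fun σ ω' hω' => ?_)
    ((integrable_one_add_abs_rpow (M := 2) (by norm_num)).const_mul _)
    (Eventually.of_forall fun σ ω' _ => ?_)).2
  · refine (hC i p rfl σ (ω' + σ)).trans ?_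
    have h1 := one_add_abs_add_rpow_le (m - 1) ω' σ
    have h3 := one_add_abs_add_rpow_le (m - 1) ω (ω' - ω)
    rw [add_sub_cancel] at h3
    have h4 : (1 + |ω' - ω|) ^ |m - 1| ≤ 2 ^ |m - 1| := by
      rw [Metric.mem_ball, Real.dist_eq] at hω'
      gcongr; linarith
    have h2 : (1 + |σ|) ^ (-(2 : ℝ)) = (1 + |σ|) ^ (-(|m - 1| + 2)) * (1 + |σ|) ^ |m - 1| := by
      rw [← Real.rpow_add (by positivity)]; ring_nf
    rw [h2]
    calc _ ≤ C * (1 + |σ|) ^ (-(|m - 1| + 2)) *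
          (((1 + |ω|) ^ (m - 1) * 2 ^ |m - 1|) * (1 + |σ|) ^ |m - 1|) := by
          gcongr
          exact h1.trans (by gcongr; exact h3.trans (by gcongr))
      _ = _ := by ring
  · have h1 := hasDerivAt_tHat_freq (h.smooth i) (p := p) (ρ := ρ) (hρ i p rfl) σ (ω' + σ)
    exact h1.comp_add_const ω' σ

/-- Since the reduction commutes with `∂_ω`, the estimates for all frequency derivatives follow from
the estimate without any, applied to the derivatives of `a`. -/
lemma freqDeriv_redAmp {a : ι → (P × ℝ) × ℝ → ℂ} {m : ℝ} (h : SymFam a m) (hr : RSupp a)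
    [LocallyCompactSpace P] (i : ι) :
    freqDeriv (redAmp (a i)) = redAmp (freqDeriv (a i)) := by
  ext ⟨p, ω⟩
  exact (freqDeriv_slice ((contDiff_redAmp h hr).1 i) p ω).unique (hasDerivAt_redAmp h hr i p ω)

/-- The reduction of a symbol is a symbol of the same order. -/
theorem SymFam.redAmp {a : ι → (P × ℝ) × ℝ → ℂ} {m : ℝ} (h : SymFam a m) (hr : RSupp a)
    [LocallyCompactSpace P] : SymFam (fun i => redAmp (a i)) m := by
  refine ⟨(contDiff_redAmp h hr).1, fun k => ?_⟩
  induction k generalizing a m with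
  | zero => simpa using (contDiff_redAmp h hr).2
  | succ k ih =>
    simp only [Function.iterate_succ_apply]
    simp_rw [fun i => freqDeriv_redAmp h hr i]
    convert ih h.freqDeriv (hr.freqDeriv h) using 1
    push_cast; ring

/-- Multiplication by `r` lowers the order of the reduction by one. -/
lemma redAmp_mul_r {a : ι → (P × ℝ) × ℝ → ℂ} {m : ℝ} (h : SymFam a m) (hr : RSupp a) (i : ι)
    (p : P) (ω : ℝ) :
    redAmp (fun z => (z.1.2 : ℂ) * a i z) (p, ω) =
      -Complex.I * redAmp (freqDeriv (a i)) (p, ω) := by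
  have hra : SymFam (fun i z => (z.1.2 : ℂ) * a i z) m :=
    h.param_mul (φ := fun q : P × ℝ => (q.2 : ℂ)) (Complex.ofRealCLM.contDiff.comp contDiff_snd)
  have hrr : RSupp (fun i (z : (P × ℝ) × ℝ) => (z.1.2 : ℂ) * a i z) := fun K hK => by
    obtain ⟨ρ, hρ⟩ := hr K hK
    exact ⟨ρ, fun i p hp r ω h => by simp [hρ i p hp r ω h]⟩
  obtain ⟨ρ, hρ⟩ := hr {p} isCompact_singleton
  have hρ := hρ i p rfl
  -- `σ` occurs twice in `tHat (a i) p σ (ω + σ)`: in the character, whose derivative brings down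
  -- `-ir`, and in the frequency, which gives `∂_ω a`. The integral over `σ` of this total
  -- derivative is zero, and that is the claimed relation.
  have hder : ∀ σ, HasDerivAt (fun σ => tHat (a i) p σ (ω + σ))
      (-Complex.I * tHat (fun z => (z.1.2 : ℂ) * a i z) p σ (ω + σ) +
        tHat (freqDeriv (a i)) p σ (ω + σ)) σ := by
    intro σ
    have hsm : ContDiff ℝ (⊤ : ℕ∞) fun z : ℝ × ℝ => negChar z.1 z.2 * a i ((p, z.2), ω + z.1) :=
      contDiff_negChar.mul ((h.smooth i).comp (by fun_prop))
    have := (hasDerivAt_integral_of_compact_support hsm (ρ := ρ)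
      (fun x r hr => by simp [hρ r _ hr]) σ).2
    refine this.congr_deriv ?_
    have h1 : ∀ r, fderiv ℝ (fun z : ℝ × ℝ => negChar z.1 z.2 * a i ((p, z.2), ω + z.1)) (σ, r)
        (1, 0) = -Complex.I * (negChar σ r * (r * a i ((p, r), ω + σ))) +
          negChar σ r * freqDeriv (a i) ((p, r), ω + σ) := by
      intro r
      have e1 : HasDerivAt (fun σ => negChar σ r) (-(Complex.I * r) * negChar σ r) σ := by
        simp_rw [fun σ => negChar_comm σ r]
        exact hasDerivAt_negChar r σ
      have e2 : HasDerivAt (fun σ => a i ((p, r), ω + σ)) (freqDeriv (a i) ((p, r), ω + σ)) σ :=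
        (freqDeriv_slice (h.smooth i) (p, r) (ω + σ)).comp_const_add ω σ
      have e3 := (((hsm.differentiable (by simp) (σ, r)).hasFDerivAt).comp_hasDerivAt σ
        ((hasDerivAt_id σ).prodMk (hasDerivAt_const σ r)))
      refine (e3.unique (e1.mul e2)).trans ?_
      simp only [id]
      ring
    simp_rw [h1]
    have i1 : Integrable fun r => negChar σ r * ((r : ℂ) * a i ((p, r), ω + σ)) :=
      integrable_negChar_mul (ρ := ρ) (hra.smooth i).continuous (fun r hr => by simp [hρ r _ hr]) σ
    have i2 : Integrable fun r => negChar σ r * freqDeriv (a i) ((p, r), ω + σ) := by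
      obtain ⟨ρ', hρ'⟩ := hr.freqDeriv h {p} isCompact_singleton
      exact integrable_negChar_mul (h.freqDeriv.smooth i).continuous
        (fun r hr => hρ' i p rfl r (ω + σ) hr) σ
    rw [integral_add (i1.const_mul _) i2, integral_const_mul]
    rfl
  have hI := integrable_tHat hra hrr i p ω
  have hI2 := integrable_tHat h.freqDeriv (hr.freqDeriv h) i p ω
  have h0 := integral_eq_zero_of_hasDerivAt_of_integrable hder ((hI.const_mul _).add hI2)
    (integrable_tHat h hr i p ω)
  rw [integral_add (hI.const_mul _) hI2, integral_const_mul] at h0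
  have h2 : -Complex.I * redAmp (fun z => (z.1.2 : ℂ) * a i z) (p, ω) +
      redAmp (freqDeriv (a i)) (p, ω) = 0 := h0
  linear_combination (Complex.I) * h2 +
    (redAmp (fun z => (z.1.2 : ℂ) * a i z) (p, ω)) * Complex.I_sq

/-- A smooth function that agrees with `u ↦ 1 / u` for `δ ≤ |u|`. -/
lemma exists_smooth_inv {δ : ℝ} (hδ : 0 < δ) :
    ∃ θ : ℝ → ℝ, ContDiff ℝ (⊤ : ℕ∞) θ ∧ ∀ u, δ ≤ |u| → θ u * u = 1 := by
  let χ : ContDiffBump (0 : ℝ) := ⟨δ / 3, δ / 2, by positivity, by linarith⟩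
  refine ⟨fun u => (1 - χ u) * u⁻¹, ?_, fun u hu => ?_⟩
  · rw [contDiff_iff_contDiffAt]
    intro u
    by_cases hu : u = 0
    · have : (fun u => (1 - χ u) * u⁻¹) =ᶠ[𝓝 u] fun _ => 0 := by
        rw [hu]
        filter_upwards [χ.eventuallyEq_one] with v hv
        rw [hv]; simp
      exact contDiffAt_const.congr_of_eventuallyEq this
    · exact (contDiffAt_const.sub χ.contDiff.contDiffAt).mul (contDiffAt_inv ℝ hu)
  · have h1 : χ u = 0 := χ.zero_of_le_dist (by
      rw [dist_zero_right, Real.norm_eq_abs]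
      show δ / 2 ≤ |u|
      linarith)
    have h2 : u ≠ 0 := by
      rintro rfl
      simp at hu; linarith
    simp [h1, h2]

/-- Where the amplitude vanishes for small `r`, its reduction decreases rapidly. -/
theorem norm_redAmp_le_of_vanish [LocallyCompactSpace P] {Z K : Set P} (hK : IsCompact K)
    (hZK : Z ⊆ K) {δ : ℝ} (hδ : 0 < δ) (M : ℕ) {a : ι → (P × ℝ) × ℝ → ℂ} {m : ℝ}
    (h : SymFam a m) (hr : RSupp a)
    (hz : ∀ i, ∀ p ∈ Z, ∀ r ω, |r| < δ → a i ((p, r), ω) = 0) :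
    ∃ C : ℝ, 0 ≤ C ∧ ∀ i, ∀ p ∈ Z, ∀ ω, ‖redAmp (a i) (p, ω)‖ ≤ C * (1 + |ω|) ^ (m - M) := by
  induction M generalizing a m with
  | zero =>
    obtain ⟨C, hC0, hC⟩ := (h.redAmp hr).norm_le hK
    exact ⟨C, hC0, fun i p hp ω => by simpa using hC i p (hZK hp) ω⟩
  | succ M ih =>
    -- For `p ∈ Z` the amplitude equals `r · (θ(r) a)` with `θ(r) = 1/r` on its support. The factor
    -- `r` is traded for a frequency derivative of `θ a`, which still vanishes for small `r`, so the
    -- step can be repeated.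
    obtain ⟨θ, hθ, hθ1⟩ := exists_smooth_inv hδ
    have hb : SymFam (fun i z => (θ z.1.2 : ℂ) * a i z) m :=
      h.param_mul (φ := fun q : P × ℝ => (θ q.2 : ℂ))
        (Complex.ofRealCLM.contDiff.comp (hθ.comp contDiff_snd))
    have hbr : RSupp (fun i (z : (P × ℝ) × ℝ) => (θ z.1.2 : ℂ) * a i z) := fun K hK => by
      obtain ⟨ρ, hρ⟩ := hr K hK
      exact ⟨ρ, fun i p hp r ω h => by simp [hρ i p hp r ω h]⟩
    obtain ⟨C, hC0, hC⟩ := ih hb.freqDeriv (hbr.freqDeriv hb) (fun i p hp r ω hrδ => by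
      rw [← (freqDeriv_slice (hb.smooth i) (p, r) ω).deriv]
      simp [hz i p hp r _ hrδ])
    refine ⟨C, hC0, fun i p hp ω => ?_⟩
    have h1 := redAmp_mul_r hb hbr i p ω
    have h2 : redAmp (a i) (p, ω) =
        redAmp (fun z : (P × ℝ) × ℝ => (z.1.2 : ℂ) * ((θ z.1.2 : ℂ) * a i z)) (p, ω) := by
      unfold BistaticSAR.redAmp tHat
      congr 1; ext σ
      congr 1; ext r
      simp only
      by_cases hrδ : |r| < δ
      · simp [hz i p hp r _ hrδ]
      · have := hθ1 r (not_lt.1 hrδ)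
        rw [← mul_assoc (r : ℂ), mul_comm (r : ℂ), ← Complex.ofReal_mul, this]
        simp
    rw [h2, h1, norm_mul, norm_neg, Complex.norm_I, one_mul]
    convert hC i p hp ω using 2
    push_cast; ring_nf

end Reduction

end BistaticSAR

namespace BistaticSAR

/-! ### Non-stationary phase -/

section NonstationaryPhase

variable {P E : Type*} [NormedAddCommGroup P] [NormedSpace ℝ P] [NormedAddCommGroup E]
  [NormedSpace ℝ E]

/-- All derivatives of `b` up to order `n` are bounded by `M`. -/
def DerivBound (n : ℕ) (b : E → ℂ) (M : ℝ) : Prop :=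
  ∀ j ≤ n, ∀ y, ‖iteratedFDeriv ℝ j b y‖ ≤ M

lemma DerivBound.nonneg {n : ℕ} {b : E → ℂ} {M : ℝ} (h : DerivBound n b M) : 0 ≤ M :=
  (norm_nonneg _).trans (h 0 (Nat.zero_le _) 0)

lemma DerivBound.norm_le {n : ℕ} {b : E → ℂ} {M : ℝ} (h : DerivBound n b M) (y : E) :
    ‖b y‖ ≤ M := by
  simpa using h 0 (Nat.zero_le _) y

lemma norm_iteratedFDeriv_mul_le_of_le {b h : E → ℂ} (hb : ContDiff ℝ (⊤ : ℕ∞) b)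
    (hh : ContDiff ℝ (⊤ : ℕ∞) h) {n j : ℕ} (hj : j ≤ n) {y : E} {M H : ℝ}
    (h1 : ∀ l ≤ n, ‖iteratedFDeriv ℝ l b y‖ ≤ M) (h2 : ∀ l ≤ n, ‖iteratedFDeriv ℝ l h y‖ ≤ H) :
    ‖iteratedFDeriv ℝ j (fun y => b y * h y) y‖ ≤ 2 ^ n * (M * H) := by
  have hM : 0 ≤ M := (norm_nonneg _).trans (h1 0 (Nat.zero_le _))
  have hH : 0 ≤ H := (norm_nonneg _).trans (h2 0 (Nat.zero_le _))
  refine (norm_iteratedFDeriv_mul_le hb hh y (n := j) (by exact_mod_cast le_top)).trans ?_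
  calc ∑ l ∈ Finset.range (j + 1), (j.choose l : ℝ) * ‖iteratedFDeriv ℝ l b y‖ *
        ‖iteratedFDeriv ℝ (j - l) h y‖
      ≤ ∑ l ∈ Finset.range (j + 1), (j.choose l : ℝ) * (M * H) := by
        refine Finset.sum_le_sum fun l hl => ?_
        have := Finset.mem_range.1 hl
        rw [mul_assoc]
        gcongr
        · exact h1 l (by omega)
        · exact h2 (j - l) (by omega)
    _ = 2 ^ j * (M * H) := by
        rw [← Finset.sum_mul]
        congr 1
        exact_mod_cast Nat.sum_range_choose j
    _ ≤ 2 ^ n * (M * H) := by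
        gcongr
        norm_num

lemma norm_iteratedFDeriv_dirDeriv_le {b : E → ℂ} (hb : ContDiff ℝ (⊤ : ℕ∞) b) (v : E) (j : ℕ)
    (y : E) : ‖iteratedFDeriv ℝ j (fun y => fderiv ℝ b y v) y‖ ≤
      ‖v‖ * ‖iteratedFDeriv ℝ (j + 1) b y‖ := by
  let L : (E →L[ℝ] ℂ) →L[ℝ] ℂ := ContinuousLinearMap.apply ℝ ℂ v
  have hL : ‖L‖ ≤ ‖v‖ := by
    refine ContinuousLinearMap.opNorm_le_bound _ (norm_nonneg v) fun φ => ?_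
    rw [mul_comm]
    exact φ.le_opNorm v
  have hf : ContDiff ℝ (⊤ : ℕ∞) (fderiv ℝ b) := hb.fderiv_right (by norm_num)
  have h1 := L.norm_iteratedFDeriv_comp_left (f := fderiv ℝ b) (x := y) (n := j)
    hf.contDiffAt (by exact_mod_cast le_top)
  rw [norm_iteratedFDeriv_fderiv] at h1
  exact h1.trans (by gcongr)

lemma hasFDerivAt_cexp_phase {φ : E → ℝ} (hφ : ContDiff ℝ (⊤ : ℕ∞) φ) (l : ℝ) (y v : E) :
    fderiv ℝ (fun y => Complex.exp (Complex.I * ((l * φ y : ℝ) : ℂ))) y v =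
      Complex.I * l * (Complex.exp (Complex.I * ((l * φ y : ℝ) : ℂ)) * (fderiv ℝ φ y v : ℂ)) := by
  have h1 : HasFDerivAt φ (fderiv ℝ φ y) y := (hφ.differentiable (by simp) y).hasFDerivAt
  have h2 := (((Complex.ofRealCLM.hasFDerivAt (x := l * φ y)).comp y (h1.const_mul l)).const_mul
    Complex.I).cexp
  have h3 : fderiv ℝ (fun y => Complex.exp (Complex.I * ((l * φ y : ℝ) : ℂ))) y = _ := h2.fderiv
  rw [h3]
  simp
  ring

lemma contDiff_cexp_phase {φ : E → ℝ} (hφ : ContDiff ℝ (⊤ : ℕ∞) φ) (l : ℝ) :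
    ContDiff ℝ (⊤ : ℕ∞) fun y => Complex.exp (Complex.I * ((l * φ y : ℝ) : ℂ)) :=
  (contDiff_const.mul (Complex.ofRealCLM.contDiff.comp (contDiff_const.mul hφ))).cexp

lemma norm_cexp_I_mul (x : ℝ) : ‖Complex.exp (Complex.I * (x : ℂ))‖ = 1 := by
  rw [mul_comm, Complex.norm_exp_ofReal_mul_I]

lemma fderiv_slice_right {F : Type*} [NormedAddCommGroup F] [NormedSpace ℝ F] {g : P × E → F}
    (hg : ContDiff ℝ (⊤ : ℕ∞) g) (p : P) (y v : E) :
    fderiv ℝ (fun y => g (p, y)) y v = fderiv ℝ g (p, y) (0, v) := by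
  have := ((hg.differentiable (by simp) (p, y)).hasFDerivAt).comp y (hasFDerivAt_prodMk_right p y)
  have h2 : fderiv ℝ (fun y => g (p, y)) y = _ := this.fderiv
  rw [h2]; simp

lemma continuous_iteratedFDeriv_slice_right {g : P × E → ℂ}
    (hg : ContDiff ℝ (⊤ : ℕ∞) g) (j : ℕ) :
    Continuous fun z : P × E => iteratedFDeriv ℝ j (fun y => g (z.1, y)) z.2 :=
  (continuous_iteratedFDeriv_slice (f := fun w : E × P => g (w.2, w.1))
    (hg.comp (by fun_prop)) j).comp continuous_swap

variable [FiniteDimensional ℝ E] [MeasurableSpace E] [BorelSpace E] (μ : Measure E)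
  [μ.IsAddHaarMeasure]

/-- Oscillatory integrals whose phase has no critical points in the support of the amplitude
decrease rapidly, with bounds that depend on the amplitude only through its derivatives. -/
theorem norm_integral_le_of_nonstationary {κ : Type*} [Fintype κ] {g : P × E → ℝ}
    (hg : ContDiff ℝ (⊤ : ℕ∞) g) (v : κ → E) {K : Set (P × E)} (hK : IsCompact K)
    (hne : ∀ z ∈ K, ∃ k, fderiv ℝ g z (0, v k) ≠ 0) (N : ℕ) :
    ∃ C : ℝ, 0 ≤ C ∧ ∀ (p : P) (b : E → ℂ), ContDiff ℝ (⊤ : ℕ∞) b →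
      (∀ y, b y ≠ 0 → (p, y) ∈ K) → ∀ M, DerivBound N b M → ∀ l : ℝ, 0 < l →
      ‖∫ y, Complex.exp (Complex.I * ((l * g (p, y) : ℝ) : ℂ)) * b y ∂μ‖ ≤ C * M / l ^ N := by
  have hsupp : ∀ (p : P) (b : E → ℂ), (∀ y, b y ≠ 0 → (p, y) ∈ K) →
      tsupport b ⊆ {y | (p, y) ∈ K} ∧ HasCompactSupport b := by
    intro p b hb
    have h1 : tsupport b ⊆ {y | (p, y) ∈ K} :=
      closure_minimal (fun y hy => hb y hy) (hK.isClosed.preimage (Continuous.prodMk_right p))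
    refine ⟨h1, (hK.image continuous_snd).of_isClosed_subset (isClosed_tsupport b) fun y hy => ?_⟩
    exact ⟨(p, y), h1 hy, rfl⟩
  induction N with
  | zero =>
    have hK2 : IsCompact (Prod.snd '' K) := hK.image continuous_snd
    refine ⟨μ.real (Prod.snd '' K), measureReal_nonneg, fun p b hb hbK M hM l hl => ?_⟩
    have : ∫ y, Complex.exp (Complex.I * ((l * g (p, y) : ℝ) : ℂ)) * b y ∂μ =
        ∫ y in Prod.snd '' K, Complex.exp (Complex.I * ((l * g (p, y) : ℝ) : ℂ)) * b y ∂μ := by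
      rw [setIntegral_eq_integral_of_forall_compl_eq_zero]
      intro y hy
      have : b y = 0 := by
        by_contra h
        exact hy ⟨(p, y), hbK y h, rfl⟩
      rw [this, mul_zero]
    rw [this, pow_zero, div_one, mul_comm]
    refine norm_setIntegral_le_of_norm_le_const hK2.measure_lt_top fun y _ => ?_
    rw [norm_mul, norm_cexp_I_mul, one_mul]
    exact hM.norm_le y
  | succ N ih =>
    obtain ⟨C, hC0, hC⟩ := ih
    let G : κ → P × E → ℝ := fun k z => fderiv ℝ g z (0, v k)
    have hG : ∀ k, ContDiff ℝ (⊤ : ℕ∞) (G k) := fun k =>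
      (hg.fderiv_right (m := (⊤ : ℕ∞)) (by norm_num)).clm_apply contDiff_const
    -- By compactness the sum of squares of the directional derivatives is bounded below on `K`.
    -- Dividing by it, with `θ` in place of the reciprocal, gives globally smooth coefficients `h k`
    -- such that the field `∑ h k · v k` differentiates `g` to `1` on `K`.
    let S : P × E → ℝ := fun z => ∑ k, G k z ^ 2
    have hS : ContDiff ℝ (⊤ : ℕ∞) S := ContDiff.sum fun k _ => (hG k).pow 2
    obtain ⟨δ, hδ, hSδ⟩ : ∃ δ : ℝ, 0 < δ ∧ ∀ z ∈ K, δ ≤ |S z| := by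
      rcases K.eq_empty_or_nonempty with rfl | hKne
      · exact ⟨1, one_pos, by simp⟩
      obtain ⟨z₀, hz₀, hmin⟩ := hK.exists_isMinOn hKne hS.continuous.continuousOn
      refine ⟨S z₀, ?_, fun z hz => (isMinOn_iff.1 hmin z hz).trans (le_abs_self _)⟩
      obtain ⟨k, hk⟩ := hne z₀ hz₀
      exact Finset.sum_pos' (fun k _ => sq_nonneg _) ⟨k, Finset.mem_univ k, by positivity⟩
    obtain ⟨θ, hθ, hθ1⟩ := exists_smooth_inv hδ
    let h : κ → P × E → ℂ := fun k z => ((G k z * θ (S z) : ℝ) : ℂ)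
    have hh : ∀ k, ContDiff ℝ (⊤ : ℕ∞) (h k) := fun k =>
      Complex.ofRealCLM.contDiff.comp ((hG k).mul (hθ.comp hS))
    have hone : ∀ z ∈ K, ∑ k, h k z * (G k z : ℂ) = 1 := by
      intro z hz
      have h1 := hθ1 _ (hSδ z hz)
      have h2 : ∑ k, (G k z * θ (S z)) * G k z = 1 := by
        rw [← h1, Finset.mul_sum]
        exact Finset.sum_congr rfl fun k _ => by ring
      simp only [h]
      exact_mod_cast h2
    have hH : ∃ H : ℝ, 0 ≤ H ∧ ∀ k, ∀ j ≤ N + 1, ∀ z ∈ K,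
        ‖iteratedFDeriv ℝ j (fun y => h k (z.1, y)) z.2‖ ≤ H := by
      have hb : ∀ k (j : ℕ), ∃ D : ℝ, 0 ≤ D ∧ ∀ z ∈ K,
          ‖iteratedFDeriv ℝ j (fun y => h k (z.1, y)) z.2‖ ≤ D := fun k j => by
        obtain ⟨D, hD⟩ := (hK.image (continuous_iteratedFDeriv_slice_right (hh k)
          j)).isBounded.exists_norm_le
        exact ⟨max D 0, le_max_right _ _, fun z hz => (hD _ ⟨z, hz, rfl⟩).trans (le_max_left _ _)⟩
      choose D hD0 hD using hb
      refine ⟨∑ k, ∑ j ∈ Finset.range (N + 2), D k j,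
        Finset.sum_nonneg fun k _ => Finset.sum_nonneg fun j _ => hD0 k j, fun k j hj z hz => ?_⟩
      refine (hD k j z hz).trans ?_
      refine le_trans ?_ (Finset.single_le_sum (f := fun k => ∑ j ∈ Finset.range (N + 2), D k j)
        (fun k _ => Finset.sum_nonneg fun j _ => hD0 k j) (Finset.mem_univ k))
      exact Finset.single_le_sum (f := D k) (fun j _ => hD0 k j) (Finset.mem_range.2 (by omega))
    obtain ⟨H, hH0, hH⟩ := hH
    let C₁ : ℝ := ∑ k, ‖v k‖ * (2 ^ (N + 1) * H)
    have hC₁ : 0 ≤ C₁ := Finset.sum_nonneg fun k _ => by positivity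
    refine ⟨C * C₁, by positivity, fun p b hb hbK M hM l hl => ?_⟩
    have hM0 := hM.nonneg
    let bh : κ → E → ℂ := fun k y => b y * h k (p, y)
    have hhp : ∀ k, ContDiff ℝ (⊤ : ℕ∞) fun y => h k (p, y) := fun k =>
      (hh k).comp (contDiff_const.prodMk contDiff_id)
    have hbh : ∀ k, ContDiff ℝ (⊤ : ℕ∞) (bh k) := fun k => hb.mul (hhp k)
    -- The transpose of that field, up to sign, applied to `b`. Integration by parts gives `∫
    -- e^{ilg} b' = -il ∫ e^{ilg} b`, which gains one power of `l` and costs one derivative of `b`.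
    let b' : E → ℂ := fun y => ∑ k, fderiv ℝ (bh k) y (v k)
    have hb's : ContDiff ℝ (⊤ : ℕ∞) b' := ContDiff.sum fun k _ => contDiff_dirDeriv (hbh k) (v k)
    have htsub : ∀ k, tsupport (bh k) ⊆ tsupport b := fun k =>
      tsupport_mul_subset_left
    have hb'0 : ∀ y ∉ tsupport b, ∀ k, fderiv ℝ (bh k) y = 0 := by
      intro y hy k
      have := (tsupport_fderiv_subset ℝ (f := bh k)).trans (htsub k)
      exact image_eq_zero_of_notMem_tsupport fun hmem => hy (this hmem)
    have hb'K : ∀ y, b' y ≠ 0 → (p, y) ∈ K := by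
      intro y hy
      by_contra hyK
      have hyt : y ∉ tsupport b := fun hmem => hyK ((hsupp p b hbK).1 hmem)
      exact hy (Finset.sum_eq_zero fun k _ => by rw [hb'0 y hyt k]; rfl)
    have hb'M : DerivBound N b' (C₁ * M) := by
      intro j hj y
      by_cases hyK : (p, y) ∈ K
      · have hn : ((j : ℕ) : WithTop ℕ∞) ≤ ((⊤ : ℕ∞) : WithTop ℕ∞) := by exact_mod_cast le_top
        have e : iteratedFDeriv ℝ j b' y =
            ∑ k, iteratedFDeriv ℝ j (fun y => fderiv ℝ (bh k) y (v k)) y := by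
          have := iteratedFDeriv_sum (𝕜 := ℝ) (i := j) (u := Finset.univ)
            (f := fun k y => fderiv ℝ (bh k) y (v k))
            (fun k _ => ((contDiff_dirDeriv (hbh k) (v k)).of_le hn))
          exact (congrFun this y).trans (Finset.sum_apply _ _ _)
        rw [e, Finset.sum_mul]
        refine norm_sum_le_of_le _ fun k _ => ?_
        refine (norm_iteratedFDeriv_dirDeriv_le (hbh k) (v k) j y).trans ?_
        have := norm_iteratedFDeriv_mul_le_of_le hb (hhp k) (n := N + 1) (j := j + 1) (by omega)
          (y := y) (fun i hi => hM i hi y) (fun i hi => hH k i hi (p, y) hyK)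
        calc _ ≤ ‖v k‖ * (2 ^ (N + 1) * (M * H)) := by gcongr
          _ = _ := by ring
      · have hyt : y ∉ tsupport b' := fun hmem => hyK ((hsupp p b' hb'K).1 hmem)
        have : iteratedFDeriv ℝ j b' y = 0 := image_eq_zero_of_notMem_tsupport
          fun hmem => hyt (tsupport_iteratedFDeriv_subset (𝕜 := ℝ) j hmem)
        rw [this, norm_zero]
        positivity
    have hgp : ContDiff ℝ (⊤ : ℕ∞) fun y => g (p, y) := hg.comp (contDiff_const.prodMk contDiff_id)
    let e : E → ℂ := fun y => Complex.exp (Complex.I * ((l * g (p, y) : ℝ) : ℂ))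
    have he : ContDiff ℝ (⊤ : ℕ∞) e := contDiff_cexp_phase hgp l
    have hfe : ∀ y k, fderiv ℝ e y (v k) = Complex.I * l * (e y * (G k (p, y) : ℂ)) := fun y k => by
      have := hasFDerivAt_cexp_phase hgp l y (v k)
      rw [fderiv_slice_right hg] at this
      exact this
    have hbhc : ∀ k, HasCompactSupport (bh k) := fun k =>
      (hsupp p b hbK).2.of_isClosed_subset (isClosed_tsupport _) (htsub k)
    have hbp : ∀ k, ∫ y, e y * fderiv ℝ (bh k) y (v k) ∂μ =
        -∫ y, fderiv ℝ e y (v k) * bh k y ∂μ := fun k => by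
      refine integral_mul_fderiv_eq_neg_fderiv_mul_of_integrable ?_ ?_ ?_
        (fun y _ => he.differentiable (by simp) y)
        (fun y _ => (hbh k).differentiable (by simp) y)
      · exact ((contDiff_dirDeriv he (v k)).continuous.mul
          (hbh k).continuous).integrable_of_hasCompactSupport ((hbhc k).mul_left)
      · exact (he.continuous.mul (contDiff_dirDeriv (hbh k) (v k)).continuous
          ).integrable_of_hasCompactSupport (((hbhc k).fderiv_apply ℝ (v k)).mul_left)
      · exact (he.continuous.mul (hbh k).continuous).integrable_of_hasCompactSupport
          ((hbhc k).mul_left)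
    have hsum : ∫ y, e y * b' y ∂μ = -(Complex.I * l) * ∫ y, e y * b y ∂μ := by
      have i1 : ∀ k ∈ Finset.univ, Integrable (fun y => e y * fderiv ℝ (bh k) y (v k)) μ :=
        fun k _ => (he.continuous.mul (contDiff_dirDeriv (hbh k) (v k)).continuous
          ).integrable_of_hasCompactSupport (((hbhc k).fderiv_apply ℝ (v k)).mul_left)
      have i2 : ∀ k ∈ Finset.univ, Integrable (fun y => fderiv ℝ e y (v k) * bh k y) μ :=
        fun k _ => ((contDiff_dirDeriv he (v k)).continuous.mul
          (hbh k).continuous).integrable_of_hasCompactSupport ((hbhc k).mul_left)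
      simp only [b', Finset.mul_sum]
      rw [integral_finsetSum _ i1]
      simp_rw [hbp]
      rw [Finset.sum_neg_distrib, ← integral_finsetSum _ i2, neg_mul, ← integral_const_mul]
      congr 2; ext y
      simp_rw [hfe]
      by_cases hby : b y = 0
      · simp [bh, hby]
      · have h1 := hone (p, y) (hbK y hby)
        calc _ = Complex.I * l * (e y * b y) * ∑ k, h k (p, y) * (G k (p, y) : ℂ) := by
              rw [Finset.mul_sum]
              exact Finset.sum_congr rfl fun k _ => by simp only [bh]; ring
          _ = _ := by rw [h1, mul_one]
    have h1 := hC p b' hb's hb'K _ hb'M l hl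
    change ‖∫ y, e y * b' y ∂μ‖ ≤ _ at h1
    rw [hsum, norm_mul, norm_neg, norm_mul, Complex.norm_I, one_mul, Complex.norm_real,
      Real.norm_of_nonneg hl.le] at h1
    change ‖∫ y, e y * b y ∂μ‖ ≤ _
    rw [le_div_iff₀ (by positivity)] at h1 ⊢
    calc _ = l * ‖∫ y, e y * b y ∂μ‖ * l ^ N := by rw [pow_succ]; ring
      _ ≤ _ := h1
      _ = _ := by ring

end NonstationaryPhase

end BistaticSAR

namespace BistaticSAR

/-! ### Geometry of the bistatic distance -/

section Geometry

/-- The distance from `(x, 0)` to `(s + β, 0, h)`. -/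
noncomputable def slant (h β s : ℝ) (x : Plane) : ℝ := √((x 0 - s - β) ^ 2 + x 1 ^ 2 + h ^ 2)

lemma bistaticDist_eq (α h s : ℝ) (x : Plane) :
    bistaticDist α h s x = slant h α s x + slant h (-α) s x := by
  unfold bistaticDist slant transmitter receiver ground
  rw [EuclideanSpace.dist_eq, EuclideanSpace.dist_eq]
  simp only [Fin.sum_univ_three, Real.dist_eq, sq_abs]
  congr 2
  · simp; ring
  · simp; ring

variable {h : ℝ}

lemma slant_arg_pos (hh : 0 < h) (u v : ℝ) : 0 < u ^ 2 + v ^ 2 + h ^ 2 := by positivity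

lemma slant_pos (hh : 0 < h) (β s : ℝ) (x : Plane) : 0 < slant h β s x :=
  Real.sqrt_pos.2 (slant_arg_pos hh _ _)

lemma slant_sq (hh : 0 < h) (β s : ℝ) (x : Plane) :
    slant h β s x ^ 2 = (x 0 - s - β) ^ 2 + x 1 ^ 2 + h ^ 2 :=
  Real.sq_sqrt (slant_arg_pos hh _ _).le

lemma contDiff_coord (i : Fin 2) : ContDiff ℝ (⊤ : ℕ∞) fun x : Plane => x i :=
  (EuclideanSpace.proj (𝕜 := ℝ) i).contDiff

lemma contDiff_slant (hh : 0 < h) (β : ℝ) :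
    ContDiff ℝ (⊤ : ℕ∞) fun z : ℝ × Plane => slant h β z.1 z.2 := by
  unfold slant
  have h0 : ContDiff ℝ (⊤ : ℕ∞) fun z : ℝ × Plane => z.2 0 := (contDiff_coord 0).comp contDiff_snd
  have h1 : ContDiff ℝ (⊤ : ℕ∞) fun z : ℝ × Plane => z.2 1 := (contDiff_coord 1).comp contDiff_snd
  exact ((((h0.sub contDiff_fst).sub contDiff_const).pow 2).add (h1.pow 2) |>.add
    contDiff_const).sqrt fun z => (slant_arg_pos hh _ _).ne'

lemma contDiff_bistaticDist (hh : 0 < h) (α : ℝ) :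
    ContDiff ℝ (⊤ : ℕ∞) fun z : ℝ × Plane => bistaticDist α h z.1 z.2 := by
  simp_rw [bistaticDist_eq]
  exact (contDiff_slant hh α).add (contDiff_slant hh (-α))

/-- The derivative of the bistatic distance with respect to `x₁`. -/
noncomputable def distGrad₀ (α h s : ℝ) (x : Plane) : ℝ :=
  (x 0 - s - α) / slant h α s x + (x 0 - s + α) / slant h (-α) s x

/-- The derivative of the bistatic distance with respect to `x₂`. -/
noncomputable def distGrad₁ (α h s : ℝ) (x : Plane) : ℝ :=
  x 1 / slant h α s x + x 1 / slant h (-α) s x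

/-- The slant range depends on `x₁` and `s` only through `x₁ - s`, whence the combination `v 0 - τ`.
In particular the Doppler shift, the derivative in `s`, is minus the derivative in `x₁`. -/
lemma hasDerivAt_slant_line (hh : 0 < h) (β s τ : ℝ) (x v : Plane) :
    HasDerivAt (fun t : ℝ => slant h β (s + t * τ) (x + t • v))
      (((x 0 - s - β) * (v 0 - τ) + x 1 * v 1) / slant h β s x) 0 := by
  have h0 : HasDerivAt (fun t : ℝ => x 0 + t * v 0 - (s + t * τ) - β) (v 0 - τ) 0 := by
    have := ((((hasDerivAt_id (0 : ℝ)).mul_const (v 0)).const_add (x 0)).sub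
      (((hasDerivAt_id (0 : ℝ)).mul_const τ).const_add s)).sub_const β
    simpa using this
  have h1 : HasDerivAt (fun t : ℝ => x 1 + t * v 1) (v 1) 0 := by
    have := (((hasDerivAt_id (0 : ℝ)).mul_const (v 1)).const_add (x 1))
    simpa using this
  have h2 := ((((h0.pow 2).add (h1.pow 2)).add_const (h ^ 2)).sqrt
    (by simpa using (slant_arg_pos hh _ _).ne'))
  have h3 : (fun t : ℝ => slant h β (s + t * τ) (x + t • v)) = fun t : ℝ =>
      √((x 0 + t * v 0 - (s + t * τ) - β) ^ 2 + (x 1 + t * v 1) ^ 2 + h ^ 2) := by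
    ext t; simp [slant]
  rw [h3]
  refine h2.congr_deriv ?_
  have := (slant_pos hh β s x).ne'
  have e : √((x 0 + 0 * v 0 - (s + 0 * τ) - β) ^ 2 + (x 1 + 0 * v 1) ^ 2 + h ^ 2) =
    slant h β s x := by simp [slant]
  simp only [Pi.add_apply, Pi.pow_apply]
  rw [e]
  field_simp
  push_cast
  ring

lemma fderiv_bistaticDist (hh : 0 < h) (α s τ : ℝ) (x v : Plane) :
    fderiv ℝ (fun z : ℝ × Plane => bistaticDist α h z.1 z.2) (s, x) (τ, v) =
      distGrad₀ α h s x * (v 0 - τ) + distGrad₁ α h s x * v 1 := by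
  have hd : HasFDerivAt (fun z : ℝ × Plane => bistaticDist α h z.1 z.2)
      (fderiv ℝ (fun z : ℝ × Plane => bistaticDist α h z.1 z.2) (s, x)) ((s, x) + (0 : ℝ) • (τ, v)) := by
    simpa using ((contDiff_bistaticDist hh α).differentiable (by simp) (s, x)).hasFDerivAt
  have hl : HasDerivAt (fun t : ℝ => (s, x) + t • (τ, v)) (τ, v) 0 := by
    simpa using ((hasDerivAt_id (0 : ℝ)).smul_const (τ, v)).const_add (s, x)
  have h1 := hd.comp_hasDerivAt (0 : ℝ) hl
  have h2 := (hasDerivAt_slant_line hh α s τ x v).add (hasDerivAt_slant_line hh (-α) s τ x v)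
  have h3 : (fun z : ℝ × Plane => bistaticDist α h z.1 z.2) ∘ (fun t : ℝ => (s, x) + t • (τ, v)) =
      (fun t : ℝ => slant h α (s + t * τ) (x + t • v)) +
        fun t : ℝ => slant h (-α) (s + t * τ) (x + t • v) := by
    ext t; simp [bistaticDist_eq]
  rw [h3] at h1
  rw [h1.unique h2, distGrad₀, distGrad₁]
  ring

lemma contDiff_bistaticDist_comp {E : Type*} [NormedAddCommGroup E] [NormedSpace ℝ E] (hh : 0 < h)
    (α : ℝ) {f : E → ℝ} {g : E → Plane} (hf : ContDiff ℝ (⊤ : ℕ∞) f) (hg : ContDiff ℝ (⊤ : ℕ∞) g) :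
    ContDiff ℝ (⊤ : ℕ∞) fun x => bistaticDist α h (f x) (g x) := by
  have h2 := (contDiff_bistaticDist hh α).comp (hf.prodMk hg)
  have h3 : (fun z : ℝ × Plane => bistaticDist α h z.1 z.2) ∘ (fun x => (f x, g x)) =
    fun x => bistaticDist α h (f x) (g x) := rfl
  rwa [h3] at h2

lemma contDiff_bistaticDist_right (hh : 0 < h) (α s : ℝ) :
    ContDiff ℝ (⊤ : ℕ∞) (bistaticDist α h s) :=
  contDiff_bistaticDist_comp hh α contDiff_const contDiff_id

lemma gradient_bistaticDist (hh : 0 < h) (α s : ℝ) (x : Plane) :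
    gradient (bistaticDist α h s) x = !₂[distGrad₀ α h s x, distGrad₁ α h s x] := by
  refine ext_inner_right ℝ fun v => ?_
  rw [gradient, InnerProductSpace.toDual_symm_apply]
  have h1 : fderiv ℝ (bistaticDist α h s) x v = _ :=
    fderiv_slice_right (contDiff_bistaticDist hh α) s x v
  rw [h1, fderiv_bistaticDist hh α s 0 x v, PiLp.inner_apply, Fin.sum_univ_two]
  simp only [RCLike.inner_apply, conj_trivial, Matrix.cons_val_zero,
    Matrix.cons_val_one, sub_zero]
  ring

/-- Squaring and cancelling leaves `h² u² = h² v²`. The denominators then coincide, and the original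
identity fixes the sign. -/
lemma div_sqrt_injective (hh : 0 < h) {u v : ℝ}
    (huv : u / √(u ^ 2 + h ^ 2) = v / √(v ^ 2 + h ^ 2)) : u = v := by
  have hu : 0 < u ^ 2 + h ^ 2 := by positivity
  have hv : 0 < v ^ 2 + h ^ 2 := by positivity
  have hu' := Real.sqrt_pos.2 hu
  have hv' := Real.sqrt_pos.2 hv
  rw [div_eq_div_iff hu'.ne' hv'.ne'] at huv
  have h1 : u ^ 2 * (v ^ 2 + h ^ 2) = v ^ 2 * (u ^ 2 + h ^ 2) := by
    have := congrArg (· ^ 2) huv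
    simp only [mul_pow, Real.sq_sqrt hu.le, Real.sq_sqrt hv.le] at this
    exact this
  have h2 : u ^ 2 = v ^ 2 := by
    have : h ^ 2 * (u ^ 2 - v ^ 2) = 0 := by linarith
    rcases mul_eq_zero.1 this with h' | h'
    · exact absurd h' (by positivity)
    · linarith
  rw [h2] at huv
  exact mul_right_cancel₀ hv'.ne' huv

/-- The bistatic distance is critical only at the point midway below the two antennas. -/
lemma eq_of_distGrad_eq_zero (hh : 0 < h) {α s : ℝ} {x : Plane} (h0 : distGrad₀ α h s x = 0)
    (h1 : distGrad₁ α h s x = 0) : x 0 = s ∧ x 1 = 0 := by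
  have p1 := slant_pos hh α s x
  have p2 := slant_pos hh (-α) s x
  have hx1 : x 1 = 0 := by
    have : x 1 * (1 / slant h α s x + 1 / slant h (-α) s x) = 0 := by
      rw [← h1, distGrad₁]; ring
    rcases mul_eq_zero.1 this with h' | h'
    · exact h'
    · exact absurd h' (by positivity)
  refine ⟨?_, hx1⟩
  have e1 : slant h α s x = √((x 0 - s - α) ^ 2 + h ^ 2) := by simp [slant, hx1]
  have e2 : slant h (-α) s x = √((-(x 0 - s + α)) ^ 2 + h ^ 2) := by
    simp only [slant, hx1]; congr 1; ring
  rw [distGrad₀, e1, e2] at h0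
  -- With `x₂ = 0` the two quotients in `distGrad₀` are values of the injective odd function `u /
  -- √(u² + h²)`; their sum is zero only at opposite arguments.
  have h3 : x 0 - s - α = -(x 0 - s + α) := by
    refine div_sqrt_injective hh ?_
    rw [neg_div, ← add_eq_zero_iff_eq_neg]
    exact h0
  linarith

lemma bistaticDist_below (α h s : ℝ) {x : Plane} (h0 : x 0 = s) (h1 : x 1 = 0) :
    bistaticDist α h s x = 2 * √(α ^ 2 + h ^ 2) := by
  rw [bistaticDist_eq, slant, slant, h0, h1]
  ring_nf

/-- Each range exceeds the horizontal offset `|x₁ - s ∓ α|` because `h > 0`, and the two offsets add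
up to at least `2α`. -/
lemma two_mul_lt_bistaticDist (hh : 0 < h) {α : ℝ} (s : ℝ) (x : Plane) :
    2 * α < bistaticDist α h s x := by
  have h1 : |x 0 - s - α| < slant h α s x := by
    rw [slant, ← Real.sqrt_sq_eq_abs]
    exact Real.sqrt_lt_sqrt (sq_nonneg _) (by nlinarith [sq_nonneg (x 1), sq_pos_of_pos hh])
  have h2 : |x 0 - s + α| < slant h (-α) s x := by
    rw [slant, ← Real.sqrt_sq_eq_abs, sub_neg_eq_add]
    exact Real.sqrt_lt_sqrt (sq_nonneg _) (by nlinarith [sq_nonneg (x 1), sq_pos_of_pos hh])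
  rw [bistaticDist_eq]
  have := neg_abs_le (x 0 - s - α)
  have := le_abs_self (x 0 - s + α)
  linarith

/-- The bistatic distance and its Doppler shift determine a point up to reflection. -/
lemma eq_or_eq_reflect (hh : 0 < h) {α s : ℝ} (hα : 0 < α) {x y : Plane}
    (hR : bistaticDist α h s x = bistaticDist α h s y)
    (hD : distGrad₀ α h s x = distGrad₀ α h s y) : y = x ∨ y = reflect x := by
  -- The squares of the two ranges differ by `4α(z₁ - s)` and their sum is `R`. For given `R`, both
  -- ranges are therefore affine in `z₁ - s`.
  have slants : ∀ z : Plane, slant h α s z =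
      bistaticDist α h s z / 2 - 2 * α * (z 0 - s) / bistaticDist α h s z ∧
      slant h (-α) s z =
      bistaticDist α h s z / 2 + 2 * α * (z 0 - s) / bistaticDist α h s z := by
    intro z
    have hRz : 0 < bistaticDist α h s z := by
      have := two_mul_lt_bistaticDist hh (α := α) s z
      linarith
    have e1 := slant_sq hh α s z
    have e2 := slant_sq hh (-α) s z
    have e3 := bistaticDist_eq α h s z
    have e4 : slant h (-α) s z - slant h α s z = 4 * α * (z 0 - s) / bistaticDist α h s z := by
      rw [eq_div_iff hRz.ne', e3]
      linear_combination e2 - e1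
    constructor
    · linear_combination (-1 / 2) * e3 - (1 / 2) * e4
    · linear_combination (-1 / 2) * e3 + (1 / 2) * e4
  obtain ⟨x1, x2⟩ := slants x
  obtain ⟨y1, y2⟩ := slants y
  rw [← hR] at y1 y2
  have hx1 := slant_pos hh α s x
  have hx2 := slant_pos hh (-α) s x
  have hy1 := slant_pos hh α s y
  have hy2 := slant_pos hh (-α) s y
  set R := bistaticDist α h s x with hRdef
  have hRα : 2 * α < R := two_mul_lt_bistaticDist hh s x
  have hR0 : 0 < R := by linarith
  have hX : x 0 - s = y 0 - s := by
    unfold distGrad₀ at hD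
    -- After cross-multiplication the quadratic terms cancel, and both quotients contribute the same
    -- factor `R/2 - 2α²/R`. It is positive since `R > 2α`, so the Doppler shift is strictly
    -- monotone in `x₁` along an isochrone.
    have n1 : (x 0 - s - α) * slant h α s y - (y 0 - s - α) * slant h α s x =
        ((x 0 - s) - (y 0 - s)) * (R / 2 - 2 * α ^ 2 / R) := by
      rw [x1, y1]; ring
    have n2 : (x 0 - s + α) * slant h (-α) s y - (y 0 - s + α) * slant h (-α) s x =
        ((x 0 - s) - (y 0 - s)) * (R / 2 - 2 * α ^ 2 / R) := by
      rw [x2, y2]; ring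
    have hpos : 0 < R / 2 - 2 * α ^ 2 / R := by
      have : 2 * α ^ 2 / R < R / 2 := by
        rw [div_lt_div_iff₀ hR0 two_pos]
        nlinarith
      linarith
    have hdiff : ((x 0 - s) - (y 0 - s)) * ((R / 2 - 2 * α ^ 2 / R) *
        (1 / (slant h α s x * slant h α s y) + 1 / (slant h (-α) s x * slant h (-α) s y))) = 0 := by
      have d1 : (x 0 - s - α) / slant h α s x - (y 0 - s - α) / slant h α s y =
          ((x 0 - s) - (y 0 - s)) * (R / 2 - 2 * α ^ 2 / R) / (slant h α s x * slant h α s y) := by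
        rw [← n1]; field_simp
      have d2 : (x 0 - s + α) / slant h (-α) s x - (y 0 - s + α) / slant h (-α) s y =
          ((x 0 - s) - (y 0 - s)) * (R / 2 - 2 * α ^ 2 / R) /
            (slant h (-α) s x * slant h (-α) s y) := by
        rw [← n2]; field_simp
      have d3 : ((x 0 - s - α) / slant h α s x - (y 0 - s - α) / slant h α s y) +
          ((x 0 - s + α) / slant h (-α) s x - (y 0 - s + α) / slant h (-α) s y) = 0 := by
        linarith
      rw [d1, d2] at d3
      rw [← d3]; ring
    rcases mul_eq_zero.1 hdiff with h' | h'
    · linarith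
    · exact absurd h' (by positivity)
  -- Equal `x₁` and equal range to one antenna leave only the sign of `x₂` undetermined.
  have hsl : slant h α s x = slant h α s y := by rw [x1, y1, hX]
  have hsq : x 1 ^ 2 = y 1 ^ 2 := by
    have e1 := slant_sq hh α s x
    have e2 := slant_sq hh α s y
    rw [hsl, hX] at e1
    linarith
  have h0 : y 0 = x 0 := by linarith
  rcases sq_eq_sq_iff_eq_or_eq_neg.1 hsq.symm with h' | h'
  · left
    ext i; fin_cases i
    · exact h0
    · exact h'
  · right
    ext i; fin_cases i
    · simpa [reflect] using h0
    · simpa [reflect] using h'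

lemma gradient_reflect (hh : 0 < h) (α s : ℝ) (x : Plane) :
    gradient (bistaticDist α h s) (reflect x) = reflect (gradient (bistaticDist α h s) x) := by
  have hs : ∀ β, slant h β s (reflect x) = slant h β s x := fun β => by simp [slant, reflect]
  rw [gradient_bistaticDist hh, gradient_bistaticDist hh, distGrad₀, distGrad₁, hs, hs, distGrad₀,
    distGrad₁]
  ext i; fin_cases i
  · simp [reflect]
  · simp [reflect]; ring

lemma abs_distGrad_le (hh : 0 < h) (α s : ℝ) (x : Plane) :
    |distGrad₀ α h s x| ≤ 2 ∧ |distGrad₁ α h s x| ≤ 2 := by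
  have key : ∀ β u, u ^ 2 ≤ slant h β s x ^ 2 → |u / slant h β s x| ≤ 1 := fun β u hu => by
    have hp := slant_pos hh β s x
    rw [abs_div, abs_of_pos hp, div_le_one hp]
    exact abs_le_of_sq_le_sq hu hp.le
  have k1 : ∀ β, |(x 0 - s - β) / slant h β s x| ≤ 1 := fun β => key β _ (by
    rw [slant_sq hh]; nlinarith [sq_nonneg (x 1), sq_nonneg h])
  have k2 : ∀ β, |x 1 / slant h β s x| ≤ 1 := fun β => key β _ (by
    rw [slant_sq hh]; nlinarith [sq_nonneg (x 0 - s - β), sq_nonneg h])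
  constructor
  · have := k1 (-α)
    rw [sub_neg_eq_add] at this
    exact (abs_add_le _ _).trans (by linarith [k1 α])
  · exact (abs_add_le _ _).trans (by linarith [k2 α, k2 (-α)])

end Geometry

end BistaticSAR

namespace BistaticSAR

/-! ### Amplitudes of the forward operator -/

section Amplitudes

variable {ι : Type}

/-- A family of amplitudes of order `2` with common bounds, supported over a common compact set. -/
structure AmpFam (Q : Set (ℝ × ℝ)) (A : ι → ℝ × ℝ × Plane → ℝ → ℂ) : Prop where
  symFam : SymFam (fun i (z : (ℝ × ℝ × Plane) × ℝ) => A i z.1 z.2) 2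
  isCompact : IsCompact Q
  eq_zero : ∀ i s t x ω, (s, t) ∉ Q → A i (s, t, x) ω = 0

/-- The symbol estimates are given over `Y` only. Since `A` vanishes off the compact set `Q ⊆ Y`,
every point with `(s, t) ∉ Q` has a neighbourhood on which `A` is zero; thus `A` is smooth
everywhere, and estimates over `K` reduce to the part of `K` over `Q`. -/
lemma IsAmplitude.ampFam {α h c₀ s₀ s₁ t₀ t₁ : ℝ} {A : ℝ × ℝ × Plane → ℝ → ℂ}
    (hA : IsAmplitude α h c₀ s₀ s₁ t₀ t₁ A) {Q : Set (ℝ × ℝ)} (hQ : IsCompact Q)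
    (hQY : Q ⊆ Ioo s₀ s₁ ×ˢ Ioo t₀ t₁) (hQA : ∀ s t x ω, (s, t) ∉ Q → A (s, t, x) ω = 0) :
    AmpFam Q (fun _ : ι => A) := by
  have hnear : ∀ p : ℝ × ℝ × Plane, (p.1, p.2.1) ∉ Q → ∀ᶠ q in 𝓝 p, ∀ ω, A q ω = 0 := by
    intro p hp
    have hc : Continuous fun q : ℝ × ℝ × Plane => (q.1, q.2.1) := by fun_prop
    filter_upwards [hc.continuousAt.eventually (hQ.isClosed.isOpen_compl.mem_nhds hp)] with q hq ω
    exact hQA q.1 q.2.1 q.2.2 ω hq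
  have hU : IsOpen (Ioo s₀ s₁ ×ˢ Ioo t₀ t₁ ×ˢ (univ : Set Plane)) :=
    isOpen_Ioo.prod (isOpen_Ioo.prod isOpen_univ)
  have hsm : ContDiff ℝ (⊤ : ℕ∞) fun z : (ℝ × ℝ × Plane) × ℝ => A z.1 z.2 := by
    rw [contDiff_iff_contDiffAt]
    intro z
    by_cases hz : (z.1.1, z.1.2.1) ∈ Q
    · have := hQY hz
      exact hA.symbol.1.contDiffAt ((hU.prod isOpen_univ).mem_nhds
        ⟨⟨this.1, this.2, trivial⟩, trivial⟩)
    · have : (fun z : (ℝ × ℝ × Plane) × ℝ => A z.1 z.2) =ᶠ[𝓝 z] fun _ => 0 := by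
        filter_upwards [continuous_fst.continuousAt.eventually (hnear z.1 hz)] with w hw
        exact hw w.2
      exact contDiffAt_const.congr_of_eventuallyEq this
  refine ⟨SymFam.of_mixed hsm fun K hK j k => ?_, hQ, fun _ => hQA⟩
  have hc : Continuous fun q : ℝ × ℝ × Plane => (q.1, q.2.1) := by fun_prop
  have hK' : IsCompact (K ∩ (fun q : ℝ × ℝ × Plane => (q.1, q.2.1)) ⁻¹' Q) :=
    hK.inter_right (hQ.isClosed.preimage hc)
  obtain ⟨C, hC⟩ := hA.symbol.2 _ (fun p hp => by
    have := hQY hp.2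
    exact ⟨this.1, this.2, trivial⟩) hK' j k
  refine ⟨max C 0, fun p hp ω => ?_⟩
  by_cases hpQ : (p.1, p.2.1) ∈ Q
  · refine (hC p ⟨hp, hpQ⟩ ω).trans ?_
    gcongr
    exact le_max_left _ _
  · have : (fun q => iteratedDeriv k (fun ω => A q ω) ω) =ᶠ[𝓝 p] fun _ => 0 := by
      filter_upwards [hnear p hpQ] with q hq
      have : (fun ω => A q ω) = fun _ => 0 := funext hq
      rw [this, iteratedDeriv_const]
      split_ifs <;> rfl
    rw [(this.iteratedFDeriv ℝ j).eq_of_nhds]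
    simp only [iteratedFDeriv_fun_zero, Pi.zero_apply, norm_zero]
    positivity

lemma AmpFam.cutoff {Q : Set (ℝ × ℝ)} {A : ι → ℝ × ℝ × Plane → ℝ → ℂ} (hA : AmpFam Q A)
    {κ : ℝ × ℝ → ℝ} (hκ : ContDiff ℝ (⊤ : ℕ∞) κ) :
    AmpFam Q fun i p ω => (κ (p.1, p.2.1) : ℂ) * A i p ω :=
  ⟨hA.symFam.param_mul (φ := fun p : ℝ × ℝ × Plane => (κ (p.1, p.2.1) : ℂ))
    (Complex.ofRealCLM.contDiff.comp (hκ.comp (by fun_prop))), hA.isCompact,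
    fun i s t x ω h => by simp [hA.eq_zero i s t x ω h]⟩

/-- The regularized amplitudes satisfy symbol estimates with constants independent of `ε`. This is
what permits dominated convergence in the limits that define oscillatory integrals, and the reason
for working with families. -/
lemma AmpFam.freqCutoff {Q : Set (ℝ × ℝ)} {A : ℝ × ℝ × Plane → ℝ → ℂ}
    (hA : AmpFam Q (fun _ : Icc (0 : ℝ) 1 => A))
    {χ : ℝ → ℝ} (hχ : ContDiff ℝ (⊤ : ℕ∞) χ) (hc : HasCompactSupport χ) :
    AmpFam Q fun (ε : Icc (0 : ℝ) 1) p ω => (χ (ε * ω) : ℂ) * A p ω := by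
  refine ⟨?_, hA.isCompact, fun i s t x ω h => by simp [hA.eq_zero i s t x ω h]⟩
  have := (SymFam.cutoff (P := ℝ × ℝ × Plane) hχ hc).mul hA.symFam
  rw [zero_add] at this
  exact this

/-- The amplitude in terms of the delay `r = t - R(s, x) / c₀`. -/
noncomputable def shiftAmp (α h c₀ : ℝ) (A : ℝ × ℝ × Plane → ℝ → ℂ)
    (w : ((ℝ × Plane) × ℝ) × ℝ) : ℂ :=
  A (w.1.1.1, w.1.2 + bistaticDist α h w.1.1.1 w.1.1.2 / c₀, w.1.1.2) w.2

variable {α h c₀ : ℝ} {Q : Set (ℝ × ℝ)} {A : ι → ℝ × ℝ × Plane → ℝ → ℂ}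

lemma AmpFam.shiftAmp (hh : 0 < h) (hA : AmpFam Q A) :
    SymFam (fun i => shiftAmp α h c₀ (A i)) 2 := by
  refine hA.symFam.comp (Φ := fun q : (ℝ × Plane) × ℝ =>
    (q.1.1, q.2 + bistaticDist α h q.1.1 q.1.2 / c₀, q.1.2)) ?_
  have h1 : ContDiff ℝ (⊤ : ℕ∞) fun q : (ℝ × Plane) × ℝ => bistaticDist α h q.1.1 q.1.2 :=
    (contDiff_bistaticDist hh α).comp contDiff_fst
  exact (contDiff_fst.comp contDiff_fst).prodMk
    ((contDiff_snd.add (h1.div_const c₀)).prodMk (contDiff_snd.comp contDiff_fst))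

lemma AmpFam.rSupp (hh : 0 < h) (hA : AmpFam Q A) :
    RSupp (fun i => BistaticSAR.shiftAmp α h c₀ (A i)) := by
  intro K hK
  obtain ⟨T, hT⟩ := (hA.isCompact.image continuous_snd).isBounded.exists_norm_le
  obtain ⟨R, hR⟩ := (hK.image ((contDiff_bistaticDist hh α).div_const
    c₀).continuous).isBounded.exists_norm_le
  refine ⟨T + R, fun i p hp r ω hr => hA.eq_zero i _ _ _ _ fun hmem => ?_⟩
  have h1 := hT _ ⟨_, hmem, rfl⟩
  have h2 := hR _ ⟨p, hp, rfl⟩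
  rw [Real.norm_eq_abs] at h1 h2
  have h3 : r = (r + bistaticDist α h p.1 p.2 / c₀) - bistaticDist α h p.1 p.2 / c₀ := by ring
  have h4 := abs_sub (r + bistaticDist α h p.1 p.2 / c₀) (bistaticDist α h p.1 p.2 / c₀)
  rw [← h3] at h4
  linarith

/-- The reduced amplitude `B(s, x, ω)` of the forward operator. -/
noncomputable def redB (α h c₀ : ℝ) (A : ℝ × ℝ × Plane → ℝ → ℂ) (w : (ℝ × Plane) × ℝ) : ℂ :=
  redAmp (shiftAmp α h c₀ A) w

lemma AmpFam.redB (hh : 0 < h) (hA : AmpFam Q A) : SymFam (fun i => redB α h c₀ (A i)) 2 :=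
  (hA.shiftAmp hh).redAmp (hA.rSupp hh)

lemma AmpFam.tHat_eq_zero (hA : AmpFam Q A) (i : ι) {s : ℝ} (hs : s ∉ Prod.fst '' Q) (x : Plane)
    (σ ω : ℝ) : tHat (BistaticSAR.shiftAmp α h c₀ (A i)) (s, x) σ ω = 0 := by
  have : ∀ r ω, BistaticSAR.shiftAmp α h c₀ (A i) (((s, x), r), ω) = 0 := fun r ω =>
    hA.eq_zero i _ _ _ _ fun hmem => hs ⟨_, hmem, rfl⟩
  simp [tHat, this]

lemma AmpFam.redB_eq_zero (hA : AmpFam Q A) (i : ι) {s : ℝ} (hs : s ∉ Prod.fst '' Q) (x : Plane)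
    (ω : ℝ) : BistaticSAR.redB α h c₀ (A i) ((s, x), ω) = 0 := by
  simp [BistaticSAR.redB, redAmp, hA.tHat_eq_zero i hs]

end Amplitudes

/-! ### Wave integrals -/

section Waves

variable {ι : Type} {α h c₀ : ℝ}

/-- The phase `θ₀ R(s, y) / c₀ - ⟨θ₁, y⟩` with parameters `(s, θ₀, θ₁)`. -/
noncomputable def dataPhase (α h c₀ : ℝ) (w : (ℝ × ℝ × Plane) × Plane) : ℝ :=
  w.1.2.1 * (bistaticDist α h w.1.1 w.2 / c₀) - inner ℝ w.1.2.2 w.2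

lemma contDiff_dataPhase (hh : 0 < h) : ContDiff ℝ (⊤ : ℕ∞) (dataPhase α h c₀) := by
  unfold dataPhase
  have h1 : ContDiff ℝ (⊤ : ℕ∞) fun w : (ℝ × ℝ × Plane) × Plane => bistaticDist α h w.1.1 w.2 :=
    contDiff_bistaticDist_comp hh α (contDiff_fst.comp contDiff_fst) contDiff_snd
  have h2 : ContDiff ℝ (⊤ : ℕ∞) fun w : (ℝ × ℝ × Plane) × Plane => w.1.2.1 := by fun_prop
  have h3 : ContDiff ℝ (⊤ : ℕ∞) fun w : (ℝ × ℝ × Plane) × Plane => w.1.2.2 := by fun_prop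
  exact (h2.mul (h1.div_const c₀)).sub (h3.inner ℝ contDiff_snd)

/-- The gradient of `dataPhase` in `y`. -/
noncomputable def phaseGrad (α h c₀ : ℝ) (w : (ℝ × ℝ × Plane) × Plane) : Plane :=
  (w.1.2.1 / c₀) • gradient (bistaticDist α h w.1.1) w.2 - w.1.2.2

lemma continuous_gradient_bistaticDist (hh : 0 < h) :
    Continuous fun z : ℝ × Plane => gradient (bistaticDist α h z.1) z.2 := by
  have h1 : (fun z : ℝ × Plane => gradient (bistaticDist α h z.1) z.2) = fun z : ℝ × Plane =>
      (!₂[distGrad₀ α h z.1 z.2, distGrad₁ α h z.1 z.2] : Plane) :=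
    funext fun z => gradient_bistaticDist hh α z.1 z.2
  have hs : ∀ β, Continuous fun z : ℝ × Plane => slant h β z.1 z.2 := fun β =>
    (contDiff_slant hh β).continuous
  have h0 : Continuous fun z : ℝ × Plane => z.2 0 := (contDiff_coord 0).continuous.comp continuous_snd
  have h1' : Continuous fun z : ℝ × Plane => z.2 1 := (contDiff_coord 1).continuous.comp continuous_snd
  have hn : ∀ β, ∀ z : ℝ × Plane, slant h β z.1 z.2 ≠ 0 := fun β z => (slant_pos hh β _ _).ne'
  rw [h1]
  refine (PiLp.continuous_toLp 2 _).comp (continuous_pi fun i => ?_)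
  fin_cases i
  · simp only [distGrad₀]
    exact (((h0.sub continuous_fst).sub continuous_const).div (hs α) (hn α)).add
      (((h0.sub continuous_fst).add continuous_const).div (hs (-α)) (hn (-α)))
  · simp only [distGrad₁]
    exact (h1'.div (hs α) (hn α)).add (h1'.div (hs (-α)) (hn (-α)))

lemma continuous_phaseGrad (hh : 0 < h) : Continuous (phaseGrad α h c₀) := by
  unfold phaseGrad
  have h0 : Continuous fun w : (ℝ × ℝ × Plane) × Plane => (w.1.1, w.2) := by fun_prop
  have h1 := (continuous_gradient_bistaticDist (α := α) hh).comp h0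
  have h2 : Continuous fun w : (ℝ × ℝ × Plane) × Plane => w.1.2.1 / c₀ := by fun_prop
  exact (h2.smul h1).sub (by fun_prop)

lemma fderiv_dataPhase (hh : 0 < h) (w : (ℝ × ℝ × Plane) × Plane) (v : Plane) :
    fderiv ℝ (dataPhase α h c₀) w (0, v) = inner ℝ (phaseGrad α h c₀ w) v := by
  obtain ⟨⟨s, θ₀, θ₁⟩, y⟩ := w
  rw [← fderiv_slice_right (contDiff_dataPhase hh)]
  have h1 : HasFDerivAt (bistaticDist α h s) (fderiv ℝ (bistaticDist α h s) y) y :=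
    ((contDiff_bistaticDist_right hh α s).differentiable (by simp) y).hasFDerivAt
  have h2 : HasFDerivAt (fun y : Plane => inner ℝ θ₁ y) (innerSL ℝ θ₁) y :=
    (innerSL ℝ θ₁).hasFDerivAt
  have h3 : HasFDerivAt (fun y => dataPhase α h c₀ ((s, θ₀, θ₁), y))
      ((θ₀ * c₀⁻¹) • fderiv ℝ (bistaticDist α h s) y - innerSL ℝ θ₁) y := by
    have e : (fun y => dataPhase α h c₀ ((s, θ₀, θ₁), y)) = fun y =>
        θ₀ * c₀⁻¹ * bistaticDist α h s y - inner ℝ θ₁ y := by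
      ext y
      simp only [dataPhase]
      ring
    rw [e]
    exact (h1.const_mul (θ₀ * c₀⁻¹)).sub h2
  rw [h3.fderiv, phaseGrad, inner_sub_left, real_inner_smul_left, gradient,
    InnerProductSpace.toDual_symm_apply]
  simp [div_eq_mul_inv]

/-- Products of symbols with test functions. -/
lemma SymFam.derivBound_mul {B : ι → (ℝ × Plane) × ℝ → ℂ} {m : ℝ} (hB : SymFam B m) {S : Set ℝ}
    (hS : IsCompact S) {L : Set Plane} (hL : IsCompact L) (n : ℕ) :
    ∃ C : ℝ, 0 ≤ C ∧ ∀ i, ∀ s ∈ S, ∀ ω : ℝ, ∀ V : Plane → ℂ, ContDiff ℝ (⊤ : ℕ∞) V →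
      tsupport V ⊆ L → ∀ M, DerivBound n V M →
      DerivBound n (fun y => B i ((s, y), ω) * V y) (C * M * (1 + |ω|) ^ m) := by
  obtain ⟨C, hC0, hC⟩ := hB.symBound.uniform (hS.prod hL) n
  refine ⟨2 ^ n * C, by positivity, fun i s hs ω V hV hVL M hM j hj y => ?_⟩
  have hM0 := hM.nonneg
  have hBs : ContDiff ℝ (⊤ : ℕ∞) fun y => B i ((s, y), ω) := (hB.smooth i).comp (by fun_prop)
  by_cases hy : y ∈ L
  · refine (norm_iteratedFDeriv_mul_le_of_le hBs hV hj (M := C * (1 + |ω|) ^ m) (H := M)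
      (fun l hl => ?_) (fun l hl => hM l hl y)).trans (le_of_eq (by ring))
    refine le_trans ?_ (hC l hl i (s, y) ⟨hs, hy⟩ ω)
    have hn : ((l : ℕ) : WithTop ℕ∞) ≤ ((⊤ : ℕ∞) : WithTop ℕ∞) := by exact_mod_cast le_top
    have e : (fun y => B i ((s, y), ω)) = (fun w => B i (w + ((s, 0), ω))) ∘
        ((ContinuousLinearMap.inl ℝ (ℝ × Plane) ℝ).comp (ContinuousLinearMap.inr ℝ ℝ Plane)) := by
      ext y; simp
    have hBt : ContDiff ℝ (⊤ : ℕ∞) fun w => B i (w + ((s, 0), ω)) :=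
      (hB.smooth i).comp (contDiff_id.add contDiff_const)
    rw [e, ContinuousLinearMap.iteratedFDeriv_comp_right _ hBt _ hn, iteratedFDeriv_comp_add_right]
    refine (ContinuousMultilinearMap.norm_compContinuousLinearMap_le _ _).trans ?_
    have e2 : ((ContinuousLinearMap.inl ℝ (ℝ × Plane) ℝ).comp (ContinuousLinearMap.inr ℝ ℝ Plane)) y
        + ((s, 0), ω) = ((s, y), ω) := by simp
    rw [e2]
    refine mul_le_of_le_one_right (norm_nonneg _)
      (Finset.prod_le_one (fun _ _ => norm_nonneg _) fun _ _ => ?_)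
    exact (ContinuousLinearMap.opNorm_comp_le _ _).trans (mul_le_one₀
      (ContinuousLinearMap.norm_inl_le_one ℝ _ _) (norm_nonneg _)
      (ContinuousLinearMap.norm_inr_le_one ℝ _ _))
  · have h1 : y ∉ tsupport fun y => B i ((s, y), ω) * V y := fun hmem =>
      hy (hVL (tsupport_mul_subset_right hmem))
    have : iteratedFDeriv ℝ j (fun y => B i ((s, y), ω) * V y) y = 0 :=
      image_eq_zero_of_notMem_tsupport
        fun hmem => h1 (tsupport_iteratedFDeriv_subset (𝕜 := ℝ) j hmem)
    rw [this, norm_zero]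
    positivity

/-- Rapid decrease of wave integrals without stationary points. -/
theorem norm_wave_le (hh : 0 < h) {B : ι → (ℝ × Plane) × ℝ → ℂ} {m : ℝ} (hB : SymFam B m)
    {S : Set ℝ} (hS : IsCompact S) {L : Set Plane} (hL : IsCompact L)
    {K : Set ((ℝ × ℝ × Plane) × Plane)} (hK : IsCompact K)
    (hne : ∀ w ∈ K, phaseGrad α h c₀ w ≠ 0) (N : ℕ) :
    ∃ C : ℝ, 0 ≤ C ∧ ∀ i, ∀ V : Plane → ℂ, ContDiff ℝ (⊤ : ℕ∞) V → tsupport V ⊆ L →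
      ∀ M, DerivBound N V M → ∀ s ∈ S, ∀ ω θ₀ : ℝ, ∀ θ₁ : Plane, ∀ l : ℝ, 0 < l →
      (∀ y, B i ((s, y), ω) * V y ≠ 0 → ((s, θ₀, θ₁), y) ∈ K) →
      ‖∫ y, Complex.exp (Complex.I * ((l * dataPhase α h c₀ ((s, θ₀, θ₁), y) : ℝ) : ℂ)) *
        (B i ((s, y), ω) * V y)‖ ≤ C * M * (1 + |ω|) ^ m / l ^ N := by
  obtain ⟨C₁, hC₁0, hC₁⟩ := hB.derivBound_mul hS hL N
  obtain ⟨C₂, hC₂0, hC₂⟩ := norm_integral_le_of_nonstationary (volume : Measure Plane)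
    (contDiff_dataPhase (α := α) (c₀ := c₀) hh) (fun i : Fin 2 => EuclideanSpace.single i (1 : ℝ)) hK
    (fun w hw => by
      by_contra! hcon
      refine hne w hw ?_
      ext i
      have := hcon i
      rw [fderiv_dataPhase hh, EuclideanSpace.inner_single_right] at this
      simpa using this) N
  refine ⟨C₂ * C₁, by positivity, fun i V hV hVL M hM s hs ω θ₀ θ₁ l hl hsup => ?_⟩
  have hBs : ContDiff ℝ (⊤ : ℕ∞) fun y => B i ((s, y), ω) := (hB.smooth i).comp (by fun_prop)
  refine (hC₂ (s, θ₀, θ₁) _ (hBs.mul hV) hsup _ (hC₁ i s hs ω V hV hVL M hM) l hl).trans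
    (le_of_eq (by ring))

end Waves

end BistaticSAR

namespace BistaticSAR

/-! ### Rapid decrease of the Fourier transform of the data -/

section FourierData

variable {ι : Type} {α h c₀ : ℝ}

/-- The Fourier transform in time of the data of `V`, for the reduced amplitude `B`. -/
noncomputable def fourierData (α h c₀ : ℝ) (B : (ℝ × Plane) × ℝ → ℂ) (V : Plane → ℂ) (s ω : ℝ) : ℂ :=
  ∫ y, Complex.exp (Complex.I * ((ω * (bistaticDist α h s y / c₀) : ℝ) : ℂ)) *
    (B ((s, y), ω) * V y)

/-- The point on the ground midway below the antennas. -/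
noncomputable def basePoint (s : ℝ) : Plane := !₂[s, 0]

lemma contDiff_basePoint : ContDiff ℝ (⊤ : ℕ∞) basePoint := by
  unfold basePoint
  rw [contDiff_euclidean]
  intro i
  fin_cases i
  · exact contDiff_id
  · exact contDiff_const

lemma continuous_fourierData_integrand (hh : 0 < h) {B : (ℝ × Plane) × ℝ → ℂ} (hB : Continuous B)
    {V : Plane → ℂ} (hV : Continuous V) : Continuous fun w : (ℝ × ℝ) × Plane =>
      Complex.exp (Complex.I * ((w.1.2 * (bistaticDist α h w.1.1 w.2 / c₀) : ℝ) : ℂ)) *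
        (B ((w.1.1, w.2), w.1.2) * V w.2) := by
  have h1 : Continuous fun w : (ℝ × ℝ) × Plane => bistaticDist α h w.1.1 w.2 :=
    (contDiff_bistaticDist_comp hh α (contDiff_fst.comp contDiff_fst) contDiff_snd).continuous
  have h2 : Continuous fun w : (ℝ × ℝ) × Plane => B ((w.1.1, w.2), w.1.2) := hB.comp (by fun_prop)
  have h3 : Continuous fun w : (ℝ × ℝ) × Plane => V w.2 := hV.comp continuous_snd
  refine Continuous.mul ?_ (h2.mul h3)
  refine Complex.continuous_exp.comp (continuous_const.mul (Complex.continuous_ofReal.comp ?_))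
  exact (continuous_snd.comp continuous_fst).mul (h1.div_const c₀)

lemma continuous_fourierData (hh : 0 < h) {B : (ℝ × Plane) × ℝ → ℂ} (hB : Continuous B)
    {V : Plane → ℂ} (hV : Continuous V) (hVc : HasCompactSupport V) :
    Continuous fun w : ℝ × ℝ => fourierData α h c₀ B V w.1 w.2 := by
  have h1 : ∀ w : ℝ × ℝ, fourierData α h c₀ B V w.1 w.2 = ∫ y in tsupport V,
      Complex.exp (Complex.I * ((w.2 * (bistaticDist α h w.1 y / c₀) : ℝ) : ℂ)) *
        (B ((w.1, y), w.2) * V y) := by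
    intro w
    rw [setIntegral_eq_integral_of_forall_compl_eq_zero]
    · rfl
    · intro y hy
      rw [image_eq_zero_of_notMem_tsupport hy, mul_zero, mul_zero]
  simp_rw [h1]
  exact continuous_parametric_integral_of_continuous
    (f := fun (w : ℝ × ℝ) y => Complex.exp (Complex.I *
      ((w.2 * (bistaticDist α h w.1 y / c₀) : ℝ) : ℂ)) * (B ((w.1, y), w.2) * V y))
    (continuous_fourierData_integrand hh hB hV) hVc.isCompact

lemma integrable_fourierData_integrand (hh : 0 < h) {B : (ℝ × Plane) × ℝ → ℂ} (hB : Continuous B)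
    {V : Plane → ℂ} (hV : Continuous V) (hVc : HasCompactSupport V) (s ω : ℝ) :
    Integrable fun y => Complex.exp (Complex.I * ((ω * (bistaticDist α h s y / c₀) : ℝ) : ℂ)) *
      (B ((s, y), ω) * V y) :=
  ((continuous_fourierData_integrand hh hB hV).comp (Continuous.prodMk_right (s, ω))
    ).integrable_of_hasCompactSupport (hVc.mul_left.mul_left)

/-- A bound for wave integrals in terms of the size of the amplitude. -/
lemma norm_integral_wave_le_of_norm_le {L : Set Plane} (hL : IsCompact L) {V : Plane → ℂ}
    (hVL : tsupport V ⊆ L) {M D : ℝ} (hM : ∀ y, ‖V y‖ ≤ M) (hD : 0 ≤ D) {b : Plane → ℂ}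
    (hb : ∀ y ∈ L, ‖b y‖ ≤ D) (φ : Plane → ℝ) :
    ‖∫ y, Complex.exp (Complex.I * (φ y : ℂ)) * (b y * V y)‖ ≤
      (volume : Measure Plane).real L * M * D := by
  have : ∫ y, Complex.exp (Complex.I * (φ y : ℂ)) * (b y * V y) =
      ∫ y in L, Complex.exp (Complex.I * (φ y : ℂ)) * (b y * V y) := by
    rw [setIntegral_eq_integral_of_forall_compl_eq_zero]
    intro y hy
    rw [image_eq_zero_of_notMem_tsupport fun hmem => hy (hVL hmem), mul_zero, mul_zero]
  rw [this]
  refine (norm_setIntegral_le_of_norm_le_const (C := D * M) hL.measure_lt_top fun y hy => ?_).trans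
    (le_of_eq (by ring))
  rw [norm_mul, norm_cexp_I_mul, one_mul, norm_mul]
  exact mul_le_mul (hb y hy) (hM y) (norm_nonneg _) hD

/-- At `y = basePoint s` and `r = 0` the time is `2√(α² + h²)/c₀`, so the data point lies in the
open set `U`. Compactness of `S` and the tube lemma make the size of the neighbourhood independent
of `s`. -/
lemma exists_vanish_near_base (hh : 0 < h) {S : Set ℝ} (hS : IsCompact S) {U : Set (ℝ × ℝ)}
    (hU : IsOpen U) (hUS : ∀ s ∈ S, (s, 2 * √(α ^ 2 + h ^ 2) / c₀) ∈ U) :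
    ∃ δ : ℝ, 0 < δ ∧ ∀ s ∈ S, ∀ y : Plane, ‖y - basePoint s‖ < δ → ∀ r : ℝ, |r| < δ →
      (s, r + bistaticDist α h s y / c₀) ∈ U := by
  let Ψ : ℝ × (Plane × ℝ) → ℝ × ℝ := fun w =>
    (w.1, w.2.2 + bistaticDist α h w.1 (w.2.1 + basePoint w.1) / c₀)
  have h1 : Continuous fun w : ℝ × (Plane × ℝ) => bistaticDist α h w.1 (w.2.1 + basePoint w.1) :=
    (contDiff_bistaticDist_comp hh α contDiff_fst ((contDiff_fst.comp contDiff_snd).add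
      (contDiff_basePoint.comp contDiff_fst))).continuous
  have hΨ : Continuous Ψ := continuous_fst.prodMk
    ((continuous_snd.comp continuous_snd).add (h1.div_const c₀))
  obtain ⟨u, v, -, hv, hSu, h0v, huv⟩ := generalized_tube_lemma hS
    (isCompact_singleton (x := ((0 : Plane), (0 : ℝ)))) (hU.preimage hΨ) (by
      rintro ⟨s, w⟩ ⟨hs, hw⟩
      rw [mem_singleton_iff] at hw
      subst hw
      have := hUS s hs
      simp only [mem_preimage, Ψ, zero_add]
      rwa [bistaticDist_below α h s (x := basePoint s) (by simp [basePoint]) (by simp [basePoint])])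
  obtain ⟨δ, hδ, hball⟩ := Metric.isOpen_iff.1 hv _ (h0v rfl)
  refine ⟨δ, hδ, fun s hs y hy r hr => ?_⟩
  have hmem : ((y - basePoint s, r) : Plane × ℝ) ∈ v := by
    refine hball ?_
    rw [Metric.mem_ball, Prod.dist_eq]
    simp only [dist_zero_right, Real.norm_eq_abs]
    exact max_lt hy hr
  have := huv (mk_mem_prod (hSu hs) hmem)
  simpa [Ψ] using this

lemma rpow_two_sub_le (N : ℕ) (ω : ℝ) :
    (1 + |ω|) ^ ((2 : ℝ) - ((N + 2 : ℕ) : ℝ)) = (1 + |ω|) ^ (-(N : ℝ)) := by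
  congr 1; push_cast; ring

/-- The data of a test function have a rapidly decreasing Fourier transform. -/
theorem norm_fourierData_le (hh : 0 < h) (hc₀ : 0 < c₀) {Q U : Set (ℝ × ℝ)}
    {A : ι → ℝ × ℝ × Plane → ℝ → ℂ} (hA : AmpFam Q A) (hU : IsOpen U)
    (hUQ : ∀ s ∈ Prod.fst '' Q, (s, 2 * √(α ^ 2 + h ^ 2) / c₀) ∈ U)
    (hAU : ∀ i s t x ω, (s, t) ∈ U → A i (s, t, x) ω = 0) {L : Set Plane} (hL : IsCompact L)
    (N : ℕ) : ∃ C : ℝ, 0 ≤ C ∧ ∀ i, ∀ V : Plane → ℂ, ContDiff ℝ (⊤ : ℕ∞) V → tsupport V ⊆ L →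
      ∀ M, DerivBound (N + 2) V M → ∀ s ω : ℝ,
      ‖fourierData α h c₀ (redB α h c₀ (A i)) V s ω‖ ≤ C * M * (1 + |ω|) ^ (-(N : ℝ)) := by
  have hS : IsCompact (Prod.fst '' Q) := hA.isCompact.image continuous_fst
  set S := Prod.fst '' Q with hSdef
  have hB : SymFam (fun i => redB α h c₀ (A i)) 2 := hA.redB hh
  obtain ⟨δ, hδ, hδU⟩ := exists_vanish_near_base hh hS hU hUQ
  -- the amplitude near the base point
  let Z : Set (ℝ × Plane) := {p | p.1 ∈ S ∧ ‖p.2 - basePoint p.1‖ < δ}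
  have hZc : ∃ K : Set (ℝ × Plane), IsCompact K ∧ Z ⊆ K := by
    have hc : Continuous fun w : ℝ × Plane => (w.1, w.2 + basePoint w.1) :=
      continuous_fst.prodMk (continuous_snd.add (contDiff_basePoint.continuous.comp continuous_fst))
    refine ⟨_, (hS.prod (isCompact_closedBall (0 : Plane) δ)).image hc, fun p hp => ?_⟩
    refine ⟨(p.1, p.2 - basePoint p.1), ⟨hp.1, ?_⟩, by simp⟩
    simpa using hp.2.le
  obtain ⟨KZ, hKZ, hZK⟩ := hZc
  -- The extra `2` cancels the order of the symbol and leaves the exponent `-N`.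
  obtain ⟨C₁, hC₁0, hC₁⟩ := norm_redAmp_le_of_vanish hKZ hZK hδ (N + 2)
    (hA.shiftAmp (α := α) (c₀ := c₀) hh) (hA.rSupp hh) (fun i p hp r ω hr =>
      hAU i _ _ _ _ (hδU p.1 hp.1 p.2 hp.2 r hr))
  -- a cutoff around the base point
  let κ : ContDiffBump (0 : Plane) := ⟨δ / 3, δ / 2, by positivity, by linarith⟩
  have hκs : ContDiff ℝ (⊤ : ℕ∞) fun p : ℝ × Plane => ((1 - κ (p.2 - basePoint p.1) : ℝ) : ℂ) :=
    Complex.ofRealCLM.contDiff.comp (contDiff_const.sub (κ.contDiff.comp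
      (contDiff_snd.sub (contDiff_basePoint.comp contDiff_fst))))
  have hB2 := hB.param_mul hκs
  obtain ⟨C₀, hC₀0, hC₀⟩ := hB.norm_le (hS.prod hL)
  -- the wave integral away from the base point
  let F : Set (ℝ × Plane) := {p | p.1 ∈ S ∧ p.2 ∈ L ∧ δ / 3 ≤ ‖p.2 - basePoint p.1‖}
  have hF : IsCompact F := by
    have hcl : IsClosed {p : ℝ × Plane | δ / 3 ≤ ‖p.2 - basePoint p.1‖} :=
      isClosed_le continuous_const (continuous_snd.sub
        (contDiff_basePoint.continuous.comp continuous_fst)).norm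
    have := (hS.prod hL).inter_right hcl
    refine this.of_isClosed_subset ?_ ?_
    · have : F = (S ×ˢ L) ∩ {p : ℝ × Plane | δ / 3 ≤ ‖p.2 - basePoint p.1‖} := by
        ext p; simp [F, and_assoc]
      rw [this]
      exact ((hS.prod hL).inter_right hcl).isClosed
    · intro p hp; exact ⟨⟨hp.1, hp.2.1⟩, hp.2.2⟩
  -- Here the frequency is normalized to its sign `±1`, there is no modulation, and `|ω|` is the
  -- large parameter. On `F` the gradient of the phase does not vanish, since its only zero
  -- `basePoint s` is at distance at least `δ/3`.
  let KF : Set ((ℝ × ℝ × Plane) × Plane) :=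
    (fun w : (ℝ × Plane) × ℝ => ((w.1.1, w.2, (0 : Plane)), w.1.2)) '' (F ×ˢ {1, -1})
  have hKF : IsCompact KF := (hF.prod (Set.Finite.isCompact (by simp))).image (by fun_prop)
  obtain ⟨C₂, hC₂0, hC₂⟩ := norm_wave_le (α := α) (c₀ := c₀) hh hB2 hS hL hKF (by
    rintro _ ⟨⟨⟨s, y⟩, θ⟩, ⟨hp, hθ⟩, rfl⟩ h0
    have hθ0 : θ ≠ 0 := by
      rcases hθ with rfl | rfl <;> norm_num
    simp only [phaseGrad, sub_zero, smul_eq_zero, div_eq_zero_iff, hθ0, hc₀.ne', or_self,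
      false_or] at h0
    rw [gradient_bistaticDist hh] at h0
    have e0 : distGrad₀ α h s y = 0 := by simpa using congrArg (fun v : Plane => v 0) h0
    have e1 : distGrad₁ α h s y = 0 := by simpa using congrArg (fun v : Plane => v 1) h0
    obtain ⟨a0, a1⟩ := eq_of_distGrad_eq_zero hh e0 e1
    have hy : y = basePoint s := by
      ext i; fin_cases i
      · simpa [basePoint] using a0
      · simpa [basePoint] using a1
    have := hp.2.2
    rw [hy] at this
    simp at this
    linarith) (N + 2)
  let v : ℝ := (volume : Measure Plane).real L
  have hv : 0 ≤ v := measureReal_nonneg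
  refine ⟨v * C₁ + C₂ * 2 ^ (N + 2) + v * C₀ * 2 ^ (N + 2), by positivity,
    fun i V hV hVL M hM s ω => ?_⟩
  have hM0 := hM.nonneg
  have hVc : HasCompactSupport V := hL.of_isClosed_subset (isClosed_tsupport V) hVL
  by_cases hs : s ∈ S
  swap
  · have : fourierData α h c₀ (redB α h c₀ (A i)) V s ω = 0 := by
      simp [fourierData, hA.redB_eq_zero i hs]
    rw [this, norm_zero]
    positivity
  have hω0 : 0 < (1 + |ω|) ^ (-(N : ℝ)) := by positivity
  -- Powers of `1/|ω|` are useless for small `|ω|`; there the size of the amplitude suffices.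
  rcases le_or_gt |ω| 1 with hω | hω
  · have h1 := norm_integral_wave_le_of_norm_le hL hVL hM.norm_le
      (D := C₀ * (1 + |ω|) ^ (2 : ℝ)) (by positivity) (fun y hy => hC₀ i (s, y) ⟨hs, hy⟩ ω)
      (fun y => ω * (bistaticDist α h s y / c₀))
    refine h1.trans ?_
    have h2 : (1 + |ω|) ^ (2 : ℝ) ≤ 2 ^ (N + 2) * (1 + |ω|) ^ (-(N : ℝ)) := by
      rw [Real.rpow_neg (by positivity), ← div_eq_mul_inv, le_div_iff₀ (by positivity),
        ← Real.rpow_add (by positivity)]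
      calc (1 + |ω|) ^ ((2 : ℝ) + N) ≤ 2 ^ ((2 : ℝ) + N) :=
            Real.rpow_le_rpow (by positivity) (by linarith) (by positivity)
        _ = 2 ^ (N + 2) := by
            rw [add_comm]; exact_mod_cast Real.rpow_natCast 2 (N + 2)
    have h3 : 0 ≤ (v * C₁ + C₂ * 2 ^ (N + 2)) * M * (1 + |ω|) ^ (-(N : ℝ)) := by positivity
    have h4 : v * M * (C₀ * (1 + |ω|) ^ (2 : ℝ)) ≤
        v * M * (C₀ * (2 ^ (N + 2) * (1 + |ω|) ^ (-(N : ℝ)))) := by gcongr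
    calc _ ≤ v * M * (C₀ * (2 ^ (N + 2) * (1 + |ω|) ^ (-(N : ℝ)))) := h4
      _ ≤ _ := by linarith
  -- split the amplitude
  let V₁ : Plane → ℂ := fun y => (κ (y - basePoint s) : ℂ) * V y
  have hsub : Continuous fun y : Plane => (κ (y - basePoint s) : ℂ) :=
    Complex.continuous_ofReal.comp (κ.continuous.comp (continuous_id.sub continuous_const))
  have hBc : Continuous fun y => redB α h c₀ (A i) ((s, y), ω) :=
    (hB.smooth i).continuous.comp (by fun_prop)
  have hec : Continuous fun y : Plane =>
      Complex.exp (Complex.I * ((ω * (bistaticDist α h s y / c₀) : ℝ) : ℂ)) :=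
    Complex.continuous_exp.comp (continuous_const.mul (Complex.continuous_ofReal.comp
      (continuous_const.mul ((contDiff_bistaticDist_right hh α s).continuous.div_const c₀))))
  have hsplit : fourierData α h c₀ (redB α h c₀ (A i)) V s ω =
      (∫ y, Complex.exp (Complex.I * ((ω * (bistaticDist α h s y / c₀) : ℝ) : ℂ)) *
        ((κ (y - basePoint s) : ℂ) * redB α h c₀ (A i) ((s, y), ω) * V y)) +
      ∫ y, Complex.exp (Complex.I * ((ω * (bistaticDist α h s y / c₀) : ℝ) : ℂ)) *
        (((1 - κ (y - basePoint s) : ℝ) : ℂ) * redB α h c₀ (A i) ((s, y), ω) * V y) := by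
    rw [← integral_add]
    · unfold fourierData
      congr 1; ext y
      push_cast; ring
    · exact (hec.mul ((hsub.mul hBc).mul hV.continuous)).integrable_of_hasCompactSupport
        hVc.mul_left.mul_left
    · have : Continuous fun y : Plane => ((1 - κ (y - basePoint s) : ℝ) : ℂ) := by
        push_cast
        exact continuous_const.sub hsub
      exact (hec.mul ((this.mul hBc).mul hV.continuous)).integrable_of_hasCompactSupport
        hVc.mul_left.mul_left
  have hp1 : ‖∫ y, Complex.exp (Complex.I * ((ω * (bistaticDist α h s y / c₀) : ℝ) : ℂ)) *
        ((κ (y - basePoint s) : ℂ) * redB α h c₀ (A i) ((s, y), ω) * V y)‖ ≤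
        v * M * (C₁ * (1 + |ω|) ^ (-(N : ℝ))) := by
    refine norm_integral_wave_le_of_norm_le hL hVL hM.norm_le (by positivity) (fun y _ => ?_)
      (fun y => ω * (bistaticDist α h s y / c₀))
    rw [norm_mul, Complex.norm_real, Real.norm_of_nonneg κ.nonneg]
    by_cases hy : ‖y - basePoint s‖ < δ
    · have h1 := hC₁ i (s, y) ⟨hs, hy⟩ ω
      rw [rpow_two_sub_le] at h1
      calc _ ≤ 1 * (C₁ * (1 + |ω|) ^ (-(N : ℝ))) :=
            mul_le_mul κ.le_one h1 (norm_nonneg _) zero_le_one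
        _ = _ := one_mul _
    · have : κ (y - basePoint s) = 0 := κ.zero_of_le_dist (by
        rw [dist_zero_right]
        show δ / 2 ≤ _
        linarith [not_lt.1 hy])
      rw [this, zero_mul]
      positivity
  have hsign : ∃ θ : ℝ, (θ = 1 ∨ θ = -1) ∧ ω = |ω| * θ := by
    rcases le_total 0 ω with h' | h'
    · exact ⟨1, Or.inl rfl, by rw [abs_of_nonneg h', mul_one]⟩
    · exact ⟨-1, Or.inr rfl, by rw [abs_of_nonpos h']; ring⟩
  obtain ⟨θ, hθ, hωθ⟩ := hsign
  have hp2 := hC₂ i V hV hVL M hM s hs ω θ 0 |ω| (by linarith) (fun y hy => by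
    refine ⟨((s, y), θ), ⟨⟨hs, ?_, ?_⟩, ?_⟩, rfl⟩
    · have : V y ≠ 0 := fun h0 => hy (by rw [h0, mul_zero])
      exact hVL (subset_tsupport V this)
    · by_contra hlt
      refine hy ?_
      have : κ (y - basePoint s) = 1 := κ.one_of_mem_closedBall (by
        rw [mem_closedBall_zero_iff]
        show _ ≤ δ / 3
        linarith [not_le.1 hlt])
      simp [this]
    · rcases hθ with rfl | rfl <;> simp)
  have hphase : ∀ y, |ω| * dataPhase α h c₀ ((s, θ, (0 : Plane)), y) =
      ω * (bistaticDist α h s y / c₀) := fun y => by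
    simp only [dataPhase, inner_zero_left, sub_zero]
    rw [← mul_assoc, ← hωθ]
  simp_rw [hphase] at hp2
  have hp3 : (1 + |ω|) ^ (2 : ℝ) / |ω| ^ (N + 2) ≤ 2 ^ (N + 2) * (1 + |ω|) ^ (-(N : ℝ)) := by
    rw [div_le_iff₀ (by positivity), mul_assoc, mul_comm _ (|ω| ^ (N + 2)), ← mul_assoc, ← mul_pow,
      Real.rpow_neg (by positivity), ← div_eq_mul_inv, le_div_iff₀ (by positivity),
      ← Real.rpow_add (by positivity)]
    have : (1 + |ω|) ^ ((2 : ℝ) + N) = (1 + |ω|) ^ (N + 2) := by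
      rw [show (2:ℝ)+N = ((N+2:ℕ):ℝ) by push_cast; ring, Real.rpow_natCast]
    rw [this]
    gcongr
    linarith
  rw [hsplit]
  refine (norm_add_le _ _).trans ((add_le_add hp1 hp2).trans ?_)
  have h3 : 0 ≤ (v * C₀ * 2 ^ (N + 2)) * M * (1 + |ω|) ^ (-(N : ℝ)) := by positivity
  have h4 : C₂ * M * (1 + |ω|) ^ (2 : ℝ) / |ω| ^ (N + 2) ≤
      C₂ * M * (2 ^ (N + 2) * (1 + |ω|) ^ (-(N : ℝ))) := by
    rw [mul_div_assoc]
    gcongr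
  linarith

end FourierData

end BistaticSAR

namespace BistaticSAR

/-! ### Unitary characters and Fourier inversion -/

section Characters

/-- `e^{ix}`. -/
noncomputable def cis (x : ℝ) : ℂ := Complex.exp (Complex.I * (x : ℂ))

lemma norm_cis (x : ℝ) : ‖cis x‖ = 1 := norm_cexp_I_mul x

lemma cis_add (x y : ℝ) : cis (x + y) = cis x * cis y := by
  rw [cis, cis, cis, ← Complex.exp_add]; push_cast; ring_nf

lemma contDiff_cis : ContDiff ℝ (⊤ : ℕ∞) cis :=
  (contDiff_const.mul Complex.ofRealCLM.contDiff).cexp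

lemma continuous_cis : Continuous cis := contDiff_cis.continuous

lemma conj_cis (x : ℝ) : conj (cis x) = cis (-x) := by
  rw [cis, cis, ← Complex.exp_conj]; simp

lemma cis_neg (x : ℝ) : cis (-x) = Complex.exp (-Complex.I * (x : ℂ)) := by
  rw [cis]; push_cast; ring_nf

lemma negChar_eq_cis (σ r : ℝ) : negChar σ r = cis (-(σ * r)) := by
  rw [negChar, cis]; push_cast; ring_nf

lemma norm_cis_mul (x : ℝ) (z : ℂ) : ‖cis x * z‖ = ‖z‖ := by
  rw [norm_mul, norm_cis, one_mul]

/-- Fourier inversion with frequencies in radians. -/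
lemma eq_integral_cis_of_fourier {G f : ℝ → ℂ} (hG : Continuous G) (hGi : Integrable G)
    (hf : Integrable f) (h : ∀ ω, ∫ t, cis (ω * t) * G t = f ω) (t : ℝ) :
    G t = (1 / (2 * Real.pi) : ℝ) * ∫ ω, cis (-(ω * t)) * f ω := by
  -- The standard transform has the character `e^{-2πitξ}`, so `ω = -2πξ`; the Jacobian of this
  -- substitution is the factor `1/2π`.
  have hF : FourierTransform.fourier G = fun ξ : ℝ => f (-(2 * Real.pi) * ξ) := by
    ext ξ
    rw [Real.fourier_real_eq_integral_exp_smul, ← h]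
    congr 1; ext v
    rw [smul_eq_mul, cis]
    congr 2; push_cast; ring
  have hpi : (-(2 * Real.pi)) ≠ 0 := by simp [Real.pi_ne_zero]
  have hFi : Integrable (FourierTransform.fourier G) := by
    rw [hF]
    exact hf.comp_mul_left' hpi
  have h1 := hGi.fourierInv_fourier_eq hFi hG.continuousAt (v := t)
  rw [← h1, hF, Real.fourierInv_eq']
  have h2 := Measure.integral_comp_mul_left (fun ω => cis (-(ω * t)) * f ω) (-(2 * Real.pi))
  have h3 : ∀ v : ℝ, Complex.exp (((2 * Real.pi * inner ℝ v t : ℝ) : ℂ) * Complex.I) •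
      f (-(2 * Real.pi) * v) = cis (-(-(2 * Real.pi) * v * t)) * f (-(2 * Real.pi) * v) := by
    intro v
    rw [smul_eq_mul, cis]
    congr 2
    simp only [RCLike.inner_apply, conj_trivial]
    push_cast; ring
  simp_rw [h3]
  rw [h2]
  have : |(-(2 * Real.pi))⁻¹| = 1 / (2 * Real.pi) := by
    rw [abs_inv, abs_neg, abs_of_pos (by positivity), one_div]
  rw [this, Complex.real_smul]

end Characters

/-! ### Oscillatory integrals -/

section OscillatoryIntegrals

/-- One admissible cutoff already determines the limit, so the value picked by `oscIntegral` is any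
value that has been proved. -/
lemma HasOscIntegral.unique {f : ℝ → ℂ} {I J : ℂ} (h : HasOscIntegral f I)
    (h' : HasOscIntegral f J) : I = J := by
  let κ : ContDiffBump (0 : ℝ) := ⟨1, 2, by norm_num, by norm_num⟩
  have h0 : κ 0 = 1 := κ.one_of_mem_closedBall (by simp [κ])
  exact tendsto_nhds_unique (h κ κ.contDiff κ.hasCompactSupport h0)
    (h' κ κ.contDiff κ.hasCompactSupport h0)

lemma HasOscIntegral.oscIntegral_eq {f : ℝ → ℂ} {I : ℂ} (h : HasOscIntegral f I) :
    oscIntegral f = I := by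
  have hf : OscConvergent f := ⟨I, h⟩
  rw [oscIntegral, dif_pos hf]
  exact hf.choose_spec.unique h

/-- The oscillatory integral of an integrable function is its integral. -/
lemma hasOscIntegral_integral {f : ℝ → ℂ} (hf : Integrable f) : HasOscIntegral f (∫ ω, f ω) := by
  intro χ hχ hc h0
  obtain ⟨C, hC⟩ := hχ.continuous.bounded_above_of_compact_support hc
  refine tendsto_integral_filter_of_dominated_convergence (fun ω => C * ‖f ω‖)
    (Eventually.of_forall fun ε => ?_) (Eventually.of_forall fun ε => ae_of_all _ fun ω => ?_)
    (hf.norm.const_mul C) (ae_of_all _ fun ω => ?_)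
  · refine AEStronglyMeasurable.mul ?_ hf.aestronglyMeasurable
    exact (Complex.continuous_ofReal.comp (hχ.continuous.comp
      (continuous_const.mul continuous_id))).aestronglyMeasurable
  · rw [norm_mul, Complex.norm_real]
    exact mul_le_mul_of_nonneg_right (hC _) (norm_nonneg _)
  · have hct : Continuous fun ε : ℝ => (χ (ε * ω) : ℂ) * f ω :=
      (Complex.continuous_ofReal.comp (hχ.continuous.comp
        (continuous_id.mul continuous_const))).mul continuous_const
    have := (hct.tendsto 0).mono_left (nhdsWithin_le_nhds (s := Ioi 0))
    simpa [h0] using this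

end OscillatoryIntegrals

/-! ### The forward operator -/

section Forward

variable {α h c₀ : ℝ} {Q U : Set (ℝ × ℝ)} {A : ℝ × ℝ × Plane → ℝ → ℂ} {V : Plane → ℂ}

lemma exists_derivBound {E : Type*} [NormedAddCommGroup E] [NormedSpace ℝ E] {V : E → ℂ}
    (hV : ContDiff ℝ (⊤ : ℕ∞) V) (hVc : HasCompactSupport V) (n : ℕ) : ∃ M, DerivBound n V M := by
  have h1 : ∀ j : ℕ, ∃ C, ∀ y, ‖iteratedFDeriv ℝ j V y‖ ≤ C := fun j =>
    (hV.continuous_iteratedFDeriv (by exact_mod_cast le_top)).bounded_above_of_compact_support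
      (hVc.iteratedFDeriv j)
  choose C hC using h1
  refine ⟨∑ j ∈ Finset.range (n + 1), C j, fun j hj y => (hC j y).trans ?_⟩
  exact Finset.single_le_sum (f := C) (fun i _ => (norm_nonneg _).trans (hC i y))
    (Finset.mem_range.2 (by omega))

lemma AmpFam.reindex {ι κ : Type} {A : ι → ℝ × ℝ × Plane → ℝ → ℂ} (hA : AmpFam Q A) (f : κ → ι) :
    AmpFam Q fun i => A (f i) :=
  ⟨hA.symFam.reindex f, hA.isCompact, fun i => hA.eq_zero (f i)⟩

/-- Amplitudes that are supported over `Q` and vanish over the neighbourhood `U` of the data from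
the points directly underneath. -/
structure DataAmp (α h c₀ : ℝ) (Q U : Set (ℝ × ℝ)) (A : ℝ × ℝ × Plane → ℝ → ℂ) : Prop where
  ampFam : AmpFam Q (fun _ : Unit => A)
  isOpen : IsOpen U
  below : ∀ s ∈ Prod.fst '' Q, (s, 2 * √(α ^ 2 + h ^ 2) / c₀) ∈ U
  vanish : ∀ s t x ω, (s, t) ∈ U → A (s, t, x) ω = 0

lemma IsAmplitude.exists_dataAmp {s₀ s₁ t₀ t₁ : ℝ} (hA : IsAmplitude α h c₀ s₀ s₁ t₀ t₁ A) :
    ∃ Q U : Set (ℝ × ℝ), Q ⊆ Ioo s₀ s₁ ×ˢ Ioo t₀ t₁ ∧ DataAmp α h c₀ Q U A := by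
  obtain ⟨Q, hQ, hQY, hQA⟩ := hA.compact_support
  obtain ⟨U, hU, hUb, hUA⟩ := hA.vanish_below
  refine ⟨Q, U, hQY, hA.ampFam hQ hQY hQA, hU, ?_, hUA⟩
  rintro _ ⟨p, hp, rfl⟩
  exact hUb _ (hQY hp).1

lemma DataAmp.cutoff (hA : DataAmp α h c₀ Q U A) {κ : ℝ × ℝ → ℝ} (hκ : ContDiff ℝ (⊤ : ℕ∞) κ) :
    DataAmp α h c₀ Q U fun p ω => (κ (p.1, p.2.1) : ℂ) * A p ω :=
  ⟨hA.ampFam.cutoff hκ, hA.isOpen, hA.below, fun s t x ω hst => by simp [hA.vanish s t x ω hst]⟩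

lemma DataAmp.norm_fourierData_le (hh : 0 < h) (hc₀ : 0 < c₀) (hA : DataAmp α h c₀ Q U A)
    {L : Set Plane} (hL : IsCompact L) (N : ℕ) : ∃ C : ℝ, 0 ≤ C ∧ ∀ V : Plane → ℂ,
      ContDiff ℝ (⊤ : ℕ∞) V → tsupport V ⊆ L → ∀ M, DerivBound (N + 2) V M → ∀ s ω : ℝ,
      ‖fourierData α h c₀ (redB α h c₀ A) V s ω‖ ≤ C * M * (1 + |ω|) ^ (-(N : ℝ)) := by
  obtain ⟨C, hC0, hC⟩ := BistaticSAR.norm_fourierData_le hh hc₀ hA.ampFam hA.isOpen hA.below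
    (fun _ => hA.vanish) hL N
  exact ⟨C, hC0, fun V => hC () V⟩

lemma contDiff_forward_kernel (hh : 0 < h) (hA : AmpFam Q (fun _ : Unit => A))
    (hV : ContDiff ℝ (⊤ : ℕ∞) V) (s : ℝ) : ContDiff ℝ (⊤ : ℕ∞) fun z : ℝ × (ℝ × Plane) =>
      cis (-(z.2.1 * (z.1 - bistaticDist α h s z.2.2 / c₀))) * A (s, z.1, z.2.2) z.2.1 *
        V z.2.2 := by
  have h1 : ContDiff ℝ (⊤ : ℕ∞) fun z : ℝ × (ℝ × Plane) => bistaticDist α h s z.2.2 :=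
    contDiff_bistaticDist_comp hh α contDiff_const (contDiff_snd.comp contDiff_snd)
  have h2 : ContDiff ℝ (⊤ : ℕ∞) fun z : ℝ × (ℝ × Plane) => A (s, z.1, z.2.2) z.2.1 :=
    (hA.symFam.smooth ()).comp (f := fun z : ℝ × (ℝ × Plane) => ((s, z.1, z.2.2), z.2.1))
      (by fun_prop)
  have h3 : ContDiff ℝ (⊤ : ℕ∞) fun z : ℝ × (ℝ × Plane) => V z.2.2 :=
    hV.comp (contDiff_snd.comp contDiff_snd)
  have h4 : ContDiff ℝ (⊤ : ℕ∞) fun z : ℝ × (ℝ × Plane) =>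
      -(z.2.1 * (z.1 - bistaticDist α h s z.2.2 / c₀)) :=
    ((contDiff_fst.comp contDiff_snd).mul (contDiff_fst.sub (h1.div_const c₀))).neg
  exact ((contDiff_cis.comp h4).mul h2).mul h3

lemma forwardIntegrand_eq (s t ω : ℝ) : forwardIntegrand α h c₀ A V s t ω =
    ∫ x, cis (-(ω * (t - bistaticDist α h s x / c₀))) * A (s, t, x) ω * V x := by
  simp_rw [cis_neg]; rfl

/-- The data for an amplitude with bounded frequencies, and their Fourier transform. -/
lemma integral_forwardIntegrand_of_bounded (hh : 0 < h) (hA : AmpFam Q (fun _ : Unit => A))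
    (hV : ContDiff ℝ (⊤ : ℕ∞) V) (hVc : HasCompactSupport V) {R : ℝ}
    (hR : ∀ p ω, R < |ω| → A p ω = 0) (s : ℝ) :
    Continuous (fun t => ∫ ω, forwardIntegrand α h c₀ A V s t ω) ∧
    Integrable (fun t => ∫ ω, forwardIntegrand α h c₀ A V s t ω) ∧
    ∀ ω, ∫ t, cis (ω * t) * ∫ u, forwardIntegrand α h c₀ A V s t u =
      fourierData α h c₀ (redB α h c₀ A) V s ω := by
  obtain ⟨T, hT⟩ := (hA.isCompact.image continuous_snd).isBounded.exists_norm_le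
  have hT' : ∀ t x ω, T < |t| → A (s, t, x) ω = 0 := fun t x ω ht => hA.eq_zero () _ _ _ _
    fun hmem => (not_lt.2 (hT _ ⟨_, hmem, rfl⟩)) ht
  let F : ℝ → ℝ × Plane → ℂ := fun t q =>
    cis (-(q.1 * (t - bistaticDist α h s q.2 / c₀))) * A (s, t, q.2) q.1 * V q.2
  have hFs : ContDiff ℝ (⊤ : ℕ∞) fun z : ℝ × (ℝ × Plane) => F z.1 z.2 :=
    contDiff_forward_kernel hh hA hV s
  let K : Set (ℝ × Plane) := Icc (-R) R ×ˢ tsupport V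
  have hK : IsCompact K := isCompact_Icc.prod hVc
  have hFK : ∀ t, ∀ q ∉ K, F t q = 0 := by
    intro t q hq
    by_cases hq1 : q.1 ∈ Icc (-R) R
    · have : V q.2 = 0 := image_eq_zero_of_notMem_tsupport fun h2 => hq ⟨hq1, h2⟩
      simp [F, this]
    · have : A (s, t, q.2) q.1 = 0 := hR _ _ (by
        by_contra hlt; exact hq1 (abs_le.1 (not_lt.1 hlt)))
      simp [F, this]
  have hFT : ∀ t q, T < |t| → F t q = 0 := fun t q ht => by simp [F, hT' t q.2 q.1 ht]
  have hFi : ∀ t, Integrable (F t) (volume.prod volume) := fun t =>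
    (hFs.continuous.comp (Continuous.prodMk_right t)).integrable_of_hasCompactSupport
      (HasCompactSupport.intro hK fun q hq => hFK t q hq)
  have hG : (fun t => ∫ ω, forwardIntegrand α h c₀ A V s t ω) = fun t => ∫ q, F t q := by
    ext t
    rw [show (∫ q, F t q) = ∫ q, F t q ∂(volume.prod volume) from rfl, integral_prod _ (hFi t)]
    simp_rw [forwardIntegrand_eq]
    rfl
  have hGs : ContDiff ℝ (⊤ : ℕ∞) fun t => ∫ q, F t q :=
    contDiff_integral_of_locally_compact_support hFs fun t₀ =>
      ⟨K, hK, Eventually.of_forall fun t q hq => hFK t q hq⟩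
  have hGT : ∀ t, T < |t| → ∫ q, F t q = 0 := fun t ht => by simp [hFT t _ ht]
  refine ⟨hG ▸ hGs.continuous, hG ▸ integrable_of_eq_zero hGs.continuous hGT, fun ω => ?_⟩
  have e1 : ∀ t, (∫ u, forwardIntegrand α h c₀ A V s t u) = ∫ q, F t q := fun t => congrFun hG t
  simp_rw [e1, ← integral_const_mul]
  have hc : Continuous (Function.uncurry fun t q => cis (ω * t) * F t q) :=
    (continuous_cis.comp (continuous_const.mul continuous_fst)).mul hFs.continuous
  have hcs : HasCompactSupport (Function.uncurry fun t q => cis (ω * t) * F t q) :=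
    HasCompactSupport.intro ((isCompact_Icc (a := -T) (b := T)).prod hK) fun z hz => by
      by_cases hz1 : z.1 ∈ Icc (-T) T
      · simp [Function.uncurry, hFK z.1 z.2 fun h2 => hz ⟨hz1, h2⟩]
      · simp [Function.uncurry, hFT z.1 z.2 (by
          by_contra hlt; exact hz1 (abs_le.1 (not_lt.1 hlt)))]
  have hci : Integrable (Function.uncurry fun t q => cis (ω * t) * F t q)
      (volume.prod (volume.prod volume)) := hc.integrable_of_hasCompactSupport hcs
  refine (integral_integral_swap hci).trans ((integral_prod_symm _ hci.integral_prod_right).trans ?_)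
  unfold fourierData
  congr 1; ext x
  -- Substituting `t = r + R/c₀` splits off `e^{iωR/c₀}` and leaves the transform of the amplitude
  -- in `r` at `u - ω`. With `u = ω + σ`, the integral over `u` is the reduced amplitude at `ω`.
  have e2 : ∀ u : ℝ, (∫ t, cis (ω * t) * F t (u, x)) =
      cis (ω * (bistaticDist α h s x / c₀)) * V x *
        tHat (shiftAmp α h c₀ A) (s, x) (u - ω) u := by
    intro u
    rw [← integral_add_right_eq_self _ (bistaticDist α h s x / c₀), tHat, ← integral_const_mul]
    congr 1; ext r
    simp only [F, shiftAmp, negChar_eq_cis, add_sub_cancel_right]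
    have : cis (ω * (r + bistaticDist α h s x / c₀)) * cis (-(u * r)) =
        cis (ω * (bistaticDist α h s x / c₀)) * cis (-((u - ω) * r)) := by
      rw [← cis_add, ← cis_add]; congr 1; ring
    linear_combination A (s, r + bistaticDist α h s x / c₀, x) u * V x * this
  refine (integral_congr_ae (ae_of_all _ e2)).trans ?_
  rw [integral_const_mul, ← integral_add_left_eq_self _ ω]
  simp only [add_sub_cancel_left]
  rw [show (∫ σ, tHat (shiftAmp α h c₀ A) (s, x) σ (ω + σ)) = redB α h c₀ A ((s, x), ω) from rfl,
    cis]
  ring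

/-- `χ(εω)` does not depend on `r` and so factors out of `tHat`. Dominated convergence applies
because `tHat` is integrable along the line of integration. -/
lemma redB_freqCutoff_tendsto (hh : 0 < h) (hA : AmpFam Q (fun _ : Unit => A)) {χ : ℝ → ℝ}
    (hχ : Continuous χ) (hc : HasCompactSupport χ) (h0 : χ 0 = 1) (w : (ℝ × Plane) × ℝ) :
    Tendsto (fun ε : ℝ => redB α h c₀ (fun p ω => (χ (ε * ω) : ℂ) * A p ω) w) (𝓝[>] 0)
      (𝓝 (redB α h c₀ A w)) := by
  obtain ⟨C, hC⟩ := hχ.bounded_above_of_compact_support hc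
  have hi := integrable_tHat (hA.shiftAmp (c₀ := c₀) (α := α) hh) (hA.rSupp hh) () w.1 w.2
  have e : ∀ ε σ ω : ℝ, tHat (shiftAmp α h c₀ (fun p ω => (χ (ε * ω) : ℂ) * A p ω)) w.1 σ ω =
      (χ (ε * ω) : ℂ) * tHat (shiftAmp α h c₀ A) w.1 σ ω := by
    intro ε σ ω
    rw [tHat, tHat, ← integral_const_mul]
    congr 1; ext r
    simp only [shiftAmp]; ring
  simp only [redB, redAmp, e]
  refine tendsto_integral_filter_of_dominated_convergence
    (fun σ => C * ‖tHat (shiftAmp α h c₀ A) w.1 σ (w.2 + σ)‖)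
    (Eventually.of_forall fun ε => ?_) (Eventually.of_forall fun ε => ae_of_all _ fun σ => ?_)
    (hi.norm.const_mul C) (ae_of_all _ fun σ => ?_)
  · refine AEStronglyMeasurable.mul ?_ hi.aestronglyMeasurable
    exact (Complex.continuous_ofReal.comp (hχ.comp
      (continuous_const.mul (continuous_const.add continuous_id)))).aestronglyMeasurable
  · rw [norm_mul, Complex.norm_real]
    exact mul_le_mul_of_nonneg_right (hC _) (norm_nonneg _)
  · have hct : Continuous fun ε : ℝ => (χ (ε * (w.2 + σ)) : ℂ) *
        tHat (shiftAmp α h c₀ A) w.1 σ (w.2 + σ) :=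
      (Complex.continuous_ofReal.comp (hχ.comp
        (continuous_id.mul continuous_const))).mul continuous_const
    have := (hct.tendsto 0).mono_left (nhdsWithin_le_nhds (s := Ioi 0))
    simpa [h0] using this

lemma one_add_abs_rpow_neg_two_integrable : Integrable fun ω : ℝ => (1 + |ω|) ^ (-((2 : ℕ) : ℝ)) :=
  integrable_one_add_abs_rpow (by norm_num)

/-- The data are the inverse Fourier transform of `fourierData`. -/
theorem hasOscIntegral_forwardIntegrand (hh : 0 < h) (hc₀ : 0 < c₀) (hA : DataAmp α h c₀ Q U A)
    (hV : ContDiff ℝ (⊤ : ℕ∞) V) (hVc : HasCompactSupport V) (s t : ℝ) :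
    HasOscIntegral (forwardIntegrand α h c₀ A V s t) ((1 / (2 * Real.pi) : ℝ) *
      ∫ ω, cis (-(ω * t)) * fourierData α h c₀ (redB α h c₀ A) V s ω) := by
  intro χ hχ hc h0
  obtain ⟨M, hM⟩ := exists_derivBound hV hVc (2 + 2)
  have hfam : AmpFam Q fun (ε : Icc (0 : ℝ) 1) p ω => (χ (ε * ω) : ℂ) * A p ω :=
    AmpFam.freqCutoff (hA.ampFam.reindex fun _ => ()) hχ hc
  obtain ⟨C, hC0, hC⟩ := BistaticSAR.norm_fourierData_le hh hc₀ hfam hA.isOpen hA.below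
    (fun i s t x ω hst => by simp [hA.vanish s t x ω hst]) hVc.isCompact 2
  have hB := hfam.redB (α := α) (c₀ := c₀) hh
  obtain ⟨D, hD0, hD⟩ := hB.norm_le ((isCompact_singleton (x := s)).prod hVc.isCompact)
  obtain ⟨R, hR⟩ := hc.isCompact.isBounded.exists_norm_le
  have hev : ∀ᶠ ε : ℝ in 𝓝[>] 0, ε ∈ Ioc (0 : ℝ) 1 := Ioc_mem_nhdsGT zero_lt_one
  -- For fixed `ε > 0` the frequencies are bounded, the data are continuous with compact support in
  -- `t`, and classical Fourier inversion applies.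
  have heq : ∀ ε ∈ Ioc (0 : ℝ) 1, ∫ ω, (χ (ε * ω) : ℂ) * forwardIntegrand α h c₀ A V s t ω =
      (1 / (2 * Real.pi) : ℝ) * ∫ ω, cis (-(ω * t)) *
        fourierData α h c₀ (redB α h c₀ (fun p ω => (χ (ε * ω) : ℂ) * A p ω)) V s ω := by
    intro ε hε
    have hAε : AmpFam Q (fun _ : Unit => fun p ω => (χ (ε * ω) : ℂ) * A p ω) :=
      hfam.reindex fun _ => ⟨ε, hε.1.le, hε.2⟩
    obtain ⟨g1, g2, g3⟩ := integral_forwardIntegrand_of_bounded (α := α) (c₀ := c₀) hh hAε hV hVc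
      (R := R / ε) (fun p ω hω => by
        have : χ (ε * ω) = 0 := by
          refine image_eq_zero_of_notMem_tsupport fun hmem => ?_
          have := hR _ hmem
          rw [Real.norm_eq_abs, abs_mul, abs_of_pos hε.1, mul_comm, ← le_div_iff₀ hε.1] at this
          linarith
        simp [this]) s
    have hfi : Integrable fun ω => fourierData α h c₀
        (redB α h c₀ (fun p ω => (χ (ε * ω) : ℂ) * A p ω)) V s ω := by
      refine Integrable.mono' (one_add_abs_rpow_neg_two_integrable.const_mul (C * M)) ?_
        (ae_of_all _ fun ω => hC ⟨ε, hε.1.le, hε.2⟩ V hV subset_rfl M hM s ω)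
      exact ((continuous_fourierData hh (hB.smooth ⟨ε, hε.1.le, hε.2⟩).continuous hV.continuous
        hVc).comp (Continuous.prodMk_right s)).aestronglyMeasurable
    rw [← eq_integral_cis_of_fourier g1 g2 hfi g3 t]
    congr 1; ext ω
    rw [forwardIntegrand, forwardIntegrand, ← integral_const_mul]
    congr 1; ext x
    ring
  refine Tendsto.congr' (hev.mono fun ε hε => (heq ε hε).symm) (Tendsto.const_mul _ ?_)
  -- The dominating function is independent of `ε` because `C` serves the whole family of cut-off
  -- amplitudes.
  refine tendsto_integral_filter_of_dominated_convergence
    (fun ω => C * M * (1 + |ω|) ^ (-((2 : ℕ) : ℝ)))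
    (hev.mono fun ε hε => ?_) (hev.mono fun ε hε => ae_of_all _ fun ω => ?_)
    (one_add_abs_rpow_neg_two_integrable.const_mul _) (ae_of_all _ fun ω => ?_)
  · refine ((continuous_cis.comp (by fun_prop)).mul ?_).aestronglyMeasurable
    exact (continuous_fourierData hh (hB.smooth ⟨ε, hε.1.le, hε.2⟩).continuous hV.continuous
        hVc).comp (Continuous.prodMk_right s)
  · rw [norm_cis_mul]
    exact hC ⟨ε, hε.1.le, hε.2⟩ V hV subset_rfl M hM s ω
  · refine Tendsto.const_mul _ ?_
    unfold fourierData
    have hRc := (contDiff_bistaticDist_right hh α s).continuous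
    refine tendsto_integral_filter_of_dominated_convergence
      (fun y => D * (1 + |ω|) ^ (2 : ℝ) * ‖V y‖)
      (hev.mono fun ε hε => ?_) (hev.mono fun ε hε => ae_of_all _ fun y => ?_)
      ((hV.continuous.integrable_of_hasCompactSupport hVc).norm.const_mul _)
      (ae_of_all _ fun y => ?_)
    · exact (integrable_fourierData_integrand hh (hB.smooth ⟨ε, hε.1.le, hε.2⟩).continuous
        hV.continuous hVc s ω).aestronglyMeasurable
    · rw [norm_mul, norm_cexp_I_mul, one_mul, norm_mul]
      by_cases hy : y ∈ tsupport V
      · exact mul_le_mul_of_nonneg_right (hD ⟨ε, hε.1.le, hε.2⟩ (s, y) ⟨rfl, hy⟩ ω) (norm_nonneg _)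
      · simp [image_eq_zero_of_notMem_tsupport hy]
    · exact Tendsto.const_mul _ ((redB_freqCutoff_tendsto hh hA.ampFam hχ.continuous hc h0
        ((s, y), ω)).mul_const _)

lemma forward_eq (hh : 0 < h) (hc₀ : 0 < c₀) (hA : DataAmp α h c₀ Q U A)
    (hV : ContDiff ℝ (⊤ : ℕ∞) V) (hVc : HasCompactSupport V) (s t : ℝ) :
    forward α h c₀ A V s t = (1 / (2 * Real.pi) : ℝ) *
      ∫ ω, cis (-(ω * t)) * fourierData α h c₀ (redB α h c₀ A) V s ω :=
  (hasOscIntegral_forwardIntegrand hh hc₀ hA hV hVc s t).oscIntegral_eq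

lemma DataAmp.redB (hh : 0 < h) (hA : DataAmp α h c₀ Q U A) :
    SymFam (fun _ : Unit => redB α h c₀ A) 2 := hA.ampFam.redB hh

lemma DataAmp.continuous_redB (hh : 0 < h) (hA : DataAmp α h c₀ Q U A) :
    Continuous (BistaticSAR.redB α h c₀ A) := ((hA.redB hh).smooth ()).continuous

lemma continuous_forward (hh : 0 < h) (hc₀ : 0 < c₀) (hA : DataAmp α h c₀ Q U A)
    (hV : ContDiff ℝ (⊤ : ℕ∞) V) (hVc : HasCompactSupport V) :
    Continuous fun p : ℝ × ℝ => forward α h c₀ A V p.1 p.2 := by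
  simp_rw [forward_eq hh hc₀ hA hV hVc]
  obtain ⟨M, hM⟩ := exists_derivBound hV hVc (2 + 2)
  obtain ⟨C, hC0, hC⟩ := hA.norm_fourierData_le hh hc₀ hVc.isCompact 2
  have hf := continuous_fourierData (α := α) (c₀ := c₀) hh (hA.continuous_redB hh) hV.continuous hVc
  refine continuous_const.mul (continuous_of_dominated
    (bound := fun ω => C * M * (1 + |ω|) ^ (-((2 : ℕ) : ℝ))) (fun p => ?_)
    (fun p => ae_of_all _ fun ω => ?_) (one_add_abs_rpow_neg_two_integrable.const_mul _)
    (ae_of_all _ fun ω => ?_))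
  · exact ((continuous_cis.comp (by fun_prop)).mul
      (hf.comp (Continuous.prodMk_right p.1))).aestronglyMeasurable
  · rw [norm_cis_mul]
    exact hC V hV subset_rfl M hM p.1 ω
  · exact (continuous_cis.comp (by fun_prop)).mul
      (hf.comp (f := fun p : ℝ × ℝ => (p.1, ω)) (by fun_prop))

/-- Cutoffs in the data space commute with the forward operator. -/
lemma forward_cutoff (hh : 0 < h) (hc₀ : 0 < c₀) (hA : DataAmp α h c₀ Q U A)
    (hV : ContDiff ℝ (⊤ : ℕ∞) V) (hVc : HasCompactSupport V) (κ : ℝ × ℝ → ℝ) (s t : ℝ) :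
    forward α h c₀ (fun p ω => (κ (p.1, p.2.1) : ℂ) * A p ω) V s t =
      (κ (s, t) : ℂ) * forward α h c₀ A V s t := by
  have h1 := hasOscIntegral_forwardIntegrand hh hc₀ hA hV hVc s t
  have e : ∀ ω, forwardIntegrand α h c₀ (fun p ω => (κ (p.1, p.2.1) : ℂ) * A p ω) V s t ω =
      (κ (s, t) : ℂ) * forwardIntegrand α h c₀ A V s t ω := by
    intro ω
    rw [forwardIntegrand, forwardIntegrand, ← integral_const_mul]
    congr 1; ext x; ring
  have h2 : HasOscIntegral
      (forwardIntegrand α h c₀ (fun p ω => (κ (p.1, p.2.1) : ℂ) * A p ω) V s t)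
      ((κ (s, t) : ℂ) * forward α h c₀ A V s t) := by
    intro χ hχ hc h0
    have := (h1 χ hχ hc h0).const_mul (κ (s, t) : ℂ)
    rw [forward, h1.oscIntegral_eq]
    refine this.congr fun ε => ?_
    rw [← integral_const_mul]
    congr 1; ext ω
    rw [e]; ring
  exact h2.oscIntegral_eq

end Forward

end BistaticSAR

namespace BistaticSAR

/-! ### Integrals over strips -/

section Strips

/-- A weight on the strip `S × ℝ`. -/
noncomputable def strip (S : Set ℝ) (p : ℝ × ℝ) : ℝ :=
  S.indicator (fun _ => (1 : ℝ)) p.1 * (1 + |p.2|) ^ (-((2 : ℕ) : ℝ))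

lemma strip_nonneg (S : Set ℝ) (p : ℝ × ℝ) : 0 ≤ strip S p :=
  mul_nonneg (indicator_nonneg (fun _ _ => zero_le_one) _) (by positivity)

lemma integrable_strip {S : Set ℝ} (hS : IsCompact S) : Integrable (strip S) := by
  have h1 : Integrable (S.indicator fun _ => (1 : ℝ)) :=
    (integrable_indicator_iff hS.measurableSet).2 (integrableOn_const hS.measure_lt_top.ne)
  exact h1.mul_prod one_add_abs_rpow_neg_two_integrable

lemma norm_le_mul_strip {S : Set ℝ} {z : ℂ} {p : ℝ × ℝ} {C : ℝ} (h0 : p.1 ∉ S → z = 0)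
    (hC : p.1 ∈ S → ‖z‖ ≤ C * (1 + |p.2|) ^ (-((2 : ℕ) : ℝ))) : ‖z‖ ≤ C * strip S p := by
  by_cases hp : p.1 ∈ S
  · simpa [strip, hp] using hC hp
  · simp [h0 hp, strip, hp]

lemma integrable_of_le_strip {S : Set ℝ} (hS : IsCompact S) {F : ℝ × ℝ → ℂ} (hF : Continuous F)
    {C : ℝ} (h0 : ∀ p, p.1 ∉ S → F p = 0)
    (hC : ∀ p, p.1 ∈ S → ‖F p‖ ≤ C * (1 + |p.2|) ^ (-((2 : ℕ) : ℝ))) : Integrable F :=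
  ((integrable_strip hS).const_mul C).mono' hF.aestronglyMeasurable
    (ae_of_all _ fun p => norm_le_mul_strip (h0 p) (hC p))

lemma norm_integral_le_of_le_strip {S : Set ℝ} (hS : IsCompact S) {F : ℝ × ℝ → ℂ}
    {C : ℝ} (h0 : ∀ p, p.1 ∉ S → F p = 0)
    (hC : ∀ p, p.1 ∈ S → ‖F p‖ ≤ C * (1 + |p.2|) ^ (-((2 : ℕ) : ℝ))) :
    ‖∫ p, F p‖ ≤ C * ∫ p, strip S p := by
  rw [← integral_const_mul]
  exact norm_integral_le_of_norm_le ((integrable_strip hS).const_mul C)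
    (ae_of_all _ fun p => norm_le_mul_strip (h0 p) (hC p))

/-- Integrability of functions bounded by a sheared product. -/
lemma integrable_of_le_shear {G : (ℝ × ℝ) × ℝ → ℂ} (hG : Continuous G) {g : ℝ × ℝ → ℝ} {k : ℝ → ℝ}
    (hg : Integrable g) (hk : Integrable k) (h : ∀ p ω, ‖G (p, ω)‖ ≤ g p * k (ω - p.2)) :
    Integrable G (volume.prod volume) := by
  have hk' : ∀ p : ℝ × ℝ, Integrable fun ω => g p * k (ω - p.2) := fun p =>
    (hk.comp_sub_right p.2).const_mul _
  have hGp : ∀ p : ℝ × ℝ, Integrable fun ω => G (p, ω) := fun p =>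
    (hk' p).mono' (hG.comp (Continuous.prodMk_right p)).aestronglyMeasurable (ae_of_all _ (h p))
  refine (integrable_prod_iff hG.aestronglyMeasurable).2 ⟨ae_of_all _ hGp, ?_⟩
  refine Integrable.mono' (hg.mul_const (∫ ω, k ω))
    hG.norm.aestronglyMeasurable.integral_prod_right' (ae_of_all _ fun p => ?_)
  rw [Real.norm_of_nonneg (integral_nonneg fun _ => norm_nonneg _)]
  refine (integral_mono (hGp p).norm (hk' p) (h p)).trans (le_of_eq ?_)
  rw [integral_const_mul, integral_sub_right_eq_self k]

end Strips

/-! ### The normal operator -/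

section Normal

variable {α h c₀ : ℝ} {Q U : Set (ℝ × ℝ)} {A A' : ℝ × ℝ × Plane → ℝ → ℂ} {V : Plane → ℂ}

lemma continuous_tHat {ι P : Type*} [NormedAddCommGroup P] [NormedSpace ℝ P]
    [LocallyCompactSpace P] {a : ι → (P × ℝ) × ℝ → ℂ} {m : ℝ} (h : SymFam a m) (hr : RSupp a)
    (i : ι) : Continuous fun w : P × ℝ × ℝ => tHat (a i) w.1 w.2.1 w.2.2 := by
  have hsm : ContDiff ℝ (⊤ : ℕ∞) fun z : (P × ℝ × ℝ) × ℝ =>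
      negChar z.1.2.1 z.2 * a i ((z.1.1, z.2), z.1.2.2) :=
    (contDiff_negChar.comp (f := fun z : (P × ℝ × ℝ) × ℝ => (z.1.2.1, z.2)) (by fun_prop)).mul
      ((h.smooth i).comp (f := fun z : (P × ℝ × ℝ) × ℝ => ((z.1.1, z.2), z.1.2.2)) (by fun_prop))
  refine (contDiff_integral_of_locally_compact_support (μ := volume) hsm fun x₀ => ?_).continuous
  obtain ⟨K, hK, hKx⟩ := exists_compact_mem_nhds x₀.1
  obtain ⟨ρ, hρ⟩ := hr K hK
  refine ⟨Icc (-ρ) ρ, isCompact_Icc, ?_⟩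
  filter_upwards [continuous_fst.continuousAt.eventually hKx] with x hx r hr'
  rw [hρ i x.1 hx r _ (by by_contra hlt; exact hr' (abs_le.1 (not_lt.1 hlt))), mul_zero]

lemma DataAmp.compact_S (hA : DataAmp α h c₀ Q U A) : IsCompact (Prod.fst '' Q) :=
  hA.ampFam.isCompact.image continuous_fst

lemma DataAmp.redB_eq_zero (hA : DataAmp α h c₀ Q U A) {s : ℝ} (hs : s ∉ Prod.fst '' Q) (x : Plane)
    (ω : ℝ) : BistaticSAR.redB α h c₀ A ((s, x), ω) = 0 := hA.ampFam.redB_eq_zero () hs x ω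

lemma DataAmp.fourierData_eq_zero (hA : DataAmp α h c₀ Q U A) {s : ℝ} (hs : s ∉ Prod.fst '' Q)
    (V : Plane → ℂ) (ω : ℝ) : fourierData α h c₀ (BistaticSAR.redB α h c₀ A) V s ω = 0 := by
  simp [fourierData, hA.redB_eq_zero hs]

lemma DataAmp.continuous_fourierData (hh : 0 < h) (hA : DataAmp α h c₀ Q U A)
    (hV : ContDiff ℝ (⊤ : ℕ∞) V) (hVc : HasCompactSupport V) :
    Continuous fun p : ℝ × ℝ => fourierData α h c₀ (BistaticSAR.redB α h c₀ A) V p.1 p.2 :=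
  BistaticSAR.continuous_fourierData hh (hA.continuous_redB hh) hV.continuous hVc

lemma DataAmp.exists_fourierData_bound (hh : 0 < h) (hc₀ : 0 < c₀) (hA : DataAmp α h c₀ Q U A)
    (hV : ContDiff ℝ (⊤ : ℕ∞) V) (hVc : HasCompactSupport V) (N : ℕ) : ∃ C : ℝ, 0 ≤ C ∧
      ∀ s ω : ℝ, ‖fourierData α h c₀ (BistaticSAR.redB α h c₀ A) V s ω‖ ≤
        C * (1 + |ω|) ^ (-(N : ℝ)) := by
  obtain ⟨M, hM⟩ := exists_derivBound hV hVc (N + 2)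
  obtain ⟨C, hC0, hC⟩ := hA.norm_fourierData_le hh hc₀ hVc.isCompact N
  exact ⟨C * M, mul_nonneg hC0 hM.nonneg, hC V hV subset_rfl M hM⟩

/-- The time integral in the backprojection of data. -/
lemma integral_backproject_time (hh : 0 < h) (hc₀ : 0 < c₀) (hA' : DataAmp α h c₀ Q U A')
    (hA : DataAmp α h c₀ Q U A) (hV : ContDiff ℝ (⊤ : ℕ∞) V) (hVc : HasCompactSupport V)
    (x : Plane) (s ω : ℝ) :
    (∫ t : ℝ, cis (ω * (t - bistaticDist α h s x / c₀)) * conj (A' (s, t, x) ω) *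
      forward α h c₀ A V s t) = ∫ u : ℝ, (1 / (2 * Real.pi) : ℝ) *
        (cis (-(u * (bistaticDist α h s x / c₀))) *
          conj (tHat (shiftAmp α h c₀ A') (s, x) (ω - u) ω) *
          fourierData α h c₀ (redB α h c₀ A) V s u) := by
  set f : ℝ → ℂ := fun u => fourierData α h c₀ (redB α h c₀ A) V s u with hf
  obtain ⟨C, hC0, hC⟩ := hA.exists_fourierData_bound hh hc₀ hV hVc 2
  have hfc : Continuous f := (hA.continuous_fourierData hh hV hVc).comp
    (Continuous.prodMk_right s)
  have hfi : Integrable f := (one_add_abs_rpow_neg_two_integrable.const_mul C).mono'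
    hfc.aestronglyMeasurable (ae_of_all _ fun u => hC s u)
  obtain ⟨T, hT⟩ := (hA'.ampFam.isCompact.image continuous_snd).isBounded.exists_norm_le
  have hT' : ∀ t, T < |t| → A' (s, t, x) ω = 0 := fun t ht => hA'.ampFam.eq_zero () _ _ _ _
    fun hmem => (not_lt.2 (hT _ ⟨_, hmem, rfl⟩)) ht
  have hAc : Continuous fun t => A' (s, t, x) ω :=
    (hA'.ampFam.symFam.smooth ()).continuous.comp (f := fun t : ℝ => ((s, t, x), ω)) (by fun_prop)
  let g : ℝ → ℂ := fun t => cis (ω * (t - bistaticDist α h s x / c₀)) * conj (A' (s, t, x) ω)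
  have hgc : Continuous g := (continuous_cis.comp (by fun_prop)).mul
    (Complex.continuous_conj.comp hAc)
  have hgi : Integrable g := integrable_of_eq_zero hgc (ρ := T) fun t ht => by simp [g, hT' t ht]
  let k : ℂ := ((1 / (2 * Real.pi) : ℝ) : ℂ)
  -- The data are replaced by their inverse Fourier integral over `u`. The backprojecting amplitude
  -- has compact support in `t`, so the `t` and `u` integrals may be exchanged.
  have e1 : ∀ t, g t * forward α h c₀ A V s t = ∫ u, k * (cis (-(u * t)) * (g t * f u)) := by
    intro t
    rw [forward_eq hh hc₀ hA hV hVc, integral_const_mul, ← mul_assoc, mul_comm (g t), mul_assoc,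
      ← integral_const_mul]
    congr 2; ext u
    ring
  have hint : Integrable (Function.uncurry fun t u => k * (cis (-(u * t)) * (g t * f u)))
      (volume.prod volume) := by
    refine Integrable.const_mul ?_ k
    have h1 : Integrable (fun z : ℝ × ℝ => g z.1 * f z.2) (volume.prod volume) := hgi.mul_prod hfi
    refine h1.bdd_mul (c := 1) (f := fun z : ℝ × ℝ => cis (-(z.2 * z.1))) ?_
      (ae_of_all _ fun z => (norm_cis _).le)
    exact (continuous_cis.comp (by fun_prop)).aestronglyMeasurable
  have e2 : (∫ t, g t * forward α h c₀ A V s t) = ∫ u, ∫ t, k * (cis (-(u * t)) * (g t * f u)) := by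
    simp_rw [e1]
    exact integral_integral_swap hint
  refine e2.trans ?_
  congr 1; ext u
  rw [← integral_add_right_eq_self _ (bistaticDist α h s x / c₀), tHat, ← integral_conj,
    mul_assoc (cis _), ← integral_mul_const, ← integral_const_mul, ← integral_const_mul]
  congr 1; ext r
  simp only [g, shiftAmp, map_mul, negChar_eq_cis, conj_cis, add_sub_cancel_right, neg_neg]
  have : cis (-(u * (r + bistaticDist α h s x / c₀))) * cis (ω * r) =
      cis (-(u * (bistaticDist α h s x / c₀))) * cis ((ω - u) * r) := by
    rw [← cis_add, ← cis_add]; congr 1; ring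
  linear_combination k * conj (A' (s, r + bistaticDist α h s x / c₀, x) ω) * f u * this

/-- The integrand of `F* F V` as an absolutely convergent integral. -/
noncomputable def normalIntegrand (α h c₀ : ℝ) (A' A : ℝ × ℝ × Plane → ℝ → ℂ) (V : Plane → ℂ)
    (x : Plane) (p : ℝ × ℝ) : ℂ :=
  cis (-(p.2 * (bistaticDist α h p.1 x / c₀))) * conj (redB α h c₀ A' ((p.1, x), p.2)) *
    fourierData α h c₀ (redB α h c₀ A) V p.1 p.2

/-- With the data written as an inverse Fourier integral over `u`, the integrand in `(s, u, ω)`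
decreases in `u` because the transform of the data does, and in `ω - u` because `tHat` does. It is
absolutely integrable, so no regularization in `ω` is needed, and integrating over `ω` first
produces the reduced amplitude. -/
theorem hasOscIntegral_adjointIntegrand (hh : 0 < h) (hc₀ : 0 < c₀) (hA' : DataAmp α h c₀ Q U A')
    (hA : DataAmp α h c₀ Q U A) (hV : ContDiff ℝ (⊤ : ℕ∞) V) (hVc : HasCompactSupport V)
    (x : Plane) : HasOscIntegral (adjointIntegrand α h c₀ A' (forward α h c₀ A V) x)
      ((1 / (2 * Real.pi) : ℝ) * ∫ p, normalIntegrand α h c₀ A' A V x p) := by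
  set S := Prod.fst '' Q with hS
  have hSc : IsCompact S := hA.compact_S
  have hfam := hA'.ampFam.shiftAmp (c₀ := c₀) (α := α) hh
  have hrs := hA'.ampFam.rSupp (c₀ := c₀) (α := α) hh
  -- Exponent `4` both here and for the data: Peetre's inequality distributes the growth `(1 + |ω|)
  -- ^ 2` of the symbol over `u` and `ω - u`, and exponent `-2` remains in each.
  obtain ⟨C, hC0, hC⟩ := norm_tHat_le hfam hrs (hSc.prod (isCompact_singleton (x := x))) 4
  obtain ⟨D, hD0, hD⟩ := hA.exists_fourierData_bound hh hc₀ hV hVc 4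
  let k : ℂ := ((1 / (2 * Real.pi) : ℝ) : ℂ)
  let J : (ℝ × ℝ) × ℝ → ℂ := fun z => k *
    (cis (-(z.1.2 * (bistaticDist α h z.1.1 x / c₀))) *
      conj (tHat (shiftAmp α h c₀ A') (z.1.1, x) (z.2 - z.1.2) z.2) *
      fourierData α h c₀ (redB α h c₀ A) V z.1.1 z.1.2)
  have hJc : Continuous J := by
    have h1 : Continuous fun z : (ℝ × ℝ) × ℝ => bistaticDist α h z.1.1 x :=
      (contDiff_bistaticDist_comp hh α (contDiff_fst.comp contDiff_fst)
        contDiff_const).continuous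
    have h2 := (continuous_tHat hfam hrs ()).comp (f := fun z : (ℝ × ℝ) × ℝ =>
      ((z.1.1, x), z.2 - z.1.2, z.2)) (by fun_prop)
    have h3 := (hA.continuous_fourierData hh hV hVc).comp (f := fun z : (ℝ × ℝ) × ℝ => z.1)
      continuous_fst
    refine continuous_const.mul (((continuous_cis.comp ?_).mul
      (Complex.continuous_conj.comp h2)).mul h3)
    exact ((continuous_snd.comp continuous_fst).mul (h1.div_const c₀)).neg
  have hJ0 : ∀ p ω, p.1 ∉ S → J (p, ω) = 0 := fun p ω hp => by
    simp [J, hA.fourierData_eq_zero hp]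
  have hJb : ∀ p ω, p.1 ∈ S → ‖J (p, ω)‖ ≤ ‖k‖ * C * D * (1 + |p.2|) ^ (-((2 : ℕ) : ℝ)) *
      (1 + |ω - p.2|) ^ (-((2 : ℕ) : ℝ)) := by
    intro p ω hp
    have b1 := hC () (p.1, x) ⟨hp, rfl⟩ (ω - p.2) ω
    have b2 := hD p.1 p.2
    have b3 := one_add_abs_add_rpow_le 2 p.2 (ω - p.2)
    rw [add_sub_cancel, abs_of_pos (by norm_num : (0:ℝ) < 2)] at b3
    simp only [J]
    rw [norm_mul, norm_mul, norm_cis_mul, RCLike.norm_conj]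
    calc ‖k‖ * (‖tHat (shiftAmp α h c₀ A') (p.1, x) (ω - p.2) ω‖ *
          ‖fourierData α h c₀ (redB α h c₀ A) V p.1 p.2‖)
        ≤ ‖k‖ * ((C * (1 + |ω - p.2|) ^ (-(4 : ℝ)) *
          ((1 + |p.2|) ^ (2 : ℝ) * (1 + |ω - p.2|) ^ (2 : ℝ))) *
          (D * (1 + |p.2|) ^ (-((4 : ℕ) : ℝ)))) := by
          gcongr
          exact b1.trans (by gcongr)
      _ = ‖k‖ * C * D * ((1 + |p.2|) ^ (-((4 : ℕ) : ℝ)) * (1 + |p.2|) ^ (2 : ℝ)) *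
          ((1 + |ω - p.2|) ^ (-(4 : ℝ)) * (1 + |ω - p.2|) ^ (2 : ℝ)) := by ring
      _ = _ := by
          rw [← Real.rpow_add (by positivity), ← Real.rpow_add (by positivity)]
          norm_num
  have hJs : ∀ p ω, ‖J (p, ω)‖ ≤ ‖k‖ * C * D * strip S p *
      (1 + |ω - p.2|) ^ (-((2 : ℕ) : ℝ)) := by
    intro p ω
    have := norm_le_mul_strip (z := J (p, ω)) (p := p) (S := S)
      (C := ‖k‖ * C * D * (1 + |ω - p.2|) ^ (-((2 : ℕ) : ℝ))) (hJ0 p ω)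
      (fun hp => (hJb p ω hp).trans (le_of_eq (by ring)))
    exact this.trans (le_of_eq (by ring))
  have hJi : Integrable J (volume.prod volume) :=
    integrable_of_le_shear hJc ((integrable_strip hSc).const_mul (‖k‖ * C * D))
      one_add_abs_rpow_neg_two_integrable hJs
  have hJω : ∀ ω, Integrable (fun p => J (p, ω)) (volume.prod volume) := fun ω =>
    integrable_of_le_strip hSc (hJc.comp (by fun_prop)) (C := ‖k‖ * C * D)
      (fun p => hJ0 p ω) fun p hp => (hJb p ω hp).trans (mul_le_of_le_one_right (by positivity)
        (Real.rpow_le_one_of_one_le_of_nonpos (by linarith [abs_nonneg (ω - p.2)]) (by simp)))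
  have e1 : adjointIntegrand α h c₀ A' (forward α h c₀ A V) x = fun ω => ∫ p, J (p, ω) := by
    ext ω
    refine Eq.trans ?_ (integral_prod _ (hJω ω)).symm
    unfold adjointIntegrand
    congr 1; ext s
    exact integral_backproject_time hh hc₀ hA' hA hV hVc x s ω
  have e2 : ((1 / (2 * Real.pi) : ℝ) * ∫ p, normalIntegrand α h c₀ A' A V x p : ℂ) =
      ∫ ω, ∫ p, J (p, ω) := by
    refine Eq.trans ?_ (integral_integral_swap (f := fun p ω => J (p, ω)) hJi)
    rw [← integral_const_mul]
    congr 1; ext p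
    have : (∫ ω, tHat (shiftAmp α h c₀ A') (p.1, x) (ω - p.2) ω) =
        redB α h c₀ A' ((p.1, x), p.2) := by
      rw [← integral_add_left_eq_self _ p.2]
      simp only [add_sub_cancel_left]
      rfl
    simp only [J]
    rw [integral_const_mul, integral_mul_const, integral_const_mul, integral_conj, this]
    rfl
  rw [e1, e2]
  exact hasOscIntegral_integral hJi.integral_prod_right

lemma backproject_forward_eq (hh : 0 < h) (hc₀ : 0 < c₀) (hA' : DataAmp α h c₀ Q U A')
    (hA : DataAmp α h c₀ Q U A) (hV : ContDiff ℝ (⊤ : ℕ∞) V) (hVc : HasCompactSupport V)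
    (x : Plane) : backproject α h c₀ A' (forward α h c₀ A V) x =
      (1 / (2 * Real.pi) : ℝ) * ∫ p, normalIntegrand α h c₀ A' A V x p :=
  (hasOscIntegral_adjointIntegrand hh hc₀ hA' hA hV hVc x).oscIntegral_eq

lemma continuous_normalIntegrand (hh : 0 < h) (hA' : DataAmp α h c₀ Q U A')
    (hA : DataAmp α h c₀ Q U A) (hV : ContDiff ℝ (⊤ : ℕ∞) V) (hVc : HasCompactSupport V) :
    Continuous fun z : Plane × (ℝ × ℝ) => normalIntegrand α h c₀ A' A V z.1 z.2 := by
  unfold normalIntegrand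
  have h1 : Continuous fun z : Plane × (ℝ × ℝ) => bistaticDist α h z.2.1 z.1 :=
    (contDiff_bistaticDist_comp hh α (contDiff_fst.comp contDiff_snd) contDiff_fst).continuous
  have h2 := (hA'.continuous_redB hh).comp (f := fun z : Plane × (ℝ × ℝ) =>
    ((z.2.1, z.1), z.2.2)) (by fun_prop)
  have h3 := (hA.continuous_fourierData hh hV hVc).comp (f := fun z : Plane × (ℝ × ℝ) => z.2)
    continuous_snd
  refine ((continuous_cis.comp ?_).mul (Complex.continuous_conj.comp h2)).mul h3
  exact ((continuous_snd.comp continuous_snd).mul (h1.div_const c₀)).neg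

lemma normalIntegrand_eq_zero (hA : DataAmp α h c₀ Q U A) (x : Plane) (p : ℝ × ℝ)
    (hp : p.1 ∉ Prod.fst '' Q) : normalIntegrand α h c₀ A' A V x p = 0 := by
  simp [normalIntegrand, hA.fourierData_eq_zero hp]

lemma norm_normalIntegrand_le (hh : 0 < h) (hc₀ : 0 < c₀) (hA' : DataAmp α h c₀ Q U A')
    (hA : DataAmp α h c₀ Q U A) (hV : ContDiff ℝ (⊤ : ℕ∞) V) (hVc : HasCompactSupport V)
    {L : Set Plane} (hL : IsCompact L) : ∃ C : ℝ, 0 ≤ C ∧ ∀ x ∈ L, ∀ p : ℝ × ℝ,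
      p.1 ∈ Prod.fst '' Q →
      ‖normalIntegrand α h c₀ A' A V x p‖ ≤ C * (1 + |p.2|) ^ (-((2 : ℕ) : ℝ)) := by
  obtain ⟨C, hC0, hC⟩ := (hA'.redB hh).norm_le (hA.compact_S.prod hL)
  obtain ⟨D, hD0, hD⟩ := hA.exists_fourierData_bound hh hc₀ hV hVc 4
  refine ⟨C * D, by positivity, fun x hx p hp => ?_⟩
  rw [normalIntegrand, norm_mul, norm_cis_mul, RCLike.norm_conj]
  calc _ ≤ (C * (1 + |p.2|) ^ (2 : ℝ)) * (D * (1 + |p.2|) ^ (-((4 : ℕ) : ℝ))) :=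
        mul_le_mul (hC () (p.1, x) ⟨hp, hx⟩ p.2) (hD p.1 p.2) (norm_nonneg _) (by positivity)
    _ = C * D * ((1 + |p.2|) ^ (2 : ℝ) * (1 + |p.2|) ^ (-((4 : ℕ) : ℝ))) := by ring
    _ = _ := by
        rw [← Real.rpow_add (by positivity)]
        norm_num

lemma continuous_backproject_forward (hh : 0 < h) (hc₀ : 0 < c₀) (hA' : DataAmp α h c₀ Q U A')
    (hA : DataAmp α h c₀ Q U A) (hV : ContDiff ℝ (⊤ : ℕ∞) V) (hVc : HasCompactSupport V) :
    Continuous (backproject α h c₀ A' (forward α h c₀ A V)) := by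
  have e : backproject α h c₀ A' (forward α h c₀ A V) = fun x =>
      ((1 / (2 * Real.pi) : ℝ) : ℂ) * ∫ p, normalIntegrand α h c₀ A' A V x p :=
    funext (backproject_forward_eq hh hc₀ hA' hA hV hVc)
  rw [e]
  refine continuous_const.mul (continuous_iff_continuousAt.2 fun x₀ => ?_)
  obtain ⟨C, hC0, hC⟩ := norm_normalIntegrand_le hh hc₀ hA' hA hV hVc
    (isCompact_closedBall x₀ 1)
  have hc := continuous_normalIntegrand hh hA' hA hV hVc
  refine continuousAt_of_dominated (bound := fun p => C * strip (Prod.fst '' Q) p)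
    (Eventually.of_forall fun x => ?_) ?_ ((integrable_strip hA.compact_S).const_mul C)
    (ae_of_all _ fun p => ?_)
  · exact (hc.comp (Continuous.prodMk_right x)).aestronglyMeasurable
  · filter_upwards [Metric.closedBall_mem_nhds x₀ zero_lt_one] with x hx
    exact ae_of_all _ fun p => norm_le_mul_strip (normalIntegrand_eq_zero hA x p) (hC x hx p)
  · exact (hc.comp (Continuous.prodMk_left p)).continuousAt

/-- Cutoffs in the data space may be moved between the factors of the normal operator. -/
lemma backproject_forward_cutoff (hh : 0 < h) (hc₀ : 0 < c₀) (hA : DataAmp α h c₀ Q U A)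
    (hV : ContDiff ℝ (⊤ : ℕ∞) V) (hVc : HasCompactSupport V) (κ : ℝ × ℝ → ℝ) :
    backproject α h c₀ A' (forward α h c₀ (fun p ω => (κ (p.1, p.2.1) : ℂ) * A p ω) V) =
      backproject α h c₀ (fun p ω => (κ (p.1, p.2.1) : ℂ) * A' p ω) (forward α h c₀ A V) := by
  ext x
  unfold backproject
  congr 1
  ext ω
  unfold adjointIntegrand
  congr 1; ext s; congr 1; ext t
  rw [forward_cutoff hh hc₀ hA hV hVc, map_mul, Complex.conj_ofReal]
  ring

end Normal

end BistaticSAR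

namespace BistaticSAR

/-! ### Distributions defined by bounds on derivatives -/

section Bounds

variable {E E' : Type*} [NormedAddCommGroup E] [NormedSpace ℝ E] [NormedAddCommGroup E']
  [NormedSpace ℝ E']

/-- A linear functional on test functions that is bounded by finitely many derivatives is a
distribution. -/
theorem exists_distribution_of_bound {Ω : Opens E} (T : (E → ℝ) → ℂ)
    (hadd : ∀ f g : 𝓓(Ω, ℝ), T (fun x => f x + g x) = T f + T g)
    (hsmul : ∀ (c : ℝ) (f : 𝓓(Ω, ℝ)), T (fun x => c * f x) = c * T f)
    (hb : ∀ K : Set E, IsCompact K → ∃ n : ℕ, ∃ C : ℝ, 0 ≤ C ∧ ∀ f : 𝓓(Ω, ℝ), tsupport f ⊆ K →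
      ∀ M : ℝ, 0 ≤ M → (∀ j ≤ n, ∀ x, ‖iteratedFDeriv ℝ j f x‖ ≤ M) → ‖T f‖ ≤ C * M) :
    ∃ u : 𝓓'(Ω, ℂ), ∀ f : 𝓓(Ω, ℝ), u f = T f := by
  let u : 𝓓(Ω, ℝ) →L[ℝ] ℂ := TestFunction.limitCLM ℝ (fun f : 𝓓(Ω, ℝ) => T f)
    (fun K hK => ContDiffMapSupportedIn.mkCLMtoNormedSpace ℝ
      (fun f => T (TestFunction.ofSupportedIn hK f))
      (fun f g => hadd (TestFunction.ofSupportedIn hK f) (TestFunction.ofSupportedIn hK g))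
      (fun c f => by
        rw [Complex.real_smul]
        exact hsmul c (TestFunction.ofSupportedIn hK f))
      (by
        obtain ⟨n, C, hC0, hC⟩ := hb K K.isCompact
        refine ⟨Finset.Iic n, C, hC0, fun f => ?_⟩
        refine hC (TestFunction.ofSupportedIn hK f) f.tsupport_subset _ (apply_nonneg _ _)
          fun j hj x => ?_
        exact (ContDiffMapSupportedIn.norm_iteratedFDeriv_apply_le_seminorm_top ℝ (f := f)).trans
          (Seminorm.le_finset_sup_apply (Finset.mem_Iic.2 hj))))
    (fun K hK f => rfl)
  exact ⟨u, fun f => rfl⟩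

lemma norm_iteratedFDeriv_slice_right_le {F : Type*} [NormedAddCommGroup F] [NormedSpace ℝ F]
    {f : E × E' → F} (hf : ContDiff ℝ (⊤ : ℕ∞) f) (j : ℕ) (x : E) (y : E') :
    ‖iteratedFDeriv ℝ j (fun y' => f (x, y')) y‖ ≤ ‖iteratedFDeriv ℝ j f (x, y)‖ := by
  have h1 : (fun y' => f (x, y')) = (fun z => f (z + (x, 0))) ∘ ContinuousLinearMap.inr ℝ E E' := by
    ext y'; simp
  have h3 : ContDiff ℝ (⊤ : ℕ∞) fun z => f (z + (x, 0)) := hf.comp (contDiff_id.add contDiff_const)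
  rw [h1, ContinuousLinearMap.iteratedFDeriv_comp_right _ h3 y (i := j)
    (by exact_mod_cast le_top), iteratedFDeriv_comp_add_right]
  refine (ContinuousMultilinearMap.norm_compContinuousLinearMap_le _ _).trans ?_
  have e : ContinuousLinearMap.inr ℝ E E' y + (x, 0) = (x, y) := by simp
  rw [e]
  exact mul_le_of_le_one_right (norm_nonneg _) (Finset.prod_le_one (fun _ _ => norm_nonneg _)
    fun _ _ => ContinuousLinearMap.norm_inr_le_one ℝ E E')

lemma derivBound_slice {Φ : E × E' → ℝ} (hΦ : ContDiff ℝ (⊤ : ℕ∞) Φ) {n : ℕ} {M : ℝ}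
    (hM : ∀ j ≤ n, ∀ z, ‖iteratedFDeriv ℝ j Φ z‖ ≤ M) (x : E) :
    DerivBound n (fun y => (Φ (x, y) : ℂ)) M := by
  intro j hj y
  have := Complex.ofRealLI.norm_iteratedFDeriv_comp_left (f := fun y => Φ (x, y)) (x := y) (i := j)
    (n := (⊤ : ℕ∞)) (hΦ.comp (by fun_prop)).contDiffAt (by exact_mod_cast le_top)
  have h2 : (Complex.ofRealLI ∘ fun y => Φ (x, y)) = fun y => (Φ (x, y) : ℂ) := rfl
  rw [h2] at this
  rw [this]
  exact (norm_iteratedFDeriv_slice_right_le hΦ j x y).trans (hM j hj _)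

end Bounds

/-! ### The kernel of the normal operator -/

section Kernel

variable {α h c₀ : ℝ} {Q U : Set (ℝ × ℝ)} {A A' : ℝ × ℝ × Plane → ℝ → ℂ} {V u : Plane → ℂ}

/-- `∫ (F* F V) u` for reduced amplitudes `B'` and `B` of the factors. -/
noncomputable def pairing (α h c₀ : ℝ) (B' B : (ℝ × Plane) × ℝ → ℂ) (u V : Plane → ℂ) : ℂ :=
  ∫ p : ℝ × ℝ, conj (fourierData α h c₀ B' (fun x => conj (u x)) p.1 p.2) *
    fourierData α h c₀ B V p.1 p.2

/-- `∫ (F* F V) u` is the `L²` product of the data of `V` with the data of `conj u`, hence the two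
conjugations in `pairing`. -/
lemma conj_fourierData (B' : (ℝ × Plane) × ℝ → ℂ) (u : Plane → ℂ) (s ω : ℝ) :
    conj (fourierData α h c₀ B' (fun x => conj (u x)) s ω) =
      ∫ x, cis (-(ω * (bistaticDist α h s x / c₀))) * conj (B' ((s, x), ω)) * u x := by
  rw [fourierData, ← integral_conj]
  congr 1; ext x
  rw [map_mul, map_mul, Complex.conj_conj, ← conj_cis, cis]
  ring

/-- Fubini for the absolutely convergent form of `F* F V`: integrating over `x` first turns the
backprojection of `u` into the conjugated transform of data. -/
theorem integral_backproject_forward_mul (hh : 0 < h) (hc₀ : 0 < c₀)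
    (hA' : DataAmp α h c₀ Q U A') (hA : DataAmp α h c₀ Q U A) (hV : ContDiff ℝ (⊤ : ℕ∞) V)
    (hVc : HasCompactSupport V) (hu : Continuous u) (huc : HasCompactSupport u) :
    ∫ x, backproject α h c₀ A' (forward α h c₀ A V) x * u x =
      (1 / (2 * Real.pi) : ℝ) * pairing α h c₀ (redB α h c₀ A') (redB α h c₀ A) u V := by
  let k : ℂ := ((1 / (2 * Real.pi) : ℝ) : ℂ)
  obtain ⟨C, hC0, hC⟩ := norm_normalIntegrand_le hh hc₀ hA' hA hV hVc huc.isCompact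
  have hc := continuous_normalIntegrand hh hA' hA hV hVc
  have hint : Integrable (Function.uncurry fun (x : Plane) (p : ℝ × ℝ) =>
      normalIntegrand α h c₀ A' A V x p * u x) (volume.prod volume) := by
    have h1 := (hu.integrable_of_hasCompactSupport huc (μ := volume)).norm.mul_prod
      ((integrable_strip hA.compact_S).const_mul C)
    refine h1.mono' ?_ (ae_of_all _ fun z => ?_)
    · exact (hc.mul (hu.comp continuous_fst)).aestronglyMeasurable
    · rw [Function.uncurry, norm_mul, mul_comm]
      by_cases hz : z.1 ∈ tsupport u
      · exact mul_le_mul_of_nonneg_left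
          (norm_le_mul_strip (normalIntegrand_eq_zero hA z.1 z.2) (hC z.1 hz z.2)) (norm_nonneg _)
      · simp [image_eq_zero_of_notMem_tsupport hz]
  have e1 : ∀ x, backproject α h c₀ A' (forward α h c₀ A V) x * u x =
      k * ∫ p, normalIntegrand α h c₀ A' A V x p * u x := by
    intro x
    rw [backproject_forward_eq hh hc₀ hA' hA hV hVc, integral_mul_const]
    ring
  simp_rw [e1]
  rw [integral_const_mul, integral_integral_swap hint, pairing]
  congr 2; ext p
  rw [conj_fourierData, ← integral_mul_const]
  congr 1; ext x
  rw [normalIntegrand]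
  ring

/-- The amplitude of the kernel. -/
noncomputable def kernelAmp (α h c₀ : ℝ) (A : ℝ × ℝ × Plane → ℝ → ℂ) (q : Plane × Plane × ℝ)
    (ω : ℝ) : ℂ :=
  (1 / (2 * Real.pi) : ℝ) *
    (redB α h c₀ A ((q.2.2, q.2.1), ω) * conj (redB α h c₀ A ((q.2.2, q.1), ω)))

lemma isSymbol_kernelAmp (hh : 0 < h) (hA : DataAmp α h c₀ Q U A) (W : Set (Plane × Plane × ℝ)) :
    IsSymbol W 4 (kernelAmp α h c₀ A) := by
  have hB := hA.redB hh
  have h1 := hB.comp (Φ := fun q : Plane × Plane × ℝ => (q.2.2, q.2.1)) (by fun_prop)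
  have h2 := (hB.comp (Φ := fun q : Plane × Plane × ℝ => (q.2.2, q.1)) (by fun_prop)).conj
  have h3 := (h1.mul h2).param_mul (φ := fun _ => ((1 / (2 * Real.pi) : ℝ) : ℂ)) contDiff_const
  rw [show (2 : ℝ) + 2 = 4 by norm_num] at h3
  exact h3.isSymbol () W

/-- The integrand in `(s, ω)` of the kernel, tested on `Φ`. -/
noncomputable def kernelIntegrand (α h c₀ : ℝ) (A : ℝ × ℝ × Plane → ℝ → ℂ)
    (Φ : Plane × Plane → ℝ) (p : ℝ × ℝ) : ℂ :=
  ∫ z : Plane × Plane, Complex.exp (Complex.I * (kernelPhase α h c₀ z.1 z.2 p.1 p.2 : ℂ)) *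
    kernelAmp α h c₀ A (z.1, z.2, p.1) p.2 * (Φ z : ℂ)

lemma exp_kernelPhase (x y : Plane) (s ω : ℝ) :
    Complex.exp (Complex.I * (kernelPhase α h c₀ x y s ω : ℂ)) =
      cis (-(ω * (bistaticDist α h s x / c₀))) * cis (ω * (bistaticDist α h s y / c₀)) := by
  rw [← cis_add, cis, kernelPhase]
  congr 3
  ring

lemma continuous_kernel (hh : 0 < h) (hA : DataAmp α h c₀ Q U A) {Φ : Plane × Plane → ℝ}
    (hΦ : Continuous Φ) : Continuous fun w : (ℝ × ℝ) × (Plane × Plane) =>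
      Complex.exp (Complex.I * (kernelPhase α h c₀ w.2.1 w.2.2 w.1.1 w.1.2 : ℂ)) *
        kernelAmp α h c₀ A (w.2.1, w.2.2, w.1.1) w.1.2 * (Φ w.2 : ℂ) := by
  have hB := hA.continuous_redB hh
  have h1 : Continuous fun w : (ℝ × ℝ) × (Plane × Plane) => bistaticDist α h w.1.1 w.2.1 :=
    (contDiff_bistaticDist_comp hh α (contDiff_fst.comp contDiff_fst)
      (contDiff_fst.comp contDiff_snd)).continuous
  have h2 : Continuous fun w : (ℝ × ℝ) × (Plane × Plane) => bistaticDist α h w.1.1 w.2.2 :=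
    (contDiff_bistaticDist_comp hh α (contDiff_fst.comp contDiff_fst)
      (contDiff_snd.comp contDiff_snd)).continuous
  have h3 : Continuous fun w : (ℝ × ℝ) × (Plane × Plane) =>
      kernelPhase α h c₀ w.2.1 w.2.2 w.1.1 w.1.2 := by
    unfold kernelPhase
    exact ((continuous_snd.comp continuous_fst).div_const c₀).mul (h2.sub h1)
  have h4 := hB.comp (f := fun w : (ℝ × ℝ) × (Plane × Plane) => ((w.1.1, w.2.2), w.1.2))
    (by fun_prop)
  have h5 := hB.comp (f := fun w : (ℝ × ℝ) × (Plane × Plane) => ((w.1.1, w.2.1), w.1.2))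
    (by fun_prop)
  exact ((continuous_cis.comp h3).mul (continuous_const.mul (h4.mul
    (Complex.continuous_conj.comp h5)))).mul
      (Complex.continuous_ofReal.comp (hΦ.comp continuous_snd))

lemma integrable_kernel (hh : 0 < h) (hA : DataAmp α h c₀ Q U A) {Φ : Plane × Plane → ℝ}
    (hΦ : Continuous Φ) (hΦc : HasCompactSupport Φ) (p : ℝ × ℝ) :
    Integrable (fun z : Plane × Plane =>
      Complex.exp (Complex.I * (kernelPhase α h c₀ z.1 z.2 p.1 p.2 : ℂ)) *
        kernelAmp α h c₀ A (z.1, z.2, p.1) p.2 * (Φ z : ℂ)) (volume.prod volume) :=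
  ((continuous_kernel hh hA hΦ).comp (Continuous.prodMk_right p)).integrable_of_hasCompactSupport
    (hΦc.comp_left (g := fun r : ℝ => (r : ℂ)) Complex.ofReal_zero).mul_left

lemma continuous_kernelIntegrand (hh : 0 < h) (hA : DataAmp α h c₀ Q U A) {Φ : Plane × Plane → ℝ}
    (hΦ : Continuous Φ) (hΦc : HasCompactSupport Φ) :
    Continuous (kernelIntegrand α h c₀ A Φ) := by
  have h1 : kernelIntegrand α h c₀ A Φ = fun p => ∫ z in tsupport Φ,
      Complex.exp (Complex.I * (kernelPhase α h c₀ z.1 z.2 p.1 p.2 : ℂ)) *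
        kernelAmp α h c₀ A (z.1, z.2, p.1) p.2 * (Φ z : ℂ) := by
    ext p
    rw [setIntegral_eq_integral_of_forall_compl_eq_zero]
    · rfl
    · intro z hz
      rw [image_eq_zero_of_notMem_tsupport hz, Complex.ofReal_zero, mul_zero]
  rw [h1]
  exact continuous_parametric_integral_of_continuous
    (f := fun (p : ℝ × ℝ) (z : Plane × Plane) =>
      Complex.exp (Complex.I * (kernelPhase α h c₀ z.1 z.2 p.1 p.2 : ℂ)) *
        kernelAmp α h c₀ A (z.1, z.2, p.1) p.2 * (Φ z : ℂ))
    (continuous_kernel hh hA hΦ) hΦc.isCompact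

/-- For fixed `x` the integral over `y` is the transform of the data of the slice `Φ(x, ·)`. The
decay in `ω` known for test functions on the plane thus applies to test functions that are not
tensor products. -/
lemma kernelIntegrand_eq (hh : 0 < h) (hA : DataAmp α h c₀ Q U A) {Φ : Plane × Plane → ℝ}
    (hΦ : Continuous Φ) (hΦc : HasCompactSupport Φ) (p : ℝ × ℝ) :
    kernelIntegrand α h c₀ A Φ p = (1 / (2 * Real.pi) : ℝ) * ∫ x,
      cis (-(p.2 * (bistaticDist α h p.1 x / c₀))) * conj (redB α h c₀ A ((p.1, x), p.2)) *
        fourierData α h c₀ (redB α h c₀ A) (fun y => (Φ (x, y) : ℂ)) p.1 p.2 := by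
  refine (integral_prod _ (integrable_kernel hh hA hΦ hΦc p)).trans ?_
  rw [← integral_const_mul]
  congr 1; ext x
  rw [fourierData, ← integral_const_mul, ← integral_const_mul]
  congr 1; ext y
  rw [exp_kernelPhase, kernelAmp, ← cis]
  ring

lemma kernelIntegrand_eq_zero (hA : DataAmp α h c₀ Q U A) (Φ : Plane × Plane → ℝ) {p : ℝ × ℝ}
    (hp : p.1 ∉ Prod.fst '' Q) : kernelIntegrand α h c₀ A Φ p = 0 := by
  simp [kernelIntegrand, kernelAmp, hA.redB_eq_zero hp]

/-- The slice in `y` gives decay of exponent `4` for `4 + 2` derivatives of `Φ`; the factor at `x`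
grows like a symbol of order `2`, and exponent `-2` is integrable. Oscillation in `x` is not used.
-/
lemma norm_kernelIntegrand_le (hh : 0 < h) (hc₀ : 0 < c₀) (hA : DataAmp α h c₀ Q U A)
    {K : Set (Plane × Plane)} (hK : IsCompact K) : ∃ C : ℝ, 0 ≤ C ∧ ∀ Φ : Plane × Plane → ℝ,
      ContDiff ℝ (⊤ : ℕ∞) Φ → tsupport Φ ⊆ K → ∀ M, 0 ≤ M →
      (∀ j ≤ 4 + 2, ∀ z, ‖iteratedFDeriv ℝ j Φ z‖ ≤ M) → ∀ p : ℝ × ℝ, p.1 ∈ Prod.fst '' Q →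
      ‖kernelIntegrand α h c₀ A Φ p‖ ≤ C * M * (1 + |p.2|) ^ (-((2 : ℕ) : ℝ)) := by
  have hL₁ := hK.image continuous_fst
  have hL₂ := hK.image continuous_snd
  obtain ⟨C, hC0, hC⟩ := (hA.redB hh).norm_le (hA.compact_S.prod hL₁)
  obtain ⟨D, hD0, hD⟩ := hA.norm_fourierData_le hh hc₀ hL₂ 4
  let k : ℂ := ((1 / (2 * Real.pi) : ℝ) : ℂ)
  let v : ℝ := (volume : Measure Plane).real (Prod.fst '' K)
  have hv : 0 ≤ v := measureReal_nonneg
  refine ⟨‖k‖ * (C * D * v), by positivity, fun Φ hΦ hΦK M hM0 hM p hp => ?_⟩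
  have hΦc : HasCompactSupport Φ := hK.of_isClosed_subset (isClosed_tsupport Φ) hΦK
  rw [kernelIntegrand_eq hh hA hΦ.continuous hΦc, norm_mul]
  have hz : ∀ x y, (x ∉ Prod.fst '' K ∨ y ∉ Prod.snd '' K) → Φ (x, y) = 0 := by
    intro x y hxy
    refine image_eq_zero_of_notMem_tsupport fun hmem => ?_
    rcases hxy with h1 | h1
    · exact h1 ⟨_, hΦK hmem, rfl⟩
    · exact h1 ⟨_, hΦK hmem, rfl⟩
  have hsup : ∀ x, tsupport (fun y => (Φ (x, y) : ℂ)) ⊆ Prod.snd '' K := fun x =>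
    closure_minimal (fun y hy => by
      by_contra hy'
      exact hy (by simp [hz x y (Or.inr hy')])) hL₂.isClosed
  have hset : (∫ x, cis (-(p.2 * (bistaticDist α h p.1 x / c₀))) *
      conj (redB α h c₀ A ((p.1, x), p.2)) *
        fourierData α h c₀ (redB α h c₀ A) (fun y => (Φ (x, y) : ℂ)) p.1 p.2) =
      ∫ x in Prod.fst '' K, cis (-(p.2 * (bistaticDist α h p.1 x / c₀))) *
      conj (redB α h c₀ A ((p.1, x), p.2)) *
        fourierData α h c₀ (redB α h c₀ A) (fun y => (Φ (x, y) : ℂ)) p.1 p.2 := by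
    rw [setIntegral_eq_integral_of_forall_compl_eq_zero]
    intro x hx
    have : (fun y => (Φ (x, y) : ℂ)) = fun _ => 0 := by
      ext y; simp [hz x y (Or.inl hx)]
    rw [this]
    simp [fourierData]
  rw [hset]
  refine (mul_le_mul_of_nonneg_left (norm_setIntegral_le_of_norm_le_const
    (C := C * D * M * (1 + |p.2|) ^ (-((2 : ℕ) : ℝ))) hL₁.measure_lt_top fun x hx => ?_)
    (norm_nonneg k)).trans (le_of_eq (by ring))
  rw [norm_mul, norm_cis_mul, RCLike.norm_conj]
  have b1 := hC () (p.1, x) ⟨hp, hx⟩ p.2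
  have b2 := hD (fun y => (Φ (x, y) : ℂ))
    (Complex.ofRealCLM.contDiff.comp (hΦ.comp (by fun_prop))) (hsup x) M (derivBound_slice hΦ hM x)
    p.1 p.2
  calc _ ≤ (C * (1 + |p.2|) ^ (2 : ℝ)) * (D * M * (1 + |p.2|) ^ (-((4 : ℕ) : ℝ))) :=
        mul_le_mul b1 b2 (norm_nonneg _) (by positivity)
    _ = C * D * M * ((1 + |p.2|) ^ (2 : ℝ) * (1 + |p.2|) ^ (-((4 : ℕ) : ℝ))) := by ring
    _ = _ := by
        rw [← Real.rpow_add (by positivity)]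
        norm_num

lemma integrable_kernelIntegrand (hh : 0 < h) (hc₀ : 0 < c₀) (hA : DataAmp α h c₀ Q U A)
    {Φ : Plane × Plane → ℝ} (hΦ : ContDiff ℝ (⊤ : ℕ∞) Φ) (hΦc : HasCompactSupport Φ) :
    Integrable (kernelIntegrand α h c₀ A Φ) := by
  obtain ⟨C, hC0, hC⟩ := norm_kernelIntegrand_le hh hc₀ hA hΦc.isCompact
  have h1 : ∀ j : ℕ, ∃ C, ∀ y, ‖iteratedFDeriv ℝ j Φ y‖ ≤ C := fun j =>
    (hΦ.continuous_iteratedFDeriv (by exact_mod_cast le_top)).bounded_above_of_compact_support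
      (hΦc.iteratedFDeriv j)
  choose D hD using h1
  have hD0 : ∀ j, 0 ≤ D j := fun j => (norm_nonneg _).trans (hD j 0)
  exact integrable_of_le_strip hA.compact_S (continuous_kernelIntegrand hh hA hΦ.continuous hΦc)
    (fun p => kernelIntegrand_eq_zero hA Φ)
    (hC Φ hΦ subset_rfl (∑ j ∈ Finset.range (4 + 2 + 1), D j) (Finset.sum_nonneg fun j _ => hD0 j)
      fun j hj z => (hD j z).trans (Finset.single_le_sum (f := D) (fun i _ => hD0 i)
        (Finset.mem_range.2 (by omega))))

theorem exists_kernel (hh : 0 < h) (hc₀ : 0 < c₀) (hA : DataAmp α h c₀ Q U A) :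
    ∃ K : 𝓓'((⊤ : Opens (Plane × Plane)), ℂ), ∀ Φ : 𝓓((⊤ : Opens (Plane × Plane)), ℝ),
      K Φ = ∫ p, kernelIntegrand α h c₀ A Φ p := by
  refine exists_distribution_of_bound (fun Φ => ∫ p, kernelIntegrand α h c₀ A Φ p)
    (fun f g => ?_) (fun c f => ?_) (fun K hK => ?_)
  · rw [← integral_add (integrable_kernelIntegrand hh hc₀ hA f.contDiff f.hasCompactSupport)
      (integrable_kernelIntegrand hh hc₀ hA g.contDiff g.hasCompactSupport)]
    congr 1; ext p
    refine Eq.trans ?_ (integral_add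
      (integrable_kernel hh hA f.continuous f.hasCompactSupport p)
      (integrable_kernel hh hA g.continuous g.hasCompactSupport p))
    unfold kernelIntegrand
    congr 1; ext z
    push_cast; ring
  · rw [← integral_const_mul]
    congr 1; ext p
    unfold kernelIntegrand
    rw [← integral_const_mul]
    congr 1; ext z
    push_cast; ring
  · obtain ⟨C, hC0, hC⟩ := norm_kernelIntegrand_le hh hc₀ hA hK
    have hI : 0 ≤ ∫ p, strip (Prod.fst '' Q) p := integral_nonneg (strip_nonneg _)
    refine ⟨4 + 2, C * ∫ p, strip (Prod.fst '' Q) p, by positivity, fun f hf M hM0 hM => ?_⟩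
    exact (norm_integral_le_of_le_strip hA.compact_S (fun p => kernelIntegrand_eq_zero hA f)
      (hC f f.contDiff hf M hM0 hM)).trans (le_of_eq (by ring))

/-- The kernel of the normal operator in terms of the Fourier data. -/
lemma integral_kernelIntegrand_tensor (u v : 𝓓((⊤ : Opens Plane), ℝ)) :
    ∫ p, kernelIntegrand α h c₀ A (tensor u v) p = (1 / (2 * Real.pi) : ℝ) *
      pairing α h c₀ (redB α h c₀ A) (redB α h c₀ A) (fun x => (u x : ℂ)) fun y => (v y : ℂ) := by
  rw [pairing, ← integral_const_mul]
  congr 1; ext p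
  rw [conj_fourierData, fourierData]
  rw [← integral_prod_mul, ← integral_const_mul]
  unfold kernelIntegrand
  congr 1; ext z
  rw [exp_kernelPhase, kernelAmp, ← cis]
  change _ * _ * (((u z.1 * v z.2 : ℝ)) : ℂ) = _
  push_cast
  ring

/-- Once `x` and `y` are integrated out, the integrand in `(s, ω)` is absolutely integrable, so the
oscillatory integral over `ω` is an ordinary one. -/
theorem isKernelOscIntegral (hh : 0 < h) (hc₀ : 0 < c₀) (hA : DataAmp α h c₀ Q U A)
    {K : 𝓓'((⊤ : Opens (Plane × Plane)), ℂ)}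
    (hK : ∀ Φ : 𝓓((⊤ : Opens (Plane × Plane)), ℝ), K Φ = ∫ p, kernelIntegrand α h c₀ A Φ p) :
    IsKernelOscIntegral α h c₀ (kernelAmp α h c₀ A) K := by
  intro Φ
  have hi : Integrable (kernelIntegrand α h c₀ A Φ) (volume.prod volume) :=
    integrable_kernelIntegrand hh hc₀ hA Φ.contDiff Φ.hasCompactSupport
  have e : (fun ω => ∫ s : ℝ, ∫ x : Plane, ∫ y : Plane,
      Complex.exp (Complex.I * (kernelPhase α h c₀ x y s ω : ℂ)) *
        kernelAmp α h c₀ A (x, y, s) ω * (Φ (x, y) : ℂ)) =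
      fun ω => ∫ s, kernelIntegrand α h c₀ A Φ (s, ω) := by
    ext ω
    congr 1; ext s
    exact (integral_prod _ (integrable_kernel hh hA Φ.continuous Φ.hasCompactSupport
      (s, ω))).symm
  rw [e, hK, show (∫ p, kernelIntegrand α h c₀ A Φ p) =
    ∫ ω, ∫ s, kernelIntegrand α h c₀ A Φ (s, ω) from integral_prod_symm _ hi]
  exact hasOscIntegral_integral hi.integral_prod_right

lemma contDiff_testFunction (u : 𝓓((⊤ : Opens Plane), ℝ)) :
    ContDiff ℝ (⊤ : ℕ∞) fun x => (u x : ℂ) := Complex.ofRealCLM.contDiff.comp u.contDiff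

lemma hasCompactSupport_testFunction (u : 𝓓((⊤ : Opens Plane), ℝ)) :
    HasCompactSupport fun x => (u x : ℂ) :=
  u.hasCompactSupport.comp_left (g := fun r : ℝ => (r : ℂ)) Complex.ofReal_zero

theorem isSchwartzKernel (hh : 0 < h) (hc₀ : 0 < c₀) (hA : DataAmp α h c₀ Q U A)
    {K : 𝓓'((⊤ : Opens (Plane × Plane)), ℂ)}
    (hK : ∀ Φ : 𝓓((⊤ : Opens (Plane × Plane)), ℝ), K Φ = ∫ p, kernelIntegrand α h c₀ A Φ p) :
    IsSchwartzKernel (normalOp α h c₀ A) K := by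
  intro u v
  rw [hK, integral_kernelIntegrand_tensor]
  exact (integral_backproject_forward_mul hh hc₀ hA hA (contDiff_testFunction v)
    (hasCompactSupport_testFunction v) (contDiff_testFunction u).continuous
    (hasCompactSupport_testFunction u)).symm

end Kernel

end BistaticSAR

namespace BistaticSAR

/-! ### Modulated test functions -/

section Modulation

variable {α h c₀ : ℝ} {Q U : Set (ℝ × ℝ)} {A A' : ℝ × ℝ × Plane → ℝ → ℂ} {V u v : Plane → ℂ}

/-- `e^{-i⟨θ, y⟩} V(y)`. -/
noncomputable def modulate (θ : Plane) (V : Plane → ℂ) (y : Plane) : ℂ :=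
  cis (-(inner ℝ θ y)) * V y

lemma contDiff_modulate (θ : Plane) (hV : ContDiff ℝ (⊤ : ℕ∞) V) :
    ContDiff ℝ (⊤ : ℕ∞) (modulate θ V) :=
  (contDiff_cis.comp (contDiff_const.inner ℝ contDiff_id).neg).mul hV

lemma hasCompactSupport_modulate (θ : Plane) (hVc : HasCompactSupport V) :
    HasCompactSupport (modulate θ V) := hVc.mul_left

lemma conj_modulate (θ : Plane) (u : Plane → ℂ) (x : Plane) :
    conj (modulate θ u x) = modulate (-θ) (fun x => conj (u x)) x := by
  rw [modulate, modulate, map_mul, conj_cis, inner_neg_left]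

lemma contDiff_conj (hu : ContDiff ℝ (⊤ : ℕ∞) u) : ContDiff ℝ (⊤ : ℕ∞) fun x => conj (u x) :=
  Complex.conjCLE.contDiff.comp hu

lemma tsupport_conj (u : Plane → ℂ) : tsupport (fun x => conj (u x)) = tsupport u := by
  have : Function.support (fun x => conj (u x)) = Function.support u := by
    ext x; simp [Function.mem_support]
  rw [tsupport, tsupport, this]

/-- Extraction of a large parameter `l`. With `l ≥ |ω|` and `l ≥ ‖θ‖` the normalized parameters
`ω/l` and `θ/l` stay in a compact set, as the uniform nonstationary phase estimate requires. -/
lemma fourierData_modulate (B : (ℝ × Plane) × ℝ → ℂ) (V : Plane → ℂ) (s ω : ℝ) (θ : Plane) {l : ℝ}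
    (hl : l ≠ 0) : fourierData α h c₀ B (modulate θ V) s ω =
      ∫ y, Complex.exp (Complex.I * ((l * dataPhase α h c₀ ((s, ω / l, l⁻¹ • θ), y) : ℝ) : ℂ)) *
        (B ((s, y), ω) * V y) := by
  unfold fourierData
  congr 1; ext y
  have e : l * dataPhase α h c₀ ((s, ω / l, l⁻¹ • θ), y) =
      ω * (bistaticDist α h s y / c₀) + -(inner ℝ θ y) := by
    simp only [dataPhase, real_inner_smul_left]
    field_simp
    ring
  rw [e, modulate, ← cis, ← cis, cis_add]
  ring

lemma norm_fourierData_modulate_le (hh : 0 < h) (hA : DataAmp α h c₀ Q U A) {L : Set Plane}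
    (hL : IsCompact L) : ∃ C : ℝ, 0 ≤ C ∧ ∀ V : Plane → ℂ, tsupport V ⊆ L → ∀ M, (∀ y, ‖V y‖ ≤ M) →
      ∀ s ∈ Prod.fst '' Q, ∀ ω : ℝ, ∀ θ : Plane,
      ‖fourierData α h c₀ (redB α h c₀ A) (modulate θ V) s ω‖ ≤ C * M * (1 + |ω|) ^ (2 : ℝ) := by
  obtain ⟨C, hC0, hC⟩ := (hA.redB hh).norm_le (hA.compact_S.prod hL)
  refine ⟨(volume : Measure Plane).real L * C, by positivity, fun V hVL M hM s hs ω θ => ?_⟩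
  rw [fourierData_modulate _ _ _ _ _ one_ne_zero]
  exact (norm_integral_wave_le_of_norm_le hL hVL hM (D := C * (1 + |ω|) ^ (2 : ℝ)) (by positivity)
    (fun y hy => hC () (s, y) ⟨hs, hy⟩ ω) _).trans (le_of_eq (by ring))

lemma inv_pow_le_two_pow {l : ℝ} (hl : 1 ≤ l) (N : ℕ) :
    1 / l ^ N ≤ 2 ^ N * (1 + l) ^ (-(N : ℝ)) := by
  rw [Real.rpow_neg (by positivity), Real.rpow_natCast, ← div_eq_mul_inv,
    div_le_div_iff₀ (by positivity) (by positivity), one_mul, ← mul_pow]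
  exact pow_le_pow_left₀ (by positivity) (by linarith) N

lemma one_le_two_pow_mul {l : ℝ} (hl0 : 0 ≤ l) (hl : l ≤ 1) (N : ℕ) :
    1 ≤ 2 ^ N * (1 + l) ^ (-(N : ℝ)) := by
  rw [Real.rpow_neg (by positivity), Real.rpow_natCast, ← div_eq_mul_inv,
    le_div_iff₀ (by positivity), one_mul]
  exact pow_le_pow_left₀ (by positivity) (by linarith) N

/-- Rapid decrease of modulated data where the phase is not stationary. -/
theorem norm_fourierData_modulate_le_of_nonstationary (hh : 0 < h) (hA : DataAmp α h c₀ Q U A)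
    {L : Set Plane} (hL : IsCompact L) {c : ℝ} (hc : 0 < c) (N : ℕ) : ∃ C : ℝ, 0 ≤ C ∧
      ∀ V : Plane → ℂ, ContDiff ℝ (⊤ : ℕ∞) V → tsupport V ⊆ L → ∀ M, DerivBound N V M →
      ∀ s ∈ Prod.fst '' Q, ∀ ω : ℝ, ∀ θ : Plane, ∀ l : ℝ, |ω| ≤ l → ‖θ‖ ≤ l →
      (∀ y ∈ L, c * l ≤ ‖(ω / c₀) • gradient (bistaticDist α h s) y - θ‖) →
      ‖fourierData α h c₀ (redB α h c₀ A) (modulate θ V) s ω‖ ≤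
        C * M * (1 + |ω|) ^ (2 : ℝ) * (1 + l) ^ (-(N : ℝ)) := by
  obtain ⟨C₀, hC₀0, hC₀⟩ := norm_fourierData_modulate_le hh hA hL
  -- The hypothesis is homogeneous: dividing by `l` makes the gradient of the normalized phase at
  -- least `c` on a compact set of parameters.
  let K : Set ((ℝ × ℝ × Plane) × Plane) :=
    (((Prod.fst '' Q) ×ˢ (Icc (-1 : ℝ) 1 ×ˢ Metric.closedBall (0 : Plane) 1)) ×ˢ L) ∩
      {w | c ≤ ‖phaseGrad α h c₀ w‖}
  have hK : IsCompact K := ((hA.compact_S.prod (isCompact_Icc.prod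
    (isCompact_closedBall _ _))).prod hL).inter_right
      (isClosed_le continuous_const (continuous_phaseGrad hh).norm)
  obtain ⟨C₁, hC₁0, hC₁⟩ := norm_wave_le (c₀ := c₀) hh (hA.redB hh) hA.compact_S hL hK
    (fun w hw h0 => by
      have := hw.2
      rw [mem_ofPred_eq, h0, norm_zero] at this
      linarith) N
  refine ⟨C₀ * 2 ^ N + C₁ * 2 ^ N, by positivity, fun V hV hVL M hM s hs ω θ l hωl hθl hne => ?_⟩
  have hM0 := hM.nonneg
  have hl0 : 0 ≤ l := (abs_nonneg ω).trans hωl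
  rcases le_total l 1 with hl | hl
  · have h1 := hC₀ V hVL M hM.norm_le s hs ω θ
    have h2 := one_le_two_pow_mul hl0 hl N
    calc _ ≤ C₀ * M * (1 + |ω|) ^ (2 : ℝ) * 1 := by rw [mul_one]; exact h1
      _ ≤ C₀ * M * (1 + |ω|) ^ (2 : ℝ) * (2 ^ N * (1 + l) ^ (-(N : ℝ))) := by gcongr
      _ ≤ C₀ * M * (1 + |ω|) ^ (2 : ℝ) * (2 ^ N * (1 + l) ^ (-(N : ℝ))) +
          C₁ * M * (1 + |ω|) ^ (2 : ℝ) * (2 ^ N * (1 + l) ^ (-(N : ℝ))) :=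
          le_add_of_nonneg_right (by positivity)
      _ = _ := by ring
  · have hlpos : 0 < l := by linarith
    rw [fourierData_modulate _ _ _ _ _ hlpos.ne']
    have h1 := hC₁ () V hV hVL M hM s hs ω (ω / l) (l⁻¹ • θ) l hlpos (fun y hy => by
      have hyL : y ∈ L := hVL (subset_tsupport V fun h0 => hy (by rw [h0, mul_zero]))
      refine ⟨⟨⟨hs, ?_, ?_⟩, hyL⟩, ?_⟩
      · rw [mem_Icc, ← abs_le, abs_div, abs_of_pos hlpos]
        exact (div_le_one hlpos).2 hωl
      · rw [mem_closedBall_zero_iff, norm_smul, norm_inv, Real.norm_of_nonneg hl0]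
        exact (inv_mul_le_one₀ hlpos).2 hθl
      · have e : phaseGrad α h c₀ ((s, ω / l, l⁻¹ • θ), y) =
            l⁻¹ • ((ω / c₀) • gradient (bistaticDist α h s) y - θ) := by
          rw [phaseGrad, smul_sub, smul_smul]
          congr 2
          show ω / l / c₀ = _
          ring
        rw [mem_ofPred_eq, e, norm_smul, norm_inv, Real.norm_of_nonneg hl0, ← div_eq_inv_mul,
          le_div_iff₀ hlpos]
        exact hne y hyL)
    have h2 := inv_pow_le_two_pow hl N
    calc _ ≤ C₁ * M * (1 + |ω|) ^ (2 : ℝ) * (1 / l ^ N) := by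
          rw [mul_one_div]; exact h1
      _ ≤ C₁ * M * (1 + |ω|) ^ (2 : ℝ) * (2 ^ N * (1 + l) ^ (-(N : ℝ))) := by gcongr
      _ ≤ C₀ * M * (1 + |ω|) ^ (2 : ℝ) * (2 ^ N * (1 + l) ^ (-(N : ℝ))) +
          C₁ * M * (1 + |ω|) ^ (2 : ℝ) * (2 ^ N * (1 + l) ^ (-(N : ℝ))) :=
          le_add_of_nonneg_left (by positivity)
      _ = _ := by ring

/-- The integrand of `pairing`. -/
noncomputable def pairIntegrand (α h c₀ : ℝ) (B' B : (ℝ × Plane) × ℝ → ℂ) (u V : Plane → ℂ)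
    (p : ℝ × ℝ) : ℂ :=
  conj (fourierData α h c₀ B' (fun x => conj (u x)) p.1 p.2) * fourierData α h c₀ B V p.1 p.2

lemma norm_pairIntegrand_modulate (B' B : (ℝ × Plane) × ℝ → ℂ) (ξ η : Plane) (p : ℝ × ℝ) :
    ‖pairIntegrand α h c₀ B' B (modulate ξ u) (modulate η v) p‖ =
      ‖fourierData α h c₀ B' (modulate (-ξ) fun x => conj (u x)) p.1 p.2‖ *
        ‖fourierData α h c₀ B (modulate η v) p.1 p.2‖ := by
  rw [pairIntegrand, norm_mul, RCLike.norm_conj]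
  simp_rw [conj_modulate]

/-- Of the exponent `N + 6`, four powers cancel the growth of two symbols of order `2`, two make the
integral over `ω` converge, and `N` remain as decay in `l`. -/
lemma rapid_weights {l ω : ℝ} (hl : 0 ≤ l) (N : ℕ) :
    (1 + |ω|) ^ (2 : ℝ) * (1 + |ω|) ^ (2 : ℝ) * (1 + max |ω| l) ^ (-((N + 6 : ℕ) : ℝ)) ≤
      (1 + l) ^ (-(N : ℝ)) * (1 + |ω|) ^ (-((2 : ℕ) : ℝ)) := by
  have h1 : (1 + max |ω| l) ^ (-((N + 6 : ℕ) : ℝ)) ≤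
      (1 + l) ^ (-(N : ℝ)) * (1 + |ω|) ^ (-(6 : ℝ)) := by
    rw [show -((N + 6 : ℕ) : ℝ) = -(N : ℝ) + -6 by push_cast; ring,
      Real.rpow_add (by positivity)]
    refine mul_le_mul (Real.rpow_le_rpow_of_nonpos (by positivity)
      (by linarith [le_max_right |ω| l]) (by simp)) (Real.rpow_le_rpow_of_nonpos (by positivity)
      (by linarith [le_max_left |ω| l]) (by norm_num)) (by positivity) (by positivity)
  calc _ ≤ (1 + |ω|) ^ (2 : ℝ) * (1 + |ω|) ^ (2 : ℝ) *
        ((1 + l) ^ (-(N : ℝ)) * (1 + |ω|) ^ (-(6 : ℝ))) := by gcongr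
    _ = (1 + l) ^ (-(N : ℝ)) * ((1 + |ω|) ^ (2 : ℝ) * (1 + |ω|) ^ (2 : ℝ) *
        (1 + |ω|) ^ (-(6 : ℝ))) := by ring
    _ = _ := by
      rw [← Real.rpow_add (by positivity), ← Real.rpow_add (by positivity)]
      norm_num

/-- If the phase of one of the two factors is not stationary, the product decreases rapidly. -/
theorem norm_pairIntegrand_le_of_nonstationary (hh : 0 < h) (hA' : DataAmp α h c₀ Q U A')
    (hA : DataAmp α h c₀ Q U A) {L₁ L₂ : Set Plane} (hL₁ : IsCompact L₁) (hL₂ : IsCompact L₂)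
    (hu : ContDiff ℝ (⊤ : ℕ∞) u) (huL : tsupport u ⊆ L₁) (hv : ContDiff ℝ (⊤ : ℕ∞) v)
    (hvL : tsupport v ⊆ L₂) {c : ℝ} (hc : 0 < c) (N : ℕ) : ∃ C : ℝ, 0 ≤ C ∧
      ∀ s ∈ Prod.fst '' Q, ∀ ω : ℝ, ∀ ξ η : Plane,
      ((∀ x ∈ L₁, c * max |ω| ‖(ξ, η)‖ ≤ ‖(ω / c₀) • gradient (bistaticDist α h s) x + ξ‖) ∨
        ∀ y ∈ L₂, c * max |ω| ‖(ξ, η)‖ ≤ ‖(ω / c₀) • gradient (bistaticDist α h s) y - η‖) →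
      ‖pairIntegrand α h c₀ (redB α h c₀ A') (redB α h c₀ A) (modulate ξ u) (modulate η v) (s, ω)‖ ≤
        C * ((1 + ‖(ξ, η)‖) ^ (-(N : ℝ)) * (1 + |ω|) ^ (-((2 : ℕ) : ℝ))) := by
  have huL' : tsupport (fun x => conj (u x)) ⊆ L₁ := (tsupport_conj u).subset.trans huL
  obtain ⟨Mu, hMu⟩ := exists_derivBound (contDiff_conj hu)
    (hL₁.of_isClosed_subset (isClosed_tsupport _) huL') (N + 6)
  obtain ⟨Mv, hMv⟩ := exists_derivBound hv
    (hL₂.of_isClosed_subset (isClosed_tsupport _) hvL) (N + 6)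
  have hMu0 := hMu.nonneg
  have hMv0 := hMv.nonneg
  obtain ⟨C₁, hC₁0, hC₁⟩ := norm_fourierData_modulate_le hh hA' hL₁
  obtain ⟨C₂, hC₂0, hC₂⟩ := norm_fourierData_modulate_le hh hA hL₂
  obtain ⟨D₁, hD₁0, hD₁⟩ := norm_fourierData_modulate_le_of_nonstationary hh hA' hL₁ hc (N + 6)
  obtain ⟨D₂, hD₂0, hD₂⟩ := norm_fourierData_modulate_le_of_nonstationary hh hA hL₂ hc (N + 6)
  refine ⟨(D₁ * Mu) * (C₂ * Mv) + (C₁ * Mu) * (D₂ * Mv), by positivity,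
    fun s hs ω ξ η hcase => ?_⟩
  rw [norm_pairIntegrand_modulate]
  have hw := rapid_weights (ω := ω) (norm_nonneg (ξ, η)) N
  set l := max |ω| ‖(ξ, η)‖ with hl
  have hωl : |ω| ≤ l := le_max_left _ _
  have hξl : ‖-ξ‖ ≤ l := by
    rw [norm_neg]; exact (norm_fst_le (ξ, η)).trans (le_max_right _ _)
  have hηl : ‖η‖ ≤ l := (norm_snd_le (ξ, η)).trans (le_max_right _ _)
  have hl0 : 0 ≤ l := (abs_nonneg ω).trans hωl
  have b1 := hC₁ _ huL' Mu hMu.norm_le s hs ω (-ξ)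
  have b2 := hC₂ v hvL Mv hMv.norm_le s hs ω η
  set W := (1 + |ω|) ^ (2 : ℝ) with hW
  have hW0 : 0 ≤ W := by positivity
  set X := (1 + l) ^ (-((N + 6 : ℕ) : ℝ)) with hX
  have hX0 : 0 ≤ X := by positivity
  have key : ‖fourierData α h c₀ (redB α h c₀ A') (modulate (-ξ) fun x => conj (u x)) s ω‖ *
      ‖fourierData α h c₀ (redB α h c₀ A) (modulate η v) s ω‖ ≤
      ((D₁ * Mu) * (C₂ * Mv) + (C₁ * Mu) * (D₂ * Mv)) * (W * W * X) := by
    rcases hcase with h1 | h1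
    · have b3 := hD₁ _ (contDiff_conj hu) huL' Mu hMu s hs ω (-ξ) l hωl hξl
        (fun x hx => by rw [sub_neg_eq_add]; exact h1 x hx)
      calc _ ≤ (D₁ * Mu * W * X) * (C₂ * Mv * W) :=
            mul_le_mul b3 b2 (norm_nonneg _) (by positivity)
        _ ≤ (D₁ * Mu * W * X) * (C₂ * Mv * W) + (C₁ * Mu * W) * (D₂ * Mv * W * X) :=
            le_add_of_nonneg_right (by positivity)
        _ = _ := by ring
    · have b3 := hD₂ v hv hvL Mv hMv s hs ω η l hωl hηl h1
      calc _ ≤ (C₁ * Mu * W) * (D₂ * Mv * W * X) :=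
            mul_le_mul b1 b3 (norm_nonneg _) (by positivity)
        _ ≤ (D₁ * Mu * W * X) * (C₂ * Mv * W) + (C₁ * Mu * W) * (D₂ * Mv * W * X) :=
            le_add_of_nonneg_left (by positivity)
        _ = _ := by ring
  exact key.trans (mul_le_mul_of_nonneg_left hw (by positivity))

/-- The slope of the cone of low frequencies, where no stationary points occur. -/
noncomputable def lowSlope (c₀ : ℝ) : ℝ := min (1 / 2) (c₀ / 8)

lemma lowSlope_pos (hc₀ : 0 < c₀) : 0 < lowSlope c₀ := by
  unfold lowSlope; positivity

lemma lowSlope_le_half : lowSlope c₀ ≤ 1 / 2 := min_le_left _ _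

lemma norm_gradient_bistaticDist_le (hh : 0 < h) (s : ℝ) (x : Plane) :
    ‖gradient (bistaticDist α h s) x‖ ≤ 4 := by
  rw [gradient_bistaticDist hh, EuclideanSpace.norm_eq, Real.sqrt_le_left (by norm_num)]
  obtain ⟨h0, h1⟩ := abs_distGrad_le hh (α := α) (s := s) (x := x)
  simp only [Fin.sum_univ_two, Real.norm_eq_abs, sq_abs]
  simp
  nlinarith [abs_le.1 h0, abs_le.1 h1]

/-- Since `‖∇R‖ ≤ 4` and `|ω| ≤ (c₀/8)‖(ξ, η)‖`, the vector `(ω/c₀)∇R` is at most half as long as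
`(ξ, η)`. In the maximum norm `‖(ξ, η)‖` is the length of `ξ` or of `η`, and the longer one cannot
be cancelled. -/
lemma low_nonstationary (hh : 0 < h) (hc₀ : 0 < c₀) {ω : ℝ} {ξ η : Plane}
    (hω : |ω| ≤ lowSlope c₀ * ‖(ξ, η)‖) (s : ℝ) :
    (∀ x, 1 / 2 * max |ω| ‖(ξ, η)‖ ≤ ‖(ω / c₀) • gradient (bistaticDist α h s) x + ξ‖) ∨
      ∀ y, 1 / 2 * max |ω| ‖(ξ, η)‖ ≤ ‖(ω / c₀) • gradient (bistaticDist α h s) y - η‖ := by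
  have hn := norm_nonneg (ξ, η)
  have h1 : |ω| ≤ ‖(ξ, η)‖ := hω.trans (by nlinarith [lowSlope_le_half (c₀ := c₀)])
  rw [max_eq_right h1]
  have h2 : ∀ x, ‖(ω / c₀) • gradient (bistaticDist α h s) x‖ ≤ 1 / 2 * ‖(ξ, η)‖ := by
    intro x
    rw [norm_smul, Real.norm_eq_abs, abs_div, abs_of_pos hc₀]
    have h3 := norm_gradient_bistaticDist_le (α := α) hh s x
    have h4 : |ω| / c₀ ≤ ‖(ξ, η)‖ / 8 := by
      rw [div_le_iff₀ hc₀]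
      refine hω.trans ?_
      have : lowSlope c₀ ≤ c₀ / 8 := min_le_right _ _
      nlinarith
    calc _ ≤ ‖(ξ, η)‖ / 8 * 4 := mul_le_mul h4 h3 (norm_nonneg _) (by positivity)
      _ = _ := by ring
  rcases le_total ‖η‖ ‖ξ‖ with hle | hle
  · left
    intro x
    have e : ‖(ξ, η)‖ = ‖ξ‖ := by rw [Prod.norm_def]; exact max_eq_left hle
    have h3 := norm_sub_norm_le ξ (-((ω / c₀) • gradient (bistaticDist α h s) x))
    rw [norm_neg, sub_neg_eq_add, add_comm] at h3
    have := h2 x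
    rw [e] at this ⊢
    linarith
  · right
    intro y
    have e : ‖(ξ, η)‖ = ‖η‖ := by rw [Prod.norm_def]; exact max_eq_right hle
    have h3 := norm_sub_norm_le η ((ω / c₀) • gradient (bistaticDist α h s) y)
    rw [norm_sub_rev] at h3
    have := h2 y
    rw [e] at this ⊢
    linarith

end Modulation

/-! ### Microlocal decay of the pairing -/

section Decay

variable {α h c₀ : ℝ} {Q U : Set (ℝ × ℝ)} {A A' A₁ A₂ : ℝ × ℝ × Plane → ℝ → ℂ} {V u v : Plane → ℂ}

/-- A cone around the direction `e`. -/
def cone (e : Plane × Plane) (ε : ℝ) : Set (Plane × Plane) := {w | ‖w - ‖w‖ • e‖ ≤ ε * ‖w‖}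

lemma cone_mono (e : Plane × Plane) {ε ε' : ℝ} (hε : ε ≤ ε') : cone e ε ⊆ cone e ε' := fun w hw =>
  (show ‖w - ‖w‖ • e‖ ≤ ε * ‖w‖ from hw).trans (mul_le_mul_of_nonneg_right hε (norm_nonneg w))

/-- The pairing of test functions near `x₀` and `y₀` decreases rapidly in a cone around `e`. -/
def Decays (α h c₀ : ℝ) (B' B : (ℝ × Plane) × ℝ → ℂ) (x₀ y₀ : Plane) (e : Plane × Plane) : Prop :=
  ∃ ρ : ℝ, 0 < ρ ∧ ∃ ε : ℝ, 0 < ε ∧ ∀ u v : Plane → ℂ, ContDiff ℝ (⊤ : ℕ∞) u →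
    tsupport u ⊆ Metric.closedBall x₀ ρ → ContDiff ℝ (⊤ : ℕ∞) v →
    tsupport v ⊆ Metric.closedBall y₀ ρ → ∀ N : ℕ, ∃ C : ℝ, ∀ ξ η : Plane, (ξ, η) ∈ cone e ε →
    ‖pairing α h c₀ B' B (modulate ξ u) (modulate η v)‖ ≤ C * (1 + ‖(ξ, η)‖) ^ (-(N : ℝ))

lemma pairIntegrand_eq_zero (hA : DataAmp α h c₀ Q U A) (B' : (ℝ × Plane) × ℝ → ℂ) {p : ℝ × ℝ}
    (hp : p.1 ∉ Prod.fst '' Q) :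
    pairIntegrand α h c₀ B' (redB α h c₀ A) u v p = 0 := by
  rw [pairIntegrand, hA.fourierData_eq_zero hp, mul_zero]

lemma continuous_pairIntegrand (hh : 0 < h) (hA' : DataAmp α h c₀ Q U A')
    (hA : DataAmp α h c₀ Q U A) (hu : ContDiff ℝ (⊤ : ℕ∞) u) (huc : HasCompactSupport u)
    (hv : ContDiff ℝ (⊤ : ℕ∞) v) (hvc : HasCompactSupport v) :
    Continuous (pairIntegrand α h c₀ (redB α h c₀ A') (redB α h c₀ A) u v) := by
  have huc' : HasCompactSupport fun x => conj (u x) :=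
    huc.comp_left (g := fun z : ℂ => conj z) (map_zero _)
  exact (Complex.continuous_conj.comp
    (hA'.continuous_fourierData hh (contDiff_conj hu) huc')).mul
    (hA.continuous_fourierData hh hv hvc)

lemma integrable_pairIntegrand (hh : 0 < h) (hc₀ : 0 < c₀) (hA' : DataAmp α h c₀ Q U A')
    (hA : DataAmp α h c₀ Q U A) (hu : ContDiff ℝ (⊤ : ℕ∞) u) (huc : HasCompactSupport u)
    (hv : ContDiff ℝ (⊤ : ℕ∞) v) (hvc : HasCompactSupport v) :
    Integrable (pairIntegrand α h c₀ (redB α h c₀ A') (redB α h c₀ A) u v) := by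
  have huc' : HasCompactSupport fun x => conj (u x) :=
    huc.comp_left (g := fun z : ℂ => conj z) (map_zero _)
  obtain ⟨C, hC0, hC⟩ := hA'.exists_fourierData_bound hh hc₀ (contDiff_conj hu) huc' 0
  obtain ⟨D, hD0, hD⟩ := hA.exists_fourierData_bound hh hc₀ hv hvc 2
  refine integrable_of_le_strip hA.compact_S (continuous_pairIntegrand hh hA' hA hu huc hv hvc)
    (C := C * D) (fun p hp => pairIntegrand_eq_zero hA _ hp) fun p _ => ?_
  rw [pairIntegrand, norm_mul, RCLike.norm_conj]
  have h1 := hC p.1 p.2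
  simp only [Nat.cast_zero, neg_zero, Real.rpow_zero, mul_one] at h1
  exact (mul_le_mul h1 (hD p.1 p.2) (norm_nonneg _) hC0).trans (le_of_eq (by ring))

lemma pairing_add (hh : 0 < h) (hc₀ : 0 < c₀) (hA' : DataAmp α h c₀ Q U A')
    (hA₁ : DataAmp α h c₀ Q U A₁) (hA₂ : DataAmp α h c₀ Q U A₂)
    (hu : ContDiff ℝ (⊤ : ℕ∞) u) (huc : HasCompactSupport u) (hv : ContDiff ℝ (⊤ : ℕ∞) v)
    (hvc : HasCompactSupport v) :
    pairing α h c₀ (redB α h c₀ A') (redB α h c₀ fun p ω => A₁ p ω + A₂ p ω) u v =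
      pairing α h c₀ (redB α h c₀ A') (redB α h c₀ A₁) u v +
      pairing α h c₀ (redB α h c₀ A') (redB α h c₀ A₂) u v := by
  have e1 : ∀ w, redB α h c₀ (fun p ω => A₁ p ω + A₂ p ω) w = redB α h c₀ A₁ w + redB α h c₀ A₂ w := by
    intro w
    have hs₁ := hA₁.ampFam.shiftAmp (α := α) (c₀ := c₀) hh
    have hs₂ := hA₂.ampFam.shiftAmp (α := α) (c₀ := c₀) hh
    have hr₁ := hA₁.ampFam.rSupp (α := α) (c₀ := c₀) hh
    have hr₂ := hA₂.ampFam.rSupp (α := α) (c₀ := c₀) hh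
    obtain ⟨ρ₁, hρ₁⟩ := hr₁ {w.1} isCompact_singleton
    obtain ⟨ρ₂, hρ₂⟩ := hr₂ {w.1} isCompact_singleton
    unfold redB redAmp
    rw [← integral_add (integrable_tHat hs₁ hr₁ () w.1 w.2) (integrable_tHat hs₂ hr₂ () w.1 w.2)]
    congr 1; ext σ
    unfold tHat
    rw [← integral_add
      (integrable_negChar_mul (hs₁.smooth ()).continuous (fun r => hρ₁ () w.1 rfl r _) σ)
      (integrable_negChar_mul (hs₂.smooth ()).continuous (fun r => hρ₂ () w.1 rfl r _) σ)]
    congr 1; ext r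
    simp only [shiftAmp]; ring
  have e2 : ∀ s ω, fourierData α h c₀ (redB α h c₀ fun p ω => A₁ p ω + A₂ p ω) v s ω =
      fourierData α h c₀ (redB α h c₀ A₁) v s ω + fourierData α h c₀ (redB α h c₀ A₂) v s ω := by
    intro s ω
    unfold fourierData
    rw [← integral_add
      (integrable_fourierData_integrand hh (hA₁.continuous_redB hh) hv.continuous hvc s ω)
      (integrable_fourierData_integrand hh (hA₂.continuous_redB hh) hv.continuous hvc s ω)]
    congr 1; ext y
    rw [e1]; ring
  unfold pairing
  refine Eq.trans ?_ (integral_add (integrable_pairIntegrand hh hc₀ hA' hA₁ hu huc hv hvc)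
    (integrable_pairIntegrand hh hc₀ hA' hA₂ hu huc hv hvc))
  congr 1; ext p
  simp only [e2]
  ring

lemma Decays.add (hh : 0 < h) (hc₀ : 0 < c₀) (hA' : DataAmp α h c₀ Q U A')
    (hA₁ : DataAmp α h c₀ Q U A₁) (hA₂ : DataAmp α h c₀ Q U A₂) {x₀ y₀ : Plane} {e : Plane × Plane}
    (h₁ : Decays α h c₀ (redB α h c₀ A') (redB α h c₀ A₁) x₀ y₀ e)
    (h₂ : Decays α h c₀ (redB α h c₀ A') (redB α h c₀ A₂) x₀ y₀ e) :
    Decays α h c₀ (redB α h c₀ A') (redB α h c₀ fun p ω => A₁ p ω + A₂ p ω) x₀ y₀ e := by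
  obtain ⟨ρ₁, hρ₁, ε₁, hε₁, H₁⟩ := h₁
  obtain ⟨ρ₂, hρ₂, ε₂, hε₂, H₂⟩ := h₂
  refine ⟨min ρ₁ ρ₂, lt_min hρ₁ hρ₂, min ε₁ ε₂, lt_min hε₁ hε₂, fun u v hu huL hv hvL N => ?_⟩
  obtain ⟨C₁, hC₁⟩ := H₁ u v hu (huL.trans (Metric.closedBall_subset_closedBall (min_le_left _ _)))
    hv (hvL.trans (Metric.closedBall_subset_closedBall (min_le_left _ _))) N
  obtain ⟨C₂, hC₂⟩ := H₂ u v hu (huL.trans (Metric.closedBall_subset_closedBall (min_le_right _ _)))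
    hv (hvL.trans (Metric.closedBall_subset_closedBall (min_le_right _ _))) N
  refine ⟨C₁ + C₂, fun ξ η hw => ?_⟩
  have huc : HasCompactSupport u :=
    (isCompact_closedBall _ _).of_isClosed_subset (isClosed_tsupport _) huL
  have hvc : HasCompactSupport v :=
    (isCompact_closedBall _ _).of_isClosed_subset (isClosed_tsupport _) hvL
  rw [pairing_add hh hc₀ hA' hA₁ hA₂ (contDiff_modulate ξ hu) (hasCompactSupport_modulate ξ huc)
    (contDiff_modulate η hv) (hasCompactSupport_modulate η hvc), add_mul]
  exact (norm_add_le _ _).trans (add_le_add (hC₁ ξ η (cone_mono e (min_le_left _ _) hw))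
    (hC₂ ξ η (cone_mono e (min_le_right _ _) hw)))

/-- For rapid decrease it is enough to consider high frequencies. -/
theorem decays_of_high (hh : 0 < h) (hc₀ : 0 < c₀) (hA' : DataAmp α h c₀ Q U A')
    (hA : DataAmp α h c₀ Q U A) {x₀ y₀ : Plane} {e : Plane × Plane} {ρ ε : ℝ} (hρ : 0 < ρ)
    (hε : 0 < ε) (H : ∀ u v : Plane → ℂ, ContDiff ℝ (⊤ : ℕ∞) u →
      tsupport u ⊆ Metric.closedBall x₀ ρ → ContDiff ℝ (⊤ : ℕ∞) v →
      tsupport v ⊆ Metric.closedBall y₀ ρ → ∀ N : ℕ, ∃ C : ℝ, 0 ≤ C ∧ ∀ ξ η : Plane,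
      (ξ, η) ∈ cone e ε → ∀ ω : ℝ, lowSlope c₀ * ‖(ξ, η)‖ < |ω| →
      ‖∫ s, pairIntegrand α h c₀ (redB α h c₀ A') (redB α h c₀ A) (modulate ξ u) (modulate η v)
        (s, ω)‖ ≤ C * ((1 + ‖(ξ, η)‖) ^ (-(N : ℝ)) * (1 + |ω|) ^ (-((2 : ℕ) : ℝ)))) :
    Decays α h c₀ (redB α h c₀ A') (redB α h c₀ A) x₀ y₀ e := by
  refine ⟨ρ, hρ, ε, hε, fun u v hu huL hv hvL N => ?_⟩
  have huc : HasCompactSupport u :=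
    (isCompact_closedBall _ _).of_isClosed_subset (isClosed_tsupport _) huL
  have hvc : HasCompactSupport v :=
    (isCompact_closedBall _ _).of_isClosed_subset (isClosed_tsupport _) hvL
  obtain ⟨C₁, hC₁0, hC₁⟩ := H u v hu huL hv hvL N
  obtain ⟨C₂, hC₂0, hC₂⟩ := norm_pairIntegrand_le_of_nonstationary hh hA' hA
    (isCompact_closedBall x₀ ρ) (isCompact_closedBall y₀ ρ) hu huL hv hvL
    (c := 1 / 2) (by norm_num) N
  let w : ℝ := (volume : Measure ℝ).real (Prod.fst '' Q)
  have hw : 0 ≤ w := measureReal_nonneg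
  refine ⟨(C₁ + C₂ * w) * ∫ ω : ℝ, (1 + |ω|) ^ (-((2 : ℕ) : ℝ)), fun ξ η hcone => ?_⟩
  set F := pairIntegrand α h c₀ (redB α h c₀ A') (redB α h c₀ A) (modulate ξ u) (modulate η v)
    with hF
  have hFi : Integrable F (volume.prod volume) := integrable_pairIntegrand hh hc₀ hA' hA
    (contDiff_modulate ξ hu) (hasCompactSupport_modulate ξ huc) (contDiff_modulate η hv)
    (hasCompactSupport_modulate η hvc)
  have e1 : pairing α h c₀ (redB α h c₀ A') (redB α h c₀ A) (modulate ξ u) (modulate η v) =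
      ∫ ω, ∫ s, F (s, ω) := integral_prod_symm F hFi
  rw [e1]
  have hb : ∀ ω : ℝ, ‖∫ s, F (s, ω)‖ ≤
      ((C₁ + C₂ * w) * (1 + ‖(ξ, η)‖) ^ (-(N : ℝ))) * (1 + |ω|) ^ (-((2 : ℕ) : ℝ)) := by
    intro ω
    rcases lt_or_ge (lowSlope c₀ * ‖(ξ, η)‖) |ω| with hω | hω
    · refine (hC₁ ξ η hcone ω hω).trans ?_
      rw [← mul_assoc]
      gcongr
      exact le_add_of_nonneg_right (by positivity)
    · have e2 : ∫ s, F (s, ω) = ∫ s in Prod.fst '' Q, F (s, ω) := by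
        rw [setIntegral_eq_integral_of_forall_compl_eq_zero]
        exact fun s hs => pairIntegrand_eq_zero hA _ hs
      rw [e2]
      refine (norm_setIntegral_le_of_norm_le_const hA.compact_S.measure_lt_top
        (fun s hs => hC₂ s hs ω ξ η ((low_nonstationary hh hc₀ hω s).imp
          (fun h1 x _ => h1 x) fun h1 y _ => h1 y))).trans ?_
      calc _ = C₂ * w * ((1 + ‖(ξ, η)‖) ^ (-(N : ℝ)) * (1 + |ω|) ^ (-((2 : ℕ) : ℝ))) := by ring
        _ ≤ (C₁ + C₂ * w) * ((1 + ‖(ξ, η)‖) ^ (-(N : ℝ)) * (1 + |ω|) ^ (-((2 : ℕ) : ℝ))) := by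
            gcongr
            exact le_add_of_nonneg_left hC₁0
        _ = _ := by ring
  refine (norm_integral_le_of_norm_le
    (one_add_abs_rpow_neg_two_integrable.const_mul _) (ae_of_all _ hb)).trans (le_of_eq ?_)
  rw [integral_const_mul]
  ring

lemma decays_of_redB_eq_zero (B' : (ℝ × Plane) × ℝ → ℂ) {B : (ℝ × Plane) × ℝ → ℂ} (hB : ∀ w, B w = 0)
    (x₀ y₀ : Plane) (e : Plane × Plane) : Decays α h c₀ B' B x₀ y₀ e := by
  refine ⟨1, one_pos, 1, one_pos, fun u v _ _ _ _ N => ⟨0, fun ξ η _ => ?_⟩⟩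
  simp [pairing, fourierData, hB]

end Decay

end BistaticSAR

namespace BistaticSAR

/-! ### Decay criteria: amplitudes vanishing on isochrones, and directions off the conormals -/

section LocalDecay

variable {α h c₀ : ℝ} {Q U : Set (ℝ × ℝ)} {A A' : ℝ × ℝ × Plane → ℝ → ℂ} {u v : Plane → ℂ}

/-- Where `|ω| > δ l`, powers of `1 + |ω|` control powers of `1 + l`, so decay in the frequency is
decay in the covector. The six extra powers play the same role as in `rapid_weights`. -/
lemma high_weights {l ω δ : ℝ} (hl : 0 ≤ l) (hδ : 0 < δ) (hδ1 : δ ≤ 1) (hω : δ * l < |ω|) (N : ℕ) :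
    (1 + |ω|) ^ ((4 : ℝ) - ((N + 6 : ℕ) : ℝ)) ≤
      (δ ^ N)⁻¹ * ((1 + l) ^ (-(N : ℝ)) * (1 + |ω|) ^ (-((2 : ℕ) : ℝ))) := by
  have h1 : δ * (1 + l) ≤ 1 + |ω| := by nlinarith
  have h2 : (1 + |ω|) ^ (-(N : ℝ)) ≤ (δ ^ N)⁻¹ * (1 + l) ^ (-(N : ℝ)) := by
    rw [Real.rpow_neg (by positivity), Real.rpow_neg (by positivity), Real.rpow_natCast,
      Real.rpow_natCast, ← mul_inv, ← mul_pow]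
    exact inv_anti₀ (by positivity) (pow_le_pow_left₀ (by positivity) h1 N)
  rw [show (4 : ℝ) - ((N + 6 : ℕ) : ℝ) = -(N : ℝ) + -((2 : ℕ) : ℝ) by push_cast; ring,
    Real.rpow_add (by positivity), ← mul_assoc]
  exact mul_le_mul_of_nonneg_right h2 (by positivity)

lemma norm_integral_slice_le (hA : DataAmp α h c₀ Q U A) (B' : (ℝ × Plane) × ℝ → ℂ) {ω b : ℝ}
    (hb : ∀ s ∈ Prod.fst '' Q, ‖pairIntegrand α h c₀ B' (redB α h c₀ A) u v (s, ω)‖ ≤ b) :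
    ‖∫ s, pairIntegrand α h c₀ B' (redB α h c₀ A) u v (s, ω)‖ ≤
      b * (volume : Measure ℝ).real (Prod.fst '' Q) := by
  have e2 : ∫ s, pairIntegrand α h c₀ B' (redB α h c₀ A) u v (s, ω) =
      ∫ s in Prod.fst '' Q, pairIntegrand α h c₀ B' (redB α h c₀ A) u v (s, ω) := by
    rw [setIntegral_eq_integral_of_forall_compl_eq_zero]
    exact fun s hs => pairIntegrand_eq_zero hA _ hs
  rw [e2]
  exact norm_setIntegral_le_of_norm_le_const hA.compact_S.measure_lt_top hb

/-- The data decrease rapidly if the amplitude vanishes on the isochrones through `L`. -/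
lemma norm_fourierData_modulate_le_of_vanish (hh : 0 < h) (hA : DataAmp α h c₀ Q U A)
    {L : Set Plane} (hL : IsCompact L) {δ : ℝ} (hδ : 0 < δ)
    (hz : ∀ s ∈ Prod.fst '' Q, ∀ y ∈ L, ∀ r ω, |r| < δ →
      A (s, r + bistaticDist α h s y / c₀, y) ω = 0) (N : ℕ) :
    ∃ C : ℝ, 0 ≤ C ∧ ∀ V : Plane → ℂ, tsupport V ⊆ L → ∀ M, (∀ y, ‖V y‖ ≤ M) →
      ∀ s ∈ Prod.fst '' Q, ∀ ω : ℝ, ∀ θ : Plane,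
      ‖fourierData α h c₀ (redB α h c₀ A) (modulate θ V) s ω‖ ≤
        C * M * (1 + |ω|) ^ ((2 : ℝ) - (N : ℝ)) := by
  have hZ : IsCompact ((Prod.fst '' Q) ×ˢ L) := hA.compact_S.prod hL
  obtain ⟨C, hC0, hC⟩ := norm_redAmp_le_of_vanish hZ subset_rfl hδ N
    (hA.ampFam.shiftAmp (α := α) (c₀ := c₀) hh) (hA.ampFam.rSupp hh)
    (fun _ p hp r ω hr => hz p.1 hp.1 p.2 hp.2 r ω hr)
  refine ⟨(volume : Measure Plane).real L * C, by positivity, fun V hVL M hM s hs ω θ => ?_⟩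
  rw [fourierData_modulate _ _ _ _ _ one_ne_zero]
  exact (norm_integral_wave_le_of_norm_le hL hVL hM (D := C * (1 + |ω|) ^ ((2 : ℝ) - (N : ℝ)))
    (by positivity) (fun y hy => hC () (s, y) ⟨hs, hy⟩ ω) _).trans (le_of_eq (by ring))

/-- Vanishing for small delay makes the reduced amplitude near `y₀` rapidly decreasing in `ω`, which
suffices at high frequencies. Oscillation is not needed there, so the direction `e` and the opening
of the cone are arbitrary. -/
lemma decays_of_vanish_right (hh : 0 < h) (hc₀ : 0 < c₀) (hA' : DataAmp α h c₀ Q U A')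
    (hA : DataAmp α h c₀ Q U A) {x₀ y₀ : Plane} (e : Plane × Plane) {ρ δ : ℝ} (hρ : 0 < ρ)
    (hδ : 0 < δ) (hz : ∀ s ∈ Prod.fst '' Q, ∀ y ∈ Metric.closedBall y₀ ρ, ∀ r ω, |r| < δ →
      A (s, r + bistaticDist α h s y / c₀, y) ω = 0) :
    Decays α h c₀ (redB α h c₀ A') (redB α h c₀ A) x₀ y₀ e := by
  refine decays_of_high hh hc₀ hA' hA hρ one_pos fun u v hu huL hv hvL N => ?_
  have huL' : tsupport (fun x => conj (u x)) ⊆ Metric.closedBall x₀ ρ :=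
    (tsupport_conj u).subset.trans huL
  obtain ⟨Mu, hMu⟩ := exists_derivBound (contDiff_conj hu)
    ((isCompact_closedBall x₀ ρ).of_isClosed_subset (isClosed_tsupport _) huL') 0
  obtain ⟨Mv, hMv⟩ := exists_derivBound hv
    ((isCompact_closedBall y₀ ρ).of_isClosed_subset (isClosed_tsupport _) hvL) 0
  have hMu0 := hMu.nonneg
  have hMv0 := hMv.nonneg
  obtain ⟨C₁, hC₁0, hC₁⟩ := norm_fourierData_modulate_le hh hA' (isCompact_closedBall x₀ ρ)
  obtain ⟨C₂, hC₂0, hC₂⟩ := norm_fourierData_modulate_le_of_vanish hh hA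
    (isCompact_closedBall y₀ ρ) hδ hz (N + 6)
  have hls := lowSlope_pos hc₀
  let w : ℝ := (volume : Measure ℝ).real (Prod.fst '' Q)
  have hw : 0 ≤ w := measureReal_nonneg
  refine ⟨(C₁ * Mu) * (C₂ * Mv) * w * (lowSlope c₀ ^ N)⁻¹, by positivity, fun ξ η _ ω hω => ?_⟩
  refine (norm_integral_slice_le hA _ (b := (C₁ * Mu) * (C₂ * Mv) *
    (1 + |ω|) ^ ((4 : ℝ) - ((N + 6 : ℕ) : ℝ))) fun s hs => ?_).trans ?_
  · rw [norm_pairIntegrand_modulate]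
    calc _ ≤ (C₁ * Mu * (1 + |ω|) ^ (2 : ℝ)) *
          (C₂ * Mv * (1 + |ω|) ^ ((2 : ℝ) - ((N + 6 : ℕ) : ℝ))) :=
          mul_le_mul (hC₁ _ huL' Mu hMu.norm_le s hs ω (-ξ)) (hC₂ v hvL Mv hMv.norm_le s hs ω η)
            (norm_nonneg _) (by positivity)
      _ = (C₁ * Mu) * (C₂ * Mv) * ((1 + |ω|) ^ (2 : ℝ) *
          (1 + |ω|) ^ ((2 : ℝ) - ((N + 6 : ℕ) : ℝ))) := by ring
      _ = _ := by
          rw [← Real.rpow_add (by positivity)]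
          congr 2; ring
  · have := high_weights (norm_nonneg (ξ, η)) hls (lowSlope_le_half.trans (by norm_num)) hω N
    calc _ = (C₁ * Mu) * (C₂ * Mv) * w * (1 + |ω|) ^ ((4 : ℝ) - ((N + 6 : ℕ) : ℝ)) := by ring
      _ ≤ (C₁ * Mu) * (C₂ * Mv) * w * ((lowSlope c₀ ^ N)⁻¹ *
          ((1 + ‖(ξ, η)‖) ^ (-(N : ℝ)) * (1 + |ω|) ^ (-((2 : ℕ) : ℝ)))) := by gcongr
      _ = _ := by ring

lemma decays_of_vanish_left (hh : 0 < h) (hc₀ : 0 < c₀) (hA' : DataAmp α h c₀ Q U A')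
    (hA : DataAmp α h c₀ Q U A) {x₀ y₀ : Plane} (e : Plane × Plane) {ρ δ : ℝ} (hρ : 0 < ρ)
    (hδ : 0 < δ) (hz : ∀ s ∈ Prod.fst '' Q, ∀ x ∈ Metric.closedBall x₀ ρ, ∀ r ω, |r| < δ →
      A' (s, r + bistaticDist α h s x / c₀, x) ω = 0) :
    Decays α h c₀ (redB α h c₀ A') (redB α h c₀ A) x₀ y₀ e := by
  refine decays_of_high hh hc₀ hA' hA hρ one_pos fun u v hu huL hv hvL N => ?_
  have huL' : tsupport (fun x => conj (u x)) ⊆ Metric.closedBall x₀ ρ :=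
    (tsupport_conj u).subset.trans huL
  obtain ⟨Mu, hMu⟩ := exists_derivBound (contDiff_conj hu)
    ((isCompact_closedBall x₀ ρ).of_isClosed_subset (isClosed_tsupport _) huL') 0
  obtain ⟨Mv, hMv⟩ := exists_derivBound hv
    ((isCompact_closedBall y₀ ρ).of_isClosed_subset (isClosed_tsupport _) hvL) 0
  have hMu0 := hMu.nonneg
  have hMv0 := hMv.nonneg
  obtain ⟨C₂, hC₂0, hC₂⟩ := norm_fourierData_modulate_le hh hA (isCompact_closedBall y₀ ρ)
  obtain ⟨C₁, hC₁0, hC₁⟩ := norm_fourierData_modulate_le_of_vanish hh hA'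
    (isCompact_closedBall x₀ ρ) hδ hz (N + 6)
  have hls := lowSlope_pos hc₀
  let w : ℝ := (volume : Measure ℝ).real (Prod.fst '' Q)
  have hw : 0 ≤ w := measureReal_nonneg
  refine ⟨(C₁ * Mu) * (C₂ * Mv) * w * (lowSlope c₀ ^ N)⁻¹, by positivity, fun ξ η _ ω hω => ?_⟩
  refine (norm_integral_slice_le hA _ (b := (C₁ * Mu) * (C₂ * Mv) *
    (1 + |ω|) ^ ((4 : ℝ) - ((N + 6 : ℕ) : ℝ))) fun s hs => ?_).trans ?_
  · rw [norm_pairIntegrand_modulate]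
    calc _ ≤ (C₁ * Mu * (1 + |ω|) ^ ((2 : ℝ) - ((N + 6 : ℕ) : ℝ))) *
          (C₂ * Mv * (1 + |ω|) ^ (2 : ℝ)) :=
          mul_le_mul (hC₁ _ huL' Mu hMu.norm_le s hs ω (-ξ)) (hC₂ v hvL Mv hMv.norm_le s hs ω η)
            (norm_nonneg _) (by positivity)
      _ = (C₁ * Mu) * (C₂ * Mv) * ((1 + |ω|) ^ (2 : ℝ) *
          (1 + |ω|) ^ ((2 : ℝ) - ((N + 6 : ℕ) : ℝ))) := by ring
      _ = _ := by
          rw [← Real.rpow_add (by positivity)]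
          congr 2; ring
  · have := high_weights (norm_nonneg (ξ, η)) hls (lowSlope_le_half.trans (by norm_num)) hω N
    calc _ = (C₁ * Mu) * (C₂ * Mv) * w * (1 + |ω|) ^ ((4 : ℝ) - ((N + 6 : ℕ) : ℝ)) := by ring
      _ ≤ (C₁ * Mu) * (C₂ * Mv) * w * ((lowSlope c₀ ^ N)⁻¹ *
          ((1 + ‖(ξ, η)‖) ^ (-(N : ℝ)) * (1 + |ω|) ^ (-((2 : ℕ) : ℝ)))) := by gcongr
      _ = _ := by ring

/-- Cutoffs in the data space may be moved between the factors of the pairing. -/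
lemma pairing_cutoff (hh : 0 < h) (hc₀ : 0 < c₀) (hA' : DataAmp α h c₀ Q U A')
    (hA : DataAmp α h c₀ Q U A) {κ : ℝ × ℝ → ℝ} (hκ : ContDiff ℝ (⊤ : ℕ∞) κ)
    (hu : ContDiff ℝ (⊤ : ℕ∞) u) (huc : HasCompactSupport u) (hv : ContDiff ℝ (⊤ : ℕ∞) v)
    (hvc : HasCompactSupport v) :
    pairing α h c₀ (redB α h c₀ A') (redB α h c₀ fun p ω => (κ (p.1, p.2.1) : ℂ) * A p ω) u v =
    pairing α h c₀ (redB α h c₀ fun p ω => (κ (p.1, p.2.1) : ℂ) * A' p ω) (redB α h c₀ A) u v := by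
  -- Both pairings equal, up to the same nonzero constant, the integral of `u` against one function:
  -- `κ` is real and multiplies the data pointwise, hence may be attributed to either factor.
  have h1 := integral_backproject_forward_mul hh hc₀ hA' (hA.cutoff hκ) hv hvc hu.continuous huc
  have h2 := integral_backproject_forward_mul hh hc₀ (hA'.cutoff hκ) hA hv hvc hu.continuous huc
  rw [backproject_forward_cutoff hh hc₀ hA hv hvc κ, h2] at h1
  have hk : ((1 / (2 * Real.pi) : ℝ) : ℂ) ≠ 0 := by
    rw [Complex.ofReal_ne_zero]; positivity
  exact (mul_left_cancel₀ hk h1).symm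

/-- The localization is placed on the right factor, whereas a cutoff away from the isochrones
through `x₀` helps only in the left one. -/
lemma Decays.move_cutoff (hh : 0 < h) (hc₀ : 0 < c₀) (hA' : DataAmp α h c₀ Q U A')
    (hA : DataAmp α h c₀ Q U A) {κ : ℝ × ℝ → ℝ} (hκ : ContDiff ℝ (⊤ : ℕ∞) κ) {x₀ y₀ : Plane}
    {e : Plane × Plane} (H : Decays α h c₀ (redB α h c₀ fun p ω => (κ (p.1, p.2.1) : ℂ) * A' p ω)
      (redB α h c₀ A) x₀ y₀ e) : Decays α h c₀ (redB α h c₀ A')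
      (redB α h c₀ fun p ω => (κ (p.1, p.2.1) : ℂ) * A p ω) x₀ y₀ e := by
  obtain ⟨ρ, hρ, ε, hε, H⟩ := H
  refine ⟨ρ, hρ, ε, hε, fun u v hu huL hv hvL N => ?_⟩
  obtain ⟨C, hC⟩ := H u v hu huL hv hvL N
  refine ⟨C, fun ξ η hw => ?_⟩
  rw [pairing_cutoff hh hc₀ hA' hA hκ (contDiff_modulate ξ hu) (hasCompactSupport_modulate ξ
    ((isCompact_closedBall _ _).of_isClosed_subset (isClosed_tsupport _) huL))
    (contDiff_modulate η hv) (hasCompactSupport_modulate η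
    ((isCompact_closedBall _ _).of_isClosed_subset (isClosed_tsupport _) hvL))]
  exact hC ξ η hw

/-- Rapid decrease in the directions that are not conormal to the phase. -/
lemma exists_decays_of_direction (hh : 0 < h) (hc₀ : 0 < c₀) {s₁ : ℝ} {x₀ y₀ : Plane}
    {e : Plane × Plane} (hne : ∀ ω a : ℝ, 0 ≤ a → max |ω| a = 1 →
      (ω / c₀) • gradient (bistaticDist α h s₁) x₀ + a • e.1 ≠ 0 ∨
      (ω / c₀) • gradient (bistaticDist α h s₁) y₀ - a • e.2 ≠ 0) :
    ∃ r : ℝ, 0 < r ∧ ∀ {Q U : Set (ℝ × ℝ)} {A A' : ℝ × ℝ × Plane → ℝ → ℂ},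
      DataAmp α h c₀ Q U A' → DataAmp α h c₀ Q U A →
      (∀ s t x ω, r ≤ |s - s₁| → A (s, t, x) ω = 0) →
      Decays α h c₀ (redB α h c₀ A') (redB α h c₀ A) x₀ y₀ e := by
  set gx := gradient (bistaticDist α h s₁) x₀ with hgx
  set gy := gradient (bistaticDist α h s₁) y₀ with hgy
  let m : ℝ × ℝ → ℝ := fun p => max ‖(p.1 / c₀) • gx + p.2 • e.1‖ ‖(p.1 / c₀) • gy - p.2 • e.2‖
  have hm : Continuous m := by fun_prop
  -- The unit sphere of the pairs of frequency `ω` and length `a` of the covector. By hypothesis the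
  -- two gradients at `(s₁, x₀, y₀)` do not vanish simultaneously on it, so their maximum has a
  -- positive minimum, and homogeneity extends the bound to all `(ω, a)`.
  let P : Set (ℝ × ℝ) := {p | 0 ≤ p.2 ∧ max |p.1| p.2 = 1}
  have hP : IsCompact P := by
    refine (isCompact_Icc.prod isCompact_Icc : IsCompact (Icc (-1 : ℝ) 1 ×ˢ Icc (0 : ℝ) 1)
      ).of_isClosed_subset ?_ ?_
    · exact (isClosed_le continuous_const continuous_snd).inter
        (isClosed_eq (by fun_prop) continuous_const)
    · rintro p ⟨h0, h1⟩
      have a1 := le_max_left |p.1| p.2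
      have a2 := le_max_right |p.1| p.2
      rw [h1] at a1 a2
      exact ⟨abs_le.1 a1, h0, a2⟩
  have hPne : P.Nonempty := ⟨(1, 0), le_rfl, by simp⟩
  obtain ⟨p₀, hp₀, hmin⟩ := hP.exists_isMinOn hPne hm.continuousOn
  have hm0 : 0 < m p₀ := by
    rcases hne p₀.1 p₀.2 hp₀.1 hp₀.2 with h1 | h1
    · exact lt_max_of_lt_left (norm_pos_iff.2 h1)
    · exact lt_max_of_lt_right (norm_pos_iff.2 h1)
  -- One quarter of the bound is spent on moving `s`, `x`, `y` off `s₁`, `x₀`, `y₀`, another on the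
  -- opening of the cone; the remaining half exceeds the required `c`.
  obtain ⟨c, hc, hmc⟩ : ∃ c : ℝ, 0 < c ∧ m p₀ = 4 * c := ⟨m p₀ / 4, by positivity, by ring⟩
  have hhom : ∀ ω a : ℝ, 0 ≤ a → 4 * c * max |ω| a ≤ m (ω, a) := by
    intro ω a ha
    rcases (le_max_of_le_right ha : (0 : ℝ) ≤ max |ω| a).eq_or_lt with h0 | h0
    · rw [← h0, mul_zero]
      exact le_max_of_le_left (norm_nonneg _)
    · set l := max |ω| a with hl
      have hmem : (ω / l, a / l) ∈ P := by
        refine ⟨by positivity, ?_⟩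
        rw [abs_div, abs_of_pos h0, max_div_div_right h0.le, ← hl, div_self h0.ne']
      have h2 : m p₀ ≤ m (ω / l, a / l) := hmin hmem
      have h3 : m (ω / l, a / l) = m (ω, a) / l := by
        simp only [m]
        rw [← max_div_div_right h0.le]
        have q1 : (ω / l / c₀) • gx + (a / l) • e.1 = l⁻¹ • ((ω / c₀) • gx + a • e.1) := by
          rw [smul_add, smul_smul, smul_smul]; congr 2 <;> ring
        have q2 : (ω / l / c₀) • gy - (a / l) • e.2 = l⁻¹ • ((ω / c₀) • gy - a • e.2) := by
          rw [smul_sub, smul_smul, smul_smul]; congr 2 <;> ring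
        rw [q1, q2, norm_smul, norm_smul, norm_inv, Real.norm_of_nonneg h0.le,
          ← div_eq_inv_mul, ← div_eq_inv_mul]
      rw [h3, hmc, le_div_iff₀ h0] at h2
      exact h2
  have hgc := continuous_gradient_bistaticDist (α := α) hh
  have hnear : ∀ z₀ : Plane, ∃ r : ℝ, 0 < r ∧ ∀ s z, |s - s₁| < r → dist z z₀ < r →
      ‖gradient (bistaticDist α h s) z - gradient (bistaticDist α h s₁) z₀‖ < c * c₀ := by
    intro z₀
    obtain ⟨r, hr, H⟩ := Metric.continuousAt_iff.1 (hgc.continuousAt (x := (s₁, z₀))) (c * c₀)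
      (by positivity)
    refine ⟨r, hr, fun s z hs hz => ?_⟩
    have := H (x := (s, z)) (by
      rw [Prod.dist_eq]
      exact max_lt (by rwa [Real.dist_eq]) hz)
    rwa [dist_eq_norm] at this
  obtain ⟨r₁, hr₁, H₁⟩ := hnear x₀
  obtain ⟨r₂, hr₂, H₂⟩ := hnear y₀
  have hr : 0 < min r₁ r₂ := lt_min hr₁ hr₂
  refine ⟨min r₁ r₂, hr, fun {Q U A A'} hA' hA hsupp => ?_⟩
  refine decays_of_high hh hc₀ hA' hA (ρ := min r₁ r₂ / 2) (ε := c) (by positivity) hc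
    fun u v hu huL hv hvL N => ?_
  obtain ⟨C, hC0, hC⟩ := norm_pairIntegrand_le_of_nonstationary hh hA' hA
    (isCompact_closedBall x₀ _) (isCompact_closedBall y₀ _) hu huL hv hvL hc N
  let w : ℝ := (volume : Measure ℝ).real (Prod.fst '' Q)
  have hw : 0 ≤ w := measureReal_nonneg
  refine ⟨C * w, by positivity, fun ξ η hcone ω _ => ?_⟩
  refine (norm_integral_slice_le hA _ (b := C * ((1 + ‖(ξ, η)‖) ^ (-(N : ℝ)) *
    (1 + |ω|) ^ (-((2 : ℕ) : ℝ)))) fun s hs => ?_).trans (le_of_eq (by ring))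
  -- Farther from `s₁` the right amplitude vanishes for all `t`, and so do its data.
  by_cases hsr : |s - s₁| < min r₁ r₂
  swap
  · have hB : ∀ y, redB α h c₀ A ((s, y), ω) = 0 := fun y => by
      simp [redB, redAmp, tHat, shiftAmp, hsupp s _ _ _ (not_lt.1 hsr)]
    have : pairIntegrand α h c₀ (redB α h c₀ A') (redB α h c₀ A) (modulate ξ u) (modulate η v)
        (s, ω) = 0 := by
      simp [pairIntegrand, fourierData, hB]
    rw [this, norm_zero]
    positivity
  refine hC s hs ω ξ η ?_
  have hcone' : ‖(ξ, η) - ‖(ξ, η)‖ • e‖ ≤ c * ‖(ξ, η)‖ := hcone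
  set a := ‖(ξ, η)‖ with ha
  have ha0 : 0 ≤ a := norm_nonneg _
  set l := max |ω| a with hl
  have hωl : |ω| ≤ l := le_max_left _ _
  have hal : a ≤ l := le_max_right _ _
  have hξ : ‖ξ - a • e.1‖ ≤ c * l := (norm_fst_le ((ξ, η) - a • e)).trans
    (hcone'.trans (mul_le_mul_of_nonneg_left hal hc.le))
  have hη : ‖η - a • e.2‖ ≤ c * l := (norm_snd_le ((ξ, η) - a • e)).trans
    (hcone'.trans (mul_le_mul_of_nonneg_left hal hc.le))
  have hgrad : ∀ {g g₀ : Plane}, ‖g - g₀‖ < c * c₀ → ‖(ω / c₀) • g₀ - (ω / c₀) • g‖ ≤ c * l := by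
    intro g g₀ hg
    rw [← smul_sub, norm_smul, norm_sub_rev, Real.norm_eq_abs, abs_div, abs_of_pos hc₀]
    calc |ω| / c₀ * ‖g - g₀‖ ≤ l / c₀ * (c * c₀) :=
          mul_le_mul (by gcongr) hg.le (norm_nonneg _) (by positivity)
      _ = c * l := by field_simp
  rcases le_max_iff.1 (hhom ω a ha0) with h1 | h1
  · left
    intro x hx
    have hx' : dist x x₀ < r₁ := lt_of_le_of_lt (Metric.mem_closedBall.1 hx) (by
      linarith [min_le_left r₁ r₂])
    have h2 := hgrad (H₁ s x (hsr.trans_le (min_le_left _ _)) hx')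
    have h3 : (ω / c₀) • gx + a • e.1 = ((ω / c₀) • gradient (bistaticDist α h s) x + ξ) +
        (((ω / c₀) • gx - (ω / c₀) • gradient (bistaticDist α h s) x) - (ξ - a • e.1)) := by abel
    have h4 := norm_add_le ((ω / c₀) • gradient (bistaticDist α h s) x + ξ)
      (((ω / c₀) • gx - (ω / c₀) • gradient (bistaticDist α h s) x) - (ξ - a • e.1))
    rw [← h3] at h4
    have h5 := norm_sub_le ((ω / c₀) • gx - (ω / c₀) • gradient (bistaticDist α h s) x)
      (ξ - a • e.1)
    have h6 : 0 ≤ c * l := by positivity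
    change 4 * c * l ≤ ‖(ω / c₀) • gx + a • e.1‖ at h1
    linarith
  · right
    intro y hy
    have hy' : dist y y₀ < r₂ := lt_of_le_of_lt (Metric.mem_closedBall.1 hy) (by
      linarith [min_le_right r₁ r₂])
    have h2 := hgrad (H₂ s y (hsr.trans_le (min_le_right _ _)) hy')
    have h3 : (ω / c₀) • gy - a • e.2 = ((ω / c₀) • gradient (bistaticDist α h s) y - η) +
        (((ω / c₀) • gy - (ω / c₀) • gradient (bistaticDist α h s) y) + (η - a • e.2)) := by abel
    have h4 := norm_add_le ((ω / c₀) • gradient (bistaticDist α h s) y - η)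
      (((ω / c₀) • gy - (ω / c₀) • gradient (bistaticDist α h s) y) + (η - a • e.2))
    rw [← h3] at h4
    have h5 := norm_add_le ((ω / c₀) • gy - (ω / c₀) • gradient (bistaticDist α h s) y)
      (η - a • e.2)
    have h6 : 0 ≤ c * l := by positivity
    change 4 * c * l ≤ ‖(ω / c₀) • gy - a • e.2‖ at h1
    linarith

end LocalDecay

end BistaticSAR

namespace BistaticSAR

/-! ### Nonstationary phase in the flight parameter -/

section StationaryInFlight

variable {α h c₀ : ℝ} {Q U : Set (ℝ × ℝ)} {A A' : ℝ × ℝ × Plane → ℝ → ℂ} {u v : Plane → ℂ}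

lemma hasDerivAt_bistaticDist_left (hh : 0 < h) (α s : ℝ) (x : Plane) :
    HasDerivAt (fun s => bistaticDist α h s x) (-distGrad₀ α h s x) s := by
  have h1 := ((contDiff_bistaticDist hh α).differentiable (by simp) (s, x)).hasFDerivAt
  have h2 : HasDerivAt (fun s : ℝ => (s, x)) ((1 : ℝ), (0 : Plane)) s :=
    (hasDerivAt_id s).prodMk (hasDerivAt_const s x)
  have h3 := h1.comp_hasDerivAt s h2
  rw [fderiv_bistaticDist hh α s 1 x 0] at h3
  have e : distGrad₀ α h s x * ((0 : Plane) 0 - 1) + distGrad₁ α h s x * (0 : Plane) 1 =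
      -distGrad₀ α h s x := by simp
  rwa [e] at h3

lemma continuous_distGrad₀ (hh : 0 < h) :
    Continuous fun z : ℝ × Plane => distGrad₀ α h z.1 z.2 := by
  have h1 := (contDiff_coord 0).continuous.comp (continuous_gradient_bistaticDist (α := α) hh)
  refine h1.congr fun z => ?_
  simp [gradient_bistaticDist hh]

/-- The phase of the kernel as a function of the flight parameter `s`. -/
noncomputable def flightPhase (α h c₀ : ℝ) (w : (ℝ × (Plane × Plane)) × ℝ) : ℝ :=
  w.1.1 * ((bistaticDist α h w.2 w.1.2.2 - bistaticDist α h w.2 w.1.2.1) / c₀)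

lemma contDiff_flightPhase (hh : 0 < h) : ContDiff ℝ (⊤ : ℕ∞) (flightPhase α h c₀) := by
  have h1 : ContDiff ℝ (⊤ : ℕ∞) fun w : (ℝ × (Plane × Plane)) × ℝ => bistaticDist α h w.2 w.1.2.2 :=
    contDiff_bistaticDist_comp hh α contDiff_snd (by fun_prop)
  have h2 : ContDiff ℝ (⊤ : ℕ∞) fun w : (ℝ × (Plane × Plane)) × ℝ => bistaticDist α h w.2 w.1.2.1 :=
    contDiff_bistaticDist_comp hh α contDiff_snd (by fun_prop)
  exact (contDiff_fst.comp contDiff_fst).mul ((h1.sub h2).div_const c₀)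

lemma fderiv_flightPhase (hh : 0 < h) (p : ℝ × (Plane × Plane)) (s : ℝ) :
    fderiv ℝ (flightPhase α h c₀) (p, s) (0, 1) =
      p.1 * ((distGrad₀ α h s p.2.1 - distGrad₀ α h s p.2.2) / c₀) := by
  rw [← fderiv_slice_right (contDiff_flightPhase hh), fderiv_apply_one_eq_deriv]
  have h1 := (((hasDerivAt_bistaticDist_left hh α s p.2.2).sub
    (hasDerivAt_bistaticDist_left hh α s p.2.1)).div_const c₀).const_mul p.1
  refine Eq.trans h1.deriv ?_
  ring

/-- The amplitude of the pairing. -/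
noncomputable def pairAmp (B' B : (ℝ × Plane) × ℝ → ℂ) (w : (ℝ × (Plane × Plane)) × ℝ) : ℂ :=
  B ((w.1.1, w.1.2.2), w.2) * conj (B' ((w.1.1, w.1.2.1), w.2))

lemma symFam_pairAmp (hh : 0 < h) (hA' : DataAmp α h c₀ Q U A') (hA : DataAmp α h c₀ Q U A) :
    SymFam (fun _ : Unit => pairAmp (redB α h c₀ A') (redB α h c₀ A)) 4 := by
  have h1 := (hA.redB hh).comp (Φ := fun q : ℝ × (Plane × Plane) => (q.1, q.2.2)) (by fun_prop)
  have h2 := ((hA'.redB hh).comp (Φ := fun q : ℝ × (Plane × Plane) => (q.1, q.2.1))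
    (by fun_prop)).conj
  have h3 := h1.mul h2
  rw [show (2 : ℝ) + 2 = 4 by norm_num] at h3
  exact h3

lemma redB_eq_zero_of_forall {s : ℝ} (hs : ∀ t x ω, A (s, t, x) ω = 0) (y : Plane) (ω : ℝ) :
    redB α h c₀ A ((s, y), ω) = 0 := by
  simp [redB, redAmp, tHat, shiftAmp, hs]

/-- Nonstationary phase in the flight parameter. -/
lemma norm_integral_flight_le (hh : 0 < h) (hc₀ : 0 < c₀) (hA' : DataAmp α h c₀ Q U A')
    (hA : DataAmp α h c₀ Q U A) {a b : ℝ} (hJ : ∀ s t x ω, s ∉ Icc a b → A (s, t, x) ω = 0)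
    {Z : Set (Plane × Plane)} (hZ : IsCompact Z) (hne : ∀ s ∈ Icc a b, ∀ z ∈ Z,
      distGrad₀ α h s z.1 ≠ distGrad₀ α h s z.2) (N : ℕ) :
    ∃ C : ℝ, 0 ≤ C ∧ ∀ z ∈ Z, ∀ ω : ℝ,
      ‖∫ s, cis (ω * ((bistaticDist α h s z.2 - bistaticDist α h s z.1) / c₀)) *
        pairAmp (redB α h c₀ A') (redB α h c₀ A) ((s, z), ω)‖ ≤
      C * (1 + |ω|) ^ ((4 : ℝ) - (N : ℝ)) := by
  have hsym := symFam_pairAmp hh hA' hA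
  have hsm := hsym.smooth ()
  obtain ⟨D, hD0, hD⟩ := hsym.symBound.uniform ((isCompact_Icc (a := a) (b := b)).prod hZ) N
  have hzero : ∀ s z ω, s ∉ Icc a b →
      pairAmp (redB α h c₀ A') (redB α h c₀ A) ((s, z), ω) = 0 := fun s z ω hs => by
    rw [pairAmp, redB_eq_zero_of_forall (fun t x ω => hJ s t x ω hs), zero_mul]
  have hbd : ∀ z ∈ Z, ∀ ω : ℝ, DerivBound N
      (fun s => pairAmp (redB α h c₀ A') (redB α h c₀ A) ((s, z), ω)) (D * (1 + |ω|) ^ (4 : ℝ)) := by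
    intro z hz ω j hj s
    by_cases hs : s ∈ Icc a b
    · have h1 := norm_iteratedFDeriv_slice_le (f := fun q : ℝ × (Plane × Plane) =>
        pairAmp (redB α h c₀ A') (redB α h c₀ A) (q, ω)) (hsm.comp (by fun_prop)) j s z
      exact h1.trans ((norm_iteratedFDeriv_slice_le hsm j (s, z) ω).trans
        (hD j hj () (s, z) ⟨hs, hz⟩ ω))
    · have h1 : s ∉ tsupport fun s => pairAmp (redB α h c₀ A') (redB α h c₀ A) ((s, z), ω) :=
        fun hmem => hs (closure_minimal (fun s' hs' => by
          by_contra hcon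
          exact hs' (hzero s' z ω hcon)) isClosed_Icc hmem)
      have h2 := fun hcon => h1 (support_iteratedFDeriv_subset (𝕜 := ℝ) j hcon)
      rw [Function.notMem_support.1 h2, norm_zero]
      positivity
  -- The phase parameter is the sign of `ω` together with the pair of ground points, and `|ω|` is
  -- the large parameter. The derivative of the phase in `s` is a nonzero multiple of the difference
  -- of the Doppler shifts.
  obtain ⟨C, hC0, hC⟩ := norm_integral_le_of_nonstationary (volume : Measure ℝ)
    (contDiff_flightPhase (α := α) (c₀ := c₀) hh) (fun _ : Unit => (1 : ℝ))
    (K := (({1, -1} : Set ℝ) ×ˢ Z) ×ˢ Icc a b)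
    ((((toFinite {1, -1}).isCompact).prod hZ).prod isCompact_Icc)
    (fun w hw => ⟨(), by
      have e : w = (w.1, w.2) := rfl
      rw [e, fderiv_flightPhase hh]
      have h1 : w.1.1 ≠ 0 := by
        rcases hw.1.1 with h1 | h1
        · rw [h1]; norm_num
        · rw [mem_singleton_iff.1 h1]; norm_num
      exact mul_ne_zero h1 (div_ne_zero (sub_ne_zero.2 (hne _ hw.2 _ hw.1.2)) hc₀.ne')⟩) N
  refine ⟨C * D * 2 ^ N + D * (volume : Measure ℝ).real (Icc a b) * 2 ^ N,
    by positivity, fun z hz ω => ?_⟩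
  have hW : (1 + |ω|) ^ ((4 : ℝ) - (N : ℝ)) = (1 + |ω|) ^ (4 : ℝ) * (1 + |ω|) ^ (-(N : ℝ)) := by
    rw [← Real.rpow_add (by positivity)]; rfl
  rw [hW]
  rcases le_total |ω| 1 with hω | hω
  · have h1 := one_le_two_pow_mul (abs_nonneg ω) hω N
    have e : ∀ f : ℝ → ℂ, (∀ s, s ∉ Icc a b → f s = 0) → ∫ s, f s = ∫ s in Icc a b, f s :=
      fun f hf => (setIntegral_eq_integral_of_forall_compl_eq_zero hf).symm
    rw [e _ fun s hs => by rw [hzero s z ω hs, mul_zero]]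
    have h2 := norm_setIntegral_le_of_norm_le_const (μ := (volume : Measure ℝ)) (s := Icc a b)
      (f := fun s => cis (ω * ((bistaticDist α h s z.2 - bistaticDist α h s z.1) / c₀)) *
        pairAmp (redB α h c₀ A') (redB α h c₀ A) ((s, z), ω)) (C := D * (1 + |ω|) ^ (4 : ℝ))
      isCompact_Icc.measure_lt_top fun s _ => by
        rw [norm_cis_mul]; exact (hbd z hz ω).norm_le s
    calc _ ≤ D * (1 + |ω|) ^ (4 : ℝ) * (volume : Measure ℝ).real (Icc a b) * 1 := by
          rw [mul_one]; exact h2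
      _ ≤ D * (1 + |ω|) ^ (4 : ℝ) * (volume : Measure ℝ).real (Icc a b) *
          (2 ^ N * (1 + |ω|) ^ (-(N : ℝ))) := by gcongr
      _ ≤ C * D * 2 ^ N * ((1 + |ω|) ^ (4 : ℝ) * (1 + |ω|) ^ (-(N : ℝ))) +
          D * (1 + |ω|) ^ (4 : ℝ) * (volume : Measure ℝ).real (Icc a b) *
          (2 ^ N * (1 + |ω|) ^ (-(N : ℝ))) := le_add_of_nonneg_left (by positivity)
      _ = _ := by ring
  · obtain ⟨θ, hθ, hθω⟩ : ∃ θ : ℝ, θ ∈ ({1, -1} : Set ℝ) ∧ |ω| * θ = ω := by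
      rcases abs_choice ω with h1 | h1
      · exact ⟨1, Or.inl rfl, by rw [h1, mul_one]⟩
      · exact ⟨-1, Or.inr rfl, by rw [h1]; ring⟩
    have h0 : 0 < |ω| := by linarith
    have h1 := hC (θ, z) (fun s => pairAmp (redB α h c₀ A') (redB α h c₀ A) ((s, z), ω))
      (hsm.comp (by fun_prop)) (fun s hs => ⟨⟨hθ, hz⟩, by
        by_contra hcon
        exact hs (hzero s z ω hcon)⟩) _ (hbd z hz ω) |ω| h0
    simp only [flightPhase, ← mul_assoc, hθω] at h1
    have h2 := inv_pow_le_two_pow hω N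
    calc _ ≤ C * (D * (1 + |ω|) ^ (4 : ℝ)) / |ω| ^ N := by
          rw [← mul_assoc C]
          exact h1
      _ = C * (D * (1 + |ω|) ^ (4 : ℝ)) * (1 / |ω| ^ N) := by ring
      _ ≤ C * (D * (1 + |ω|) ^ (4 : ℝ)) * (2 ^ N * (1 + |ω|) ^ (-(N : ℝ))) := by gcongr
      _ ≤ C * (D * (1 + |ω|) ^ (4 : ℝ)) * (2 ^ N * (1 + |ω|) ^ (-(N : ℝ))) +
          D * (volume : Measure ℝ).real (Icc a b) * 2 ^ N *
            ((1 + |ω|) ^ (4 : ℝ) * (1 + |ω|) ^ (-(N : ℝ))) := le_add_of_nonneg_right (by positivity)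
      _ = _ := by ring

/-- The pairing as an integral over `x` and `y` of integrals over the flight parameter. -/
lemma integral_pairIntegrand_eq (hh : 0 < h) (hA' : DataAmp α h c₀ Q U A')
    (hA : DataAmp α h c₀ Q U A) (hu : Continuous u) (huc : HasCompactSupport u)
    (hv : Continuous v) (hvc : HasCompactSupport v) (ω : ℝ) :
    ∫ s, pairIntegrand α h c₀ (redB α h c₀ A') (redB α h c₀ A) u v (s, ω) =
      ∫ z : Plane × Plane, (u z.1 * v z.2) *
        ∫ s, cis (ω * ((bistaticDist α h s z.2 - bistaticDist α h s z.1) / c₀)) *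
          pairAmp (redB α h c₀ A') (redB α h c₀ A) ((s, z), ω) := by
  let G : ℝ → Plane × Plane → ℂ := fun s z => (u z.1 * v z.2) *
    (cis (ω * ((bistaticDist α h s z.2 - bistaticDist α h s z.1) / c₀)) *
      pairAmp (redB α h c₀ A') (redB α h c₀ A) ((s, z), ω))
  have hG : Continuous (Function.uncurry G) := by
    have h1 : Continuous fun w : ℝ × (Plane × Plane) => bistaticDist α h w.1 w.2.2 :=
      (contDiff_bistaticDist_comp hh α contDiff_fst (contDiff_snd.comp contDiff_snd)).continuous
    have h2 : Continuous fun w : ℝ × (Plane × Plane) => bistaticDist α h w.1 w.2.1 :=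
      (contDiff_bistaticDist_comp hh α contDiff_fst (contDiff_fst.comp contDiff_snd)).continuous
    have h3 : Continuous fun w : ℝ × (Plane × Plane) =>
        pairAmp (redB α h c₀ A') (redB α h c₀ A) (w, ω) :=
      ((symFam_pairAmp hh hA' hA).smooth ()).continuous.comp (by fun_prop)
    have h4 := continuous_cis
    exact ((hu.comp (continuous_fst.comp continuous_snd)).mul
      (hv.comp (continuous_snd.comp continuous_snd))).mul
      ((h4.comp (continuous_const.mul ((h1.sub h2).div_const c₀))).mul h3)
  have hGc : HasCompactSupport (Function.uncurry G) := by
    refine HasCompactSupport.intro (hA.compact_S.prod (huc.isCompact.prod hvc.isCompact))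
      fun w hw => ?_
    rw [Function.uncurry]
    simp only [G]
    by_cases h1 : w.1 ∈ Prod.fst '' Q
    · by_cases h2 : w.2.1 ∈ tsupport u
      · have h3 : w.2.2 ∉ tsupport v := fun h3 => hw ⟨h1, h2, h3⟩
        simp [image_eq_zero_of_notMem_tsupport h3]
      · simp [image_eq_zero_of_notMem_tsupport h2]
    · rw [pairAmp, hA.redB_eq_zero h1, zero_mul, mul_zero, mul_zero]
  have hGi : Integrable (Function.uncurry G) (volume.prod (volume : Measure (Plane × Plane))) :=
    hG.integrable_of_hasCompactSupport hGc
  have e1 : ∀ s, pairIntegrand α h c₀ (redB α h c₀ A') (redB α h c₀ A) u v (s, ω) =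
      ∫ z, G s z := by
    intro s
    rw [pairIntegrand, conj_fourierData, fourierData]
    refine (integral_prod_mul _ _).symm.trans ?_
    congr 1; ext z
    simp only [G, pairAmp]
    have e2 : ω * ((bistaticDist α h s z.2 - bistaticDist α h s z.1) / c₀) =
        -(ω * (bistaticDist α h s z.1 / c₀)) + ω * (bistaticDist α h s z.2 / c₀) := by ring
    rw [e2, cis_add, ← cis]
    ring
  simp_rw [e1]
  rw [integral_integral_swap hGi]
  congr 1; ext z
  exact integral_const_mul _ _

/-- Rapid decrease where the phase is not stationary in the flight parameter. -/
lemma decays_of_distGrad_ne (hh : 0 < h) (hc₀ : 0 < c₀) (hA' : DataAmp α h c₀ Q U A')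
    (hA : DataAmp α h c₀ Q U A) {x₀ y₀ : Plane} (e : Plane × Plane) {a b ρ : ℝ} (hρ : 0 < ρ)
    (hJ : ∀ s t x ω, s ∉ Icc a b → A (s, t, x) ω = 0)
    (hne : ∀ s ∈ Icc a b, ∀ x ∈ Metric.closedBall x₀ ρ, ∀ y ∈ Metric.closedBall y₀ ρ,
      distGrad₀ α h s x ≠ distGrad₀ α h s y) :
    Decays α h c₀ (redB α h c₀ A') (redB α h c₀ A) x₀ y₀ e := by
  refine decays_of_high hh hc₀ hA' hA hρ one_pos fun u v hu huL hv hvL N => ?_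
  have huc : HasCompactSupport u :=
    (isCompact_closedBall _ _).of_isClosed_subset (isClosed_tsupport _) huL
  have hvc : HasCompactSupport v :=
    (isCompact_closedBall _ _).of_isClosed_subset (isClosed_tsupport _) hvL
  let Z : Set (Plane × Plane) := Metric.closedBall x₀ ρ ×ˢ Metric.closedBall y₀ ρ
  have hZ : IsCompact Z := (isCompact_closedBall _ _).prod (isCompact_closedBall _ _)
  obtain ⟨C, hC0, hC⟩ := norm_integral_flight_le hh hc₀ hA' hA hJ hZ
    (fun s hs z hz => hne s hs z.1 hz.1 z.2 hz.2) (N + 6)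
  obtain ⟨Mu, hMu⟩ := hu.continuous.bounded_above_of_compact_support huc
  obtain ⟨Mv, hMv⟩ := hv.continuous.bounded_above_of_compact_support hvc
  have hMu0 : 0 ≤ Mu := (norm_nonneg _).trans (hMu 0)
  have hMv0 : 0 ≤ Mv := (norm_nonneg _).trans (hMv 0)
  have hls := lowSlope_pos hc₀
  let w : ℝ := (volume : Measure (Plane × Plane)).real Z
  have hw : 0 ≤ w := measureReal_nonneg
  refine ⟨Mu * Mv * C * w * (lowSlope c₀ ^ N)⁻¹, by positivity, fun ξ η _ ω hω => ?_⟩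
  -- The modulations do not depend on `s` and have modulus one. Integrating over `s` first gives
  -- decay in `ω` uniformly in `(ξ, η)`, and high frequencies convert it into decay in `(ξ, η)`.
  rw [integral_pairIntegrand_eq hh hA' hA (contDiff_modulate ξ hu).continuous
    (hasCompactSupport_modulate ξ huc) (contDiff_modulate η hv).continuous
    (hasCompactSupport_modulate η hvc)]
  rw [← setIntegral_eq_integral_of_forall_compl_eq_zero (s := Z) fun z hz => by
    rcases not_and_or.1 hz with h1 | h1
    · simp [modulate, image_eq_zero_of_notMem_tsupport fun h2 => h1 (huL h2)]
    · simp [modulate, image_eq_zero_of_notMem_tsupport fun h2 => h1 (hvL h2)]]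
  refine (norm_setIntegral_le_of_norm_le_const (C := Mu * Mv *
    (C * (1 + |ω|) ^ ((4 : ℝ) - ((N + 6 : ℕ) : ℝ)))) hZ.measure_lt_top fun z hz => ?_).trans ?_
  · rw [norm_mul, norm_mul, modulate, modulate, norm_cis_mul, norm_cis_mul]
    exact mul_le_mul (mul_le_mul (hMu _) (hMv _) (norm_nonneg _) hMu0) (hC z hz ω) (norm_nonneg _)
      (by positivity)
  · have := high_weights (norm_nonneg (ξ, η)) hls (lowSlope_le_half.trans (by norm_num)) hω N
    calc _ = Mu * Mv * C * w * (1 + |ω|) ^ ((4 : ℝ) - ((N + 6 : ℕ) : ℝ)) := by ring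
      _ ≤ Mu * Mv * C * w * ((lowSlope c₀ ^ N)⁻¹ *
          ((1 + ‖(ξ, η)‖) ^ (-(N : ℝ)) * (1 + |ω|) ^ (-((2 : ℕ) : ℝ)))) := by gcongr
      _ = _ := by ring

end StationaryInFlight

end BistaticSAR

namespace BistaticSAR

/-! ### Localization in the data space -/

section Localization

variable {α h c₀ : ℝ} {Q U : Set (ℝ × ℝ)} {A : ℝ × ℝ × Plane → ℝ → ℂ}

/-- Cutoffs near a point of the data space off the isochrones through `z₀` vanish on the isochrones
near `z₀`. -/
lemma exists_cutoff_eq_zero (hh : 0 < h) (α c₀ : ℝ) {q : ℝ × ℝ} {z₀ : Plane}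
    (hq : q.2 ≠ bistaticDist α h q.1 z₀ / c₀) : ∃ r : ℝ, 0 < r ∧ ∃ ρ : ℝ, 0 < ρ ∧
      ∃ δ : ℝ, 0 < δ ∧ ∀ κ : ℝ × ℝ → ℝ, (∀ p, κ p ≠ 0 → p ∈ Metric.ball q r) →
      ∀ s, ∀ y ∈ Metric.closedBall z₀ ρ, ∀ t, |t| < δ →
        κ (s, t + bistaticDist α h s y / c₀) = 0 := by
  have hd : 0 < |q.2 - bistaticDist α h q.1 z₀ / c₀| := abs_pos.2 (sub_ne_zero.2 hq)
  set d := |q.2 - bistaticDist α h q.1 z₀ / c₀| with hd_def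
  have hcont : Continuous fun z : ℝ × Plane => bistaticDist α h z.1 z.2 / c₀ :=
    (contDiff_bistaticDist hh α).continuous.div_const c₀
  -- The gap `d` between `q.2` and the isochrone time is split in quarters: one for the radius of
  -- the cutoff, one for the variation of `R/c₀`, one for the delay. Together they stay below `d`,
  -- so the support of `κ` misses the isochrones.
  obtain ⟨r, hr, H⟩ := Metric.continuousAt_iff.1 (hcont.continuousAt (x := (q.1, z₀))) (d / 4)
    (by positivity)
  refine ⟨min r (d / 4), by positivity, r / 2, by positivity, d / 4, by positivity,
    fun κ hκ s y hy t ht => ?_⟩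
  by_contra hne
  have h1 := Metric.mem_ball.1 (hκ _ hne)
  rw [Prod.dist_eq, max_lt_iff] at h1
  have h2 := H (x := (s, y)) (by
    rw [Prod.dist_eq]
    exact max_lt (h1.1.trans_le (min_le_left _ _))
      (lt_of_le_of_lt (Metric.mem_closedBall.1 hy) (by linarith)))
  have h3 := h1.2.trans_le (min_le_right _ _)
  simp only [Real.dist_eq] at h2 h3
  have h4 : q.2 - bistaticDist α h q.1 z₀ / c₀ = -(t + bistaticDist α h s y / c₀ - q.2) + t +
      (bistaticDist α h s y / c₀ - bistaticDist α h q.1 z₀ / c₀) := by ring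
  rw [h4] at hd_def
  have h5 := (abs_add_le (-(t + bistaticDist α h s y / c₀ - q.2) + t)
    (bistaticDist α h s y / c₀ - bistaticDist α h q.1 z₀ / c₀))
  have h6 := abs_add_le (-(t + bistaticDist α h s y / c₀ - q.2)) t
  rw [abs_neg] at h6
  linarith

/-- Rapid decrease of the contribution of the data near one point. -/
theorem exists_decays_near (hα : 0 < α) (hh : 0 < h) (hc₀ : 0 < c₀) (hA : DataAmp α h c₀ Q U A)
    {q : ℝ × ℝ} (hq : q ∈ Q) {x₀ y₀ : Plane} {e : Plane × Plane}
    (he : y₀ = x₀ ∨ y₀ = reflect x₀ → ∀ s ∈ Prod.fst '' Q, ∀ τ : ℝ,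
      e.1 = -(τ • gradient (bistaticDist α h s) x₀) →
      e.2 ≠ τ • gradient (bistaticDist α h s) y₀) :
    ∃ r : ℝ, 0 < r ∧ ∀ κ : ℝ × ℝ → ℝ, ContDiff ℝ (⊤ : ℕ∞) κ →
      (∀ p, κ p ≠ 0 → p ∈ Metric.ball q r) → Decays α h c₀ (redB α h c₀ A)
        (redB α h c₀ fun p ω => (κ (p.1, p.2.1) : ℂ) * A p ω) x₀ y₀ e := by
  -- Near points of `U` the amplitude is zero, so the localized factor vanishes identically.
  by_cases hU : q ∈ U
  · obtain ⟨r, hr, hball⟩ := Metric.isOpen_iff.1 hA.isOpen q hU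
    refine ⟨r, hr, fun κ hκ hsupp => decays_of_redB_eq_zero _ (fun w => ?_) x₀ y₀ e⟩
    refine redB_eq_zero_of_forall (fun t x ω => ?_) w.1.2 w.2
    by_cases h0 : κ (w.1.1, t) = 0
    · simp [h0]
    · rw [hA.vanish _ _ _ _ (hball (hsupp _ h0)), mul_zero]
  -- Data near `q` contribute only if `q` lies on the isochrones through both ground points:
  -- otherwise the cut-off amplitude vanishes for small delay at `y₀`, or, after moving the cutoff
  -- to the left factor, at `x₀`.
  by_cases hy : q.2 = bistaticDist α h q.1 y₀ / c₀
  swap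
  · obtain ⟨r, hr, ρ, hρ, δ, hδ, H⟩ := exists_cutoff_eq_zero hh α c₀ hy
    refine ⟨r, hr, fun κ hκ hsupp => decays_of_vanish_right hh hc₀ hA (hA.cutoff hκ) e hρ hδ
      fun s _ y hy t ω ht => ?_⟩
    simp [H κ hsupp s y hy t ht]
  by_cases hx : q.2 = bistaticDist α h q.1 x₀ / c₀
  swap
  · obtain ⟨r, hr, ρ, hρ, δ, hδ, H⟩ := exists_cutoff_eq_zero hh α c₀ hx
    refine ⟨r, hr, fun κ hκ hsupp => Decays.move_cutoff hh hc₀ hA hA hκ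
      (decays_of_vanish_left hh hc₀ (hA.cutoff hκ) hA e hρ hδ fun s _ y hy t ω ht => ?_)⟩
    simp [H κ hsupp s y hy t ht]
  have hclose : ∀ {s r : ℝ} {κ : ℝ × ℝ → ℝ}, (∀ p, κ p ≠ 0 → p ∈ Metric.ball q r) →
      r ≤ |s - q.1| → ∀ t (x : Plane) ω, (κ (s, t) : ℂ) * A (s, t, x) ω = 0 := by
    intro s r κ hsupp hs t x ω
    have h0 : κ (s, t) = 0 := by
      by_contra hne
      have h1 := Metric.mem_ball.1 (hsupp _ hne)
      rw [Prod.dist_eq, max_lt_iff] at h1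
      exact absurd h1.1 (not_lt.2 hs)
    rw [h0, Complex.ofReal_zero, zero_mul]
  -- Different Doppler shifts at `q.1` remain different for nearby `s`, `x`, `y`, and the phase is
  -- not stationary in `s`.
  by_cases hD : distGrad₀ α h q.1 x₀ = distGrad₀ α h q.1 y₀
  swap
  · have hcont : Continuous fun z : ℝ × (Plane × Plane) =>
        distGrad₀ α h z.1 z.2.1 - distGrad₀ α h z.1 z.2.2 :=
      ((continuous_distGrad₀ hh).comp (continuous_fst.prodMk (continuous_fst.comp
        continuous_snd))).sub ((continuous_distGrad₀ hh).comp (continuous_fst.prodMk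
          (continuous_snd.comp continuous_snd)))
    obtain ⟨r, hr, H⟩ := Metric.isOpen_iff.1 (isOpen_ne_fun hcont continuous_const)
      (q.1, (x₀, y₀)) (sub_ne_zero.2 hD)
    refine ⟨r / 2, by positivity, fun κ hκ hsupp => decays_of_distGrad_ne hh hc₀ hA
      (hA.cutoff hκ) (a := q.1 - r / 2) (b := q.1 + r / 2) (ρ := r / 2) e (by positivity)
      (fun s t x ω hs => hclose hsupp (le_of_not_gt fun hlt => hs ?_) t x ω)
      fun s hs x hx y hy => ?_⟩
    · rw [abs_lt] at hlt
      exact ⟨by linarith, by linarith⟩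
    · refine sub_ne_zero.1 (H (a := (s, (x, y))) ?_)
      rw [Metric.mem_ball, Prod.dist_eq, Prod.dist_eq]
      refine max_lt ?_ (max_lt ?_ ?_)
      · rw [Real.dist_eq, abs_lt]
        constructor <;> linarith [hs.1, hs.2]
      · exact lt_of_le_of_lt (Metric.mem_closedBall.1 hx) (by linarith)
      · exact lt_of_le_of_lt (Metric.mem_closedBall.1 hy) (by linarith)
  have hR : bistaticDist α h q.1 x₀ = bistaticDist α h q.1 y₀ := by
    rw [hx, div_left_inj' hc₀.ne'] at hy
    exact hy
  have hqS : q.1 ∈ Prod.fst '' Q := ⟨q, hq, rfl⟩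
  -- Range and Doppler shift now agree, so `y₀` is `x₀` or its reflection, and only the direction
  -- `e` is left to exclude stationary points.
  have he' := he (eq_or_eq_reflect hh hα hR hD) q.1 hqS
  -- A critical point of `R` would lie midway below the antennas, and its travel time would put `q`
  -- in `U`.
  have hg : gradient (bistaticDist α h q.1) x₀ ≠ 0 := by
    intro h0
    rw [gradient_bistaticDist hh] at h0
    have h1 : distGrad₀ α h q.1 x₀ = 0 := by simpa using congrArg (fun v : Plane => v 0) h0
    have h2 : distGrad₁ α h q.1 x₀ = 0 := by simpa using congrArg (fun v : Plane => v 1) h0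
    obtain ⟨b0, b1⟩ := eq_of_distGrad_eq_zero hh h1 h2
    rw [bistaticDist_below α h q.1 b0 b1] at hx
    have := hA.below q.1 hqS
    rw [← hx] at this
    exact hU this
  obtain ⟨r, hr, H⟩ := exists_decays_of_direction (s₁ := q.1) (x₀ := x₀) (y₀ := y₀) (e := e) hh hc₀
    (fun ω a ha hmax => by
      by_contra! hcon
      -- For `a = 0` the normalization forces `ω ≠ 0` and `hg` rules out stationarity; for `a > 0`,
      -- stationarity would make `e` conormal with multiplier `τ = ω / (a c₀)`.
      rcases ha.eq_or_lt with h0 | h0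
      · rw [← h0, zero_smul, add_zero] at hcon
        rw [← h0] at hmax
        rcases smul_eq_zero.1 hcon.1 with h1 | h1
        · rw [(div_eq_zero_iff.1 h1).resolve_right hc₀.ne'] at hmax
          simp at hmax
        · exact hg h1
      · refine he' (a⁻¹ * (ω / c₀)) ?_ ?_
        · rw [mul_smul, ← smul_neg, eq_inv_smul_iff₀ h0.ne']
          exact (neg_eq_of_add_eq_zero_right hcon.1).symm
        · rw [mul_smul, eq_inv_smul_iff₀ h0.ne']
          exact (sub_eq_zero.1 hcon.2).symm)
  exact ⟨r, hr, fun κ hκ hsupp => H hA (hA.cutoff hκ) fun s t x ω hs => hclose hsupp hs t x ω⟩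

/-- The pairing decreases rapidly in the directions off the two relations. -/
theorem decays_of_direction (hα : 0 < α) (hh : 0 < h) (hc₀ : 0 < c₀) (hA : DataAmp α h c₀ Q U A)
    {x₀ y₀ : Plane} {e : Plane × Plane}
    (he : y₀ = x₀ ∨ y₀ = reflect x₀ → ∀ s ∈ Prod.fst '' Q, ∀ τ : ℝ,
      e.1 = -(τ • gradient (bistaticDist α h s) x₀) →
      e.2 ≠ τ • gradient (bistaticDist α h s) y₀) :
    Decays α h c₀ (redB α h c₀ A) (redB α h c₀ A) x₀ y₀ e := by
  -- A radius is assigned to every point so that it can be chosen as a function; its value off `Q`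
  -- is immaterial.
  have hloc : ∀ q : ℝ × ℝ, ∃ r : ℝ, 0 < r ∧ (q ∈ Q → ∀ κ : ℝ × ℝ → ℝ, ContDiff ℝ (⊤ : ℕ∞) κ →
      (∀ p, κ p ≠ 0 → p ∈ Metric.ball q r) → Decays α h c₀ (redB α h c₀ A)
        (redB α h c₀ fun p ω => (κ (p.1, p.2.1) : ℂ) * A p ω) x₀ y₀ e) := by
    intro q
    by_cases hq : q ∈ Q
    · obtain ⟨r, hr, H⟩ := exists_decays_near hα hh hc₀ hA hq he
      exact ⟨r, hr, fun _ => H⟩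
    · exact ⟨1, one_pos, fun h0 => absurd h0 hq⟩
  choose r hr H using hloc
  -- A partition of unity built one ball at a time. Only the part of the support of `κ` inside `Q`
  -- has to be covered, because the amplitude vanishes off `Q`.
  have hfin : ∀ F : Finset (ℝ × ℝ), (∀ q ∈ F, q ∈ Q) → ∀ κ : ℝ × ℝ → ℝ, ContDiff ℝ (⊤ : ℕ∞) κ →
      (∀ p ∈ Q, κ p ≠ 0 → ∃ q ∈ F, p ∈ Metric.ball q (r q / 2)) → Decays α h c₀ (redB α h c₀ A)
        (redB α h c₀ fun p ω => (κ (p.1, p.2.1) : ℂ) * A p ω) x₀ y₀ e := by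
    intro F
    induction F using Finset.induction_on with
    | empty =>
      intro _ κ _ hcov
      refine decays_of_redB_eq_zero _ (fun w => ?_) x₀ y₀ e
      refine redB_eq_zero_of_forall (fun t x ω => ?_) w.1.2 w.2
      by_cases hQ : (w.1.1, t) ∈ Q
      · have h0 : κ (w.1.1, t) = 0 := by
          by_contra hne
          obtain ⟨q, hqF, -⟩ := hcov _ hQ hne
          simp at hqF
        simp [h0]
      · rw [hA.ampFam.eq_zero () _ _ _ _ hQ, mul_zero]
    | insert q F _ ih =>
      intro hFQ κ hκ hcov
      -- `f` is supported in the large ball, where the local result holds, and equals `1` on the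
      -- half ball, so `(1 - f) κ` no longer needs `q` in the cover.
      let f : ContDiffBump q := ⟨r q / 2, r q, by linarith [hr q], by linarith [hr q]⟩
      have h1 : Decays α h c₀ (redB α h c₀ A)
          (redB α h c₀ fun p ω => ((f (p.1, p.2.1) * κ (p.1, p.2.1) : ℝ) : ℂ) * A p ω) x₀ y₀ e := by
        refine H q (hFQ q (Finset.mem_insert_self _ _)) (fun p => f p * κ p)
          (f.contDiff.mul hκ) fun p hp => ?_
        have h2 : p ∈ Function.support f := left_ne_zero_of_mul hp
        rwa [f.support_eq] at h2
      have h2 : Decays α h c₀ (redB α h c₀ A) (redB α h c₀ fun p ω =>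
          (((1 - f (p.1, p.2.1)) * κ (p.1, p.2.1) : ℝ) : ℂ) * A p ω) x₀ y₀ e := by
        refine ih (fun q hq => hFQ q (Finset.mem_insert_of_mem hq)) (fun p => (1 - f p) * κ p)
          ((contDiff_const.sub f.contDiff).mul hκ) fun p hp hne => ?_
        obtain ⟨q', hq', hmem⟩ := hcov p hp (right_ne_zero_of_mul hne)
        rcases Finset.mem_insert.1 hq' with h3 | h3
        · subst h3
          exfalso
          refine left_ne_zero_of_mul hne ?_
          rw [f.one_of_mem_closedBall (Metric.ball_subset_closedBall hmem), sub_self]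
        · exact ⟨q', h3, hmem⟩
      have h3 := Decays.add hh hc₀ hA (hA.cutoff (f.contDiff.mul hκ))
        (hA.cutoff ((contDiff_const.sub f.contDiff).mul hκ)) h1 h2
      have e1 : (fun p ω => (κ (p.1, p.2.1) : ℂ) * A p ω) = fun p ω =>
          ((f (p.1, p.2.1) * κ (p.1, p.2.1) : ℝ) : ℂ) * A p ω +
          (((1 - f (p.1, p.2.1)) * κ (p.1, p.2.1) : ℝ) : ℂ) * A p ω := by
        ext p ω
        push_cast; ring
      rw [e1]
      exact h3
  obtain ⟨F, hFQ, hcov⟩ := hA.ampFam.isCompact.elim_nhds_subcover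
    (fun q => Metric.ball q (r q / 2)) fun q _ => Metric.ball_mem_nhds q (half_pos (hr q))
  have h1 := hfin F hFQ (fun _ => 1) contDiff_const fun p hp _ => by
    simpa using hcov hp
  simpa using h1

end Localization

end BistaticSAR

namespace BistaticSAR

/-! ### The localized Fourier transform of the kernel -/

section LocalizedFourier

variable {α h c₀ : ℝ} {Q U : Set (ℝ × ℝ)} {A : ℝ × ℝ × Plane → ℝ → ℂ}

lemma fourierData_add_mul (hh : 0 < h) (hA : DataAmp α h c₀ Q U A) {f g : Plane → ℂ}
    (hf : Continuous f) (hfc : HasCompactSupport f) (hg : Continuous g) (hgc : HasCompactSupport g)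
    (c : ℂ) (s ω : ℝ) : fourierData α h c₀ (redB α h c₀ A) (fun y => f y + c * g y) s ω =
      fourierData α h c₀ (redB α h c₀ A) f s ω + c * fourierData α h c₀ (redB α h c₀ A) g s ω := by
  unfold fourierData
  rw [← integral_const_mul, ← integral_add
    (integrable_fourierData_integrand hh (hA.continuous_redB hh) hf hfc s ω)
    ((integrable_fourierData_integrand hh (hA.continuous_redB hh) hg hgc s ω).const_mul c)]
  congr 1; ext y
  ring

/-- The real and imaginary parts of modulated real test functions. -/
lemma modulate_ofReal (ξ : Plane) (u : 𝓓((⊤ : Opens Plane), ℝ)) (x : Plane) :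
    modulate ξ (fun x => (u x : ℂ)) x =
      (mulSmooth u _ (contDiff_cos_dual (innerSL ℝ ξ)) x : ℂ) +
        -Complex.I * (mulSmooth u _ (contDiff_sin_dual (innerSL ℝ ξ)) x : ℂ) := by
  change cis (-(inner ℝ ξ x)) * (u x : ℂ) = ((u x * Real.cos (inner ℝ ξ x) : ℝ) : ℂ) +
    -Complex.I * ((u x * Real.sin (inner ℝ ξ x) : ℝ) : ℂ)
  rw [cis, mul_comm Complex.I, Complex.exp_mul_I, Complex.ofReal_neg, Complex.cos_neg,
    Complex.sin_neg]
  push_cast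
  ring

/-- The kernel is tested on real functions only, so each modulated test function is split into
cosine and sine parts and the pairing expanded bilinearly. The left factor is linear in `u` because
its two conjugations cancel. -/
lemma pairing_modulate (hh : 0 < h) (hc₀ : 0 < c₀) (hA : DataAmp α h c₀ Q U A)
    (u v : 𝓓((⊤ : Opens Plane), ℝ)) (ξ η : Plane) :
    let P := fun u v : 𝓓((⊤ : Opens Plane), ℝ) =>
      pairing α h c₀ (redB α h c₀ A) (redB α h c₀ A) (fun x => (u x : ℂ)) (fun y => (v y : ℂ))
    let uc := mulSmooth u _ (contDiff_cos_dual (innerSL ℝ ξ))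
    let us := mulSmooth u _ (contDiff_sin_dual (innerSL ℝ ξ))
    let vc := mulSmooth v _ (contDiff_cos_dual (innerSL ℝ η))
    let vs := mulSmooth v _ (contDiff_sin_dual (innerSL ℝ η))
    pairing α h c₀ (redB α h c₀ A) (redB α h c₀ A) (modulate ξ fun x => (u x : ℂ))
      (modulate η fun y => (v y : ℂ)) =
      P uc vc - P us vs - Complex.I * (P us vc + P uc vs) := by
  intro P uc us vc vs
  have hi : ∀ u v : 𝓓((⊤ : Opens Plane), ℝ), Integrable (pairIntegrand α h c₀ (redB α h c₀ A)
      (redB α h c₀ A) (fun x => (u x : ℂ)) (fun y => (v y : ℂ))) := fun u v =>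
    integrable_pairIntegrand hh hc₀ hA hA (contDiff_testFunction u)
      (hasCompactSupport_testFunction u) (contDiff_testFunction v) (hasCompactSupport_testFunction v)
  have e1 : ∀ s ω, fourierData α h c₀ (redB α h c₀ A) (modulate η fun y => (v y : ℂ)) s ω =
      fourierData α h c₀ (redB α h c₀ A) (fun y => (vc y : ℂ)) s ω +
        -Complex.I * fourierData α h c₀ (redB α h c₀ A) (fun y => (vs y : ℂ)) s ω := by
    intro s ω
    rw [funext (modulate_ofReal η v)]
    exact fourierData_add_mul hh hA (contDiff_testFunction vc).continuous
      (hasCompactSupport_testFunction vc) (contDiff_testFunction vs).continuous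
      (hasCompactSupport_testFunction vs) _ s ω
  have e2 : ∀ s ω, conj (fourierData α h c₀ (redB α h c₀ A)
      (fun x => conj (modulate ξ (fun x => (u x : ℂ)) x)) s ω) =
      conj (fourierData α h c₀ (redB α h c₀ A) (fun x => conj (uc x : ℂ)) s ω) +
        -Complex.I * conj (fourierData α h c₀ (redB α h c₀ A) (fun x => conj (us x : ℂ)) s ω) := by
    intro s ω
    have e3 : (fun x => conj (modulate ξ (fun x => (u x : ℂ)) x)) =
        fun x => (uc x : ℂ) + Complex.I * (us x : ℂ) := by
      ext x
      rw [modulate_ofReal]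
      simp [uc, us]
    rw [e3, fourierData_add_mul hh hA (contDiff_testFunction uc).continuous
      (hasCompactSupport_testFunction uc) (contDiff_testFunction us).continuous
      (hasCompactSupport_testFunction us)]
    simp
  have hP : ∀ u v, P u v = ∫ p, pairIntegrand α h c₀ (redB α h c₀ A) (redB α h c₀ A)
      (fun x => (u x : ℂ)) (fun y => (v y : ℂ)) p := fun _ _ => rfl
  rw [hP, hP, hP, hP, pairing]
  rw [← integral_add (hi us vc) (hi uc vs), ← integral_const_mul, ← integral_sub (hi uc vc) (hi us vs)]
  refine Eq.trans ?_ (integral_sub ((hi uc vc).sub (hi us vs))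
    (((hi us vc).add (hi uc vs)).const_mul Complex.I))
  congr 1; ext p
  simp only [pairIntegrand, e1, e2]
  linear_combination (conj (fourierData α h c₀ (redB α h c₀ A) (fun x => conj (us x : ℂ)) p.1 p.2) *
    fourierData α h c₀ (redB α h c₀ A) (fun y => (vs y : ℂ)) p.1 p.2) * Complex.I_mul_I

lemma IsSchwartzKernel.tensor_eq (hh : 0 < h) (hc₀ : 0 < c₀) (hA : DataAmp α h c₀ Q U A)
    {K : 𝓓'((⊤ : Opens (Plane × Plane)), ℂ)} (hK : IsSchwartzKernel (normalOp α h c₀ A) K)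
    (u v : 𝓓((⊤ : Opens Plane), ℝ)) : K (tensor u v) = (1 / (2 * Real.pi) : ℝ) *
      pairing α h c₀ (redB α h c₀ A) (redB α h c₀ A) (fun x => (u x : ℂ)) fun y => (v y : ℂ) := by
  rw [hK u v]
  exact integral_backproject_forward_mul hh hc₀ hA hA (contDiff_testFunction v)
    (hasCompactSupport_testFunction v) (contDiff_testFunction u).continuous
    (hasCompactSupport_testFunction u)

/-- The localized Fourier transforms of the kernel are pairings of modulated test functions. -/
theorem localizedFourier_tensor (hh : 0 < h) (hc₀ : 0 < c₀) (hA : DataAmp α h c₀ Q U A)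
    {K : 𝓓'((⊤ : Opens (Plane × Plane)), ℂ)} (hK : IsSchwartzKernel (normalOp α h c₀ A) K)
    (u v : 𝓓((⊤ : Opens Plane), ℝ)) (ξ η : Plane) :
    localizedFourier K (tensor u v) (pairCovector ξ η) = (1 / (2 * Real.pi) : ℝ) *
      pairing α h c₀ (redB α h c₀ A) (redB α h c₀ A) (modulate ξ fun x => (u x : ℂ))
        (modulate η fun y => (v y : ℂ)) := by
  rw [pairing_modulate hh hc₀ hA, localizedFourier]
  have e1 : mulSmooth (tensor u v) _ (contDiff_cos_dual (pairCovector ξ η)) =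
      tensor (mulSmooth u _ (contDiff_cos_dual (innerSL ℝ ξ)))
        (mulSmooth v _ (contDiff_cos_dual (innerSL ℝ η))) -
      tensor (mulSmooth u _ (contDiff_sin_dual (innerSL ℝ ξ)))
        (mulSmooth v _ (contDiff_sin_dual (innerSL ℝ η))) := by
    ext z
    change u z.1 * v z.2 * Real.cos (inner ℝ ξ z.1 + inner ℝ η z.2) =
      u z.1 * Real.cos (inner ℝ ξ z.1) * (v z.2 * Real.cos (inner ℝ η z.2)) -
      u z.1 * Real.sin (inner ℝ ξ z.1) * (v z.2 * Real.sin (inner ℝ η z.2))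
    rw [Real.cos_add]; ring
  have e2 : mulSmooth (tensor u v) _ (contDiff_sin_dual (pairCovector ξ η)) =
      tensor (mulSmooth u _ (contDiff_sin_dual (innerSL ℝ ξ)))
        (mulSmooth v _ (contDiff_cos_dual (innerSL ℝ η))) +
      tensor (mulSmooth u _ (contDiff_cos_dual (innerSL ℝ ξ)))
        (mulSmooth v _ (contDiff_sin_dual (innerSL ℝ η))) := by
    ext z
    change u z.1 * v z.2 * Real.sin (inner ℝ ξ z.1 + inner ℝ η z.2) =
      u z.1 * Real.sin (inner ℝ ξ z.1) * (v z.2 * Real.cos (inner ℝ η z.2)) +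
      u z.1 * Real.cos (inner ℝ ξ z.1) * (v z.2 * Real.sin (inner ℝ η z.2))
    rw [Real.sin_add]; ring
  rw [e1, e2, map_sub, map_add, hK.tensor_eq hh hc₀ hA, hK.tensor_eq hh hc₀ hA,
    hK.tensor_eq hh hc₀ hA, hK.tensor_eq hh hc₀ hA]
  ring

end LocalizedFourier

/-! ### Covectors on the product -/

section Covectors

/-- The vectors `ξ` and `η` that represent a covector on the product. -/
noncomputable def pairVector (ζ : StrongDual ℝ (Plane × Plane)) : Plane × Plane :=
  ((InnerProductSpace.toDual ℝ Plane).symm (ζ.comp (ContinuousLinearMap.inl ℝ Plane Plane)),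
    (InnerProductSpace.toDual ℝ Plane).symm (ζ.comp (ContinuousLinearMap.inr ℝ Plane Plane)))

lemma pairCovector_apply (ξ η x y : Plane) :
    pairCovector ξ η (x, y) = inner ℝ ξ x + inner ℝ η y := by
  simp [pairCovector]

lemma pairCovector_pairVector (ζ : StrongDual ℝ (Plane × Plane)) :
    pairCovector (pairVector ζ).1 (pairVector ζ).2 = ζ := by
  refine ContinuousLinearMap.ext fun z => ?_
  rw [← Prod.mk.eta (p := z), pairCovector_apply, pairVector,
    InnerProductSpace.toDual_symm_apply, InnerProductSpace.toDual_symm_apply]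
  simp [← map_add]

lemma pairVector_pairCovector (ξ η : Plane) : pairVector (pairCovector ξ η) = (ξ, η) := by
  refine Prod.ext (ext_inner_right ℝ fun z => ?_) (ext_inner_right ℝ fun z => ?_)
  · rw [pairVector, InnerProductSpace.toDual_symm_apply]
    simp [pairCovector]
  · rw [pairVector, InnerProductSpace.toDual_symm_apply]
    simp [pairCovector]

lemma pairVector_smul (r : ℝ) (ζ : StrongDual ℝ (Plane × Plane)) :
    pairVector (r • ζ) = r • pairVector ζ := by
  simp [pairVector, Prod.smul_mk]

lemma continuous_pairVector : Continuous pairVector := by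
  unfold pairVector
  exact ((InnerProductSpace.toDual ℝ Plane).symm.continuous.comp (by fun_prop)).prodMk
    ((InnerProductSpace.toDual ℝ Plane).symm.continuous.comp (by fun_prop))

/-- The product carries the maximum norm, so each of the two components contributes at most
`‖pairVector ζ‖ ‖z‖`. This one-sided comparison is all that transfers decay from `(ξ, η)` to `ζ`. -/
lemma norm_le_two_mul_pairVector (ζ : StrongDual ℝ (Plane × Plane)) :
    ‖ζ‖ ≤ 2 * ‖pairVector ζ‖ := by
  refine ζ.opNorm_le_bound (by positivity) fun z => ?_
  have h1 : ζ z = inner ℝ (pairVector ζ).1 z.1 + inner ℝ (pairVector ζ).2 z.2 := by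
    rw [← pairCovector_apply, pairCovector_pairVector]
  rw [h1]
  refine (norm_add_le _ _).trans ?_
  have h2 := (norm_inner_le_norm (𝕜 := ℝ) (pairVector ζ).1 z.1).trans
    (mul_le_mul (norm_fst_le (pairVector ζ)) (norm_fst_le z) (norm_nonneg _) (norm_nonneg _))
  have h3 := (norm_inner_le_norm (𝕜 := ℝ) (pairVector ζ).2 z.2).trans
    (mul_le_mul (norm_snd_le (pairVector ζ)) (norm_snd_le z) (norm_nonneg _) (norm_nonneg _))
  linarith

end Covectors

/-! ### The wavefront set of the kernel -/

section WavefrontSet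

variable {α h c₀ : ℝ} {Q U : Set (ℝ × ℝ)} {A : ℝ × ℝ × Plane → ℝ → ℂ}

lemma exists_testFunction (x₀ : Plane) {ρ : ℝ} (hρ : 0 < ρ) : ∃ u : 𝓓((⊤ : Opens Plane), ℝ),
    u x₀ ≠ 0 ∧ tsupport (fun x => (u x : ℂ)) ⊆ Metric.closedBall x₀ ρ := by
  let f : ContDiffBump x₀ := ⟨ρ / 2, ρ, by positivity, by linarith⟩
  refine ⟨⟨f, f.contDiff, f.hasCompactSupport, fun _ _ => trivial⟩, ?_, ?_⟩
  · change f x₀ ≠ 0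
    rw [f.one_of_mem_closedBall (Metric.mem_closedBall_self (by positivity))]
    exact one_ne_zero
  · rw [← f.tsupport_eq]
    exact closure_mono fun x hx h0 => hx (by
      change ((f x : ℝ) : ℂ) = 0
      rw [h0, Complex.ofReal_zero])

/-- A product cutoff is admissible in the definition of the wavefront set, and
`localizedFourier_tensor` makes the localized transform a pairing of modulated test functions.
Strict inequality replaces the closed cone by an open one that still contains the direction of `w`.
-/
theorem microlocallySmoothAt_of_decays (hh : 0 < h) (hc₀ : 0 < c₀) (hA : DataAmp α h c₀ Q U A)
    {K : 𝓓'((⊤ : Opens (Plane × Plane)), ℂ)} (hK : IsSchwartzKernel (normalOp α h c₀ A) K)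
    {x₀ y₀ : Plane} {w : Plane × Plane} (hw : w ≠ 0)
    (hd : Decays α h c₀ (redB α h c₀ A) (redB α h c₀ A) x₀ y₀ (‖w‖⁻¹ • w)) :
    MicrolocallySmoothAt K (x₀, y₀) (pairCovector w.1 w.2) := by
  obtain ⟨ρ, hρ, ε, hε, H⟩ := hd
  obtain ⟨u, hu0, huL⟩ := exists_testFunction x₀ hρ
  obtain ⟨v, hv0, hvL⟩ := exists_testFunction y₀ hρ
  have hw0 : 0 < ‖w‖ := norm_pos_iff.2 hw
  refine ⟨tensor u v, mul_ne_zero hu0 hv0, pairVector ⁻¹' {z | ‖z - ‖z‖ • ‖w‖⁻¹ • w‖ < ε * ‖z‖},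
    (isOpen_lt (by fun_prop) (by fun_prop)).preimage continuous_pairVector, ?_, ?_, fun N => ?_⟩
  · rw [mem_preimage, pairVector_pairCovector, mem_ofPred_eq]
    rw [smul_inv_smul₀ hw0.ne', sub_self, norm_zero]
    positivity
  · intro ζ hζ r hr
    rw [mem_preimage, mem_ofPred_eq] at hζ ⊢
    rw [pairVector_smul, norm_smul, Real.norm_of_nonneg hr.le, mul_smul, ← smul_sub, norm_smul,
      Real.norm_of_nonneg hr.le, mul_left_comm]
    exact mul_lt_mul_of_pos_left hζ hr
  · obtain ⟨C, hC⟩ := H (fun x => (u x : ℂ)) (fun y => (v y : ℂ)) (contDiff_testFunction u) huL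
      (contDiff_testFunction v) hvL N
    let k : ℂ := ((1 / (2 * Real.pi) : ℝ) : ℂ)
    refine ⟨‖k‖ * |C| * 2 ^ N, fun ζ hζ => ?_⟩
    have h1 := hC (pairVector ζ).1 (pairVector ζ).2 (le_of_lt hζ :
      ‖pairVector ζ - ‖pairVector ζ‖ • ‖w‖⁻¹ • w‖ ≤ ε * ‖pairVector ζ‖)
    have h2 := norm_le_two_mul_pairVector ζ
    have h3 : (1 + ‖pairVector ζ‖) ^ (-(N : ℝ)) ≤ 2 ^ N / (1 + ‖ζ‖) ^ N := by
      rw [Real.rpow_neg (by positivity), Real.rpow_natCast, inv_eq_one_div,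
        div_le_div_iff₀ (by positivity) (by positivity), one_mul, ← mul_pow]
      exact pow_le_pow_left₀ (by positivity) (by linarith) N
    conv_lhs => rw [← pairCovector_pairVector ζ]
    rw [localizedFourier_tensor hh hc₀ hA hK, norm_mul]
    calc _ ≤ ‖k‖ * (|C| * (1 + ‖pairVector ζ‖) ^ (-(N : ℝ))) := by
          refine mul_le_mul_of_nonneg_left (h1.trans ?_) (norm_nonneg k)
          exact mul_le_mul_of_nonneg_right (le_abs_self C) (by positivity)
      _ ≤ ‖k‖ * (|C| * (2 ^ N / (1 + ‖ζ‖) ^ N)) := by gcongr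
      _ = _ := by ring

lemma reflect_smul (r : ℝ) (x : Plane) : reflect (r • x) = r • reflect x := by
  ext i; fin_cases i <;> simp [reflect]

lemma reflect_neg (x : Plane) : reflect (-x) = -reflect x := by
  ext i; fin_cases i <;> simp [reflect]

/-- Undoing the normalization by `l` gives both covectors the same multiplier `l τ`, which is
nonzero because `ξ` and `η` are not both zero. The twist `η ↦ -η` accounts for the opposite signs of
the hypotheses, and the equivariance of `∇R` under reflection identifies the second case with `Λ`.
-/
lemma mem_relations (hh : 0 < h) {s₀ s₁ s l τ : ℝ} (hs : s ∈ Ioo s₀ s₁) {x y ξ η : Plane}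
    (hxy : y = x ∨ y = reflect x) (hw : ξ ≠ 0 ∨ η ≠ 0) (hl : l ≠ 0)
    (h1 : l⁻¹ • ξ = -(τ • gradient (bistaticDist α h s) x))
    (h2 : l⁻¹ • -η = τ • gradient (bistaticDist α h s) y) :
    ((x, ξ), (y, η)) ∈ diagonalRelation α h s₀ s₁ ∪ reflectionRelation α h s₀ s₁ := by
  have e1 : ξ = (l * τ) • -gradient (bistaticDist α h s) x := by
    rw [inv_smul_eq_iff₀ hl] at h1
    rw [h1, mul_smul, smul_neg, smul_neg, smul_neg]
  have e2 : η = (l * τ) • -gradient (bistaticDist α h s) y := by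
    rw [inv_smul_eq_iff₀ hl] at h2
    rw [← neg_neg η, h2, mul_smul, smul_neg, smul_neg]
  have hτ : l * τ ≠ 0 := by
    intro hτ
    rw [hτ, zero_smul] at e1 e2
    exact hw.elim (fun h0 => h0 e1) fun h0 => h0 e2
  have hcov : ξ ∈ covectors α h s₀ s₁ x := ⟨s, hs, l * τ, hτ, e1⟩
  rcases hxy with hxy | hxy
  · rw [hxy, ← e1] at e2
    exact Or.inl ⟨hcov, Prod.ext hxy e2⟩
  · rw [hxy, gradient_reflect hh, ← reflect_neg, ← reflect_smul, ← e1] at e2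
    exact Or.inr ⟨hcov, Prod.ext hxy e2⟩

/-- Contrapositive: a covector outside both relations satisfies the hypothesis of
`decays_of_direction`. The argument applies to every Schwartz kernel `K`, since it evaluates `K`
only on combinations of tensor products, where its values are prescribed. -/
theorem twistedWavefrontSet_subset (hα : 0 < α) (hh : 0 < h) (hc₀ : 0 < c₀)
    (hA : DataAmp α h c₀ Q U A) {s₀ s₁ : ℝ} (hQ : Prod.fst '' Q ⊆ Ioo s₀ s₁)
    {K : 𝓓'((⊤ : Opens (Plane × Plane)), ℂ)} (hK : IsSchwartzKernel (normalOp α h c₀ A) K) :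
    twistedWavefrontSet K ⊆ diagonalRelation α h s₀ s₁ ∪ reflectionRelation α h s₀ s₁ := by
  rintro ⟨⟨x, ξ⟩, ⟨y, η⟩⟩ hmem
  obtain ⟨-, h0, hsing⟩ : ((x, y), pairCovector ξ (-η)) ∈ wavefrontSet K := hmem
  by_contra hp
  have hξη : ξ ≠ 0 ∨ η ≠ 0 := by
    by_contra! hcon
    refine h0 ?_
    rw [hcon.1, hcon.2]
    refine ContinuousLinearMap.ext fun z => ?_
    simp [pairCovector]
  have hw : ((ξ, -η) : Plane × Plane) ≠ 0 := by
    rw [Ne, Prod.mk_eq_zero, not_and_or, neg_eq_zero]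
    exact hξη
  refine hsing (microlocallySmoothAt_of_decays hh hc₀ hA hK (w := (ξ, -η)) hw
    (decays_of_direction hα hh hc₀ hA fun hxy s hs τ h1 h2 => hp ?_))
  rw [Prod.smul_fst] at h1
  rw [Prod.smul_snd] at h2
  exact mem_relations (l := ‖((ξ, -η) : Plane × Plane)‖) hh (hQ hs) hxy hξη
    (norm_ne_zero_iff.2 hw) h1 h2

end WavefrontSet

end BistaticSAR
theorem mainTheorem3 (α h c₀ s₀ s₁ t₀ t₁ : ℝ) (hα : 0 < α) (hh : 0 < h) (hc₀ : 0 < c₀)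
    (A : ℝ × ℝ × BistaticSAR.Plane → ℝ → ℂ)
    (hA : BistaticSAR.IsAmplitude α h c₀ s₀ s₁ t₀ t₁ A) :
    -- `F V` and `F* F V` are well-defined continuous functions for every test function `V`
    (∀ V : 𝓓((⊤ : Opens BistaticSAR.Plane), ℂ),
      (∀ s t, BistaticSAR.OscConvergent (BistaticSAR.forwardIntegrand α h c₀ A V s t)) ∧
      Continuous (fun p : ℝ × ℝ => BistaticSAR.forward α h c₀ A V p.1 p.2) ∧
      (∀ x, BistaticSAR.OscConvergent
        (BistaticSAR.adjointIntegrand α h c₀ A (BistaticSAR.forward α h c₀ A V) x)) ∧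
      Continuous (BistaticSAR.normalOp α h c₀ A V)) ∧
    -- `F* F` has a kernel, which is an oscillatory integral with phase `φ`
    (∃ K : 𝓓'((⊤ : Opens (BistaticSAR.Plane × BistaticSAR.Plane)), ℂ),
      BistaticSAR.IsSchwartzKernel (BistaticSAR.normalOp α h c₀ A) K ∧
      ∃ a : BistaticSAR.Plane × BistaticSAR.Plane × ℝ → ℝ → ℂ,
        BistaticSAR.IsSymbol (univ ×ˢ univ ×ˢ Ioo s₀ s₁) 4 a ∧
        (∃ S : Set ℝ, IsCompact S ∧ S ⊆ Ioo s₀ s₁ ∧ ∀ x y s ω, s ∉ S → a (x, y, s) ω = 0) ∧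
        BistaticSAR.IsKernelOscIntegral α h c₀ a K) ∧
    -- the wavefront relation of the kernel
    ∀ K : 𝓓'((⊤ : Opens (BistaticSAR.Plane × BistaticSAR.Plane)), ℂ),
      BistaticSAR.IsSchwartzKernel (BistaticSAR.normalOp α h c₀ A) K →
      BistaticSAR.twistedWavefrontSet K ⊆
        BistaticSAR.diagonalRelation α h s₀ s₁ ∪ BistaticSAR.reflectionRelation α h s₀ s₁ := by
  obtain ⟨Q, U, hQ, hd⟩ := hA.exists_dataAmp
  have hS : Prod.fst '' Q ⊆ Ioo s₀ s₁ := by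
    rintro _ ⟨p, hp, rfl⟩
    exact (hQ hp).1
  refine ⟨fun V => ⟨fun s t => ⟨_, BistaticSAR.hasOscIntegral_forwardIntegrand hh hc₀ hd V.contDiff
      V.hasCompactSupport s t⟩,
    BistaticSAR.continuous_forward hh hc₀ hd V.contDiff V.hasCompactSupport,
    fun x => ⟨_, BistaticSAR.hasOscIntegral_adjointIntegrand hh hc₀ hd hd V.contDiff
      V.hasCompactSupport x⟩,
    BistaticSAR.continuous_backproject_forward hh hc₀ hd hd V.contDiff V.hasCompactSupport⟩, ?_,
    fun K hK => BistaticSAR.twistedWavefrontSet_subset hα hh hc₀ hd hS hK⟩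
  obtain ⟨K, hK⟩ := BistaticSAR.exists_kernel hh hc₀ hd
  exact ⟨K, BistaticSAR.isSchwartzKernel hh hc₀ hd hK, BistaticSAR.kernelAmp α h c₀ A,
    BistaticSAR.isSymbol_kernelAmp hh hd _, ⟨Prod.fst '' Q, hd.compact_S, hS,
      fun x y s ω hs => by
        simp [BistaticSAR.kernelAmp, hd.redB_eq_zero hs]⟩,
    BistaticSAR.isKernelOscIntegral hh hc₀ hd hK⟩
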